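/- **Setting.** Let $\Gamma=\partial O\subset\mathbb R^3$ be the smooth ($C^\infty$) boundary of a bounded open set $O$, with signed distance function $\rho$ (negative in $O$), $n=\nabla\rho$, $\kappa=\nabla\otimes\nabla\rho$, $P_\Gamma=I-n\otimes n$, $U_\delta=\{|\rho|<\delta\}$, and let $\delta_0>0$ be such that every point of $U_{\delta_0}$ has a unique closest point $p(x)\in\Gamma$. Let $\alpha:\Gamma\to\mathbb R$ and the tangential field $\beta:\Gamma\to\mathbb R^3$ be smooth, with $\beta_\infty=\max_\Gamma|\beta|>0$ and $\alpha-\tfrac12\operatorname{div}_\Gamma\beta\ge\alpha_0>0$ on $\Gamma$. Let $\Omega_0\supset U_{\delta_0}$ be a polyhedral domain and, for $h\in(0,h_0]$, let $\mathcal T_{0,h}$ be finite conforming partitions of $\overline{\Omega_0}$ into closed tetrahedra, shape regular and quasiuniform with mesh parameter $h$: for some $\sigma>0$ independent of $h$, each tetrahedron has diameter at most $\sigma h$ and contains a ball of radius $h/\sigma$. Let $\Gamma_h$ be a compact connected surface, $\mathcal T_h=\{T\in\mathcal T_{0,h}: T\cap\Gamma_h\ne\emptyset\}$ the active mesh, and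 suppose that for each $T\in\mathcal T_h$ the set $T\cap\Gamma_h$ lies in a plane with unit normal $n_h|_T$. Let $\mathcal K_h$ be the partition of $\Gamma_h$ into the nonempty sets $\operatorname{int}(T)\cap\Gamma_h$, $T\in\mathcal T_h$, and the relatively open common faces of two tetrahedra of $\mathcal T_h$ that are contained in $\Gamma_h$; let $P_{\Gamma_h}=I-n_h\otimes n_h$, $\nabla_{\Gamma_h}=P_{\Gamma_h}\nabla$. Let $\alpha_h,\beta_h$ be affine on each $K\in\mathcal K_h$. Assume, with constants independent of $h\in(0,h_0]$: * (A) $\Gamma_h\subset U_{\delta_0}$, $p:\Gamma_h\to\Gamma$ is a bijection, $|\rho|\le Ch^2$ on $\Gamma_h$, and $|n-n_h|_T|\le Ch$ on $T\cap\Gamma_h$ for all $T\in\mathcal T_h$; * (B) $\alpha_h-\tfrac12\operatorname{div}_{\Gamma_h}\beta_h\ge a_0>0$ on every $K\in\mathcal K_h$, and on each edge shared by two cells $K_1,K_2\in\mathcal K_h$, with exterior unit conormals $\nu_{h,K_i}$, $|\nu_{h,K_1}\cdot\beta_h|_{K_1}+\nu_{h,K_2}\cdot\beta_h|_{K_2}|\le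 Ch^2$; * (C) $\beta_h=P_{\Gamma_h}\beta_h$, $|\alpha_h|\le C$, $|\beta_h|\le C$, and for all $x\in K\in\mathcal K_h$, $\big|\beta(p(x))-|B|^{-1}B\,\beta_h(x)\big|\le Ch^2$ and $\big|\alpha(p(x))-|B|^{-1}\alpha_h(x)\big|\le Ch^2$, where $B=P_\Gamma(I-\rho\kappa)P_{\Gamma_h}$ at $x$ and $|B|$ is the absolute value of its determinant as a map between the tangent planes $n_h^\perp$ and $n^\perp$. Let $V_h$ be the space of continuous piecewise linear functions on $\mathcal T_h$, and for $\epsilon\ge0$, $0\le\gamma<2$ let $$A_h(v,w)=(\beta_h\cdot\nabla_{\Gamma_h}v,w)_{\mathcal K_h}+(\alpha_hv,w)_{\mathcal K_h}+\epsilon(\nabla_{\Gamma_h}v,\nabla_{\Gamma_h}w)_{\mathcal K_h}+\tau_1h(\beta_h\cdot\nabla_{\Gamma_h}v+\alpha_hv,\beta_h\cdot\nabla_{\Gamma_h}w)_{\mathcal K_h}+\tau_2h^\gamma(n_h\cdot\nabla v,n_h\cdot\nabla w)_{\mathcal T_h},$$ where $\tau_1=c_\tau\min(\beta_\infty^{-1},h\epsilon^{-1})$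 with a fixed $c_\tau>0$ (so $\tau_1=c_\tau\beta_\infty^{-1}$ for $\epsilon=0$), and $\tau_2$ is any number with $c_2\le\tau_2\le C_2(1+\epsilon h^{-1})$ for fixed $c_2,C_2>0$; this includes fixed positive constants and $\tau_2=\tau_1^{-1}$. Let $\{\varphi_i\}_{i=1}^N$ be the nodal basis of $V_h$, $\mathcal A$ the matrix with entries $a_{ij}=A_h(\varphi_i,\varphi_j)$, and $\kappa_h(\mathcal A)=|\mathcal A|_{\mathbb R^N}|\mathcal A^{-1}|_{\mathbb R^N}$ its spectral condition number (Euclidean operator norms). **Theorem.** There is a constant $C>0$, independent of $h$, $\epsilon$, $\tau_2$ and $\gamma$, such that for every $\gamma\in[0,2)$ there is $h_1\in(0,h_0]$ (independent of $h$, $\epsilon$ and $\tau_2$) such that for all $h\in(0,h_1]$, all $\epsilon\ge0$ and all admissible $\tau_2$ the matrix $\mathcal A$ is invertible and $$\kappa_h(\mathcal A)\le C\,h^{\min(1,2-\gamma)-2}\,(1+\epsilon h^{-1}).$$ In particular, for $\gamma=1$, $$\kappa_h(\mathcal A)\le C\,h^{-1}(1+\epsilon h^{-1}).$$ -/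

import Mathlib

open MeasureTheory Set

noncomputable section

abbrev E3 : Type := EuclideanSpace ℝ (Fin 3)

instance instDecidableEqE3 : DecidableEq E3 := Classical.decEq E3

/-! ### The smooth surface -/

/-- `O` is a bounded open set with `C^∞` boundary: near each boundary point it is a sublevel set
`{φ < 0}` of a smooth function with nonvanishing gradient. The surface is `frontier O`. -/
structure IsSmoothDomain (O : Set E3) : Prop where
  isOpen : IsOpen O
  isBounded : Bornology.IsBounded O
  smooth : ∀ x ∈ frontier O, ∃ (U : Set E3) (φ : E3 → ℝ), IsOpen U ∧ x ∈ U ∧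
    ContDiffOn ℝ (⊤ : ℕ∞) φ U ∧ gradient φ x ≠ 0 ∧ ∀ y ∈ U, y ∈ O ↔ φ y < 0

open Classical in
/-- Signed distance to the surface `frontier O`, negative in `O`. -/
def signDist (O : Set E3) (x : E3) : ℝ :=
  if x ∈ O then -Metric.infDist x (frontier O) else Metric.infDist x (frontier O)

/-- `n = ∇ρ`; on the surface this is the exterior unit normal. -/
def surfNormal (O : Set E3) (x : E3) : E3 := gradient (signDist O) x

/-- The tubular neighbourhood `U_δ = {|ρ| < δ}`. -/
def tube (O : Set E3) (δ : ℝ) : Set E3 := {x | |signDist O x| < δ}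

open Classical in
/-- Closest point mapping onto the surface. -/
def closestPt (O : Set E3) (x : E3) : E3 :=
  if h : ∃ y ∈ frontier O, dist x y = Metric.infDist x (frontier O) then h.choose else x

/-- Orthogonal projection `I - n ⊗ n` (for a unit vector `n`). -/
def tanProj (n : E3) : E3 →L[ℝ] E3 :=
  ContinuousLinearMap.id ℝ E3 - (innerSL ℝ n).smulRight n

/-- Tangential divergence `tr L - n · L n` of a field with derivative `L`. -/
def tanDiv (n : E3) (L : E3 →ₗ[ℝ] E3) : ℝ :=
  LinearMap.trace ℝ E3 L - inner ℝ n (L n)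

/-- Surface divergence on `frontier O`, computed through the extension `β ∘ p`. -/
def surfDiv (O : Set E3) (β : E3 → E3) (x : E3) : ℝ :=
  tanDiv (surfNormal O x) (fderiv ℝ (fun y => β (closestPt O y)) x : E3 →L[ℝ] E3)

/-- The maximum norm of a vector field over the surface. -/
def surfSup (O : Set E3) (β : E3 → E3) : ℝ := sSup ((fun x => ‖β x‖) '' frontier O)

/-- Curvature tensor `κ = ∇ ⊗ ∇ρ`. -/
def curvature (O : Set E3) (x : E3) : E3 →L[ℝ] E3 := fderiv ℝ (surfNormal O) x

/-- `B = P_Γ (I - ρ κ) P_{Γ_h}` at `x`, where `m` is the unit normal of the discrete surface. -/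
def liftB (O : Set E3) (m x : E3) : E3 →L[ℝ] E3 :=
  (tanProj (surfNormal O x)).comp
    ((ContinuousLinearMap.id ℝ E3 - signDist O x • curvature O x).comp (tanProj m))

/-- `|B|`, the absolute value of the determinant of `B` as a map between the tangent planes `m^⊥`
and `n^⊥`; it equals the determinant of the map of `ℝ³` that agrees with `B` on `m^⊥` and sends
the unit vector `m` to the unit vector `n`. -/
def liftDet (O : Set E3) (m x : E3) : ℝ :=
  |(liftB O m x + (innerSL ℝ m).smulRight (surfNormal O x)).det|

/-! ### Tetrahedral meshes -/

/-- A finite conforming tetrahedral mesh: a finite simplicial complex in `ℝ³` all of whose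
simplices are faces of tetrahedra. -/
structure TetMesh where
  complex : Geometry.SimplicialComplex ℝ E3
  finite : complex.faces.Finite
  pure : ∀ s ∈ complex.faces, ∃ T ∈ complex.faces, s ⊆ T ∧ T.card = 4

/-- The closed tetrahedron with vertex set `T`. -/
def hull (T : Finset E3) : Set E3 := convexHull ℝ (T : Set E3)

/-- The tetrahedra of the mesh, as vertex sets. -/
def TetMesh.tets (M : TetMesh) : Finset (Finset E3) :=
  M.finite.toFinset.filter (fun T => T.card = 4)

/-- Shape regularity and quasiuniformity with mesh parameter `h`. -/
def TetMesh.Quasiuniform (M : TetMesh) (h σ : ℝ) : Prop :=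
  ∀ T ∈ M.tets, Metric.diam (hull T) ≤ σ * h ∧ ∃ x, Metric.ball x (h / σ) ⊆ hull T

/-- The discrete objects for one value of `h`: background mesh, discrete surface `Γ_h`, the
unit normal `n_h` on each tetrahedron, and the elementwise affine coefficients `α_h`, `β_h`
(one affine map for each cell `K` of the discrete surface). -/
structure CutData where
  mesh : TetMesh
  surf : Set E3
  nrm : Finset E3 → E3
  alpha : Set E3 → (E3 →ᵃ[ℝ] ℝ)
  beta : Set E3 → (E3 →ᵃ[ℝ] E3)

namespace CutData

open Classical in
/-- The active mesh `𝒯_h`: the closed tetrahedra that meet `Γ_h`. -/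
def active (D : CutData) : Finset (Finset E3) :=
  D.mesh.tets.filter (fun T => (hull T ∩ D.surf).Nonempty)

theorem mem_faces_of_active (D : CutData) {T : Finset E3} (hT : T ∈ D.active) :
    T ∈ D.mesh.complex.faces ∧ T.card = 4 := by
  classical
  unfold active at hT
  have h := (Finset.mem_filter.mp hT).1
  simpa [TetMesh.tets] using h

/-- The nodes of the active mesh. -/
def nodes (D : CutData) : Finset E3 := D.active.biUnion id

open Classical in
/-- The cells `𝒦_h` of `Γ_h`: the nonempty sets `T ∩ Γ_h` with `T` an open tetrahedron of the
active mesh, and the (relatively open) common faces of two of them that are contained in `Γ_h`. -/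
def cells (D : CutData) : Finset (Set E3) :=
  (D.active.image (fun T => interior (hull T) ∩ D.surf)).filter Set.Nonempty ∪
  (((D.active ×ˢ D.active).filter (fun q => (q.1 ∩ q.2).card = 3)).image
    (fun q => intrinsicInterior ℝ (hull (q.1 ∩ q.2)))).filter (fun K => K ⊆ D.surf)

open Classical in
/-- An active tetrahedron that contains the cell `K`. -/
def tetOf (D : CutData) (K : Set E3) : Finset E3 :=
  if h : ∃ T ∈ D.active, K ⊆ hull T then h.choose else ∅

/-- The unit normal `n_h` on the cell `K`. -/
def cellNrm (D : CutData) (K : Set E3) : E3 := D.nrm (D.tetOf K)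

/-- `div_{Γ_h} β_h` on the cell `K`. -/
def cellDiv (D : CutData) (K : Set E3) : ℝ := tanDiv (D.cellNrm K) (D.beta K).linear

/-- `ν` is the exterior unit conormal of the cell `K` along its edge `e`. -/
def IsConormal (D : CutData) (K e : Set E3) (ν : E3) : Prop :=
  ‖ν‖ = 1 ∧ inner ℝ ν (D.cellNrm K) = 0 ∧
  (∀ x ∈ e, ∀ y ∈ e, inner ℝ ν (y - x) = 0) ∧ (∀ x ∈ e, ∀ y ∈ K, inner ℝ ν (y - x) ≤ 0)

/-- `Γ_h` is a compact connected surface in `U_{δ₀}` which the closest point mapping sends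
bijectively onto the smooth surface, and in each active tetrahedron it lies in a plane with
unit normal `n_h`. -/
structure IsDiscreteSurface (D : CutData) (O : Set E3) (δ₀ : ℝ) : Prop where
  isCompact : IsCompact D.surf
  isConnected : IsConnected D.surf
  subset_tube : D.surf ⊆ tube O δ₀
  bijOn : Set.BijOn (closestPt O) D.surf (frontier O)
  norm_nrm : ∀ T ∈ D.active, ‖D.nrm T‖ = 1
  planar : ∀ T ∈ D.active, ∃ c : ℝ, ∀ x ∈ hull T ∩ D.surf, inner ℝ (D.nrm T) x = c

/-- Accuracy of the geometry: `|ρ| ≤ C h²` and `|n - n_h| ≤ C h` on `Γ_h`. -/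
structure GeomApprox (D : CutData) (O : Set E3) (h C : ℝ) : Prop where
  dist_le : ∀ x ∈ D.surf, |signDist O x| ≤ C * h ^ 2
  normal_le : ∀ T ∈ D.active, ∀ x ∈ hull T ∩ D.surf, ‖surfNormal O x - D.nrm T‖ ≤ C * h

/-- Positivity `a₀ ≤ α_h - ½ div β_h` and the bound `C h²` for the jump
`[ν_h · β_h]` across the edges of `Γ_h` (segments shared by the boundaries of two cells). -/
structure CoeffStable (D : CutData) (h a₀ C : ℝ) : Prop where
  pos : ∀ K ∈ D.cells, ∀ x ∈ K, a₀ ≤ D.alpha K x - (1 / 2) * D.cellDiv K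
  jump : ∀ K₁ ∈ D.cells, ∀ K₂ ∈ D.cells, K₁ ≠ K₂ → (closure K₁ ∩ closure K₂).Nontrivial →
    ∀ ν₁ ν₂ : E3, D.IsConormal K₁ (closure K₁ ∩ closure K₂) ν₁ →
      D.IsConormal K₂ (closure K₁ ∩ closure K₂) ν₂ →
      ∀ x ∈ closure K₁ ∩ closure K₂,
        |inner ℝ ν₁ (D.beta K₁ x) + inner ℝ ν₂ (D.beta K₂ x)| ≤ C * h ^ 2

/-- `β_h` is tangential, `α_h` and `β_h` are bounded, and
`|β - |B|⁻¹ B β_h^l| ≤ C h²`, `|α - |B|⁻¹ α_h^l| ≤ C h²` on the smooth surface (the lift is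
written out: the inequalities are evaluated at `p(x)` for `x ∈ K ⊆ Γ_h`). -/
structure CoeffApprox (D : CutData) (O : Set E3) (α : E3 → ℝ) (β : E3 → E3) (h C : ℝ) :
    Prop where
  tangential : ∀ K ∈ D.cells, ∀ x ∈ K, inner ℝ (D.cellNrm K) (D.beta K x) = 0
  alpha_bdd : ∀ K ∈ D.cells, ∀ x ∈ K, |D.alpha K x| ≤ C
  beta_bdd : ∀ K ∈ D.cells, ∀ x ∈ K, ‖D.beta K x‖ ≤ C
  beta_approx : ∀ K ∈ D.cells, ∀ x ∈ K,
    ‖β (closestPt O x) -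
      (liftDet O (D.cellNrm K) x)⁻¹ • liftB O (D.cellNrm K) x (D.beta K x)‖ ≤ C * h ^ 2
  alpha_approx : ∀ K ∈ D.cells, ∀ x ∈ K,
    |α (closestPt O x) - (liftDet O (D.cellNrm K) x)⁻¹ * D.alpha K x| ≤ C * h ^ 2

end CutData

/-! ### Piecewise linear functions -/

open Classical in
/-- The affine function with the same values as `v` at the vertices of the tetrahedron `T`. -/
def interp (T : Finset E3) (v : E3 → ℝ) : E3 →ᵃ[ℝ] ℝ :=
  if h : ∃ g : E3 →ᵃ[ℝ] ℝ, ∀ b ∈ T, g b = v b then h.choose else 0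

/-- The (constant) gradient on `T` of a function `v` that is affine on `T`. -/
def elemGrad (T : Finset E3) (v : E3 → ℝ) : E3 :=
  (InnerProductSpace.toDual ℝ E3).symm (LinearMap.toContinuousLinearMap (interp T v).linear)

theorem exists_affine_of_indep (T : Finset E3) (hT : AffineIndependent ℝ ((↑) : T → E3))
    (hc : T.card = 4) (v : E3 → ℝ) : ∃ g : E3 →ᵃ[ℝ] ℝ, ∀ b ∈ T, g b = v b := by
  have htop : affineSpan ℝ (Set.range ((↑) : T → E3)) = ⊤ := by
    rw [hT.affineSpan_eq_top_iff_card_eq_finrank_add_one]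
    simp [hc]
  let B : AffineBasis T ℝ E3 := ⟨(↑), hT, htop⟩
  refine ⟨∑ i : T, v i • B.coord i, fun b hb => ?_⟩
  have key : ∀ s : Finset T, (∑ i ∈ s, v i • B.coord i : E3 →ᵃ[ℝ] ℝ) b =
      ∑ i ∈ s, v i * B.coord i b := by
    intro s
    induction s using Finset.induction_on with
    | empty => simp
    | insert a s ha ih => rw [Finset.sum_insert ha, Finset.sum_insert ha, ← ih]; rfl
  rw [key, Finset.sum_eq_single ⟨b, hb⟩]
  · have h1 : B.coord ⟨b, hb⟩ b = 1 := B.coord_apply_eq ⟨b, hb⟩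
    rw [h1, mul_one]
  · intro i _ hi
    have h0 : B.coord i b = 0 := B.coord_apply_ne (j := ⟨b, hb⟩) hi
    rw [h0, mul_zero]
  · simp

theorem interp_apply (T : Finset E3) (hT : AffineIndependent ℝ ((↑) : T → E3))
    (hc : T.card = 4) (v : E3 → ℝ) : ∀ b ∈ T, interp T v b = v b := by
  have h := exists_affine_of_indep T hT hc v
  rw [interp, dif_pos h]
  exact h.choose_spec

namespace CutData

open Classical in
/-- The nodal basis function `φ_a` of the node `a`: on each active tetrahedron `T` the affine
function that is `1` at `a` and `0` at the other nodes (see `hat_eqOn` and `hat_node`);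
`0` outside the active mesh. -/
def hat (D : CutData) (a x : E3) : ℝ :=
  if h : ∃ T ∈ D.active, x ∈ hull T then interp h.choose (fun b => if b = a then 1 else 0) x
  else 0

theorem hat_eqOn (D : CutData) (a : E3) {T : Finset E3} (hT : T ∈ D.active) :
    EqOn (D.hat a) (interp T (fun b => if b = a then 1 else 0)) (hull T) := by
  intro x hx
  have h : ∃ T ∈ D.active, x ∈ hull T := ⟨T, hT, hx⟩
  rw [hat, dif_pos h]
  obtain ⟨hS, hxS⟩ := h.choose_spec
  generalize h.choose = S at hS hxS
  have hx' : x ∈ convexHull ℝ ((S : Set E3) ∩ T) :=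
    D.mesh.complex.inter_subset_convexHull (D.mem_faces_of_active hS).1 (D.mem_faces_of_active hT).1 ⟨hxS, hx⟩
  refine AffineMap.eqOn_affineSpan (k := ℝ) (s := (S : Set E3) ∩ T) ?_
    (convexHull_subset_affineSpan _ hx')
  rintro b ⟨hbS, hbT⟩
  rw [interp_apply S (D.mesh.complex.indep (D.mem_faces_of_active hS).1) (D.mem_faces_of_active hS).2 _ b hbS,
    interp_apply T (D.mesh.complex.indep (D.mem_faces_of_active hT).1) (D.mem_faces_of_active hT).2 _ b hbT]

theorem hat_node (D : CutData) (a b : E3) (hb : b ∈ D.nodes) :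
    D.hat a b = if b = a then 1 else 0 := by
  obtain ⟨T, hT, hbT⟩ := Finset.mem_biUnion.mp hb
  have hm := D.mem_faces_of_active hT
  rw [D.hat_eqOn a hT (subset_convexHull ℝ _ hbT),
    interp_apply T (D.mesh.complex.indep hm.1) hm.2 _ b hbT]

/-! ### The discrete forms -/

/-- `∇_{Γ_h} v` on the cell `K`. -/
def surfGrad (D : CutData) (K : Set E3) (v : E3 → ℝ) : E3 :=
  tanProj (D.cellNrm K) (elemGrad (D.tetOf K) v)

/-- `a_h(v,w)`, with integration with respect to surface area. -/
def ah (D : CutData) (ε : ℝ) (v w : E3 → ℝ) : ℝ :=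
  ∑ K ∈ D.cells, ∫ x in K, (inner ℝ (D.beta K x) (D.surfGrad K v) * w x +
    D.alpha K x * v x * w x + ε * inner ℝ (D.surfGrad K v) (D.surfGrad K w)) ∂μHE[2]

/-- Streamline diffusion stabilization `s_{h,1}(v,w)`. -/
def sh1 (D : CutData) (τ₁ h : ℝ) (v w : E3 → ℝ) : ℝ :=
  τ₁ * h * ∑ K ∈ D.cells, ∫ x in K, (inner ℝ (D.beta K x) (D.surfGrad K v) +
    D.alpha K x * v x) * inner ℝ (D.beta K x) (D.surfGrad K w) ∂μHE[2]

/-- Normal gradient stabilization `s_{h,2}(v,w)`. -/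
def sh2 (D : CutData) (τ₂ h γ : ℝ) (v w : E3 → ℝ) : ℝ :=
  τ₂ * h ^ γ * ∑ T ∈ D.active, ∫ _x in hull T,
    inner ℝ (D.nrm T) (elemGrad T v) * inner ℝ (D.nrm T) (elemGrad T w)

/-- `A_h = a_h + s_{h,1} + s_{h,2}`. -/
def Ah (D : CutData) (ε τ₁ τ₂ h γ : ℝ) (v w : E3 → ℝ) : ℝ :=
  D.ah ε v w + D.sh1 τ₁ h v w + D.sh2 τ₂ h γ v w

/-- The stiffness matrix in the nodal basis. -/
def stiffness (D : CutData) (ε τ₁ τ₂ h γ : ℝ) : Matrix D.nodes D.nodes ℝ :=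
  Matrix.of fun i j => D.Ah ε τ₁ τ₂ h γ (D.hat i) (D.hat j)

end CutData

open Classical in
/-- `τ₁ = c_τ min(β_∞⁻¹, h ε⁻¹)`, where the second entry is `+∞` for `ε = 0`. -/
def tauOne (cτ βinf ε h : ℝ) : ℝ := if ε ≤ βinf * h then cτ * βinf⁻¹ else cτ * (h * ε⁻¹)

/-- Spectral condition number `|A| |A⁻¹|` (Euclidean operator norms). -/
def condNumber {ι : Type*} [Fintype ι] [DecidableEq ι] (A : Matrix ι ι ℝ) : ℝ :=
  ‖Matrix.toEuclideanCLM (𝕜 := ℝ) A‖ * ‖Matrix.toEuclideanCLM (𝕜 := ℝ) A⁻¹‖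

end

/-! ### The signed distance function near a smooth surface -/

section SignedDistance

open Filter Topology

/-! Let M(v) (`vertexSq`) be the sum of the squared vertex values of v over the active tetrahedra. A
node lies in boundedly many tetrahedra, so M is equivalent to the squared Euclidean norm of the
coefficient vector, and both factors of the condition number are read off from bounds of A_h by M.

Upper bound: areas scale like h², volumes like h³ and gradients like h⁻¹, so |A_h(v,w)| ≤
L(h+ε)(M(v)+M(w)) (`abs_Ah_le`). Lower bound: with θ = max(0, γ-1), A_h(v,v) ≥ c h^(2+θ) M(v) for
small h (`exists_coercivity`). The quotient is h^(-1-θ)(1+ε/h) up to a constant, and -1-θ = min(1,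
2-γ) - 2.

Coercivity: the divergence theorem for v²β_h on every cell (`integral_divergence`) replaces the
convection term by -½ div β_h v² and edge integrals. The conormal fluxes at an edge cancel up to
O(h²), so the edge integrals sum to O(h³)M (`abs_sum_edges_le`). The streamline term costs O(h)∫v².
There remain ∫v² over Γ_h and h^(γ+3) ∑|n_h·∇v|². The Poincaré type inequality h²M ≤ C(∫v² + h⁴
∑|n_h·∇v|²) (`exists_nodal_bound`), multiplied by h^θ, is dominated by these two terms because θ+4 ≥
γ+3. The edge error is smaller by h^(1-θ) and is absorbed because γ < 2.

Poincaré inequality: every active T contains a ball of radius comparable to h whose points are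
joined to Γ_h by segments in direction n_h|_T that stay inside active tetrahedra
(`exists_normalBall`). Along such a segment v changes by its normal derivatives times h, up to
O(h²)|∇v|, since neighbouring normals differ by O(h) (`norm_nrm_sub_le`). The end points of the
segments project onto a disc and thus fill an area of order h². The hard case is a tetrahedron that
Γ_h barely touches: there the segments must leave T and still stay in the active mesh.

Geometry: the position of Γ_h in the mesh is described by a continuous function F near Γ that
vanishes exactly on Γ_h, is affine up to O(h²) at scale h, and has slope one along the normals of Γ
(`exists_levelSurface`). Its expansion comes from balls touching Γ from both sides. Sign arguments
with F show that Γ_h fills every plane section whose interior it meets (`mem_surf_iff_plane`), that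
every edge of a cell belongs to a second cell (`exists_neighbour`), and that the cells exhaust the
area of Γ_h (`area_diff_cells`). -/

theorem abs_signDist (O : Set E3) (x : E3) : |signDist O x| = Metric.infDist x (frontier O) := by
  unfold signDist
  split_ifs
  · rw [abs_neg, abs_of_nonneg Metric.infDist_nonneg]
  · rw [abs_of_nonneg Metric.infDist_nonneg]

theorem exists_mem_frontier_segment {O : Set E3} {x y : E3} (hx : x ∈ O) (hy : y ∉ O) :
    ∃ z ∈ segment ℝ x y, z ∈ frontier O := by
  have hpre : IsPreconnected (segment ℝ x y) := (convex_segment (𝕜 := ℝ) x y).isPreconnected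
  by_contra! hcon
  have hopen : IsOpen (closure O)ᶜ := isClosed_closure.isOpen_compl
  have h := isPreconnected_iff_subset_of_disjoint.mp hpre (interior O) (closure O)ᶜ isOpen_interior
    hopen (fun z hz => by
      by_contra hz'
      simp only [mem_union, mem_compl_iff, not_or, not_not] at hz'
      exact hcon z hz ⟨hz'.2, hz'.1⟩) (by
      rw [eq_empty_iff_forall_notMem]
      exact fun z hz => hz.2.2 (interior_subset_closure hz.2.1))
  rcases h with h | h
  · exact hy (interior_subset (h (right_mem_segment ℝ x y)))
  · exact h (left_mem_segment ℝ x y) (subset_closure hx)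

/-- If x and y lie on different sides, the segment between them crosses the boundary, and the two
distances add up to at most its length; on one side this is the Lipschitz bound of the distance. -/
theorem signDist_sub_le (O : Set E3) (x y : E3) : signDist O x - signDist O y ≤ ‖x - y‖ := by
  have h1 := Metric.infDist_le_infDist_add_dist (s := frontier O) (x := x) (y := y)
  have h2 := Metric.infDist_le_infDist_add_dist (s := frontier O) (x := y) (y := x)
  rw [dist_comm y x] at h2
  rw [dist_eq_norm] at h1 h2
  unfold signDist
  have n1 := Metric.infDist_nonneg (s := frontier O) (x := x)
  have n2 := Metric.infDist_nonneg (s := frontier O) (x := y)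
  split_ifs with hx hy hy
  · linarith
  · linarith [norm_nonneg (x - y)]
  · obtain ⟨z, hz, hzO⟩ := exists_mem_frontier_segment hy hx
    have a1 := Metric.infDist_le_dist_of_mem (x := x) hzO
    have a2 := Metric.infDist_le_dist_of_mem (x := y) hzO
    have := dist_add_dist_of_mem_segment hz
    rw [dist_comm z x, dist_comm y x, dist_eq_norm x y] at this
    linarith
  · linarith

theorem abs_signDist_sub_le (O : Set E3) (x y : E3) :
    |signDist O x - signDist O y| ≤ ‖x - y‖ := by
  rw [abs_le]
  have := signDist_sub_le O x y
  have h2 := signDist_sub_le O y x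
  rw [norm_sub_rev] at h2
  constructor <;> linarith

theorem continuous_signDist (O : Set E3) : Continuous (signDist O) :=
  (LipschitzWith.of_dist_le_mul (K := 1) fun x y => by
    rw [Real.dist_eq, dist_eq_norm]; simpa using abs_signDist_sub_le O x y).continuous

/-- The balls of radius `r` that touch the surface at `y` from outside and from inside, with
outward normal `n`. -/
structure TouchingBalls (O : Set E3) (r : ℝ) (y n : E3) : Prop where
  norm_eq : ‖n‖ = 1
  outside : r ≤ signDist O (y + r • n)
  inside : signDist O (y - r • n) ≤ -r

/-- This is 2ab ≤ a² + b² with b = ‖a • n - d‖. It linearises the distance to the centre of a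
touching ball with a quadratic remainder. -/
theorem norm_smul_sub_le {a : ℝ} (ha : 0 < a) {n : E3} (hn : ‖n‖ = 1) (d : E3) :
    ‖a • n - d‖ ≤ a - inner ℝ n d + ‖d‖ ^ 2 / (2 * a) := by
  have h1 : ‖a • n - d‖ ^ 2 = a ^ 2 - 2 * a * inner ℝ n d + ‖d‖ ^ 2 := by
    rw [norm_sub_sq_real, norm_smul, hn, real_inner_smul_left, Real.norm_eq_abs, mul_one, sq_abs]
    ring
  have h2 : a - inner ℝ n d + ‖d‖ ^ 2 / (2 * a) = (a ^ 2 + ‖a • n - d‖ ^ 2) / (2 * a) := by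
    rw [h1]; field_simp; ring
  rw [h2, le_div_iff₀ (by positivity)]
  nlinarith [sq_nonneg (a - ‖a • n - d‖)]

namespace TouchingBalls

variable {O : Set E3} {r : ℝ} {y n : E3}

/-- The values r and -r at the two centres and the Lipschitz bound pinch the function along the
whole diameter. -/
theorem signDist_add_smul (H : TouchingBalls O r y n) {t : ℝ} (ht : |t| ≤ r) :
    signDist O (y + t • n) = t := by
  have h1 := signDist_sub_le O (y + r • n) (y + t • n)
  have h2 := signDist_sub_le O (y + t • n) (y - r • n)
  have e1 : y + r • n - (y + t • n) = (r - t) • n := by module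
  have e2 : y + t • n - (y - r • n) = (r + t) • n := by module
  obtain ⟨l, u⟩ := abs_le.mp ht
  rw [e1, norm_smul, H.norm_eq, Real.norm_eq_abs, abs_of_nonneg (by linarith)] at h1
  rw [e2, norm_smul, H.norm_eq, Real.norm_eq_abs, abs_of_nonneg (by linarith)] at h2
  linarith [H.outside, H.inside]

theorem mono (H : TouchingBalls O r y n) {r' : ℝ} (h0 : 0 ≤ r') (h : r' ≤ r) :
    TouchingBalls O r' y n := by
  refine ⟨H.norm_eq, ?_, ?_⟩
  · rw [H.signDist_add_smul (abs_le.mpr ⟨by linarith, h⟩)]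
  · have := H.signDist_add_smul (t := -r') (abs_le.mpr ⟨by linarith, by linarith⟩)
    rw [neg_smul, ← sub_eq_add_neg] at this
    rw [this]

/-- The Lipschitz bound from the outer centre gives the lower estimate and from the inner centre the
upper one; `norm_smul_sub_le` linearises both distances. No differentiability of the closest point
mapping is needed. -/
theorem signDist_expansion (H : TouchingBalls O r y n) {t : ℝ} (ht : |t| < r) (x : E3) :
    |signDist O x - t - inner ℝ n (x - (y + t • n))| ≤
      ‖x - (y + t • n)‖ ^ 2 / (2 * (r - |t|)) := by
  obtain ⟨l, u⟩ := abs_lt.mp ht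
  set d := x - (y + t • n) with hd
  have hpos : 0 < r - |t| := by linarith
  have h1 := signDist_sub_le O (y + r • n) x
  have h2 := signDist_sub_le O x (y - r • n)
  have e1 : y + r • n - x = (r - t) • n - d := by rw [hd]; module
  have e2 : x - (y - r • n) = -((r + t) • (-n) - d) := by rw [hd]; module
  have q1 := norm_smul_sub_le (a := r - t) (by linarith) H.norm_eq d
  have q2 := norm_smul_sub_le (a := r + t) (by linarith) (n := -n) (by rw [norm_neg, H.norm_eq]) d
  rw [inner_neg_left] at q2
  rw [e1] at h1
  rw [e2, norm_neg] at h2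
  have b1 : ‖d‖ ^ 2 / (2 * (r - t)) ≤ ‖d‖ ^ 2 / (2 * (r - |t|)) := by
    gcongr; exact le_abs_self t
  have b2 : ‖d‖ ^ 2 / (2 * (r + t)) ≤ ‖d‖ ^ 2 / (2 * (r - |t|)) := by
    gcongr; linarith [neg_abs_le t]
  rw [abs_le]
  constructor <;> linarith [H.outside, H.inside]

/-- The quadratic remainder identifies `surfNormal` with n along the whole normal segment. -/
theorem hasGradientAt (H : TouchingBalls O r y n) {t : ℝ} (ht : |t| < r) :
    HasGradientAt (signDist O) n (y + t • n) := by
  rw [hasGradientAt_iff_isLittleO]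
  have hb : (fun x' => signDist O x' - signDist O (y + t • n) - inner ℝ n (x' - (y + t • n)))
      =O[𝓝 (y + t • n)] fun x' => ‖x' - (y + t • n)‖ ^ 2 := by
    refine Asymptotics.IsBigO.of_bound (1 / (2 * (r - |t|))) (Eventually.of_forall fun x => ?_)
    rw [H.signDist_add_smul ht.le, Real.norm_eq_abs, norm_pow, norm_norm,
      one_div_mul_eq_div]
    exact H.signDist_expansion ht x
  refine hb.trans_isLittleO ?_
  have h0 : Tendsto (fun x : E3 => ‖x - (y + t • n)‖) (𝓝 (y + t • n)) (𝓝 0) := by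
    have : Continuous (fun x : E3 => ‖x - (y + t • n)‖) := by fun_prop
    simpa using this.tendsto (y + t • n)
  have := (Asymptotics.isLittleO_one_iff ℝ).mpr h0
  have := this.mul_isBigO (Asymptotics.isBigO_refl (fun x : E3 => ‖x - (y + t • n)‖)
    (𝓝 (y + t • n)))
  refine (this.congr (fun x => by ring) (fun x => one_mul _)).of_norm_right

/-- The direction from a closest point is the normal. -/
theorem eq_add_smul_of_closest (H : TouchingBalls O r y n) (hr : 0 < r)
    {x : E3} (hx : dist x y = Metric.infDist x (frontier O)) :
    x = y + signDist O x • n := by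
  have hd : ‖x - y‖ = |signDist O x| := by rw [abs_signDist, ← hx, dist_eq_norm]
  set ρ := signDist O x with hρ
  rcases eq_or_ne ρ 0 with h0 | h0
  · rw [h0, abs_zero, norm_eq_zero, sub_eq_zero] at hd
    rw [h0, zero_smul, add_zero, hd]
  set e : E3 := ρ⁻¹ • (x - y) with he
  have hxe : x - y = ρ • e := by rw [he, smul_smul, mul_inv_cancel₀ h0, one_smul]
  have hene : ‖e‖ = 1 := by
    rw [he, norm_smul, hd, norm_inv, Real.norm_eq_abs, inv_mul_cancel₀ (abs_ne_zero.mpr h0)]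
  have hpos : 0 < |ρ| := abs_pos.mpr h0
  -- The Lipschitz bound from x forces |ρ| ≥ s|ρ(x)|, with the sign of ρ(x), at the point y +
  -- sρ(x)e. Comparing with the expansion at y and letting s tend to 0 gives n·e ≥ 1, hence n = e.
  have key : ∀ s : ℝ, 0 < s → s ≤ 1 → 1 ≤ inner ℝ n e + s * (|ρ| / (2 * r)) := by
    intro s hs hs1
    have ex := H.signDist_expansion (t := 0) (by simpa using hr) (y + (s * ρ) • e)
    have e1 : y + (s * ρ) • e - (y + (0 : ℝ) • n) = (s * ρ) • e := by module
    rw [e1, abs_zero, sub_zero, sub_zero, norm_smul, hene, mul_one, real_inner_smul_right,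
      Real.norm_eq_abs, sq_abs] at ex
    have hl := abs_signDist_sub_le O x (y + (s * ρ) • e)
    have e2 : x - (y + (s * ρ) • e) = ((1 - s) * ρ) • e := by
      rw [← sub_sub, hxe]; module
    rw [e2, norm_smul, hene, mul_one, Real.norm_eq_abs, abs_mul, abs_of_nonneg (a := 1 - s) (by linarith),
      ← hρ] at hl
    obtain ⟨x1, x2⟩ := abs_le.mp ex
    obtain ⟨l1, l2⟩ := abs_le.mp hl
    have e3 : (s * ρ) ^ 2 / (2 * r) = s * |ρ| * (s * (|ρ| / (2 * r))) := by
      rw [mul_pow, ← sq_abs ρ]; ring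
    have : s * |ρ| * 1 ≤ s * |ρ| * (inner ℝ n e + s * (|ρ| / (2 * r))) := by
      rw [mul_add, ← e3]
      rcases abs_cases ρ with ⟨h, _⟩ | ⟨h, _⟩ <;> rw [h] at l1 l2 ⊢ <;> linarith
    exact le_of_mul_le_mul_left this (by positivity)
  have hge : 1 ≤ inner ℝ n e := by
    refine le_of_forall_pos_le_add fun δ hδ => ?_
    have hk := key (min 1 (δ / (|ρ| / (2 * r)))) (by positivity) (min_le_left _ _)
    have : min 1 (δ / (|ρ| / (2 * r))) * (|ρ| / (2 * r)) ≤ δ := by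
      calc _ ≤ δ / (|ρ| / (2 * r)) * (|ρ| / (2 * r)) := by gcongr; exact min_le_right _ _
        _ = δ := div_mul_cancel₀ _ (by positivity)
    linarith
  have hne : n = e := by
    rw [← inner_eq_one_iff_of_norm_eq_one H.norm_eq hene (𝕜 := ℝ)]
    exact le_antisymm (by simpa [H.norm_eq, hene] using real_inner_le_norm n e) hge
  rw [hne, ← hxe]; abel

end TouchingBalls

/-- A ball without points of O contains no boundary point, nor does a ball inside the open set O; so
the distance of each centre to the boundary is at least r, and its sign is known. -/
theorem touchingBalls_of_disjoint {O : Set E3} (hO : IsOpen O) {r : ℝ} (hr : 0 < r) {y n : E3}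
    (hy : y ∈ frontier O) (hn : ‖n‖ = 1)
    (h1 : ∀ z, ‖z - (y + r • n)‖ < r → z ∉ O) (h2 : ∀ z, ‖z - (y - r • n)‖ < r → z ∈ O) :
    TouchingBalls O r y n := by
  have hne : (frontier O).Nonempty := ⟨y, hy⟩
  have a1 : r ≤ Metric.infDist (y + r • n) (frontier O) := by
    rw [Metric.le_infDist hne]
    intro z hz
    by_contra! hlt
    rw [dist_comm, dist_eq_norm] at hlt
    have hz' : z ∈ closure O := hz.1
    rw [_root_.mem_closure_iff] at hz'
    obtain ⟨w, hw, hwO⟩ := hz' (Metric.ball (y + r • n) r) Metric.isOpen_ball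
      (by rwa [Metric.mem_ball, dist_eq_norm])
    rw [Metric.mem_ball, dist_eq_norm] at hw
    exact h1 w hw hwO
  have a2 : r ≤ Metric.infDist (y - r • n) (frontier O) := by
    rw [Metric.le_infDist hne]
    intro z hz
    by_contra! hlt
    rw [dist_comm, dist_eq_norm] at hlt
    have hzO := h2 z hlt
    rw [hO.frontier_eq] at hz
    exact hz.2 hzO
  refine ⟨hn, ?_, ?_⟩
  · rw [signDist, if_neg (h1 _ (by simpa using hr))]; exact a1
  · rw [signDist, if_pos (h2 _ (by simpa using hr))]; linarith

/-- A quadratic lower bound for a defining function yields touching balls. -/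
theorem touchingBalls_of_quadratic {O U : Set E3} (hO : IsOpen O) {φ : E3 → ℝ} {y g : E3}
    (hy : y ∈ frontier O) (hφ : ∀ z ∈ U, z ∈ O ↔ φ z < 0) (hφy : φ y = 0) {M r : ℝ} (hr : 0 < r)
    (hg : 0 < ‖g‖) (hM : 2 * r * M < ‖g‖) (hU : ∀ z, ‖z - y‖ < 2 * r → z ∈ U)
    (hq : ∀ z, ‖z - y‖ < 2 * r → |φ z - φ y - inner ℝ g (z - y)| ≤ M * ‖z - y‖ ^ 2) :
    TouchingBalls O r y (‖g‖⁻¹ • g) := by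
  set n : E3 := ‖g‖⁻¹ • g with hn
  have hn1 : ‖n‖ = 1 := by rw [hn, norm_smul, norm_inv, norm_norm, inv_mul_cancel₀ hg.ne']
  have hgn : g = ‖g‖ • n := by rw [hn, smul_smul, mul_inv_cancel₀ hg.ne', one_smul]
  -- The sign σ treats both balls at once: membership in the ball with centre y + σrn means ‖z - y‖²
  -- < 2rσ n·(z - y), so the linear part of φ dominates the quadratic remainder.
  have aux : ∀ (σ : ℝ), σ ^ 2 = 1 → ∀ z, ‖z - (y + (σ * r) • n)‖ < r →
      ‖z - y‖ < 2 * r ∧ ‖z - y‖ ^ 2 < 2 * r * (σ * inner ℝ n (z - y)) := by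
    intro σ hσ z hz
    have hσ1 : |σ| = 1 := by rw [← sq_abs] at hσ; nlinarith [abs_nonneg σ]
    have e : z - (y + (σ * r) • n) = (z - y) - (σ * r) • n := by abel
    rw [e] at hz
    constructor
    · have h3 : ‖z - y‖ ≤ ‖(z - y) - (σ * r) • n‖ + ‖(σ * r) • n‖ := by
        simpa using norm_add_le ((z - y) - (σ * r) • n) ((σ * r) • n)
      have : ‖(σ * r) • n‖ = r := by
        rw [norm_smul, hn1, mul_one, Real.norm_eq_abs, abs_mul, hσ1, one_mul, abs_of_pos hr]
      linarith
    · have h4 : ‖(z - y) - (σ * r) • n‖ ^ 2 < r ^ 2 := by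
        gcongr
      rw [norm_sub_sq_real, norm_smul, hn1, real_inner_smul_right, Real.norm_eq_abs, mul_one, sq_abs,
        mul_pow, hσ, real_inner_comm] at h4
      linarith
  have fin : ∀ z, ‖z - y‖ ^ 2 < 2 * r * |inner ℝ n (z - y)| → ‖z - y‖ < 2 * r →
      M * ‖z - y‖ ^ 2 < ‖g‖ * |inner ℝ n (z - y)| := by
    intro z hz hz2
    have hpos : 0 < |inner ℝ n (z - y)| := by
      by_contra! hc
      nlinarith [sq_nonneg ‖z - y‖]
    rcases le_or_gt M 0 with hM0 | hM0
    · nlinarith [sq_nonneg ‖z - y‖, mul_pos hg hpos]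
    · nlinarith
  refine touchingBalls_of_disjoint hO hr hy hn1 ?_ ?_
  · intro z hz hzO
    obtain ⟨z1, z2⟩ := aux 1 (by norm_num) z (by simpa using hz)
    rw [one_mul] at z2
    have hpos : 0 ≤ inner ℝ n (z - y) := by
      by_contra! hc
      nlinarith [sq_nonneg ‖z - y‖]
    have h5 := fin z (by rwa [abs_of_nonneg hpos]) z1
    rw [abs_of_nonneg hpos] at h5
    have h6 := hq z z1
    rw [hφy, sub_zero] at h6
    nth_rw 1 [hgn] at h6
    rw [real_inner_smul_left] at h6
    have := (hφ z (hU z z1)).mp hzO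
    linarith [(abs_le.mp h6).1]
  · intro z hz
    obtain ⟨z1, z2⟩ := aux (-1) (by norm_num) z (by
      rw [neg_mul, one_mul, neg_smul, ← sub_eq_add_neg]; exact hz)
    have hneg : inner ℝ n (z - y) ≤ 0 := by
      by_contra! hc
      nlinarith [sq_nonneg ‖z - y‖]
    have h5 := fin z (by rw [abs_of_nonpos hneg]; linarith) z1
    rw [abs_of_nonpos hneg] at h5
    have h6 := hq z z1
    rw [hφy, sub_zero] at h6
    nth_rw 1 [hgn] at h6
    rw [real_inner_smul_left] at h6
    rw [hφ z (hU z z1)]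
    linarith [(abs_le.mp h6).2]

/-- The derivative of a C² function is locally Lipschitz, which gives a second order remainder with
one constant M for all base points near x. This uniformity yields one radius for all nearby boundary
points. -/
theorem exists_quadratic_bound {φ : E3 → ℝ} {x : E3} (hφ : ContDiffAt ℝ 2 φ x) :
    ∃ ε M : ℝ, 0 < ε ∧ 0 ≤ M ∧ (∀ y ∈ Metric.ball x ε, ∀ z ∈ Metric.ball x ε,
      |φ z - φ y - inner ℝ (gradient φ y) (z - y)| ≤ M * ‖z - y‖ ^ 2) ∧
      ContinuousOn (gradient φ) (Metric.ball x ε) := by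
  have hd : ContDiffAt ℝ 1 (fderiv ℝ φ) x := hφ.fderiv_right (m := 1) (by norm_num)
  obtain ⟨K, t, ht, hK⟩ := hd.exists_lipschitzOnWith
  have hdiff : ∀ᶠ z in 𝓝 x, DifferentiableAt ℝ φ z := by
    filter_upwards [hφ.eventually (by simp)] with z hz
    exact hz.differentiableAt (by norm_num)
  obtain ⟨ε, hε, hball⟩ := Metric.mem_nhds_iff.mp (Filter.inter_mem ht hdiff)
  have hlip : LipschitzOnWith K (fderiv ℝ φ) (Metric.ball x ε) :=
    hK.mono fun z hz => (hball hz).1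
  refine ⟨ε, K, hε, K.2, ?_, ?_⟩
  · intro y hy z hz
    have hseg : segment ℝ y z ⊆ Metric.ball x ε := (convex_ball x ε).segment_subset hy hz
    have := (convex_segment y z).norm_image_sub_le_of_norm_hasFDerivWithin_le'
      (f := φ) (f' := fderiv ℝ φ) (φ := fderiv ℝ φ y) (C := K * ‖z - y‖)
      (fun w hw => ((hball (hseg hw)).2).hasFDerivAt.hasFDerivWithinAt)
      (fun w hw => by
        have h1 := hlip.dist_le_mul w (hseg hw) y hy
        rw [dist_eq_norm, dist_eq_norm] at h1
        refine h1.trans ?_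
        gcongr
        obtain ⟨a, b, ha, hb, hab, rfl⟩ := hw
        have : a • y + b • z - y = b • (z - y) := by
          rw [show a = 1 - b by linarith]; module
        rw [this, norm_smul, Real.norm_eq_abs, abs_of_nonneg hb]
        exact mul_le_of_le_one_left (norm_nonneg _) (by linarith))
      (left_mem_segment ℝ y z) (right_mem_segment ℝ y z)
    rw [Real.norm_eq_abs, ← toDual_gradient, InnerProductSpace.toDual_apply_apply] at this
    linarith
  · exact (InnerProductSpace.toDual ℝ E3).symm.continuous.comp_continuousOn hlip.continuousOn

theorem IsSmoothDomain.isCompact_frontier {O : Set E3} (hO : IsSmoothDomain O) :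
    IsCompact (frontier O) :=
  Metric.isCompact_of_isClosed_isBounded isClosed_frontier
    (hO.isBounded.closure.subset frontier_subset_closure)

/-- The radius from the local quadratic bound serves a whole neighbourhood in the boundary. Touching
balls can be shrunk, so compactness gives one radius for the whole surface. -/
theorem IsSmoothDomain.exists_touchingBalls {O : Set E3} (hO : IsSmoothDomain O) :
    ∃ r > 0, ∀ y ∈ frontier O, ∃ n, TouchingBalls O r y n := by
  refine hO.isCompact_frontier.induction_on (p := fun s => ∃ r > 0, ∀ y ∈ s, ∃ n,
    TouchingBalls O r y n) ⟨1, one_pos, fun y hy => hy.elim⟩ ?_ ?_ ?_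
  · rintro s t hst ⟨r, hr, h⟩
    exact ⟨r, hr, fun y hy => h y (hst hy)⟩
  · rintro s t ⟨r, hr, h⟩ ⟨r', hr', h'⟩
    refine ⟨min r r', lt_min hr hr', ?_⟩
    rintro y (hy | hy)
    · obtain ⟨n, hn⟩ := h y hy
      exact ⟨n, hn.mono (lt_min hr hr').le (min_le_left _ _)⟩
    · obtain ⟨n, hn⟩ := h' y hy
      exact ⟨n, hn.mono (lt_min hr hr').le (min_le_right _ _)⟩
  · intro x hx
    obtain ⟨U, φ, hU, hxU, hφ, hgrad, hiff⟩ := hO.smooth x hx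
    have hcd : ContDiffAt ℝ 2 φ x :=
      (hφ.contDiffAt (hU.mem_nhds hxU)).of_le (WithTop.coe_le_coe.mpr (le_top : (2 : ℕ∞) ≤ ⊤))
    obtain ⟨ε, M, hε, hM, hq, hc⟩ := exists_quadratic_bound hcd
    set m := ‖gradient φ x‖ with hm
    have hmpos : 0 < m := norm_pos_iff.mpr hgrad
    have hcx : ContinuousAt (gradient φ) x := hc.continuousAt (Metric.ball_mem_nhds x hε)
    have hev : ∀ᶠ z in 𝓝 x, m / 2 < ‖gradient φ z‖ :=
      hcx.norm.eventually (lt_mem_nhds (by linarith))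
    obtain ⟨η, hη, hball⟩ := Metric.mem_nhds_iff.mp
      (Filter.inter_mem (hU.mem_nhds hxU) (Filter.inter_mem hev (Metric.ball_mem_nhds x hε)))
    -- The first entry keeps the touching balls inside the ball of radius η, where the sign
    -- criterion and the quadratic bound hold; the second gives 2rM < m/2 < ‖∇φ(y)‖.
    set r : ℝ := min (η / 4) (m / (8 * (M + 1))) with hr
    have hrpos : 0 < r := by positivity
    refine ⟨Metric.ball x (η / 2) ∩ frontier O, ?_, r, hrpos, ?_⟩
    · exact Filter.inter_mem (mem_nhdsWithin_of_mem_nhds (Metric.ball_mem_nhds x (by linarith)))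
        self_mem_nhdsWithin
    · rintro y ⟨hy, hyO⟩
      have hyη : y ∈ Metric.ball x η := Metric.ball_subset_ball (by linarith) hy
      have hzη : ∀ z, ‖z - y‖ < 2 * r → z ∈ Metric.ball x η := by
        intro z hz
        rw [← dist_eq_norm] at hz
        rw [Metric.mem_ball] at hy ⊢
        have := min_le_left (η / 4) (m / (8 * (M + 1)))
        linarith [dist_triangle z y x]
      have hyU : y ∈ U := (hball hyη).1
      have hcy : ContinuousAt φ y := (hφ.contDiffAt (hU.mem_nhds hyU)).continuousAt
      have hφy : φ y = 0 := by
        refine le_antisymm ?_ ?_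
        · have hcl : y ∈ closure O := hyO.1
          by_contra! hpos
          have hev2 := (hcy.eventually (lt_mem_nhds hpos)).and (hU.mem_nhds hyU)
          obtain ⟨w, hw, hwO⟩ := mem_closure_iff_nhds.mp hcl _ hev2
          exact absurd ((hiff w hw.2).mp hwO) (not_lt.mpr (le_of_lt hw.1))
        · by_contra! hneg
          rw [hO.isOpen.frontier_eq] at hyO
          exact hyO.2 ((hiff y hyU).mpr hneg)
      have hgy : m / 2 < ‖gradient φ y‖ := (hball hyη).2.1
      refine ⟨_, touchingBalls_of_quadratic (U := U) hO.isOpen hyO hiff hφy hrpos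
        (lt_trans (by linarith) hgy) (M := M) ?_ (fun z hz => (hball (hzη z hz)).1)
        (fun z hz => hq y (hball hyη).2.2 z (hball (hzη z hz)).2.2)⟩
      have hr2 : r ≤ m / (8 * (M + 1)) := min_le_right _ _
      have : r * (8 * (M + 1)) ≤ m := by rwa [le_div_iff₀ (by positivity)] at hr2
      nlinarith

end SignedDistance

/-! ### The level function of the discrete surface -/

section LevelFunction

open Filter Topology

theorem MapClusterPt.eq_of_tendsto {X Y : Type*} [TopologicalSpace X] [T2Space X] {l : Filter Y}
    {f : Y → X} {a b : X} (h : MapClusterPt a l f) (hf : Tendsto f l (𝓝 b)) : a = b :=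
  eq_of_nhds_neBot (ClusterPt.mono h hf)

theorem closestPt_spec {O : Set E3} (hc : IsCompact (frontier O)) (hne : (frontier O).Nonempty)
    (x : E3) :
    closestPt O x ∈ frontier O ∧ dist x (closestPt O x) = Metric.infDist x (frontier O) := by
  have h : ∃ y ∈ frontier O, dist x y = Metric.infDist x (frontier O) := by
    obtain ⟨y, hy, h⟩ := hc.exists_infDist_eq_dist hne x
    exact ⟨y, hy, h.symm⟩
  rw [closestPt, dif_pos h]
  exact h.choose_spec

/-- The closest point mapping is continuous where the closest point is unique. -/
theorem continuousAt_closestPt {O : Set E3} (hc : IsCompact (frontier O))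
    (hne : (frontier O).Nonempty) {x : E3}
    (hx : ∃! y, y ∈ frontier O ∧ dist x y = Metric.infDist x (frontier O)) :
    ContinuousAt (closestPt O) x := by
  refine hc.tendsto_nhds_of_unique_mapClusterPt
    (Eventually.of_forall fun z => (closestPt_spec hc hne z).1) fun y hy hcl => ?_
  refine hx.unique ⟨hy, ?_⟩ (closestPt_spec hc hne x)
  have h1 : Tendsto (fun z => dist x (closestPt O z)) (𝓝 x) (𝓝 (Metric.infDist x (frontier O))) := by
    rw [tendsto_iff_dist_tendsto_zero]
    have h2 : Tendsto (fun z => 2 * dist z x) (𝓝 x) (𝓝 0) := by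
      have : Continuous (fun z : E3 => 2 * dist z x) := by fun_prop
      simpa using this.tendsto x
    refine squeeze_zero (fun _ => dist_nonneg) (fun z => ?_) h2
    have e1 := (closestPt_spec hc hne z).2
    have e2 := Metric.infDist_le_infDist_add_dist (s := frontier O) (x := x) (y := z)
    have e3 := Metric.infDist_le_infDist_add_dist (s := frontier O) (x := z) (y := x)
    have e4 := dist_triangle x z (closestPt O z)
    have e5 := dist_triangle z x (closestPt O z)
    rw [dist_comm x z] at *
    rw [Real.dist_eq, abs_le]
    constructor <;> linarith
  have hd : ContinuousAt (fun p => dist x p) y := (continuous_const.dist continuous_id).continuousAt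
  exact (hcl.continuousAt_comp hd).eq_of_tendsto h1

/-- The discrete surface at one mesh size, described near the smooth surface as the zero set of a
continuous function `F` that is close to the signed distance. -/
structure LevelSurface (D : CutData) (F : E3 → ℝ) (U : Set E3) (h σ C R : ℝ) : Prop where
  h_pos : 0 < h
  σ_pos : 0 < σ
  C_nonneg : 0 ≤ C
  R_pos : 0 < R
  quasi : D.mesh.Quasiuniform h σ
  isOpen : IsOpen U
  cont : ContinuousOn F U
  cover : ∀ z ∈ U, ∃ T ∈ D.mesh.tets, z ∈ hull T
  closedBall_subset : ∀ x ∈ D.surf, Metric.closedBall x R ⊆ U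
  zero_iff : ∀ z ∈ U, F z = 0 ↔ z ∈ D.surf
  norm_nrm : ∀ T ∈ D.active, ‖D.nrm T‖ = 1
  planar : ∀ T ∈ D.active, ∃ c : ℝ, ∀ x ∈ hull T ∩ D.surf, inner ℝ (D.nrm T) x = c
  expansion : ∀ T ∈ D.active, ∀ x ∈ hull T ∩ D.surf, ∀ z ∈ Metric.closedBall x R,
    |F z - inner ℝ (D.nrm T) (z - x)| ≤ C * (h ^ 2 + h * ‖z - x‖ + ‖z - x‖ ^ 2)
  transversal : ∀ x ∈ D.surf, ∃ n, ‖n‖ = 1 ∧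
    (∀ T ∈ D.active, x ∈ hull T → ‖n - D.nrm T‖ ≤ C * h) ∧ ∀ s, |s| ≤ R → F (x + s • n) = s

theorem TetMesh.exists_tet_of_mem_space (M : TetMesh) {z : E3} (hz : z ∈ M.complex.space) :
    ∃ T ∈ M.tets, z ∈ hull T := by
  rw [Geometry.SimplicialComplex.mem_space_iff] at hz
  obtain ⟨s, hs, hzs⟩ := hz
  obtain ⟨T, hT, hsT, hc⟩ := M.pure s hs
  exact ⟨T, by simp [TetMesh.tets, hT, hc], convexHull_mono (by exact_mod_cast hsT) hzs⟩

/-- F(z) = ρ(z) - ρ(G z), where G z is the point of Γ_h with the closest point of z. A point is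
determined by its closest point and its signed distance, so F vanishes only on Γ_h. On a normal of Γ
the point G z is constant, so F grows with slope one. As ρ = O(h²) on Γ_h, F inherits the expansion
of ρ. -/
theorem exists_levelSurface (O : Set E3) (hO : IsSmoothDomain O) (hne : (frontier O).Nonempty)
    (δ₀ : ℝ) (hδ₀ : 0 < δ₀)
    (hp : ∀ x ∈ tube O δ₀, ∃! y, y ∈ frontier O ∧ dist x y = Metric.infDist x (frontier O))
    (Ω₀ : Set E3) (hΩ : tube O δ₀ ⊆ Ω₀) (h₀ : ℝ) (hh₀ : 0 < h₀) (D : ℝ → CutData)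
    (hspace : ∀ h ∈ Set.Ioc 0 h₀, (D h).mesh.complex.space = closure Ω₀)
    (σ : ℝ) (hσ : 0 < σ) (hmesh : ∀ h ∈ Set.Ioc 0 h₀, (D h).mesh.Quasiuniform h σ)
    (hsurf : ∀ h ∈ Set.Ioc 0 h₀, (D h).IsDiscreteSurface O δ₀)
    (C : ℝ) (hA : ∀ h ∈ Set.Ioc 0 h₀, (D h).GeomApprox O h C) :
    ∃ C' R hs : ℝ, ∃ U, 0 < hs ∧ hs ≤ h₀ ∧
      ∀ h ∈ Set.Ioc 0 hs, ∃ F, LevelSurface (D h) F U h σ C' R := by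
  have hc := hO.isCompact_frontier
  obtain ⟨r, hr, hballs⟩ := hO.exists_touchingBalls
  choose! N hN using hballs
  set δ := min δ₀ r with hδ
  have hδpos : 0 < δ := lt_min hδ₀ hr
  set C₁ := |C| with hC₁
  have hC₁0 : 0 ≤ C₁ := abs_nonneg C
  -- For h ≤ hs one has C₁h² < δ/2, so all balls of radius δ/2 about points of Γ_h stay in the tube
  -- of width δ.
  set hs := min (min h₀ 1) (δ / (2 * (C₁ + 1))) with hhs
  have hspos : 0 < hs := by positivity
  have hsh0 : hs ≤ h₀ := (min_le_left _ _).trans (min_le_left _ _)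
  have hs1 : hs ≤ 1 := (min_le_left _ _).trans (min_le_right _ _)
  set p := closestPt O with hpdef
  have hpmem : ∀ x, p x ∈ frontier O := fun x => (closestPt_spec hc hne x).1
  have hpdist : ∀ x, dist x (p x) = Metric.infDist x (frontier O) :=
    fun x => (closestPt_spec hc hne x).2
  have htube : ∀ x ∈ tube O δ, x ∈ tube O δ₀ := fun x hx =>
    lt_of_lt_of_le (show |signDist O x| < δ from hx) (min_le_left _ _)
  have hrep : ∀ x, x = p x + signDist O x • N (p x) := fun x =>
    (hN (p x) (hpmem x)).eq_add_smul_of_closest hr (hpdist x)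
  have hpline : ∀ y ∈ frontier O, ∀ t : ℝ, |t| < δ → p (y + t • N y) = y := by
    intro y hy t ht
    have hs := (hN y hy).signDist_add_smul (ht.le.trans (min_le_right _ _))
    have hmem : y + t • N y ∈ tube O δ₀ := by
      rw [tube, mem_ofPred_eq, hs]; exact ht.trans_le (min_le_left _ _)
    refine (hp _ hmem).unique ⟨hpmem _, hpdist _⟩ ⟨hy, ?_⟩
    rw [← abs_signDist, hs, dist_eq_norm, add_sub_cancel_left, norm_smul, (hN y hy).norm_eq, mul_one,
      Real.norm_eq_abs]
  refine ⟨C₁ + 2 * C₁ + (C₁ + 1) ^ 2 / r + 1 / r, δ / 2, hs, tube O δ, hspos, hsh0, fun h hh => ?_⟩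
  have hh0 : h ∈ Set.Ioc 0 h₀ := ⟨hh.1, hh.2.trans hsh0⟩
  have hhpos : 0 < h := hh.1
  have hh1 : h ≤ 1 := hh.2.trans hs1
  have hS := hsurf h hh0
  have hG := hA h hh0
  have hdist : ∀ x ∈ (D h).surf, |signDist O x| ≤ C₁ * h ^ 2 := fun x hx =>
    (hG.dist_le x hx).trans (by gcongr; exact le_abs_self C)
  have hsmall : C₁ * h ^ 2 < δ / 2 := by
    have h1 : h ≤ δ / (2 * (C₁ + 1)) := hh.2.trans (min_le_right _ _)
    rw [le_div_iff₀ (by positivity)] at h1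
    nlinarith [mul_nonneg hC₁0 hhpos.le, mul_nonneg (mul_nonneg hC₁0 hhpos.le) (sub_nonneg.mpr hh1)]
  have hnormal : ∀ T ∈ (D h).active, ∀ x ∈ hull T ∩ (D h).surf,
      ‖N (p x) - (D h).nrm T‖ ≤ C₁ * h := by
    intro T hT x hx
    have h1 := hG.normal_le T hT x hx
    have h2 : surfNormal O x = N (p x) := by
      have h3 := (hN (p x) (hpmem x)).hasGradientAt (t := signDist O x)
        (by linarith [hdist x hx.2, min_le_right δ₀ r])
      rw [← hrep x] at h3
      exact h3.gradient
    rw [h2] at h1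
    exact h1.trans (by gcongr; exact le_abs_self C)
  have hsurfδ : ∀ x ∈ (D h).surf, x ∈ tube O δ := fun x hx => by
    rw [tube, mem_ofPred_eq]; linarith [hdist x hx]
  have hex : ∀ z, ∃ x ∈ (D h).surf, p x = p z := fun z => hS.bijOn.surjOn (hpmem z)
  choose G hGmem hGp using hex
  have hGself : ∀ x ∈ (D h).surf, G x = x := fun x hx =>
    hS.bijOn.injOn (hGmem x) hx (hGp x)
  have hpcont : ∀ z ∈ tube O δ, ContinuousAt p z := fun z hz =>
    continuousAt_closestPt hc hne (hp z (htube z hz))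
  -- By compactness of Γ_h it suffices to identify cluster points of G; continuity of p shows that
  -- they lie over p(z), and p is injective on Γ_h.
  have hGcont : ∀ z ∈ tube O δ, ContinuousAt G z := by
    intro z hz
    refine hS.isCompact.tendsto_nhds_of_unique_mapClusterPt (Eventually.of_forall hGmem)
      fun x hx hcl => hS.bijOn.injOn hx (hGmem z) ?_
    have h1 := hcl.continuousAt_comp (hpcont x (hsurfδ x hx))
    have h2 : Tendsto (p ∘ G) (𝓝 z) (𝓝 (p z)) :=
      (hpcont z hz).tendsto.congr fun w => (hGp w).symm
    change p x = p (G z)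
    rw [hGp z]
    exact h1.eq_of_tendsto h2
  refine ⟨fun z => signDist O z - signDist O (G z), ?_⟩
  have hball : ∀ x ∈ (D h).surf, Metric.closedBall x (δ / 2) ⊆ tube O δ := by
    intro x hx z hz
    rw [Metric.mem_closedBall, dist_eq_norm] at hz
    have h1 := abs_signDist_sub_le O z x
    have h2 := abs_sub_abs_le_abs_sub (signDist O z) (signDist O x)
    rw [tube, mem_ofPred_eq]
    linarith [hdist x hx]
  refine ⟨hhpos, hσ, by positivity, by positivity, hmesh h hh0, ?_, ?_, ?_, hball, ?_, hS.norm_nrm,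
    hS.planar, ?_, ?_⟩
  · exact isOpen_lt (continuous_signDist O).abs continuous_const
  · exact fun z hz => ((continuous_signDist O).continuousAt.sub
      ((continuous_signDist O).continuousAt.comp (hGcont z hz))).continuousWithinAt
  · intro z hz
    refine (D h).mesh.exists_tet_of_mem_space ?_
    rw [hspace h hh0]
    exact subset_closure (hΩ (htube z hz))
  · intro z hz
    constructor
    · intro h1
      have h2 : z = G z := by
        calc z = p z + signDist O z • N (p z) := hrep z
          _ = p (G z) + signDist O (G z) • N (p (G z)) := by rw [hGp, sub_eq_zero.mp h1]
          _ = G z := (hrep (G z)).symm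
      rw [h2]; exact hGmem z
    · intro h1
      simp [hGself z h1]
  · intro T hT x hx z hz
    set y := p x with hy
    have hxy : ‖x - y‖ ≤ C₁ * h ^ 2 := by
      rw [← dist_eq_norm, hpdist, ← abs_signDist]; exact hdist x hx.2
    -- The expansion is taken at the foot point y = p(x) on Γ. Moving the base point to x, and
    -- replacing ρ(G z) by 0, cost O(h²) each; replacing the exact normal by n_h costs O(h)‖z - x‖.
    have e1 := (hN y (hpmem x)).signDist_expansion (t := 0) (by simpa using hr) z
    rw [zero_smul, add_zero, abs_zero, sub_zero, sub_zero] at e1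
    have e2 := hdist (G z) (hGmem z)
    have e3 : |inner ℝ (N y) (x - y)| ≤ C₁ * h ^ 2 := by
      refine (abs_real_inner_le_norm _ _).trans ?_
      rwa [(hN y (hpmem x)).norm_eq, one_mul]
    have e4 : |inner ℝ (N y - (D h).nrm T) (z - x)| ≤ C₁ * h * ‖z - x‖ :=
      (abs_real_inner_le_norm _ _).trans (by gcongr; exact hnormal T hT x hx)
    have e5 : inner ℝ (N y) (z - y) - inner ℝ ((D h).nrm T) (z - x) =
        inner ℝ (N y) (x - y) + inner ℝ (N y - (D h).nrm T) (z - x) := by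
      rw [inner_sub_left, ← sub_add_sub_cancel z x y, inner_add_right]; ring
    have e6 : ‖z - y‖ ≤ ‖z - x‖ + C₁ * h ^ 2 := by
      rw [← sub_add_sub_cancel z x y]
      exact (norm_add_le _ _).trans (by gcongr)
    have e7 : ‖z - y‖ ^ 2 / (2 * r) ≤ (‖z - x‖ ^ 2 + (C₁ + 1) ^ 2 * h ^ 2) / r := by
      rw [div_le_div_iff₀ (by positivity) hr]
      have a1 : ‖z - y‖ ^ 2 ≤ (‖z - x‖ + C₁ * h ^ 2) ^ 2 := by gcongr
      have a2 : (C₁ * h ^ 2) ^ 2 ≤ (C₁ + 1) ^ 2 * h ^ 2 := by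
        rw [mul_pow]
        gcongr
        · linarith
        · nlinarith
      nlinarith [sq_nonneg (‖z - x‖ - C₁ * h ^ 2)]
    have e8 : (‖z - x‖ ^ 2 + (C₁ + 1) ^ 2 * h ^ 2) / r =
      1 / r * ‖z - x‖ ^ 2 + (C₁ + 1) ^ 2 / r * h ^ 2 := by ring
    rw [e8] at e7
    have p1 : 0 ≤ 1 / r := by positivity
    have p2 : 0 ≤ (C₁ + 1) ^ 2 / r := by positivity
    have p3 : 0 ≤ h * ‖z - x‖ := by positivity
    have p4 : 0 ≤ h ^ 2 := by positivity
    have p5 : 0 ≤ ‖z - x‖ ^ 2 := by positivity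
    generalize 1 / r = A at *
    generalize (C₁ + 1) ^ 2 / r = B at *
    have tot : |signDist O z - signDist O (G z) - inner ℝ ((D h).nrm T) (z - x)| ≤
        A * ‖z - x‖ ^ 2 + B * h ^ 2 + 2 * (C₁ * h ^ 2) + C₁ * h * ‖z - x‖ := by
      rw [abs_le] at *
      constructor <;> linarith
    refine tot.trans ?_
    nlinarith [mul_nonneg p1 p3, mul_nonneg p1 p4, mul_nonneg p2 p3, mul_nonneg p2 p5,
      mul_nonneg hC₁0 p3, mul_nonneg hC₁0 p4, mul_nonneg hC₁0 p5]
  · intro x hx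
    refine ⟨N (p x), (hN _ (hpmem x)).norm_eq, fun T hT hxT =>
      (hnormal T hT x ⟨hxT, hx⟩).trans ?_, fun s hs => ?_⟩
    · have : 0 ≤ 2 * C₁ + (C₁ + 1) ^ 2 / r + 1 / r := by positivity
      nlinarith
    · have h1 : x + s • N (p x) = p x + (signDist O x + s) • N (p x) := by
        nth_rw 1 [hrep x]; module
      have h2 : |signDist O x + s| < δ := by
        linarith [abs_add_le (signDist O x) s, hdist x hx]
      have h3 : G (x + s • N (p x)) = x := by
        refine hS.bijOn.injOn (hGmem _) hx ?_
        change p _ = p x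
        rw [hGp, h1, hpline _ (hpmem x) _ h2]
      change signDist O (x + s • N (p x)) - signDist O (G (x + s • N (p x))) = s
      rw [h3, h1, (hN _ (hpmem x)).signDist_add_smul (h2.le.trans (min_le_right _ _))]
      ring

end LevelFunction

/-! ### Barycentric coordinates on tetrahedra -/

section Barycentric

/-- `T` is the vertex set of a nondegenerate tetrahedron. -/
structure IsTet (T : Finset E3) : Prop where
  indep : AffineIndependent ℝ ((↑) : T → E3)
  card_eq : T.card = 4

/-- The barycentric coordinate of the vertex `a` of `T`. -/
noncomputable def bary (T : Finset E3) (a : E3) : E3 →ᵃ[ℝ] ℝ :=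
  interp T (fun b => if b = a then 1 else 0)

/-- The gradient of an affine function. -/
noncomputable def affGrad (g : E3 →ᵃ[ℝ] ℝ) : E3 :=
  (InnerProductSpace.toDual ℝ E3).symm (LinearMap.toContinuousLinearMap g.linear)

theorem elemGrad_eq (T : Finset E3) (v : E3 → ℝ) : elemGrad T v = affGrad (interp T v) := rfl

theorem inner_affGrad (g : E3 →ᵃ[ℝ] ℝ) (w : E3) : inner ℝ (affGrad g) w = g.linear w := by
  rw [affGrad, InnerProductSpace.toDual_symm_apply]; rfl

theorem affine_sub (g : E3 →ᵃ[ℝ] ℝ) (x y : E3) : g y - g x = inner ℝ (affGrad g) (y - x) := by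
  rw [inner_affGrad, ← vsub_eq_sub y x, g.linearMap_vsub]; rfl

theorem affine_eq (g : E3 →ᵃ[ℝ] ℝ) (x y : E3) : g y = g x + inner ℝ (affGrad g) (y - x) := by
  rw [← affine_sub]; ring

theorem affine_continuous (g : E3 →ᵃ[ℝ] ℝ) : Continuous g := g.continuous_of_finiteDimensional

theorem affine_combo (g : E3 →ᵃ[ℝ] ℝ) {a b : ℝ} (hab : a + b = 1) (x y : E3) :
    g (a • x + b • y) = a * g x + b * g y := by
  simpa using Convex.combo_affine_apply (f := g) (x := x) (y := y) hab

/-- A step of length r/2 along the gradient stays in the ball and raises g by (r/2)‖∇g‖, which is at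
most 1. -/
theorem norm_affGrad_le {g : E3 →ᵃ[ℝ] ℝ} {c : E3} {r : ℝ} (hr : 0 < r)
    (h : ∀ x ∈ Metric.ball c r, 0 ≤ g x ∧ g x ≤ 1) : ‖affGrad g‖ ≤ 2 / r := by
  rcases eq_or_ne (affGrad g) 0 with h0 | h0
  · rw [h0, norm_zero]; positivity
  have hpos := norm_pos_iff.mpr h0
  have h1 := h c (Metric.mem_ball_self hr)
  have h2 := h (c + (r / 2 / ‖affGrad g‖) • affGrad g) (by
    rw [Metric.mem_ball, dist_eq_norm, add_sub_cancel_left, norm_smul, Real.norm_eq_abs,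
      abs_of_nonneg (by positivity), div_mul_cancel₀ _ hpos.ne']
    linarith)
  rw [affine_eq g c, add_sub_cancel_left, real_inner_smul_right, real_inner_self_eq_norm_sq] at h2
  have h3 : r / 2 / ‖affGrad g‖ * ‖affGrad g‖ ^ 2 = r / 2 * ‖affGrad g‖ := by field_simp
  rw [h3] at h2
  rw [le_div_iff₀ hr]
  linarith [h2.2, h1.1]

namespace IsTet

variable {T : Finset E3} (hT : IsTet T)
include hT

theorem exists_basis : ∃ B : AffineBasis T ℝ E3, ∀ i : T, B i = i := by
  have htop : affineSpan ℝ (Set.range ((↑) : T → E3)) = ⊤ := by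
    rw [hT.indep.affineSpan_eq_top_iff_card_eq_finrank_add_one]
    simp [hT.card_eq]
  exact ⟨⟨(↑), hT.indep, htop⟩, fun i => rfl⟩

theorem interp_vertex (v : E3 → ℝ) {b : E3} (hb : b ∈ T) : interp T v b = v b :=
  interp_apply T hT.indep hT.card_eq v b hb

theorem affine_ext {V : Type*} [AddCommGroup V] [Module ℝ V] {f g : E3 →ᵃ[ℝ] V}
    (h : ∀ b ∈ T, f b = g b) : f = g := by
  obtain ⟨B, hB⟩ := hT.exists_basis
  refine AffineMap.ext_on (s := Set.range B) B.tot ?_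
  rintro _ ⟨i, rfl⟩
  rw [hB i]; exact h i i.2

theorem bary_vertex (a : E3) {b : E3} (hb : b ∈ T) : bary T a b = if b = a then 1 else 0 :=
  hT.interp_vertex _ hb

theorem bary_self {a : E3} (ha : a ∈ T) : bary T a a = 1 := by
  rw [hT.bary_vertex a ha, if_pos rfl]

theorem bary_ne {a b : E3} (hb : b ∈ T) (hab : b ≠ a) : bary T a b = 0 := by
  rw [hT.bary_vertex a hb, if_neg hab]

theorem bary_eq_coord (B : AffineBasis T ℝ E3) (hB : ∀ i : T, B i = i) (a : T) :
    bary T a = B.coord a := by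
  refine hT.affine_ext fun b hb => ?_
  rw [hT.bary_vertex _ hb]
  have h := B.coord_apply a ⟨b, hb⟩
  rw [hB] at h
  rw [h]
  simp only [Subtype.ext_iff]
  split_ifs <;> first | rfl | (exfalso; simp_all)

theorem sum_bary (x : E3) : ∑ a ∈ T, bary T a x = 1 := by
  obtain ⟨B, hB⟩ := hT.exists_basis
  rw [← B.sum_coord_apply_eq_one x, ← Finset.sum_coe_sort]
  exact Finset.sum_congr rfl fun i _ => by rw [hT.bary_eq_coord B hB]

theorem sum_bary_smul (x : E3) : ∑ a ∈ T, bary T a x • a = x := by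
  obtain ⟨B, hB⟩ := hT.exists_basis
  conv_rhs => rw [← B.linear_combination_coord_eq_self x]
  rw [← Finset.sum_coe_sort]
  exact Finset.sum_congr rfl fun i _ => by rw [hT.bary_eq_coord B hB, hB]

theorem affine_eq_sum (g : E3 →ᵃ[ℝ] ℝ) (x : E3) : g x = ∑ a ∈ T, g a * bary T a x := by
  obtain ⟨b, hb⟩ : T.Nonempty := Finset.card_pos.mp (by rw [hT.card_eq]; norm_num)
  have h1 : x - b = ∑ a ∈ T, bary T a x • (a - b) := by
    simp_rw [smul_sub, Finset.sum_sub_distrib, hT.sum_bary_smul, ← Finset.sum_smul, hT.sum_bary,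
      one_smul]
  rw [affine_eq g b x, h1, inner_sum]
  simp_rw [real_inner_smul_right, ← affine_sub, mul_sub, Finset.sum_sub_distrib, ← Finset.sum_mul,
    hT.sum_bary]
  rw [one_mul, add_sub_cancel]
  exact Finset.sum_congr rfl fun _ _ => mul_comm _ _

theorem interp_eq_sum (v : E3 → ℝ) (x : E3) : interp T v x = ∑ a ∈ T, v a * bary T a x := by
  rw [hT.affine_eq_sum (interp T v) x]
  exact Finset.sum_congr rfl fun a ha => by rw [hT.interp_vertex v ha]

theorem affGrad_eq_sum (g : E3 →ᵃ[ℝ] ℝ) : affGrad g = ∑ a ∈ T, g a • affGrad (bary T a) := by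
  refine ext_inner_right ℝ fun w => ?_
  rw [sum_inner]
  simp_rw [real_inner_smul_left]
  have h := affine_sub g 0 w
  rw [sub_zero] at h
  rw [← h, hT.affine_eq_sum g w, hT.affine_eq_sum g 0, ← Finset.sum_sub_distrib]
  refine Finset.sum_congr rfl fun a _ => ?_
  rw [← mul_sub, affine_sub, sub_zero]

theorem mem_hull_iff {x : E3} : x ∈ hull T ↔ ∀ a ∈ T, 0 ≤ bary T a x := by
  obtain ⟨B, hB⟩ := hT.exists_basis
  have h : hull T = convexHull ℝ (Set.range B) := by
    rw [hull]; congr 1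
    ext y; simp [hB]
  rw [h, B.convexHull_eq_nonneg_coord]
  simp only [mem_ofPred_eq, Subtype.forall]
  exact forall₂_congr fun a ha => by rw [← hT.bary_eq_coord B hB ⟨a, ha⟩]

theorem mem_interior_iff {x : E3} : x ∈ interior (hull T) ↔ ∀ a ∈ T, 0 < bary T a x := by
  obtain ⟨B, hB⟩ := hT.exists_basis
  have h : hull T = convexHull ℝ (Set.range B) := by
    rw [hull]; congr 1
    ext y; simp [hB]
  rw [h, B.interior_convexHull]
  simp only [mem_ofPred_eq, Subtype.forall]
  exact forall₂_congr fun a ha => by rw [← hT.bary_eq_coord B hB ⟨a, ha⟩]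

theorem bary_le_one {x : E3} (hx : x ∈ hull T) {a : E3} (ha : a ∈ T) : bary T a x ≤ 1 := by
  rw [← hT.sum_bary x]
  exact Finset.single_le_sum (f := fun a => bary T a x) (fun b hb => hT.mem_hull_iff.mp hx b hb) ha

theorem mem_hull_face_iff {S : Finset E3} (hS : S ⊆ T) {x : E3} :
    x ∈ hull S ↔ x ∈ hull T ∧ ∀ a ∈ T, a ∉ S → bary T a x = 0 := by
  constructor
  · intro hx
    refine ⟨convexHull_mono (by exact_mod_cast hS) hx, fun a ha haS => ?_⟩
    have : hull S ⊆ (bary T a) ⁻¹' {0} := by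
      refine convexHull_min (fun b hb => ?_) ((convex_singleton 0).affine_preimage _)
      have hb' : b ∈ S := by exact_mod_cast hb
      exact hT.bary_ne (hS hb') (fun h => haS (h ▸ hb'))
    exact this hx
  · rintro ⟨hx, h0⟩
    have e1 : ∑ a ∈ S, bary T a x = 1 := by
      rw [← hT.sum_bary x]
      exact Finset.sum_subset hS fun a ha haS => h0 a ha haS
    have e2 : ∑ a ∈ S, bary T a x • a = x := by
      conv_rhs => rw [← hT.sum_bary_smul x]
      exact Finset.sum_subset hS fun a ha haS => by rw [h0 a ha haS, zero_smul]
    rw [← e2, hull]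
    refine (convex_convexHull ℝ _).sum_mem (fun a ha => hT.mem_hull_iff.mp hx a (hS ha)) e1
      fun a ha => subset_convexHull ℝ _ (by exact_mod_cast ha)

omit hT in
theorem _root_.vertex_mem_hull {a : E3} (ha : a ∈ T) : a ∈ hull T :=
  subset_convexHull ℝ _ (by exact_mod_cast ha)

omit hT in
variable (T) in
theorem _root_.isCompact_hull : IsCompact (hull T) :=
  T.finite_toSet.isCompact_convexHull (𝕜 := ℝ)

theorem interior_hull_nonempty : (interior (hull T)).Nonempty := by
  refine ⟨∑ a ∈ T, (1 / 4 : ℝ) • a, hT.mem_interior_iff.mpr fun b hb => ?_⟩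
  have h4 : ∑ _a ∈ T, (1 / 4 : ℝ) = 1 := by simp [hT.card_eq]
  have : bary T b (∑ a ∈ T, (1 / 4 : ℝ) • a) = ∑ a ∈ T, (1 / 4 : ℝ) * bary T b a := by
    rw [affine_eq _ b]
    have e : ∑ a ∈ T, (1 / 4 : ℝ) • a - b = ∑ a ∈ T, (1 / 4 : ℝ) • (a - b) := by
      simp_rw [smul_sub, Finset.sum_sub_distrib, ← Finset.sum_smul, h4, one_smul]
    rw [e, inner_sum]
    simp_rw [real_inner_smul_right, ← affine_sub, mul_sub, Finset.sum_sub_distrib, ← Finset.sum_mul,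
      h4]
    ring
  rw [this]
  refine Finset.sum_pos' (fun a ha => ?_) ⟨b, hb, ?_⟩
  · rw [hT.bary_vertex b ha]; split_ifs <;> norm_num
  · rw [hT.bary_self hb]; norm_num

/-- An affine function that is nonzero at one vertex only is a multiple of a barycentric
coordinate. -/
theorem affine_eq_smul_bary {g : E3 →ᵃ[ℝ] ℝ} {o : E3} (ho : o ∈ T)
    (h : ∀ a ∈ T, a ≠ o → g a = 0) (x : E3) : g x = g o * bary T o x := by
  rw [hT.affine_eq_sum g x]
  exact Finset.sum_eq_single_of_mem o ho fun a ha hao => by rw [h a ha hao, zero_mul]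

end IsTet

end Barycentric

/-! ### Neighbouring tetrahedra of a mesh -/

section Mesh

namespace TetMesh

variable (M : TetMesh)

theorem mem_tets {T : Finset E3} : T ∈ M.tets ↔ T ∈ M.complex.faces ∧ T.card = 4 := by
  simp [tets]

variable {M} {T T' : Finset E3}

theorem isTet (hT : T ∈ M.tets) : IsTet T :=
  ⟨M.complex.indep (M.mem_tets.mp hT).1, (M.mem_tets.mp hT).2⟩

theorem mem_hull_inter (hT : T ∈ M.tets) (hT' : T' ∈ M.tets) {x : E3} (hx : x ∈ hull T)
    (hx' : x ∈ hull T') : x ∈ hull (T ∩ T') := by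
  have h := M.complex.inter_subset_convexHull (M.mem_tets.mp hT).1 (M.mem_tets.mp hT').1 ⟨hx, hx'⟩
  rwa [hull, Finset.coe_inter]

theorem bary_eq_zero (hT : T ∈ M.tets) (hT' : T' ∈ M.tets) {x : E3} (hx : x ∈ hull T)
    (hx' : x ∈ hull T') {a : E3} (ha : a ∈ T) (ha' : a ∉ T') : bary T a x = 0 :=
  ((isTet hT).mem_hull_face_iff Finset.inter_subset_left).mp (mem_hull_inter hT hT' hx hx') |>.2 a ha
    (by simp [ha'])

theorem affine_eqOn_of_eqOn {S : Finset E3} {f g : E3 →ᵃ[ℝ] ℝ} (h : ∀ a ∈ S, f a = g a) {x : E3}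
    (hx : x ∈ hull S) : f x = g x :=
  AffineMap.eqOn_affineSpan (k := ℝ) (s := (S : Set E3)) (fun a ha => h a (by exact_mod_cast ha))
    (convexHull_subset_affineSpan _ hx)

/-- By conformity x lies in the hull of the common vertices, where both coordinates are affine with
the same vertex values. It holds for every a, a vertex of the tetrahedra or not. -/
theorem bary_eq_bary (hT : T ∈ M.tets) (hT' : T' ∈ M.tets) {x : E3} (hx : x ∈ hull T)
    (hx' : x ∈ hull T') (a : E3) : bary T a x = bary T' a x := by
  refine affine_eqOn_of_eqOn (fun b hb => ?_) (mem_hull_inter hT hT' hx hx')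
  rw [Finset.mem_inter] at hb
  rw [(isTet hT).bary_vertex a hb.1, (isTet hT').bary_vertex a hb.2]

/-- The carrier of a point belongs to all tetrahedra that contain it. -/
theorem mem_of_bary_pos (hT : T ∈ M.tets) (hT' : T' ∈ M.tets) {x : E3} (hx : x ∈ hull T)
    (hx' : x ∈ hull T') {a : E3} (ha : a ∈ T) (hpos : 0 < bary T a x) : a ∈ T' := by
  by_contra ha'
  exact hpos.ne' (bary_eq_zero hT hT' hx hx' ha ha')

theorem eq_of_mem_interior (hT : T ∈ M.tets) (hT' : T' ∈ M.tets) {x : E3}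
    (hx : x ∈ interior (hull T)) (hx' : x ∈ hull T') : T = T' := by
  refine Finset.eq_of_subset_of_card_le (fun a ha => ?_)
    (by rw [(isTet hT).card_eq, (isTet hT').card_eq])
  exact mem_of_bary_pos hT hT' (interior_subset hx) hx' ha ((isTet hT).mem_interior_iff.mp hx a ha)

open Filter Topology in
/-- Near a point there are only tetrahedra that contain it. -/
theorem eventually_mem_hull (M : TetMesh) (x : E3) :
    ∀ᶠ z in 𝓝 x, ∀ T ∈ M.tets, z ∈ hull T → x ∈ hull T := by
  rw [Filter.eventually_all_finset]
  intro T hT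
  by_cases hx : x ∈ hull T
  · exact Eventually.of_forall fun _ _ => hx
  · filter_upwards [(isCompact_hull T).isClosed.isOpen_compl.mem_nhds hx] with z hz hz'
    exact absurd hz' hz

variable {h σ : ℝ} (hM : M.Quasiuniform h σ) (hh : 0 < h) (hσ : 0 < σ)
include hM

theorem dist_le_of_mem_hull (hT : T ∈ M.tets) {x y : E3} (hx : x ∈ hull T) (hy : y ∈ hull T) :
    dist x y ≤ σ * h :=
  (Metric.dist_le_diam_of_mem (isCompact_hull T).isBounded hx hy).trans (hM T hT).1

include hh hσ

theorem norm_affGrad_bary_le (hT : T ∈ M.tets) {a : E3} (ha : a ∈ T) :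
    ‖affGrad (bary T a)‖ ≤ 2 * σ / h := by
  obtain ⟨c, hc⟩ := (hM T hT).2
  have := norm_affGrad_le (g := bary T a) (c := c) (r := h / σ) (by positivity) fun x hx =>
    ⟨(isTet hT).mem_hull_iff.mp (hc hx) a ha, (isTet hT).bary_le_one (hc hx) ha⟩
  rwa [div_div_eq_mul_div] at this

omit hh in
theorem norm_affGrad_sq_le (hh : 0 < h) (hT : T ∈ M.tets) (g : E3 →ᵃ[ℝ] ℝ) :
    ‖affGrad g‖ ^ 2 ≤ 16 * σ ^ 2 / h ^ 2 * ∑ a ∈ T, g a ^ 2 := by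
  rw [(isTet hT).affGrad_eq_sum g]
  have h1 : ‖∑ a ∈ T, g a • affGrad (bary T a)‖ ≤ ∑ a ∈ T, |g a| * (2 * σ / h) := by
    refine (norm_sum_le _ _).trans (Finset.sum_le_sum fun a ha => ?_)
    rw [norm_smul, Real.norm_eq_abs]
    gcongr
    exact norm_affGrad_bary_le hM hh hσ hT ha
  have h2 : (∑ a ∈ T, |g a|) ^ 2 ≤ 4 * ∑ a ∈ T, g a ^ 2 := by
    have := sq_sum_le_card_mul_sum_sq (s := T) (f := fun a => |g a|)
    simpa [(isTet hT).card_eq] using this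
  calc _ ≤ (∑ a ∈ T, |g a| * (2 * σ / h)) ^ 2 := by gcongr
    _ = (2 * σ / h) ^ 2 * (∑ a ∈ T, |g a|) ^ 2 := by rw [← Finset.sum_mul]; ring
    _ ≤ (2 * σ / h) ^ 2 * (4 * ∑ a ∈ T, g a ^ 2) := by gcongr
    _ = _ := by ring

end TetMesh

end Mesh

/-! ### Piecewise affine functions along segments. -/

section Segments

/-- Induction on the number of pieces: jump from a to the last point t of a piece that contains a.
This piece is not met again after t and can be discarded, however often the path returned to it
before. -/
theorem abs_sub_le_of_closed_cover {ι : Type*} {f : ℝ → ℝ} {L : ℝ} (I : ι → Set ℝ)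
    (s : Finset ι) (hI : ∀ i ∈ s, IsClosed (I i))
    (hf : ∀ i ∈ s, ∀ x ∈ I i, ∀ y ∈ I i, |f y - f x| ≤ L * |y - x|) {a b : ℝ} (hab : a ≤ b)
    (hcov : ∀ x ∈ Icc a b, ∃ i ∈ s, x ∈ I i) : |f b - f a| ≤ L * (b - a) := by
  classical
  induction s using Finset.strongInduction generalizing a with
  | H s ih =>
    obtain ⟨i, hi, hai⟩ := hcov a (left_mem_Icc.mpr hab)
    have hcl : IsCompact (I i ∩ Icc a b) := isCompact_Icc.inter_left (hI i hi)
    have hne : (I i ∩ Icc a b).Nonempty := ⟨a, hai, left_mem_Icc.mpr hab⟩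
    obtain ⟨t, ⟨hti, hat, htb⟩, hmax⟩ := hcl.exists_isGreatest hne
    have h1 := hf i hi a hai t hti
    rw [abs_of_nonneg (sub_nonneg.mpr hat)] at h1
    rcases htb.eq_or_lt with rfl | htb
    · exact h1
    have h2 : |f b - f t| ≤ L * (b - t) := by
      refine ih (s.erase i) (Finset.erase_ssubset hi)
        (fun j hj => hI j (Finset.mem_of_mem_erase hj))
        (fun j hj => hf j (Finset.mem_of_mem_erase hj)) htb.le ?_
      have hclo : IsClosed (⋃ j ∈ s.erase i, I j) := by
        refine isClosed_biUnion_finset fun j hj => hI j (Finset.mem_of_mem_erase hj)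
      -- The remaining pieces cover (t, b]; being closed and finitely many, they also cover t.
      have hsub : Ioc t b ⊆ ⋃ j ∈ s.erase i, I j := by
        intro x hx
        obtain ⟨j, hj, hxj⟩ := hcov x ⟨hat.trans hx.1.le, hx.2⟩
        have hji : j ≠ i := by
          rintro rfl
          exact absurd (hmax ⟨hxj, hat.trans hx.1.le, hx.2⟩) (not_le.mpr hx.1)
        simp only [mem_iUnion]
        exact ⟨j, Finset.mem_erase.mpr ⟨hji, hj⟩, hxj⟩
      have hcl2 := closure_minimal hsub hclo
      rw [closure_Ioc htb.ne] at hcl2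
      intro x hx
      have := hcl2 hx
      simp only [mem_iUnion] at this
      obtain ⟨j, hj, hxj⟩ := this
      exact ⟨j, hj, hxj⟩
    calc |f b - f a| = |(f b - f t) + (f t - f a)| := by ring_nf
      _ ≤ L * (b - t) + L * (t - a) := (abs_add_le _ _).trans (add_le_add h2 h1)
      _ = L * (b - a) := by ring

/-- A piecewise affine function along a segment that is covered by finitely many simplices. -/
theorem abs_sub_le_of_segment (A : Finset (Finset E3)) {v : E3 → ℝ} {g : Finset E3 → E3 →ᵃ[ℝ] ℝ}
    {y w : E3} {L l : ℝ} (hl : 0 ≤ l)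
    (hv : ∀ S ∈ A, ∀ x ∈ hull S, x ∈ segment ℝ y (y + l • w) → v x = g S x)
    (hL : ∀ S ∈ A, |inner ℝ (affGrad (g S)) w| ≤ L)
    (hcov : ∀ x ∈ segment ℝ y (y + l • w), ∃ S ∈ A, x ∈ hull S) :
    |v (y + l • w) - v y| ≤ L * l := by
  have hseg : ∀ s ∈ Icc 0 l, y + s • w ∈ segment ℝ y (y + l • w) := by
    intro s hs
    rw [segment_eq_image']
    rcases hl.eq_or_lt with rfl | hl
    · exact ⟨0, by simp, by simp [le_antisymm hs.2 hs.1]⟩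
    · refine ⟨s / l, ⟨div_nonneg hs.1 hl.le, (div_le_one hl).mpr hs.2⟩, ?_⟩
      simp only [add_sub_cancel_left, smul_smul]
      rw [div_mul_cancel₀ _ hl.ne']
  have h := abs_sub_le_of_closed_cover (f := fun s => v (y + s • w)) (L := L)
    (fun S : Finset E3 => {s : ℝ | y + s • w ∈ hull S} ∩ Icc 0 l) A (fun S _ =>
      ((isCompact_hull S).isClosed.preimage (by fun_prop)).inter isClosed_Icc)
    (fun S hS s hs t ht => by
      rw [hv S hS _ hs.1 (hseg s hs.2), hv S hS _ ht.1 (hseg t ht.2), affine_sub]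
      have : y + t • w - (y + s • w) = (t - s) • w := by module
      rw [this, real_inner_smul_right, abs_mul, mul_comm]
      gcongr
      exact hL S hS) hl
    (fun s hs => by
      obtain ⟨S, hS, hx⟩ := hcov _ (hseg s hs)
      exact ⟨S, hS, hx, hs⟩)
  simpa using h

end Segments

/-! ### Packing and volume bounds from shape regularity. -/

section Packing

namespace TetMesh

variable {M : TetMesh} {T : Finset E3}
variable {h σ : ℝ} (hM : M.Quasiuniform h σ) (hh : 0 < h) (hσ : 0 < σ)

include hM hh hσ

/-- The tetrahedra that meet a small ball around a vertex contain that vertex. -/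
theorem mem_of_dist_lt (hT : T ∈ M.tets) {b : E3} (hb : b ∈ T) {S : Finset E3} (hS : S ∈ M.tets)
    {z : E3} (hz : z ∈ hull S) (hseg : ∀ x ∈ segment ℝ b z, ∃ S ∈ M.tets, x ∈ hull S)
    (hd : ‖z - b‖ < h / (2 * σ)) : b ∈ S := by
  classical
  by_contra hbS
  have hzero : ∀ S ∈ M.tets, b ∉ S → bary S b = 0 := by
    intro S hS hbS
    refine (isTet hS).affine_ext fun a ha => ?_
    rw [(isTet hS).bary_vertex b ha, if_neg (fun e : a = b => hbS (e ▸ ha))]; rfl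
  rcases eq_or_ne z b with rfl | hzb
  · have h1 := mem_of_bary_pos hT hS (vertex_mem_hull hb) hz hb
      (by rw [(isTet hT).bary_self hb]; norm_num)
    exact hbS h1
  have hpos : 0 < ‖z - b‖ := norm_pos_iff.mpr (sub_ne_zero.mpr hzb)
  -- The hat function of b on the whole mesh: it is 1 at b, has slope at most 2σ/h, and vanishes on
  -- S if b is not a vertex of S. Hence it cannot reach S within h/(2σ).
  let v : E3 → ℝ := fun x => if hx : ∃ S ∈ M.tets, x ∈ hull S then bary hx.choose b x else 0
  have hv : ∀ S ∈ M.tets, ∀ x ∈ hull S, v x = bary S b x := by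
    intro S hS x hx
    have hex : ∃ S ∈ M.tets, x ∈ hull S := ⟨S, hS, hx⟩
    simp only [v]
    rw [dif_pos hex]
    exact bary_eq_bary hex.choose_spec.1 hS hex.choose_spec.2 hx b
  set w : E3 := ‖z - b‖⁻¹ • (z - b) with hw
  have hwn : ‖w‖ = 1 := by rw [hw, norm_smul, norm_inv, norm_norm, inv_mul_cancel₀ hpos.ne']
  have hzw : b + ‖z - b‖ • w = z := by
    rw [hw, smul_smul, mul_inv_cancel₀ hpos.ne', one_smul, add_sub_cancel]
  have key := abs_sub_le_of_segment M.tets (v := v) (g := fun S => bary S b) (y := b) (w := w)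
    (L := 2 * σ / h) (norm_nonneg (z - b)) (fun S hS x hx _ => hv S hS x hx) (fun S hS => by
      by_cases hbS : b ∈ S
      · refine (abs_real_inner_le_norm _ _).trans ?_
        rw [hwn, mul_one]
        exact norm_affGrad_bary_le hM hh hσ hS hbS
      · have : inner ℝ (affGrad (bary S b)) w = 0 := by
          rw [inner_affGrad, hzero S hS hbS]; rfl
        rw [this, abs_zero]; positivity) (by rw [hzw]; exact hseg)
  rw [hzw, hv S hS z hz, hv T hT b (vertex_mem_hull hb), (isTet hT).bary_self hb,
    hzero S hS hbS] at key
  have h2 : 2 * σ / h * ‖z - b‖ < 2 * σ / h * (h / (2 * σ)) := by gcongr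
  have h3 : 2 * σ / h * (h / (2 * σ)) = 1 := by field_simp
  simp at key
  linarith

/-- The inscribed balls of radius h/σ are disjoint and all lie in the ball of radius (R+σ+1)h about
x; compare volumes. -/
theorem card_near_le {R : ℝ} (hR : 0 ≤ R) (x : E3) (A : Finset (Finset E3)) (hA : A ⊆ M.tets)
    (hne : ∀ S ∈ A, (hull S ∩ Metric.closedBall x (R * h)).Nonempty) :
    (A.card : ℝ) ≤ ((R + σ + 1) * σ) ^ 3 := by
  have hex : ∀ S ∈ M.tets, ∃ c, Metric.ball c (h / σ) ⊆ hull S := fun S hS => (hM S hS).2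
  choose! c hc using hex
  have hint : ∀ S ∈ M.tets, Metric.ball (c S) (h / σ) ⊆ interior (hull S) := fun S hS =>
    interior_maximal (hc S hS) Metric.isOpen_ball
  have hdisj : (A : Set (Finset E3)).PairwiseDisjoint (fun S => Metric.ball (c S) (h / σ)) := by
    intro S hS S' hS' hne
    refine Set.disjoint_left.mpr fun z hz hz' => hne ?_
    exact eq_of_mem_interior (hA hS) (hA hS') (hint S (hA hS) hz) (hc S' (hA hS') hz')
  have hsub : (⋃ S ∈ A, Metric.ball (c S) (h / σ)) ⊆ Metric.ball x ((R + σ + 1) * h) := by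
    intro z hz
    simp only [mem_iUnion] at hz
    obtain ⟨S, hS, hz⟩ := hz
    obtain ⟨p, hp, hpx⟩ := hne S hS
    rw [Metric.mem_closedBall] at hpx
    have := dist_le_of_mem_hull hM (hA hS) (hc S (hA hS) hz) hp
    rw [Metric.mem_ball]
    nlinarith [dist_triangle z p x]
  have hvol := measure_mono (μ := (volume : Measure E3)) hsub
  rw [measure_biUnion_finset hdisj (fun _ _ => measurableSet_ball)] at hvol
  have hb : ∀ (y : E3) (r : ℝ), 0 ≤ r → (volume : Measure E3) (Metric.ball y r) =
      ENNReal.ofReal (r ^ 3) * volume (Metric.ball (0 : E3) 1) := by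
    intro y r hr
    rw [Measure.addHaar_ball volume y hr]; simp
  have h0 : (volume : Measure E3) (Metric.ball (0 : E3) 1) ≠ 0 :=
    (Metric.measure_ball_pos volume 0 one_pos).ne'
  have hT : (volume : Measure E3) (Metric.ball (0 : E3) 1) ≠ ⊤ := measure_ball_lt_top.ne
  simp_rw [hb _ _ (show 0 ≤ h / σ by positivity)] at hvol
  rw [Finset.sum_const, hb x _ (by positivity), nsmul_eq_mul, ← mul_assoc,
    ENNReal.mul_le_mul_iff_left h0 hT, ← ENNReal.ofReal_natCast,
    ← ENNReal.ofReal_mul (by positivity), ENNReal.ofReal_le_ofReal_iff (by positivity)] at hvol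
  have e1 : (A.card : ℝ) * (h / σ) ^ 3 * (σ / h) ^ 3 = A.card := by field_simp
  calc (A.card : ℝ) = A.card * (h / σ) ^ 3 * (σ / h) ^ 3 := e1.symm
    _ ≤ ((R + σ + 1) * h) ^ 3 * (σ / h) ^ 3 := by gcongr
    _ = _ := by field_simp

theorem volume_hull_ge (hT : T ∈ M.tets) :
    (h / σ) ^ 3 * volume.real (Metric.ball (0 : E3) 1) ≤ volume.real (hull T) := by
  obtain ⟨c, hc⟩ := (hM T hT).2
  have h1 : volume.real (Metric.ball c (h / σ)) ≤ volume.real (hull T) :=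
    measureReal_mono hc (isCompact_hull T).measure_lt_top.ne
  refine le_trans (le_of_eq ?_) h1
  rw [measureReal_def, measureReal_def, Measure.addHaar_ball volume c (by positivity),
    ENNReal.toReal_mul, ENNReal.toReal_ofReal (by positivity)]
  simp

theorem volume_hull_le (hT : T ∈ M.tets) :
    volume.real (hull T) ≤ (σ * h) ^ 3 * volume.real (Metric.ball (0 : E3) 1) := by
  obtain ⟨x, hx⟩ := (isTet hT).interior_hull_nonempty
  have hsub : hull T ⊆ Metric.closedBall x (σ * h) := fun y hy => by
    rw [Metric.mem_closedBall]
    exact dist_le_of_mem_hull hM hT hy (interior_subset hx)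
  refine (measureReal_mono hsub (isCompact_closedBall x _).measure_lt_top.ne).trans (le_of_eq ?_)
  rw [measureReal_def, measureReal_def, Measure.addHaar_closedBall volume x (by positivity),
    ENNReal.toReal_mul, ENNReal.toReal_ofReal (by positivity)]
  simp

end TetMesh

end Packing

/-! ### The sign of the level function on the active tetrahedra -/

section Signs

open Filter Topology

/-- The affine function that vanishes on the plane of `Γ_h` in the tetrahedron `T`. -/
noncomputable def CutData.plane (D : CutData) (T : Finset E3) : E3 →ᵃ[ℝ] ℝ :=
  open Classical in
  (innerSL ℝ (D.nrm T)).toLinearMap.toAffineMap - AffineMap.const ℝ E3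
    (if h : (hull T ∩ D.surf).Nonempty then inner ℝ (D.nrm T) h.choose else 0)

theorem CutData.plane_sub (D : CutData) (T : Finset E3) (x y : E3) :
    D.plane T y - D.plane T x = inner ℝ (D.nrm T) (y - x) := by
  simp [plane, inner_sub_right]

theorem CutData.affGrad_plane (D : CutData) (T : Finset E3) : affGrad (D.plane T) = D.nrm T := by
  refine ext_inner_right ℝ fun w => ?_
  have h1 := affine_sub (D.plane T) 0 w
  have h2 := D.plane_sub T 0 w
  rw [sub_zero] at h1 h2
  rw [← h1, h2]

/-- The same discrete surface with the opposite orientation. -/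
def CutData.neg (D : CutData) : CutData := { D with nrm := fun T => -D.nrm T }

theorem CutData.plane_neg (D : CutData) (T : Finset E3) (x : E3) :
    D.neg.plane T x = -D.plane T x := by
  by_cases hne : (hull T ∩ D.surf).Nonempty
  · simp [plane, neg, hne]
    exact neg_add_eq_sub _ _
  · simp [plane, neg, hne]

theorem CutData.mem_active (D : CutData) {T : Finset E3} :
    T ∈ D.active ↔ T ∈ D.mesh.tets ∧ (hull T ∩ D.surf).Nonempty := by
  classical
  simp [active]

theorem IsPreconnected.pos_of_ne_zero {X : Type*} [TopologicalSpace X] {S : Set X} {F : X → ℝ}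
    (hS : IsPreconnected S) (hF : ContinuousOn F S) (h0 : ∀ z ∈ S, F z ≠ 0) {x : X} (hx : x ∈ S)
    (hpos : 0 < F x) : ∀ z ∈ S, 0 < F z := by
  intro z hz
  by_contra! hle
  obtain ⟨y, hy, hy0⟩ := hS.intermediate_value hz hx hF ⟨hle, hpos.le⟩
  exact h0 y hy hy0

theorem convex_hull (T : Finset E3) : Convex ℝ (hull T) := convex_convexHull ℝ _

/-- A point of the closed half simplex is a limit of points of the open half simplex. -/
theorem mem_closure_interior_inter {T : Finset E3} {g : E3 →ᵃ[ℝ] ℝ} {x z : E3}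
    (hx : x ∈ interior (hull T)) (hgx : 0 < g x) (hz : z ∈ hull T) (hgz : 0 ≤ g z) :
    z ∈ closure (interior (hull T) ∩ {y | 0 < g y}) := by
  have hcont : ContinuousWithinAt (fun t : ℝ => (1 - t) • z + t • x) (Ioc 0 1) 0 := by
    exact Continuous.continuousWithinAt (by fun_prop)
  have h0 : (0 : ℝ) ∈ closure (Ioc (0 : ℝ) 1) := by
    rw [closure_Ioc zero_ne_one]; exact left_mem_Icc.mpr zero_le_one
  have hmap : MapsTo (fun t : ℝ => (1 - t) • z + t • x) (Ioc 0 1)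
      (interior (hull T) ∩ {y | 0 < g y}) := by
    intro t ht
    refine ⟨(convex_hull T).combo_self_interior_mem_interior hz hx (by linarith [ht.2]) ht.1
      (by ring), ?_⟩
    change 0 < g ((1 - t) • z + t • x)
    rw [affine_combo g (by ring)]
    have := mul_pos ht.1 hgx
    have := mul_nonneg (sub_nonneg.mpr ht.2) hgz
    linarith
  have := hcont.mem_closure h0 hmap
  simpa using this

theorem nonneg_of_pos_interior {T : Finset E3} {F : E3 → ℝ} (hF : ContinuousOn F (hull T))
    {g : E3 →ᵃ[ℝ] ℝ} {x : E3} (hx : x ∈ interior (hull T)) (hgx : 0 < g x)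
    (h : ∀ y ∈ interior (hull T), 0 < g y → 0 ≤ F y) {z : E3} (hz : z ∈ hull T) (hgz : 0 ≤ g z) :
    0 ≤ F z := by
  have hcl := mem_closure_interior_inter hx hgx hz hgz
  have hc : ContinuousWithinAt F (interior (hull T) ∩ {y | 0 < g y}) z :=
    (hF z hz).mono (inter_subset_left.trans interior_subset)
  have := hc.mem_closure (t := Ici 0) hcl fun y hy => h y hy.1 hy.2
  simpa using this

/-- A level surface on a sufficiently fine mesh. -/
structure FineSurface (D : CutData) (F : E3 → ℝ) (U : Set E3) (h σ C R : ℝ) : Prop extends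
    LevelSurface D F U h σ C R where
  mesh_le : σ * h ≤ R
  normal_le : C * h ≤ 1 / 2

namespace FineSurface

variable {D : CutData} {F : E3 → ℝ} {U : Set E3} {h σ C R : ℝ} (H : FineSurface D F U h σ C R)
include H

/-- Reversing the orientation turns every one-sided statement about signs into its mirror image. -/
theorem neg : FineSurface D.neg (fun z => -F z) U h σ C R where
  h_pos := H.h_pos
  σ_pos := H.σ_pos
  C_nonneg := H.C_nonneg
  R_pos := H.R_pos
  quasi := H.quasi
  isOpen := H.isOpen
  cont := H.cont.neg
  cover := H.cover
  closedBall_subset := H.closedBall_subset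
  zero_iff z hz := by rw [neg_eq_zero]; exact H.zero_iff z hz
  norm_nrm T hT := by
    change ‖-D.nrm T‖ = 1
    rw [norm_neg]; exact H.norm_nrm T hT
  planar T hT := by
    obtain ⟨c, hc⟩ := H.planar T hT
    refine ⟨-c, fun x hx => ?_⟩
    change inner ℝ (-D.nrm T) x = -c
    rw [inner_neg_left, hc x hx]
  expansion T hT x hx z hz := by
    change |-F z - inner ℝ (-D.nrm T) (z - x)| ≤ _
    rw [inner_neg_left, ← abs_neg, neg_sub, sub_neg_eq_add, neg_add_eq_sub]
    exact H.expansion T hT x hx z hz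
  transversal x hx := by
    obtain ⟨n, h1, h2, h3⟩ := H.transversal x hx
    refine ⟨-n, by rwa [norm_neg], fun T hT hxT => ?_, fun s hs => ?_⟩
    · change ‖-n - -D.nrm T‖ ≤ _
      rw [← neg_sub', norm_neg]; exact h2 T hT hxT
    · have := h3 (-s) (by rwa [abs_neg])
      rw [smul_neg, ← neg_smul, this, neg_neg]
  mesh_le := H.mesh_le
  normal_le := H.normal_le

omit H in
theorem mem_tets {T : Finset E3} (hT : T ∈ D.active) : T ∈ D.mesh.tets := (D.mem_active.mp hT).1

omit H in
theorem isTet {T : Finset E3} (hT : T ∈ D.active) : IsTet T := TetMesh.isTet (mem_tets hT)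

omit H in
theorem active_of_mem {T : Finset E3} (hT : T ∈ D.mesh.tets) {x : E3} (hx : x ∈ hull T)
    (hxs : x ∈ D.surf) : T ∈ D.active := D.mem_active.mpr ⟨hT, x, hx, hxs⟩

theorem hull_subset {T : Finset E3} (hT : T ∈ D.active) : hull T ⊆ U := by
  obtain ⟨hT', x, hx, hxs⟩ := D.mem_active.mp hT
  intro y hy
  refine H.closedBall_subset x hxs ?_
  rw [Metric.mem_closedBall]
  exact (TetMesh.dist_le_of_mem_hull H.quasi hT' hy hx).trans H.mesh_le

theorem surf_subset : D.surf ⊆ U := fun x hx =>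
  H.closedBall_subset x hx (Metric.mem_closedBall_self H.R_pos.le)

theorem eq_zero_of_mem {x : E3} (hx : x ∈ D.surf) : F x = 0 :=
  (H.zero_iff x (H.surf_subset hx)).mpr hx

theorem continuousOn_hull {T : Finset E3} (hT : T ∈ D.active) : ContinuousOn F (hull T) :=
  H.cont.mono (H.hull_subset hT)

theorem mem_surf_of_eq_zero {T : Finset E3} (hT : T ∈ D.active) {x : E3} (hx : x ∈ hull T)
    (h0 : F x = 0) : x ∈ D.surf := (H.zero_iff x (H.hull_subset hT hx)).mp h0

theorem plane_eq_zero {T : Finset E3} (hT : T ∈ D.active) {x : E3} (hx : x ∈ hull T)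
    (hxs : x ∈ D.surf) : D.plane T x = 0 := by
  obtain ⟨c, hc⟩ := H.planar T hT
  have hne : (hull T ∩ D.surf).Nonempty := (D.mem_active.mp hT).2
  simp only [CutData.plane]
  rw [dif_pos hne]
  simp [hc x ⟨hx, hxs⟩, hc _ hne.choose_spec]

/-- A transversal direction at a point of the surface. -/
theorem exists_transversal {x : E3} (hx : x ∈ D.surf) : ∃ n : E3, ‖n‖ = 1 ∧
    (∀ T ∈ D.active, x ∈ hull T → 1 / 2 ≤ inner ℝ (D.nrm T) n) ∧
    ∀ s, |s| ≤ R → F (x + s • n) = s := by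
  obtain ⟨n, h1, h2, h3⟩ := H.transversal x hx
  refine ⟨n, h1, fun T hT hxT => ?_, h3⟩
  have h4 := (h2 T hT hxT).trans H.normal_le
  have h5 := norm_sub_sq_real n (D.nrm T)
  rw [h1, H.norm_nrm T hT, real_inner_comm] at h5
  nlinarith [norm_nonneg (n - D.nrm T)]

theorem exists_small {x : E3} {P : E3 → Prop} (hP : ∀ᶠ z in 𝓝 x, P z) (n : E3) :
    ∃ ε > 0, ε ≤ R ∧ ∀ s, |s| ≤ ε → P (x + s • n) := by
  have hc : Tendsto (fun s : ℝ => x + s • n) (𝓝 0) (𝓝 x) := by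
    have : Continuous fun s : ℝ => x + s • n := by fun_prop
    simpa using this.tendsto 0
  obtain ⟨ε, hε, hball⟩ := Metric.eventually_nhds_iff.mp (hc.eventually hP)
  refine ⟨min (ε / 2) R, by have := H.R_pos; positivity, min_le_right _ _, fun s hs => hball ?_⟩
  rw [Real.dist_eq, sub_zero]
  exact (hs.trans (min_le_left _ _)).trans_lt (by linarith)

theorem exists_interior_pos {T : Finset E3} (hT : T ∈ D.active)
    (hK : (interior (hull T) ∩ D.surf).Nonempty) :
    ∃ y ∈ interior (hull T), 0 < D.plane T y ∧ 0 < F y := by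
  obtain ⟨x, hx, hxs⟩ := hK
  obtain ⟨n, -, hn, hF⟩ := H.exists_transversal hxs
  obtain ⟨ε, hε, hεR, hP⟩ := H.exists_small (isOpen_interior.mem_nhds hx) n
  refine ⟨x + ε • n, hP ε (by rw [abs_of_pos hε]), ?_, ?_⟩
  · have h1 := D.plane_sub T x (x + ε • n)
    rw [H.plane_eq_zero hT (interior_subset hx) hxs, add_sub_cancel_left, sub_zero,
      real_inner_smul_right] at h1
    rw [h1]
    have := hn T hT (interior_subset hx)
    positivity
  · rw [hF ε (by rwa [abs_of_pos hε])]; exact hε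

/-- The open half simplex is convex and contains no zero of F, since inside T the surface lies in
the plane. So F keeps the sign that it has just above a surface point. -/
theorem pos_of_plane_pos_interior {T : Finset E3} (hT : T ∈ D.active)
    (hK : (interior (hull T) ∩ D.surf).Nonempty) {z : E3} (hz : z ∈ interior (hull T))
    (hpos : 0 < D.plane T z) : 0 < F z := by
  obtain ⟨y, hy, hy1, hy2⟩ := H.exists_interior_pos hT hK
  have hconv : Convex ℝ (interior (hull T) ∩ {y | 0 < D.plane T y}) :=
    (convex_hull T).interior.inter ((convex_Ioi 0).affine_preimage (D.plane T))
  refine hconv.isPreconnected.pos_of_ne_zero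
    ((H.continuousOn_hull hT).mono (inter_subset_left.trans interior_subset)) ?_ ⟨hy, hy1⟩ hy2 z
    ⟨hz, hpos⟩
  intro w hw h0
  exact (ne_of_gt hw.2) (H.plane_eq_zero hT (interior_subset hw.1)
    (H.mem_surf_of_eq_zero hT (interior_subset hw.1) h0))

theorem nonneg_of_plane_nonneg {T : Finset E3} (hT : T ∈ D.active)
    (hK : (interior (hull T) ∩ D.surf).Nonempty) {z : E3} (hz : z ∈ hull T)
    (hpos : 0 ≤ D.plane T z) : 0 ≤ F z := by
  obtain ⟨y, hy, hy1, -⟩ := H.exists_interior_pos hT hK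
  exact nonneg_of_pos_interior (H.continuousOn_hull hT) hy hy1
    (fun w hw hw' => (H.pos_of_plane_pos_interior hT hK hw hw').le) hz hpos

theorem nonpos_of_plane_nonpos {T : Finset E3} (hT : T ∈ D.active)
    (hK : (interior (hull T) ∩ D.surf).Nonempty) {z : E3} (hz : z ∈ hull T)
    (hneg : D.plane T z ≤ 0) : F z ≤ 0 := by
  have := H.neg.nonneg_of_plane_nonneg hT hK hz (by rw [D.plane_neg]; linarith)
  linarith

theorem pos_of_plane_pos {T : Finset E3} (hT : T ∈ D.active)
    (hK : (interior (hull T) ∩ D.surf).Nonempty) {z : E3} (hz : z ∈ hull T)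
    (hpos : 0 < D.plane T z) : 0 < F z := by
  refine lt_of_le_of_ne (H.nonneg_of_plane_nonneg hT hK hz hpos.le) fun h0 => hpos.ne' ?_
  exact H.plane_eq_zero hT hz (H.mem_surf_of_eq_zero hT hz h0.symm)

theorem neg_of_plane_neg {T : Finset E3} (hT : T ∈ D.active)
    (hK : (interior (hull T) ∩ D.surf).Nonempty) {z : E3} (hz : z ∈ hull T)
    (hneg : D.plane T z < 0) : F z < 0 := by
  have := H.neg.pos_of_plane_pos hT hK hz (by rw [D.plane_neg]; linarith)
  linarith

/-- If the surface meets the interior of `T`, it fills the whole plane section of `T`. -/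
theorem mem_surf_iff_plane {T : Finset E3} (hT : T ∈ D.active)
    (hK : (interior (hull T) ∩ D.surf).Nonempty) {z : E3} (hz : z ∈ hull T) :
    z ∈ D.surf ↔ D.plane T z = 0 := by
  refine ⟨H.plane_eq_zero hT hz, fun h0 => H.mem_surf_of_eq_zero hT hz (le_antisymm ?_ ?_)⟩
  · exact H.nonpos_of_plane_nonpos hT hK hz h0.le
  · exact H.nonneg_of_plane_nonneg hT hK hz h0.ge

/-- If Γ_h meets T only in its boundary, F has no zero in the connected interior; its sign there
passes to the closed tetrahedron. -/
theorem nonneg_or_nonpos {T : Finset E3} (hT : T ∈ D.active)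
    (hK : ¬(interior (hull T) ∩ D.surf).Nonempty) :
    (∀ z ∈ hull T, 0 ≤ F z) ∨ (∀ z ∈ hull T, F z ≤ 0) := by
  have hpre : IsPreconnected (interior (hull T)) := (convex_hull T).interior.isPreconnected
  have hc := (H.continuousOn_hull hT).mono (interior_subset (s := hull T))
  have h0 : ∀ z ∈ interior (hull T), F z ≠ 0 := fun z hz h0 =>
    hK ⟨z, hz, H.mem_surf_of_eq_zero hT (interior_subset hz) h0⟩
  obtain ⟨y, hy⟩ := (isTet hT).interior_hull_nonempty
  rcases lt_or_gt_of_ne (h0 y hy) with hlt | hgt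
  · right
    intro z hz
    have := nonneg_of_pos_interior (F := fun z => -F z) (H.continuousOn_hull hT).neg
      (g := AffineMap.const ℝ E3 1) hy (by simp) (fun w hw _ => by
        have := hpre.pos_of_ne_zero (F := fun z => -F z) hc.neg
          (fun z hz => neg_ne_zero.mpr (h0 z hz)) hy (by linarith) w hw
        exact this.le) hz (by simp)
    linarith
  · left
    intro z hz
    exact nonneg_of_pos_interior (H.continuousOn_hull hT)
      (g := AffineMap.const ℝ E3 1) hy (by simp) (fun w hw _ =>
        (hpre.pos_of_ne_zero hc h0 hy hgt w hw).le) hz (by simp)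

omit H in
theorem exists_bary_pos {T : Finset E3} (hT : IsTet T) (x : E3) :
    ∃ a ∈ T, 0 < bary T a x := by
  by_contra! hcon
  have := hT.sum_bary x
  linarith [Finset.sum_nonpos hcon]

omit H in
theorem exists_bary_pos_of_eq_zero {T : Finset E3} (hT : IsTet T) {x : E3} (hx : x ∈ hull T)
    {g : E3 →ᵃ[ℝ] ℝ} (hg : g x = 0) : ∃ a ∈ T, 0 < bary T a x ∧ g a ≤ 0 := by
  by_contra! hcon
  obtain ⟨a, ha, hpos⟩ := exists_bary_pos hT x
  have h1 := hT.affine_eq_sum g x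
  rw [hg] at h1
  have h2 : 0 < ∑ a ∈ T, g a * bary T a x := by
    refine Finset.sum_pos' (fun b hb => ?_) ⟨a, ha, mul_pos (hcon a ha hpos) hpos⟩
    rcases (hT.mem_hull_iff.mp hx b hb).eq_or_lt with h0 | h0
    · rw [← h0, mul_zero]
    · exact (mul_pos (hcon b hb h0) h0).le
  linarith

/-- The carrier of a point of the surface has a vertex where the level function is nonpositive. -/
theorem exists_vertex_nonpos {T : Finset E3} (hT : T ∈ D.active) {x : E3} (hx : x ∈ hull T)
    (hxs : x ∈ D.surf) : ∃ b ∈ T, 0 < bary T b x ∧ F b ≤ 0 := by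
  by_contra! hcon
  -- If F were positive at all vertices of the carrier of x, no tetrahedron around x could have x in
  -- a section through its interior, nor have F ≤ 0. So F ≥ 0 near x, against the slope of F along
  -- the transversal direction.
  have hS : ∀ S ∈ D.mesh.tets, x ∈ hull S → ∀ z ∈ hull S, 0 ≤ F z := by
    intro S hS hxS
    have hSa := active_of_mem hS hxS hxs
    have hcar : ∀ b ∈ S, 0 < bary S b x → 0 < F b := fun b hb hpos =>
      hcon b (TetMesh.mem_of_bary_pos hS (mem_tets hT) hxS hx hb hpos)
        (by rwa [TetMesh.bary_eq_bary (mem_tets hT) hS hx hxS])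
    by_cases hK : (interior (hull S) ∩ D.surf).Nonempty
    · obtain ⟨b, hb, hpos, hle⟩ := exists_bary_pos_of_eq_zero (isTet hSa) hxS
        (H.plane_eq_zero hSa hxS hxs)
      have h1 := H.nonpos_of_plane_nonpos hSa hK (vertex_mem_hull hb) hle
      exact absurd (hcar b hb hpos) (not_lt.mpr h1)
    · rcases H.nonneg_or_nonpos hSa hK with h1 | h1
      · exact h1
      · obtain ⟨b, hb, hpos⟩ := exists_bary_pos (isTet hSa) x
        exact absurd (hcar b hb hpos) (not_lt.mpr (h1 b (vertex_mem_hull hb)))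
  obtain ⟨n, -, -, hF⟩ := H.exists_transversal hxs
  obtain ⟨ε, hε, hεR, hP⟩ := H.exists_small ((D.mesh.eventually_mem_hull x).and
    (H.isOpen.mem_nhds (H.surf_subset hxs))) n
  obtain ⟨h1, h2⟩ := hP (-ε) (by rw [abs_neg, abs_of_pos hε])
  obtain ⟨S, hSt, hzS⟩ := H.cover _ h2
  have h3 := hS S hSt (h1 S hSt hzS) _ hzS
  rw [hF (-ε) (by rwa [abs_neg, abs_of_pos hε])] at h3
  linarith

end FineSurface

end Signs

/-! ### The structure of the cells -/

section Cells

open Filter Topology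

namespace FineSurface

variable {D : CutData} {F : E3 → ℝ} {U : Set E3} {h σ C R : ℝ} (H : FineSurface D F U h σ C R)
include H

theorem exists_plane_ne_zero {T : Finset E3} (hT : T ∈ D.active) : ∃ a ∈ T, D.plane T a ≠ 0 := by
  by_contra! hcon
  have h0 : D.plane T = 0 := (isTet hT).affine_ext (by simpa using hcon)
  have h1 := D.affGrad_plane T
  rw [h0] at h1
  have h2 : affGrad (0 : E3 →ᵃ[ℝ] ℝ) = 0 := by
    refine ext_inner_right ℝ fun w => ?_
    rw [inner_affGrad]; simp
  have := H.norm_nrm T hT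
  rw [← h1, h2, norm_zero] at this
  exact zero_ne_one this

/-- If the plane of `Γ_h` in `T` contains a face then it is that of the face. -/
theorem plane_eq_of_face {T : Finset E3} (hT : T ∈ D.active) {o : E3} (ho : o ∈ T)
    (hface : ∀ a ∈ T, a ≠ o → D.plane T a = 0) :
    D.plane T o ≠ 0 ∧ ∀ x, D.plane T x = D.plane T o * bary T o x := by
  refine ⟨fun h0 => ?_, fun x => (isTet hT).affine_eq_smul_bary ho hface x⟩
  obtain ⟨a, ha, hne⟩ := H.exists_plane_ne_zero hT
  by_cases hao : a = o
  · exact hne (hao ▸ h0)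
  · exact hne (hface a ha hao)

theorem interior_inter_empty_of_face {T : Finset E3} (hT : T ∈ D.active) {o : E3} (ho : o ∈ T)
    (hface : ∀ a ∈ T, a ≠ o → D.plane T a = 0) : ¬(interior (hull T) ∩ D.surf).Nonempty := by
  rintro ⟨x, hx, hxs⟩
  obtain ⟨h1, h2⟩ := H.plane_eq_of_face hT ho hface
  have h3 := H.plane_eq_zero hT (interior_subset hx) hxs
  rw [h2] at h3
  exact mul_ne_zero h1 ((isTet hT).mem_interior_iff.mp hx o ho).ne' h3

omit H in
theorem mem_hull_erase {T : Finset E3} (hT : IsTet T) {o : E3} (ho : o ∈ T) {x : E3} :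
    x ∈ hull (T.erase o) ↔ x ∈ hull T ∧ bary T o x = 0 := by
  rw [hT.mem_hull_face_iff (Finset.erase_subset o T)]
  refine and_congr_right fun _ => ⟨fun h => h o ho (by simp), fun h a ha hao => ?_⟩
  have : a = o := by
    by_contra hne
    exact hao (Finset.mem_erase.mpr ⟨hne, ha⟩)
  rwa [this]

omit H in
/-- The relative interior of a face of a tetrahedron. -/
theorem intrinsicInterior_face {T : Finset E3} (hT : IsTet T) {o : E3} (ho : o ∈ T) :
    intrinsicInterior ℝ (hull (T.erase o)) =
      {z | bary T o z = 0 ∧ ∀ a ∈ T.erase o, 0 < bary T a z} := by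
  have hspan : ∀ w ∈ affineSpan ℝ (hull (T.erase o)), bary T o w = 0 := by
    intro w hw
    exact AffineMap.eqOn_affineSpan (k := ℝ) (f := bary T o) (g := AffineMap.const ℝ E3 0)
      (s := hull (T.erase o)) (fun a ha => by simpa using ((mem_hull_erase hT ho).mp ha).2) hw
  have hmem : ∀ z, bary T o z = 0 → (∀ a ∈ T.erase o, 0 ≤ bary T a z) → z ∈ hull (T.erase o) := by
    intro z hz h
    refine (mem_hull_erase hT ho).mpr ⟨hT.mem_hull_iff.mpr fun a ha => ?_, hz⟩
    by_cases hao : a = o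
    · rw [hao, hz]
    · exact h a (Finset.mem_erase.mpr ⟨hao, ha⟩)
  have hint_sub : ∀ w : affineSpan ℝ (hull (T.erase o)),
      w ∈ interior ((↑) ⁻¹' (hull (T.erase o)) : Set (affineSpan ℝ (hull (T.erase o)))) →
      (w : E3) ∈ hull (T.erase o) := fun w hw => by
    have := interior_subset hw
    exact this
  ext z
  simp only [mem_ofPred_eq]
  constructor
  · rintro ⟨⟨z', hz'⟩, hint, rfl⟩
    have hzh : z' ∈ hull (T.erase o) := hint_sub _ hint
    refine ⟨hspan z' hz', fun a ha => ?_⟩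
    have haT := Finset.mem_of_mem_erase ha
    refine lt_of_le_of_ne (hT.mem_hull_iff.mp ((mem_hull_erase hT ho).mp hzh).1 a haT) fun h0 => ?_
    have hasp : a ∈ affineSpan ℝ (hull (T.erase o)) :=
      subset_affineSpan ℝ _ (vertex_mem_hull ha)
    -- If the coordinate of a vanished at z', the line through a and z' could be prolonged beyond z'
    -- only by making this coordinate negative, that is by leaving the face.
    let γ : ℝ → affineSpan ℝ (hull (T.erase o)) :=
      fun t => ⟨AffineMap.lineMap z' a t, AffineMap.lineMap_mem t hz' hasp⟩
    have hγ : Continuous γ := by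
      refine Continuous.subtype_mk ?_ _
      exact AffineMap.lineMap_continuous
    have hγ0 : γ 0 = ⟨z', hz'⟩ := by simp [γ]
    have hev : ∀ᶠ t in 𝓝 (0 : ℝ), γ t ∈ interior ((↑) ⁻¹' (hull (T.erase o)) : Set _) :=
      hγ.continuousAt.eventually (by rw [hγ0]; exact isOpen_interior.mem_nhds hint)
    obtain ⟨ε, hε, hball⟩ := Metric.eventually_nhds_iff.mp hev
    have h1 : (γ (-(ε / 2)) : E3) ∈ hull (T.erase o) := hint_sub _ (hball (y := -(ε / 2)) (by
      rw [Real.dist_eq, sub_zero, abs_neg, abs_of_pos (by linarith)]; linarith))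
    have h2 := hT.mem_hull_iff.mp ((mem_hull_erase hT ho).mp h1).1 a haT
    have h3 : bary T a (γ (-(ε / 2)) : E3) = -(ε / 2) := by
      simp only [γ, AffineMap.apply_lineMap, ← h0, hT.bary_self haT]
      simp [AffineMap.lineMap_apply]
    rw [h3] at h2
    linarith
  · rintro ⟨hz0, hz⟩
    have hzh := hmem z hz0 fun a ha => (hz a ha).le
    refine ⟨⟨z, subset_affineSpan ℝ _ hzh⟩, ?_, rfl⟩
    rw [mem_interior]
    refine ⟨{w | ∀ a ∈ T.erase o, 0 < bary T a (w : E3)}, ?_, ?_, hz⟩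
    · intro w hw
      exact hmem w (hspan w w.2) fun a ha => (hw a ha).le
    · have : {w : affineSpan ℝ (hull (T.erase o)) | ∀ a ∈ T.erase o, 0 < bary T a (w : E3)} =
          ⋂ a ∈ T.erase o, {w : affineSpan ℝ (hull (T.erase o)) | 0 < bary T a (w : E3)} := by
        ext; simp
      rw [this]
      exact isOpen_biInter_finset fun a _ => isOpen_lt continuous_const
        ((affine_continuous _).comp continuous_subtype_val)

/-- Description of a cell `K` through the barycentric coordinates, with index set `I`, of its
tetrahedron. -/
structure _root_.CellData (D : CutData) (K : Set E3) (I : Finset E3) : Prop where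
  mem : D.tetOf K ∈ D.active
  sub : I ⊆ D.tetOf K
  eq : K = {z | D.plane (D.tetOf K) z = 0 ∧ ∀ a ∈ I, 0 < bary (D.tetOf K) a z}
  zero : ∀ z, D.plane (D.tetOf K) z = 0 → ∀ a ∈ D.tetOf K, a ∉ I → bary (D.tetOf K) a z = 0
  surf : ∀ z ∈ hull (D.tetOf K), D.plane (D.tetOf K) z = 0 → z ∈ D.surf
  nonempty : K.Nonempty
  cases : I = D.tetOf K ∨ I.card = 3 ∧ ∀ a ∈ I, D.plane (D.tetOf K) a = 0

omit H in
theorem mem_cells {K : Set E3} : K ∈ D.cells ↔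
    (∃ T ∈ D.active, K = interior (hull T) ∩ D.surf ∧ K.Nonempty) ∨
    (∃ T ∈ D.active, ∃ T' ∈ D.active, (T ∩ T').card = 3 ∧
      K = intrinsicInterior ℝ (hull (T ∩ T')) ∧ K ⊆ D.surf) := by
  classical
  simp only [CutData.cells, Finset.mem_union, Finset.mem_filter, Finset.mem_image,
    Finset.mem_product, Prod.exists]
  constructor
  · rintro (⟨⟨T, hT, rfl⟩, hne⟩ | ⟨⟨T, T', ⟨⟨hT, hT'⟩, hc⟩, rfl⟩, hs⟩)
    · exact Or.inl ⟨T, hT, rfl, hne⟩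
    · exact Or.inr ⟨T, hT, T', hT', hc, rfl, hs⟩
  · rintro (⟨T, hT, rfl, hne⟩ | ⟨T, hT, T', hT', hc, rfl, hs⟩)
    · exact Or.inl ⟨⟨T, hT, rfl⟩, hne⟩
    · exact Or.inr ⟨⟨T, T', ⟨⟨hT, hT'⟩, hc⟩, rfl⟩, hs⟩

omit H in
theorem tetOf_spec {K : Set E3} {T : Finset E3} (hT : T ∈ D.active) (hK : K ⊆ hull T) :
    D.tetOf K ∈ D.active ∧ K ⊆ hull (D.tetOf K) := by
  have hex : ∃ T ∈ D.active, K ⊆ hull T := ⟨T, hT, hK⟩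
  rw [CutData.tetOf, dif_pos hex]
  exact hex.choose_spec

omit H in
theorem tetOf_interior {T : Finset E3} (hT : T ∈ D.active)
    (hne : (interior (hull T) ∩ D.surf).Nonempty) : D.tetOf (interior (hull T) ∩ D.surf) = T := by
  obtain ⟨h1, h2⟩ := tetOf_spec hT (inter_subset_left.trans interior_subset :
    interior (hull T) ∩ D.surf ⊆ hull T)
  obtain ⟨x, hx⟩ := hne
  exact (TetMesh.eq_of_mem_interior (mem_tets hT) (mem_tets h1) hx.1 (h2 hx)).symm

omit H in
theorem exists_erase_of_card {T f : Finset E3} (hT : IsTet T) (hf : f ⊆ T) (hc : f.card = 3) :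
    ∃ o ∈ T, f = T.erase o := by
  have h1 : (T \ f).card = 1 := by rw [Finset.card_sdiff_of_subset hf, hT.card_eq, hc]
  obtain ⟨o, ho⟩ := Finset.card_eq_one.mp h1
  have hoT : o ∈ T \ f := by rw [ho]; simp
  refine ⟨o, (Finset.mem_sdiff.mp hoT).1, Finset.eq_of_subset_of_card_le (fun a ha => ?_) ?_⟩
  · refine Finset.mem_erase.mpr ⟨?_, hf ha⟩
    rintro rfl
    exact (Finset.mem_sdiff.mp hoT).2 ha
  · rw [Finset.card_erase_of_mem (Finset.mem_sdiff.mp hoT).1, hT.card_eq, hc]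

omit H in
/-- A point in the relative interior of a face. -/
theorem exists_face_point {T : Finset E3} (hT : IsTet T) {o : E3} (ho : o ∈ T) :
    ∃ z ∈ hull T, bary T o z = 0 ∧ ∀ a ∈ T.erase o, 0 < bary T a z := by
  obtain ⟨y, hy⟩ := hT.interior_hull_nonempty
  rw [hT.mem_interior_iff] at hy
  obtain ⟨b, hb⟩ : (T.erase o).Nonempty := Finset.card_pos.mp (by
    rw [Finset.card_erase_of_mem ho, hT.card_eq]; norm_num)
  have hbo : b ≠ o := Finset.ne_of_mem_erase hb
  have hbT := Finset.mem_of_mem_erase hb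
  have hval : ∀ a ∈ T, bary T a (y + bary T o y • (b - o)) = bary T a y + bary T o y *
      ((if b = a then 1 else 0) - (if o = a then 1 else 0)) := by
    intro a ha
    rw [affine_eq _ y, add_sub_cancel_left, real_inner_smul_right, ← affine_sub,
      hT.bary_vertex a hbT, hT.bary_vertex a ho]
  have h0 : bary T o (y + bary T o y • (b - o)) = 0 := by
    rw [hval o ho, if_neg hbo, if_pos rfl]; ring
  have hpos : ∀ a ∈ T.erase o, 0 < bary T a (y + bary T o y • (b - o)) := by
    intro a ha
    have haT := Finset.mem_of_mem_erase ha
    rw [hval a haT, if_neg (Finset.ne_of_mem_erase ha).symm]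
    have := hy a haT
    have := hy o ho
    split_ifs <;> nlinarith
  refine ⟨_, hT.mem_hull_iff.mpr fun a ha => ?_, h0, hpos⟩
  by_cases hao : a = o
  · rw [hao, h0]
  · exact (hpos a (Finset.mem_erase.mpr ⟨hao, ha⟩)).le

/-- The index set I is the carrier of the points of K: all four vertices for a section through the
interior, the three vertices of the face for a cell that is a face. This treats both kinds of cells
alike. -/
theorem exists_cellData {K : Set E3} (hK : K ∈ D.cells) : ∃ I, CellData D K I := by
  rcases mem_cells.mp hK with ⟨T, hT, rfl, hne⟩ | ⟨T, hT, T', hT', hc, rfl, hs⟩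
  · have ht := tetOf_interior hT hne
    refine ⟨T, ?_⟩
    refine ⟨by rwa [ht], by rw [ht], ?_, ?_, ?_, hne, Or.inl ht.symm⟩
    · rw [ht]
      ext z
      simp only [mem_inter_iff, mem_ofPred_eq, ← (isTet hT).mem_interior_iff]
      constructor
      · rintro ⟨h1, h2⟩
        exact ⟨H.plane_eq_zero hT (interior_subset h1) h2, h1⟩
      · rintro ⟨h1, h2⟩
        exact ⟨h2, (H.mem_surf_iff_plane hT hne (interior_subset h2)).mpr h1⟩
    · rw [ht]; exact fun z _ a ha ha' => absurd ha ha'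
    · rw [ht]; exact fun z hz h0 => (H.mem_surf_iff_plane hT hne hz).mpr h0
  · set f := T ∩ T' with hf
    have hfT : f ⊆ T := Finset.inter_subset_left
    obtain ⟨o, ho, hfo⟩ := exists_erase_of_card (isTet hT) hfT hc
    obtain ⟨x, hxT, hx0, hxpos⟩ := exists_face_point (isTet hT) ho
    have hKsub : intrinsicInterior ℝ (hull f) ⊆ hull T :=
      intrinsicInterior_subset.trans (convexHull_mono (by exact_mod_cast hfT))
    obtain ⟨hS, hKS⟩ := tetOf_spec hT hKsub
    set K := intrinsicInterior ℝ (hull f) with hKdef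
    set S := D.tetOf K with hSdef
    have hxK : x ∈ K := by
      rw [hKdef, hfo, intrinsicInterior_face (isTet hT) ho]; exact ⟨hx0, hxpos⟩
    -- `tetOf` may select an active tetrahedron other than T and T'; a point in the relative
    -- interior of the face f shows that f is a face of it as well.
    have hfS : f ⊆ S := fun a ha =>
      TetMesh.mem_of_bary_pos (mem_tets hT) (mem_tets hS) hxT (hKS hxK) (hfT ha)
        (hxpos a (hfo ▸ ha))
    obtain ⟨o', ho', hfo'⟩ := exists_erase_of_card (isTet hS) hfS hc
    have hKeq : K = {z | bary S o' z = 0 ∧ ∀ a ∈ f, 0 < bary S a z} := by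
      rw [hKdef, hfo', intrinsicInterior_face (isTet hS) ho']
    have hxK' : x ∈ {z | bary S o' z = 0 ∧ ∀ a ∈ f, 0 < bary S a z} := hKeq ▸ hxK
    have hplaneK : ∀ z ∈ K, D.plane S z = 0 := fun z hz => H.plane_eq_zero hS (hKS hz) (hs hz)
    have hcombo : ∀ z ∈ hull f, ∀ t ∈ Ioc (0 : ℝ) 1, (1 - t) • z + t • x ∈ K := by
      intro z hz t ht
      rw [hfo', mem_hull_erase (isTet hS) ho'] at hz
      rw [hKeq]
      refine ⟨?_, fun a ha => ?_⟩
      · rw [affine_combo _ (by ring), hz.2, hxK'.1]; ring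
      · rw [affine_combo _ (by ring)]
        have h1 := (isTet hS).mem_hull_iff.mp hz.1 a (hfS ha)
        have h2 := hxK'.2 a ha
        have := mul_pos ht.1 h2
        have := mul_nonneg (sub_nonneg.mpr ht.2) h1
        linarith
    -- Conditions known on the relative interior extend to the closed face: the plane function
    -- vanishes at its vertices and F on all of it.
    have hclos : hull f ⊆ closure K := by
      intro z hz
      have hcont : ContinuousWithinAt (fun t : ℝ => (1 - t) • z + t • x) (Ioc 0 1) 0 :=
        Continuous.continuousWithinAt (by fun_prop)
      have h0 : (0 : ℝ) ∈ closure (Ioc (0 : ℝ) 1) := by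
        rw [closure_Ioc zero_ne_one]; exact left_mem_Icc.mpr zero_le_one
      simpa using hcont.mem_closure h0 (hcombo z hz)
    have hplane : ∀ a ∈ f, D.plane S a = 0 := by
      intro a ha
      have h1 := hclos (vertex_mem_hull ha)
      exact closure_minimal hplaneK (isClosed_eq (affine_continuous _) continuous_const) h1
    have hface : ∀ a ∈ S, a ≠ o' → D.plane S a = 0 := fun a ha hne =>
      hplane a (by rw [hfo']; exact Finset.mem_erase.mpr ⟨hne, ha⟩)
    obtain ⟨hp1, hp2⟩ := H.plane_eq_of_face hS ho' hface
    have hiff : ∀ z, D.plane S z = 0 ↔ bary S o' z = 0 := fun z => by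
      rw [hp2, mul_eq_zero, or_iff_right hp1]
    refine ⟨f, hS, hfS, ?_, ?_, ?_, ⟨x, hxK⟩, Or.inr ⟨hc, hplane⟩⟩
    · rw [← hSdef, hKeq]
      ext z
      simp only [mem_ofPred_eq]
      rw [hiff]
    · intro z hz a ha haf
      rw [← hSdef] at hz ha ⊢
      have : a = o' := by
        by_contra hne
        exact haf (by rw [hfo']; exact Finset.mem_erase.mpr ⟨hne, ha⟩)
      rw [this]; exact (hiff z).mp hz
    · intro z hz hz0
      rw [← hSdef] at hz hz0
      have hzf : z ∈ hull f := by
        rw [hfo', mem_hull_erase (isTet hS) ho']; exact ⟨hz, (hiff z).mp hz0⟩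
      refine H.mem_surf_of_eq_zero hS hz ?_
      have hc : ContinuousWithinAt F K z := (H.continuousOn_hull hS z hz).mono hKS
      have := hc.mem_closure (t := {0}) (hclos hzf) fun y hy => H.eq_zero_of_mem (hs hy)
      simpa using this

/-- If the surface meets the relative interior of a face that lies in the plane of `T`, then the
face is a cell. -/
theorem exists_cell_of_face {T : Finset E3} (hT : T ∈ D.active) {o : E3} (ho : o ∈ T)
    (hface : ∀ a ∈ T, a ≠ o → D.plane T a = 0) {x : E3} (hx : x ∈ hull T) (hxs : x ∈ D.surf)
    (hpos : ∀ a ∈ T.erase o, 0 < bary T a x) :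
    intrinsicInterior ℝ (hull (T.erase o)) ∈ D.cells ∧ hull (T.erase o) ⊆ D.surf := by
  have hempty := H.interior_inter_empty_of_face hT ho hface
  obtain ⟨hp1, hp2⟩ := H.plane_eq_of_face hT ho hface
  have hx0 : bary T o x = 0 := by
    have := H.plane_eq_zero hT hx hxs
    rwa [hp2, mul_eq_zero, or_iff_right hp1] at this
  have hsub : ∀ S ∈ D.mesh.tets, x ∈ hull S → T.erase o ⊆ S := fun S hS hxS a ha =>
    TetMesh.mem_of_bary_pos (mem_tets hT) hS hx hxS (Finset.mem_of_mem_erase ha) (hpos a ha)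
  -- every neighbour has a definite sign
  have hsign : ∀ S ∈ D.mesh.tets, x ∈ hull S →
      (∀ z ∈ hull S, 0 ≤ F z) ∨ (∀ z ∈ hull S, F z ≤ 0) := by
    intro S hS hxS
    have hSa := active_of_mem hS hxS hxs
    by_cases hK : (interior (hull S) ∩ D.surf).Nonempty
    -- A neighbour S cut in its interior does not have this face in its plane. Its plane function
    -- has a weighted mean zero over the vertices of the face at x, hence values of both signs
    -- there; then so has F, against the definite sign of F on T.
    · exfalso
      have hSf := hsub S hS hxS
      have hxp := H.plane_eq_zero hSa hxS hxs
      obtain ⟨o', ho', hfo'⟩ := exists_erase_of_card (isTet hSa) hSf (by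
        rw [Finset.card_erase_of_mem ho, (isTet hT).card_eq])
      have hx0' : bary S o' x = 0 :=
        ((mem_hull_erase (isTet hSa) ho').mp
          (hfo' ▸ (mem_hull_erase (isTet hT) ho).mpr ⟨hx, hx0⟩)).2
      have hne : ∃ a ∈ T.erase o, D.plane S a ≠ 0 := by
        by_contra! hcon
        refine H.interior_inter_empty_of_face hSa ho' (fun a ha hne => hcon a ?_) hK
        rw [hfo']; exact Finset.mem_erase.mpr ⟨hne, ha⟩
      have hsum : ∑ a ∈ T.erase o, D.plane S a * bary S a x = 0 := by
        rw [(isTet hSa).affine_eq_sum (D.plane S) x] at hxp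
        rw [← hxp]
        refine Finset.sum_subset hSf fun a ha hao => ?_
        have : a = o' := by
          by_contra hne
          exact hao (by rw [hfo']; exact Finset.mem_erase.mpr ⟨hne, ha⟩)
        rw [this, hx0', mul_zero]
      have hposS : ∀ a ∈ T.erase o, 0 < bary S a x := fun a ha => by
        rw [← TetMesh.bary_eq_bary (mem_tets hT) hS hx hxS]; exact hpos a ha
      obtain ⟨a₀, ha₀, hne₀⟩ := hne
      have hp : ∃ a ∈ T.erase o, 0 < D.plane S a := by
        by_contra! hcon
        have h1 := (Finset.sum_eq_zero_iff_of_nonpos (fun a ha =>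
          mul_nonpos_of_nonpos_of_nonneg (hcon a ha) (hposS a ha).le)).mp hsum a₀ ha₀
        rcases mul_eq_zero.mp h1 with h | h
        · exact hne₀ h
        · exact (hposS a₀ ha₀).ne' h
      have hn : ∃ a ∈ T.erase o, D.plane S a < 0 := by
        by_contra! hcon
        have h1 := (Finset.sum_eq_zero_iff_of_nonneg (fun a ha =>
          mul_nonneg (hcon a ha) (hposS a ha).le)).mp hsum a₀ ha₀
        rcases mul_eq_zero.mp h1 with h | h
        · exact hne₀ h
        · exact (hposS a₀ ha₀).ne' h
      obtain ⟨b, hb, hbpos⟩ := hp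
      obtain ⟨c, hc, hcneg⟩ := hn
      have hFb := H.pos_of_plane_pos hSa hK (vertex_mem_hull (hSf hb)) hbpos
      have hFc := H.neg_of_plane_neg hSa hK (vertex_mem_hull (hSf hc)) hcneg
      rcases H.nonneg_or_nonpos hT hempty with h1 | h1
      · linarith [h1 c (vertex_mem_hull (Finset.mem_of_mem_erase hc))]
      · linarith [h1 b (vertex_mem_hull (Finset.mem_of_mem_erase hb))]
    · exact H.nonneg_or_nonpos hSa hK
  obtain ⟨n, -, -, hF⟩ := H.exists_transversal hxs
  obtain ⟨ε, hε, hεR, hP⟩ := H.exists_small ((D.mesh.eventually_mem_hull x).and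
    (H.isOpen.mem_nhds (H.surf_subset hxs))) n
  have habs : |ε| ≤ ε := by rw [abs_of_pos hε]
  have habs' : |-ε| ≤ ε := by rw [abs_neg, abs_of_pos hε]
  obtain ⟨p1, p2⟩ := hP ε habs
  obtain ⟨m1, m2⟩ := hP (-ε) habs'
  -- One transversal step to each side yields a neighbour with F ≥ 0 and one with F ≤ 0. They share
  -- the face, so F vanishes on it, and their intersection is exactly the face.
  obtain ⟨S₁, hS₁, hz₁⟩ := H.cover _ p2
  obtain ⟨S₂, hS₂, hz₂⟩ := H.cover _ m2
  have hx₁ := p1 S₁ hS₁ hz₁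
  have hx₂ := m1 S₂ hS₂ hz₂
  have hge : ∀ z ∈ hull S₁, 0 ≤ F z := by
    rcases hsign S₁ hS₁ hx₁ with h1 | h1
    · exact h1
    · have := h1 _ hz₁
      rw [hF ε (habs.trans hεR)] at this
      linarith
  have hle : ∀ z ∈ hull S₂, F z ≤ 0 := by
    rcases hsign S₂ hS₂ hx₂ with h1 | h1
    · have := h1 _ hz₂
      rw [hF (-ε) (habs'.trans hεR)] at this
      linarith
    · exact h1
  have hmono : ∀ S, T.erase o ⊆ S → hull (T.erase o) ⊆ hull S := fun S hS =>
    convexHull_mono (by exact_mod_cast hS)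
  have hsurf : hull (T.erase o) ⊆ D.surf := fun z hz =>
    H.mem_surf_of_eq_zero hT (hmono T (Finset.erase_subset _ _) hz)
      (le_antisymm (hle z (hmono S₂ (hsub S₂ hS₂ hx₂) hz))
        (hge z (hmono S₁ (hsub S₁ hS₁ hx₁) hz)))
  refine ⟨?_, hsurf⟩
  have hne12 : S₁ ≠ S₂ := by
    rintro rfl
    have h1 := hle _ hz₁
    rw [hF ε (habs.trans hεR)] at h1
    linarith
  have hinter : S₁ ∩ S₂ = T.erase o := by
    have hT3 : (T.erase o).card = 3 := by rw [Finset.card_erase_of_mem ho, (isTet hT).card_eq]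
    refine (Finset.eq_of_subset_of_card_le
      (Finset.subset_inter (hsub S₁ hS₁ hx₁) (hsub S₂ hS₂ hx₂)) ?_).symm
    rw [hT3]
    by_contra! hlt
    have h1 : S₁ ∩ S₂ = S₁ := Finset.eq_of_subset_of_card_le Finset.inter_subset_left
      (by rw [(TetMesh.isTet hS₁).card_eq]; exact hlt)
    have h2 : S₁ ∩ S₂ = S₂ := Finset.eq_of_subset_of_card_le Finset.inter_subset_right
      (by rw [(TetMesh.isTet hS₂).card_eq]; exact hlt)
    exact hne12 (h1.symm.trans h2)
  refine mem_cells.mpr (Or.inr ⟨S₁, active_of_mem hS₁ hx₁ hxs, S₂, active_of_mem hS₂ hx₂ hxs, ?_⟩)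
  rw [hinter]
  exact ⟨by rw [Finset.card_erase_of_mem ho, (isTet hT).card_eq], rfl,
    intrinsicInterior_subset.trans hsurf⟩

end FineSurface

end Cells

/-! ### Edges of the cells -/

section Edges

open Filter Topology

/-- Three points on two independent planes are collinear. -/
theorem exists_smul_of_indep {u v : E3} (huv : LinearIndependent ℝ ![u, v]) {d e : E3}
    (hd : d ≠ 0) (h1 : inner ℝ u d = 0) (h2 : inner ℝ v d = 0) (h3 : inner ℝ u e = 0)
    (h4 : inner ℝ v e = 0) : ∃ s : ℝ, e = s • d := by
  set W : Submodule ℝ E3 := (Submodule.span ℝ (Set.range ![u, v]))ᗮ with hW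
  have hfin : Module.finrank ℝ W = 1 := by
    have h5 := Submodule.finrank_add_finrank_orthogonal (Submodule.span ℝ (Set.range ![u, v]))
    rw [finrank_span_eq_card huv, ← hW] at h5
    simp at h5
    omega
  have hmem : ∀ w : E3, inner ℝ u w = 0 → inner ℝ v w = 0 → w ∈ W := by
    intro w h1 h2
    rw [hW, Submodule.mem_orthogonal]
    intro x hx
    induction hx using Submodule.span_induction with
    | mem x hx =>
      obtain ⟨i, rfl⟩ := hx
      fin_cases i
      · exact h1
      · exact h2
    | zero => simp
    | add x y _ _ hx hy => rw [inner_add_left, hx, hy, add_zero]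
    | smul a x _ hx => rw [real_inner_smul_left, hx, mul_zero]
  obtain ⟨c, hc⟩ := (finrank_eq_one_iff_of_nonzero' (⟨d, hmem d h1 h2⟩ : W)
    (by simpa [Subtype.ext_iff] using hd)).mp hfin ⟨e, hmem e h3 h4⟩
  exact ⟨c, by simpa [Subtype.ext_iff] using hc.symm⟩

theorem affine_eq_zero_of_line {f g : E3 →ᵃ[ℝ] ℝ}
    (hfg : LinearIndependent ℝ ![affGrad f, affGrad g]) {p q r : E3} (hpq : p ≠ q)
    (hp : f p = 0 ∧ g p = 0) (hq : f q = 0 ∧ g q = 0) (hr : f r = 0 ∧ g r = 0) {k : E3 →ᵃ[ℝ] ℝ}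
    (hkp : k p = 0) (hkq : k q = 0) : k r = 0 := by
  obtain ⟨s, hs⟩ := exists_smul_of_indep hfg (d := q - p) (e := r - p) (sub_ne_zero.mpr hpq.symm)
    (by rw [← affine_sub, hq.1, hp.1, sub_zero]) (by rw [← affine_sub, hq.2, hp.2, sub_zero])
    (by rw [← affine_sub, hr.1, hp.1, sub_zero]) (by rw [← affine_sub, hr.2, hp.2, sub_zero])
  rw [affine_eq k p r, hs, real_inner_smul_right, ← affine_sub, hkp, hkq]
  ring

namespace CellData

variable {D : CutData} {K : Set E3} {I : Finset E3} (Hc : CellData D K I)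
include Hc

theorem isTet : IsTet (D.tetOf K) := FineSurface.isTet Hc.mem

theorem mem_tets : D.tetOf K ∈ D.mesh.tets := FineSurface.mem_tets Hc.mem

theorem mem_iff {z : E3} : z ∈ K ↔
    D.plane (D.tetOf K) z = 0 ∧ ∀ a ∈ I, 0 < bary (D.tetOf K) a z := by
  conv_lhs => rw [Hc.eq]
  rfl

theorem mem_hull_iff {z : E3} (hz : D.plane (D.tetOf K) z = 0) :
    z ∈ hull (D.tetOf K) ↔ ∀ a ∈ I, 0 ≤ bary (D.tetOf K) a z := by
  rw [Hc.isTet.mem_hull_iff]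
  refine ⟨fun h a ha => h a (Hc.sub ha), fun h a ha => ?_⟩
  by_cases haI : a ∈ I
  · exact h a haI
  · rw [Hc.zero z hz a ha haI]

theorem subset_hull : K ⊆ hull (D.tetOf K) := fun z hz => by
  obtain ⟨h1, h2⟩ := Hc.mem_iff.mp hz
  exact (Hc.mem_hull_iff h1).mpr fun a ha => (h2 a ha).le

theorem subset_surf : K ⊆ D.surf := fun z hz => Hc.surf z (Hc.subset_hull hz) (Hc.mem_iff.mp hz).1

theorem mem_closure_iff {z : E3} :
    z ∈ closure K ↔ z ∈ hull (D.tetOf K) ∧ D.plane (D.tetOf K) z = 0 := by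
  constructor
  · intro hz
    exact ⟨closure_minimal Hc.subset_hull (isCompact_hull _).isClosed hz,
      closure_minimal (fun w hw => (Hc.mem_iff.mp hw).1)
        (isClosed_eq (affine_continuous (D.plane (D.tetOf K))) continuous_const) hz⟩
  · rintro ⟨hz, hz0⟩
    obtain ⟨x, hx⟩ := Hc.nonempty
    obtain ⟨hx0, hxpos⟩ := Hc.mem_iff.mp hx
    have hcont : ContinuousWithinAt (fun t : ℝ => (1 - t) • z + t • x) (Ioc 0 1) 0 :=
      Continuous.continuousWithinAt (by fun_prop)
    have h0 : (0 : ℝ) ∈ closure (Ioc (0 : ℝ) 1) := by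
      rw [closure_Ioc zero_ne_one]; exact left_mem_Icc.mpr zero_le_one
    have hmap : MapsTo (fun t : ℝ => (1 - t) • z + t • x) (Ioc 0 1) K := by
      intro t ht
      refine Hc.mem_iff.mpr ⟨?_, fun a ha => ?_⟩
      · rw [affine_combo _ (by ring), hz0, hx0]; ring
      · rw [affine_combo _ (by ring)]
        have h1 := (Hc.mem_hull_iff hz0).mp hz a ha
        have := mul_pos ht.1 (hxpos a ha)
        have := mul_nonneg (sub_nonneg.mpr ht.2) h1
        linarith
    simpa using hcont.mem_closure h0 hmap

theorem closure_subset_surf : closure K ⊆ D.surf := fun z hz => by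
  obtain ⟨h1, h2⟩ := Hc.mem_closure_iff.mp hz
  exact Hc.surf z h1 h2

theorem convex_closure : Convex ℝ (closure K) := by
  have : closure K = hull (D.tetOf K) ∩ (D.plane (D.tetOf K)) ⁻¹' {0} := by
    ext z; exact Hc.mem_closure_iff
  rw [this]
  exact (convex_hull _).inter ((convex_singleton 0).affine_preimage _)

theorem mem_closure_of_surf {F : E3 → ℝ} {U : Set E3} {h σ C R : ℝ}
    (H : FineSurface D F U h σ C R) {z : E3} (hz : z ∈ hull (D.tetOf K)) (hzs : z ∈ D.surf) :
    z ∈ closure K :=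
  Hc.mem_closure_iff.mpr ⟨hz, H.plane_eq_zero Hc.mem hz hzs⟩

/-- A point x of K satisfies plane = 0 and bary > 0, while both functions vanish at z. Testing a
linear relation with x - z removes the coefficient of the barycentric gradient. -/
theorem indep {F : E3 → ℝ} {U : Set E3} {h σ C R : ℝ} (H : FineSurface D F U h σ C R) {a : E3}
    (ha : a ∈ I) {z : E3} (hz0 : D.plane (D.tetOf K) z = 0) (hza : bary (D.tetOf K) a z = 0) :
    LinearIndependent ℝ ![affGrad (D.plane (D.tetOf K)), affGrad (bary (D.tetOf K) a)] := by
  obtain ⟨x, hx⟩ := Hc.nonempty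
  obtain ⟨hx0, hxpos⟩ := Hc.mem_iff.mp hx
  rw [LinearIndependent.pair_iff]
  intro s t hst
  have h1 := congrArg (fun w => inner ℝ w (x - z)) hst
  simp only [inner_add_left, real_inner_smul_left, inner_zero_left] at h1
  rw [← affine_sub, ← affine_sub, hx0, hz0, hza, sub_zero, sub_zero, mul_zero, zero_add] at h1
  have ht : t = 0 := (mul_eq_zero.mp h1).resolve_right (hxpos a ha).ne'
  refine ⟨?_, ht⟩
  rw [ht, zero_smul, add_zero, D.affGrad_plane, smul_eq_zero] at hst
  refine hst.resolve_right fun h0 => ?_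
  have := H.norm_nrm _ Hc.mem
  rw [h0, norm_zero] at this
  exact zero_ne_one this

/-- The index set of a cell is the carrier of its points. -/
theorem mem_index_iff {z : E3} (hz : z ∈ K) {a : E3} (ha : a ∈ D.tetOf K) :
    a ∈ I ↔ 0 < bary (D.tetOf K) a z := by
  obtain ⟨h1, h2⟩ := Hc.mem_iff.mp hz
  refine ⟨h2 a, fun hpos => ?_⟩
  by_contra haI
  exact hpos.ne' (Hc.zero z h1 a ha haI)

end CellData

namespace FineSurface

variable {D : CutData} {F : E3 → ℝ} {U : Set E3} {h σ C R : ℝ} (H : FineSurface D F U h σ C R)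
include H

/-- A common point has one carrier in the mesh, so both cells have the same index set. Then the
points of K lie in the tetrahedron of K' with the same coordinates. -/
theorem cell_subset_of_mem {K K' : Set E3} {I I' : Finset E3} (Hc : CellData D K I)
    (Hc' : CellData D K' I') {x : E3} (hx : x ∈ K) (hx' : x ∈ K') : K ⊆ K' := by
  have hxT := Hc.subset_hull hx
  have hxT' := Hc'.subset_hull hx'
  have hII : ∀ a, a ∈ I ↔ a ∈ I' := by
    intro a
    constructor
    · intro ha
      have hpos := (Hc.mem_index_iff hx (Hc.sub ha)).mp ha
      have haT' := TetMesh.mem_of_bary_pos Hc.mem_tets Hc'.mem_tets hxT hxT' (Hc.sub ha) hpos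
      rw [TetMesh.bary_eq_bary Hc.mem_tets Hc'.mem_tets hxT hxT'] at hpos
      exact (Hc'.mem_index_iff hx' haT').mpr hpos
    · intro ha
      have hpos := (Hc'.mem_index_iff hx' (Hc'.sub ha)).mp ha
      have haT' := TetMesh.mem_of_bary_pos Hc'.mem_tets Hc.mem_tets hxT' hxT (Hc'.sub ha) hpos
      rw [TetMesh.bary_eq_bary Hc'.mem_tets Hc.mem_tets hxT' hxT] at hpos
      exact (Hc.mem_index_iff hx haT').mpr hpos
  intro z hz
  obtain ⟨hz1, hz2⟩ := Hc.mem_iff.mp hz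
  have hzT := Hc.subset_hull hz
  have hzT' : z ∈ hull (D.tetOf K') := by
    have : z ∈ hull I := (Hc.isTet.mem_hull_face_iff Hc.sub).mpr ⟨hzT, Hc.zero z hz1⟩
    refine convexHull_mono ?_ this
    exact_mod_cast fun a ha => Hc'.sub ((hII a).mp ha)
  refine Hc'.mem_iff.mpr ⟨H.plane_eq_zero Hc'.mem hzT' (Hc.subset_surf hz), fun a ha => ?_⟩
  rw [← TetMesh.bary_eq_bary Hc.mem_tets Hc'.mem_tets hzT hzT']
  exact hz2 a ((hII a).mpr ha)

/-- Different cells are disjoint. -/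
theorem cell_eq_of_mem {K K' : Set E3} (hK : K ∈ D.cells) (hK' : K' ∈ D.cells) {x : E3}
    (hx : x ∈ K) (hx' : x ∈ K') : K = K' := by
  obtain ⟨I, Hc⟩ := H.exists_cellData hK
  obtain ⟨I', Hc'⟩ := H.exists_cellData hK'
  exact Subset.antisymm (H.cell_subset_of_mem Hc Hc' hx hx') (H.cell_subset_of_mem Hc' Hc hx' hx)

end FineSurface

open Classical in
/-- The edges of the cell `K`, as sets. -/
noncomputable def CutData.edges (D : CutData) (K : Set E3) : Finset (Set E3) :=
  ((D.tetOf K).image (fun a => closure K ∩ {z | bary (D.tetOf K) a z = 0})).filter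
    (fun e => e.Nontrivial ∧ e ≠ closure K)

theorem CellData.mem_edges_iff {D : CutData} {K : Set E3} {I : Finset E3} (Hc : CellData D K I)
    {e : Set E3} : e ∈ D.edges K ↔
      ∃ a ∈ I, e = closure K ∩ {z | bary (D.tetOf K) a z = 0} ∧ e.Nontrivial := by
  classical
  simp only [CutData.edges, Finset.mem_filter, Finset.mem_image]
  constructor
  · rintro ⟨⟨a, ha, rfl⟩, hn, hne⟩
    refine ⟨a, ?_, rfl, hn⟩
    by_contra haI
    refine hne (inter_eq_left.mpr fun z hz => ?_)
    exact Hc.zero z (Hc.mem_closure_iff.mp hz).2 a ha haI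
  · rintro ⟨a, ha, rfl, hn⟩
    refine ⟨⟨a, Hc.sub ha, rfl⟩, hn, fun heq => ?_⟩
    obtain ⟨x, hx⟩ := Hc.nonempty
    have hx' := subset_closure hx
    rw [← heq] at hx'
    exact ((Hc.mem_iff.mp hx).2 a ha).ne' hx'.2

/-- A convex set has a point whose carrier contains the carriers of all its points. -/
theorem exists_max_carrier {T : Finset E3} {e : Set E3} (he : Convex ℝ e)
    (hne : e.Nonempty) (hnn : ∀ z ∈ e, ∀ a ∈ T, 0 ≤ bary T a z) :
    ∃ x ∈ e, ∀ z ∈ e, ∀ a ∈ T, 0 < bary T a z → 0 < bary T a x := by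
  suffices hs : ∀ s ⊆ T, ∃ x ∈ e, ∀ z ∈ e, ∀ a ∈ s, 0 < bary T a z → 0 < bary T a x from
    hs T subset_rfl
  intro s
  induction s using Finset.induction_on with
  | empty => exact fun _ => ⟨hne.some, hne.some_mem, by simp⟩
  | insert b s hb ih =>
    intro hsub
    obtain ⟨x, hx, hxs⟩ := ih ((Finset.subset_insert b s).trans hsub)
    by_cases hex : ∃ z ∈ e, 0 < bary T b z
    · obtain ⟨z, hz, hzb⟩ := hex
      refine ⟨(1 / 2 : ℝ) • x + (1 / 2 : ℝ) • z, he hx hz (by norm_num) (by norm_num)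
        (by norm_num), fun w hw a ha hpos => ?_⟩
      rw [affine_combo _ (by norm_num)]
      have h1 := hnn x hx a (hsub ha)
      have h2 := hnn z hz a (hsub ha)
      rcases Finset.mem_insert.mp ha with rfl | ha
      · linarith
      · linarith [hxs w hw a ha hpos]
    · push Not at hex
      refine ⟨x, hx, fun w hw a ha hpos => ?_⟩
      rcases Finset.mem_insert.mp ha with rfl | ha
      · exact absurd hpos (not_lt.mpr (hex w hw))
      · exact hxs w hw a ha hpos

namespace FineSurface

variable {D : CutData} {F : E3 → ℝ} {U : Set E3} {h σ C R : ℝ} (H : FineSurface D F U h σ C R)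
include H

/-- Two different cells with a common edge meet in that edge only. -/
theorem closure_inter_closure {K K' : Set E3} (hK : K ∈ D.cells) (hK' : K' ∈ D.cells)
    (hne : K ≠ K') {e : Set E3} (he : e ∈ D.edges K) (he' : e ∈ D.edges K') :
    closure K ∩ closure K' = e := by
  obtain ⟨I, Hc⟩ := H.exists_cellData hK
  obtain ⟨I', Hc'⟩ := H.exists_cellData hK'
  obtain ⟨a, ha, hea, hnt⟩ := Hc.mem_edges_iff.mp he
  obtain ⟨a', ha', hea', -⟩ := Hc'.mem_edges_iff.mp he'
  have hsub : e ⊆ closure K := by rw [hea]; exact inter_subset_left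
  have hsub' : e ⊆ closure K' := by rw [hea']; exact inter_subset_left
  refine Subset.antisymm (fun w hw => ?_) (subset_inter hsub hsub')
  by_contra hwe
  obtain ⟨p, hp, q, hq, hpq⟩ := hnt
  -- If a common point w lay off the edge, the centroid of w and two points p, q of the edge would
  -- have positive coordinates in both cells, which are disjoint.
  have key : ∀ {K K' : Set E3} {I : Finset E3} {a : E3}, CellData D K I → a ∈ I →
      e = closure K ∩ {z | bary (D.tetOf K) a z = 0} → w ∈ closure K →
      (1 / 3 : ℝ) • w + (2 / 3 : ℝ) • ((1 / 2 : ℝ) • p + (1 / 2 : ℝ) • q) ∈ K := by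
    intro K K' I a Hc ha hea hw
    rw [hea] at hp hq
    have hwe' : bary (D.tetOf K) a w ≠ 0 := fun h0 => hwe (by rw [hea]; exact ⟨hw, h0⟩)
    obtain ⟨p1, p2⟩ := Hc.mem_closure_iff.mp hp.1
    obtain ⟨q1, q2⟩ := Hc.mem_closure_iff.mp hq.1
    obtain ⟨w1, w2⟩ := Hc.mem_closure_iff.mp hw
    have hval : ∀ g : E3 →ᵃ[ℝ] ℝ,
        g ((1 / 3 : ℝ) • w + (2 / 3 : ℝ) • ((1 / 2 : ℝ) • p + (1 / 2 : ℝ) • q)) =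
        1 / 3 * (g w + g p + g q) := by
      intro g
      rw [affine_combo g (by norm_num), affine_combo g (by norm_num)]; ring
    refine Hc.mem_iff.mpr ⟨by rw [hval, p2, q2, w2]; ring, fun b hb => ?_⟩
    rw [hval]
    have hb0 := Hc.isTet.mem_hull_iff.mp p1 b (Hc.sub hb)
    have hb1 := Hc.isTet.mem_hull_iff.mp q1 b (Hc.sub hb)
    have hb2 := Hc.isTet.mem_hull_iff.mp w1 b (Hc.sub hb)
    by_contra! hle
    have z0 : bary (D.tetOf K) b p = 0 := by linarith
    have z1 : bary (D.tetOf K) b q = 0 := by linarith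
    have z2 : bary (D.tetOf K) b w = 0 := by linarith
    exact hwe' (affine_eq_zero_of_line (Hc.indep H hb p2 z0) hpq ⟨p2, z0⟩ ⟨q2, z1⟩ ⟨w2, z2⟩
      hp.2 hq.2)
  exact hne (H.cell_eq_of_mem hK hK' (key (K' := K') Hc ha hea hw.1)
    (key (K' := K) Hc' ha' hea' hw.2))

/-- Beyond an edge of a cell there are points of the surface outside of the tetrahedron. -/
theorem exists_surf_beyond {K : Set E3} {I : Finset E3} (Hc : CellData D K I) {a : E3}
    (ha : a ∈ I) {x : E3} (hx : x ∈ closure K) (hxa : bary (D.tetOf K) a x = 0) {P : E3 → Prop}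
    (hP : ∀ᶠ z in 𝓝 x, P z) : ∃ z ∈ D.surf, z ∉ hull (D.tetOf K) ∧ P z := by
  obtain ⟨hxT, hx0⟩ := Hc.mem_closure_iff.mp hx
  have hxs := Hc.closure_subset_surf hx
  set T := D.tetOf K with hT
  obtain ⟨n, hn1, hn, hF⟩ := H.exists_transversal hxs
  have hnT := hn T Hc.mem hxT
  obtain ⟨y, hy⟩ := Hc.nonempty
  obtain ⟨hy0, hypos⟩ := Hc.mem_iff.mp hy
  set ν := x - y with hν
  have hν0 : inner ℝ (D.nrm T) ν = 0 := by rw [hν, ← D.plane_sub, hx0, hy0, sub_zero]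
  have hνa : inner ℝ (affGrad (bary T a)) ν < 0 := by
    rw [hν, ← affine_sub, hxa, zero_sub]
    linarith [hypos a ha]
  have hev : ∀ᶠ z in 𝓝 x, P z ∧ z ∈ U := hP.and (H.isOpen.mem_nhds (H.surf_subset hxs))
  obtain ⟨δ, hδ, hball⟩ := Metric.eventually_nhds_iff.mp hev
  set s := min R (δ / (2 * (1 + ‖ν‖))) with hs
  have hRpos := H.R_pos
  have hspos : 0 < s := by positivity
  -- A bent path from x - sn to x + sn that bulges out of T in the direction ν, which points away
  -- from the cell across the edge. F changes sign along it and so has a zero on the path.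
  let γ : ℝ → E3 := fun u => x + s • (u • n + (1 - |u|) • ν)
  have hγc : Continuous γ := by
    simp only [γ]
    fun_prop
  have hγP : ∀ u ∈ Icc (-1 : ℝ) 1, P (γ u) ∧ γ u ∈ U := by
    intro u hu
    apply hball
    have hu' : |u| ≤ 1 := abs_le.mpr hu
    have h1 : ‖u • n + (1 - |u|) • ν‖ ≤ 1 + ‖ν‖ := by
      refine (norm_add_le _ _).trans ?_
      rw [norm_smul, norm_smul, hn1, mul_one, Real.norm_eq_abs, Real.norm_eq_abs,
        abs_of_nonneg (sub_nonneg.mpr hu')]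
      have := mul_le_of_le_one_left (norm_nonneg ν) (show 1 - |u| ≤ 1 by linarith [abs_nonneg u])
      linarith
    rw [dist_eq_norm, add_sub_cancel_left, norm_smul, Real.norm_eq_abs, abs_of_pos hspos]
    calc s * _ ≤ δ / (2 * (1 + ‖ν‖)) * (1 + ‖ν‖) := by
          gcongr
          exact min_le_right _ _
      _ = δ / 2 := by have : 1 + ‖ν‖ ≠ 0 := by positivity
                      field_simp
      _ < δ := by linarith
  have hFc : ContinuousOn (fun u => F (γ u)) (Icc (-1) 1) :=
    H.cont.comp hγc.continuousOn fun u hu => (hγP u hu).2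
  have h1 : F (γ 1) = s := by
    simp only [γ, abs_one, sub_self, zero_smul, add_zero, one_smul]
    exact hF s (by rw [abs_of_pos hspos]; exact min_le_left _ _)
  have h2 : F (γ (-1)) = -s := by
    simp only [γ, abs_neg, abs_one, sub_self, zero_smul, add_zero, neg_smul, one_smul, smul_neg]
    rw [← smul_neg, smul_neg, ← neg_smul]
    exact hF (-s) (by rw [abs_neg, abs_of_pos hspos]; exact min_le_left _ _)
  obtain ⟨u, hu, hu0⟩ := isPreconnected_Icc.intermediate_value
    (left_mem_Icc.mpr (by norm_num : (-1 : ℝ) ≤ 1)) (right_mem_Icc.mpr (by norm_num)) hFc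
    (show (0 : ℝ) ∈ Icc _ _ from ⟨by rw [h2]; linarith, by rw [h1]; exact hspos.le⟩)
  have hzs : γ u ∈ D.surf := (H.zero_iff _ (hγP u hu).2).mp hu0
  refine ⟨γ u, hzs, fun hzT => ?_, (hγP u hu).1⟩
  -- If the zero were in T, it would lie in the plane, which forces u = 0; but x + sν has a negative
  -- coordinate.
  have h3 := H.plane_eq_zero Hc.mem hzT hzs
  have h4 := D.plane_sub T x (γ u)
  rw [h3, hx0, sub_zero] at h4
  simp only [γ, add_sub_cancel_left, real_inner_smul_right, inner_add_right, hν0, mul_zero,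
    add_zero] at h4
  have hu_zero : u = 0 := by
    rcases mul_eq_zero.mp h4.symm with h5 | h5
    · exact absurd h5 hspos.ne'
    · exact (mul_eq_zero.mp h5).resolve_right (by linarith)
  have h6 := Hc.isTet.mem_hull_iff.mp hzT a (Hc.sub ha)
  rw [affine_eq _ x, hxa, zero_add] at h6
  simp only [γ, hu_zero, add_sub_cancel_left, real_inner_smul_right, abs_zero, sub_zero, zero_smul,
    zero_add, one_smul] at h6
  nlinarith

/-- Every edge of a cell is an edge of a second cell. -/
theorem exists_neighbour {K : Set E3} (hK : K ∈ D.cells) {e : Set E3} (he : e ∈ D.edges K) :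
    ∃ K' ∈ D.cells, K' ≠ K ∧ e ∈ D.edges K' := by
  classical
  obtain ⟨I, Hc⟩ := H.exists_cellData hK
  obtain ⟨a, ha, hea, hnt⟩ := Hc.mem_edges_iff.mp he
  set T := D.tetOf K with hT
  have hesub : e ⊆ closure K := by rw [hea]; exact inter_subset_left
  have hconv : Convex ℝ e := by
    rw [hea]
    exact Hc.convex_closure.inter ((convex_singleton 0).affine_preimage (bary T a))
  have heT : ∀ z ∈ e, z ∈ hull T := fun z hz => (Hc.mem_closure_iff.mp (hesub hz)).1
  -- With x of maximal carrier G, every tetrahedron containing x contains the whole edge e, so it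
  -- suffices to study the neighbours of x.
  obtain ⟨x, hxe, hxmax⟩ := exists_max_carrier hconv hnt.nonempty
    fun z hz b hb => Hc.isTet.mem_hull_iff.mp (heT z hz) b hb
  have hxT := heT x hxe
  have hxs := Hc.closure_subset_surf (hesub hxe)
  have hae : ∀ z ∈ e, bary T a z = 0 := fun z hz => by rw [hea] at hz; exact hz.2
  set G := T.filter (fun b => 0 < bary T b x) with hG
  have hGT : G ⊆ T := Finset.filter_subset _ _
  have haG : a ∉ G := fun h => ((Finset.mem_filter.mp h).2).ne' (hae x hxe)
  have heG : ∀ z ∈ e, z ∈ hull G := by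
    intro z hz
    refine (Hc.isTet.mem_hull_face_iff hGT).mpr ⟨heT z hz, fun b hb hbG => ?_⟩
    have h1 := Hc.isTet.mem_hull_iff.mp (heT z hz) b hb
    by_contra hne
    exact hbG (Finset.mem_filter.mpr ⟨hb, hxmax z hz b hb (lt_of_le_of_ne h1 (Ne.symm hne))⟩)
  have hGS : ∀ S ∈ D.mesh.tets, x ∈ hull S → G ⊆ S ∧ ∀ b ∈ G, 0 < bary S b x := by
    intro S hS hxS
    refine ⟨fun b hb => ?_, fun b hb => ?_⟩
    · exact TetMesh.mem_of_bary_pos Hc.mem_tets hS hxT hxS (hGT hb) (Finset.mem_filter.mp hb).2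
    · rw [← TetMesh.bary_eq_bary Hc.mem_tets hS hxT hxS]; exact (Finset.mem_filter.mp hb).2
  have hGmono : ∀ S, G ⊆ S → hull G ⊆ hull S := fun S hS =>
    convexHull_mono (by exact_mod_cast hS)
  have hes : ∀ z ∈ e, z ∈ D.surf := fun z hz => Hc.closure_subset_surf (hesub hz)
  have hGcard : 2 ≤ G.card := by
    by_contra! hlt
    obtain ⟨p, hp, q, hq, hpq⟩ := hnt
    have h1 : G.card ≤ 1 := by omega
    obtain ⟨b, hb⟩ := Finset.card_le_one_iff_subset_singleton.mp h1
    have hsub : hull G ⊆ {b} := by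
      refine (convexHull_mono (s := (G : Set E3)) (t := {b}) (by exact_mod_cast hb)).trans ?_
      rw [convexHull_singleton]
    exact hpq ((hsub (heG p hp)).trans (hsub (heG q hq)).symm)
  -- a second cell whose closure contains `x`
  obtain ⟨K', hK', hxK', hKne⟩ : ∃ K' ∈ D.cells, x ∈ closure K' ∧ K' ≠ K := by
    have hev : ∀ᶠ z in 𝓝 x, (∀ S ∈ D.mesh.tets, z ∈ hull S → x ∈ hull S) ∧ z ∈ U ∧
        ∀ S ∈ D.mesh.tets, ∀ b ∈ G, x ∈ hull S → 0 < bary S b z := by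
      have hU : ∀ᶠ z in 𝓝 x, z ∈ U := H.isOpen.mem_nhds (H.surf_subset hxs)
      refine (D.mesh.eventually_mem_hull x).and (hU.and ?_)
      rw [Filter.eventually_all_finset]
      intro S hS
      rw [Filter.eventually_all_finset]
      intro b hb
      by_cases hxS : x ∈ hull S
      · filter_upwards [(affine_continuous (bary S b)).continuousAt.eventually
          (lt_mem_nhds ((hGS S hS hxS).2 b hb))] with z hz _
        exact hz
      · exact Eventually.of_forall fun z h => absurd h hxS
    obtain ⟨z, hzs, hzT, hz1, hzU, hz2⟩ := H.exists_surf_beyond Hc ha (hesub hxe) (hae x hxe) hev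
    obtain ⟨S, hS, hzS⟩ := H.cover z hzU
    have hxS := hz1 S hS hzS
    have hSa := active_of_mem hS hxS hxs
    have hnotK : ∀ K' : Set E3, z ∈ closure K' → K' ≠ K := by
      rintro K' hz rfl
      exact hzT (Hc.mem_closure_iff.mp hz).1
    by_cases hint : (interior (hull S) ∩ D.surf).Nonempty
    · have hmem : interior (hull S) ∩ D.surf ∈ D.cells :=
        mem_cells.mpr (Or.inl ⟨S, hSa, rfl, hint⟩)
      obtain ⟨I', Hc'⟩ := H.exists_cellData hmem
      have ht := tetOf_interior hSa hint
      refine ⟨_, hmem, Hc'.mem_closure_of_surf H (by rwa [ht]) hxs,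
        hnotK _ (Hc'.mem_closure_of_surf H (by rwa [ht]) hzs)⟩
    -- The surface avoids the interior of S, so z lies on a proper face. Its carrier G' strictly
    -- contains G, since z is not in T, and G has at least two vertices; so G' is a triangle and e
    -- lies on a mesh edge.
    · obtain ⟨hGsub, hGpos⟩ := hGS S hS hxS
      set G' := S.filter (fun b => 0 < bary S b z) with hG'
      have hGG' : G ⊆ G' := fun b hb =>
        Finset.mem_filter.mpr ⟨hGsub hb, hz2 S hS b hb hxS⟩
      have hzG' : z ∈ hull G' := by
        refine ((TetMesh.isTet hS).mem_hull_face_iff (Finset.filter_subset _ _)).mpr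
          ⟨hzS, fun b hb hbG => ?_⟩
        have h1 := (TetMesh.isTet hS).mem_hull_iff.mp hzS b hb
        by_contra hne
        exact hbG (Finset.mem_filter.mpr ⟨hb, lt_of_le_of_ne h1 (Ne.symm hne)⟩)
      have hGne : G ≠ G' := by
        intro heq
        rw [← heq] at hzG'
        exact hzT (hGmono T hGT hzG')
      have hcardlt : G.card < G'.card := Finset.card_lt_card (hGG'.ssubset_of_ne hGne)
      have hG'S : G' ⊆ S := Finset.filter_subset _ _
      have hG'lt : G'.card < 4 := by
        rw [← (TetMesh.isTet hS).card_eq]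
        refine Finset.card_lt_card (hG'S.ssubset_of_ne fun heq => hint ⟨z, ?_, hzs⟩)
        refine (TetMesh.isTet hS).mem_interior_iff.mpr fun b hb => ?_
        rw [← heq] at hb
        exact (Finset.mem_filter.mp hb).2
      have hG'3 : G'.card = 3 := by omega
      have hG2 : G.card = 2 := by omega
      obtain ⟨o, ho, hG'o⟩ := exists_erase_of_card (TetMesh.isTet hS) hG'S hG'3
      -- the plane of `S` contains the face `G'`
      have hpG : ∀ b ∈ G, D.plane S b = 0 := by
        obtain ⟨b₁, b₂, hb12, hGb⟩ := Finset.card_eq_two.mp hG2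
        have hval : ∀ p ∈ e, D.plane S b₁ * bary S b₁ p + D.plane S b₂ * bary S b₂ p = 0 ∧
            bary S b₁ p + bary S b₂ p = 1 := by
          intro p hp
          have hpS : p ∈ hull S := hGmono S hGsub (heG p hp)
          have hp0 := ((TetMesh.isTet hS).mem_hull_face_iff hGsub).mp (heG p hp)
          have h1 := H.plane_eq_zero hSa hpS (hes p hp)
          rw [(TetMesh.isTet hS).affine_eq_sum (D.plane S) p] at h1
          have h2 := (TetMesh.isTet hS).sum_bary p
          rw [← Finset.sum_subset hGsub fun b hb hbG => by rw [hp0.2 b hb hbG, mul_zero], hGb,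
            Finset.sum_pair hb12] at h1
          rw [← Finset.sum_subset hGsub fun b hb hbG => hp0.2 b hb hbG, hGb,
            Finset.sum_pair hb12] at h2
          exact ⟨h1, h2⟩
        obtain ⟨p, hp, q, hq, hpq⟩ := hnt
        obtain ⟨p1, p2⟩ := hval p hp
        obtain ⟨q1, q2⟩ := hval q hq
        have hne : bary S b₁ p ≠ bary S b₁ q := by
          intro heq
          apply hpq
          have hpo := ((TetMesh.isTet hS).mem_hull_face_iff hGsub).mp (heG p hp)
          have hqo := ((TetMesh.isTet hS).mem_hull_face_iff hGsub).mp (heG q hq)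
          rw [← (TetMesh.isTet hS).sum_bary_smul p, ← (TetMesh.isTet hS).sum_bary_smul q]
          refine Finset.sum_congr rfl fun b hb => ?_
          by_cases hbG : b ∈ G
          · rw [hGb, Finset.mem_insert, Finset.mem_singleton] at hbG
            rcases hbG with rfl | rfl
            · rw [heq]
            · rw [show bary S b p = bary S b q by linarith]
          · rw [hpo.2 b hb hbG, hqo.2 b hb hbG]
        have e1 : D.plane S b₁ = D.plane S b₂ := by
          have : (D.plane S b₁ - D.plane S b₂) * (bary S b₁ p - bary S b₁ q) = 0 := by
            rw [show bary S b₂ p = 1 - bary S b₁ p by linarith] at p1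
            rw [show bary S b₂ q = 1 - bary S b₁ q by linarith] at q1
            linear_combination p1 - q1
          exact sub_eq_zero.mp ((mul_eq_zero.mp this).resolve_right (sub_ne_zero.mpr hne))
        have e2 : D.plane S b₂ = 0 := by
          rw [e1, ← mul_add, p2, mul_one] at p1; exact p1
        intro b hb
        rw [hGb, Finset.mem_insert, Finset.mem_singleton] at hb
        rcases hb with rfl | rfl
        · rw [e1, e2]
        · exact e2
      have hface : ∀ b ∈ S, b ≠ o → D.plane S b = 0 := by
        have h1 := H.plane_eq_zero hSa hzS hzs
        rw [(TetMesh.isTet hS).affine_eq_sum (D.plane S) z,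
          ← Finset.sum_subset hG'S fun b hb hbG => by
            rw [((TetMesh.isTet hS).mem_hull_face_iff hG'S).mp hzG' |>.2 b hb hbG, mul_zero]] at h1
        obtain ⟨c, hc⟩ : ∃ c, G' \ G = {c} := Finset.card_eq_one.mp (by
          rw [Finset.card_sdiff_of_subset hGG', hG'3, hG2])
        have hcmem : c ∈ G' ∧ c ∉ G := Finset.mem_sdiff.mp (by rw [hc]; simp)
        have hother : ∀ b ∈ G', b ≠ c → b ∈ G := by
          intro b hb hbc
          by_contra hbG
          have : b ∈ G' \ G := Finset.mem_sdiff.mpr ⟨hb, hbG⟩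
          rw [hc, Finset.mem_singleton] at this
          exact hbc this
        rw [Finset.sum_eq_single_of_mem c hcmem.1 fun b hb hbc => by
          rw [hpG b (hother b hb hbc), zero_mul]] at h1
        have hc0 : D.plane S c = 0 :=
          (mul_eq_zero.mp h1).resolve_right (Finset.mem_filter.mp hcmem.1).2.ne'
        intro b hb hbo
        have hbG' : b ∈ G' := by rw [hG'o]; exact Finset.mem_erase.mpr ⟨hbo, hb⟩
        by_cases hbc : b = c
        · rw [hbc, hc0]
        · exact hpG b (hother b hbG' hbc)
      obtain ⟨hcell, -⟩ := H.exists_cell_of_face hSa ho hface hzS hzs fun b hb => by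
        rw [← hG'o] at hb
        exact (Finset.mem_filter.mp hb).2
      obtain ⟨I', Hc'⟩ := H.exists_cellData hcell
      have hzK' : z ∈ intrinsicInterior ℝ (hull (S.erase o)) := by
        rw [intrinsicInterior_face (TetMesh.isTet hS) ho]
        refine ⟨?_, fun b hb => ?_⟩
        · exact ((mem_hull_erase (TetMesh.isTet hS) ho).mp (hG'o ▸ hzG')).2
        · rw [← hG'o] at hb
          exact (Finset.mem_filter.mp hb).2
      have hG't : G' ⊆ D.tetOf (intrinsicInterior ℝ (hull (S.erase o))) := fun b hb =>
        TetMesh.mem_of_bary_pos hS Hc'.mem_tets hzS (Hc'.subset_hull hzK') (hG'S hb)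
          (Finset.mem_filter.mp hb).2
      refine ⟨_, hcell, ?_, hnotK _ (subset_closure hzK')⟩
      exact Hc'.mem_closure_of_surf H (hGmono _ (hGG'.trans hG't) (heG x hxe)) hxs
  -- the edge is an edge of that cell
  obtain ⟨I', Hc'⟩ := H.exists_cellData hK'
  refine ⟨K', hK', hKne, ?_⟩
  set T' := D.tetOf K' with hT'
  obtain ⟨hxT', hx0'⟩ := Hc'.mem_closure_iff.mp hxK'
  obtain ⟨hGsub, hGpos⟩ := hGS T' Hc'.mem_tets hxT'
  have heT' : ∀ z ∈ e, z ∈ hull T' := fun z hz => hGmono T' hGsub (heG z hz)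
  have heK' : ∀ z ∈ e, z ∈ closure K' := fun z hz => Hc'.mem_closure_of_surf H (heT' z hz) (hes z hz)
  have hGI' : G ⊆ I' := fun b hb => by
    by_contra hbI
    exact (hGpos b hb).ne' (Hc'.zero x hx0' b (hGsub hb) hbI)
  -- Equality would make G a face of T whose three vertices lie on the surface. The plane of T would
  -- then be the plane of this face, opposite to a, and the coordinate of a would vanish on K.
  have hGneI' : G ≠ I' := by
    intro heq
    have hGlt : G.card < 4 := by
      rw [← Hc.isTet.card_eq]
      exact Finset.card_lt_card (hGT.ssubset_of_ne fun h => haG (h ▸ Hc.sub ha))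
    rcases Hc'.cases with h4 | ⟨h3, hp3⟩
    · rw [heq, h4, Hc'.isTet.card_eq] at hGlt
      exact lt_irrefl _ hGlt
    · have hsurfG : ∀ b ∈ G, b ∈ D.surf := fun b hb =>
        Hc'.surf b (vertex_mem_hull (hGsub hb)) (hp3 b (heq ▸ hb))
      have hpT : ∀ b ∈ G, D.plane T b = 0 := fun b hb =>
        H.plane_eq_zero Hc.mem (vertex_mem_hull (hGT hb)) (hsurfG b hb)
      obtain ⟨o, ho, hGo⟩ := exists_erase_of_card Hc.isTet hGT (by rw [heq, h3])
      obtain ⟨hp1, hp2⟩ := H.plane_eq_of_face Hc.mem ho fun b hb hbo =>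
        hpT b (by rw [hGo]; exact Finset.mem_erase.mpr ⟨hbo, hb⟩)
      have hao : a = o := by
        by_contra hne
        exact haG (by rw [hGo]; exact Finset.mem_erase.mpr ⟨hne, Hc.sub ha⟩)
      obtain ⟨y, hy⟩ := Hc.nonempty
      obtain ⟨hy0, hypos⟩ := Hc.mem_iff.mp hy
      rw [hp2, mul_eq_zero, or_iff_right hp1, ← hao] at hy0
      exact (hypos a ha).ne' hy0
  obtain ⟨a', ha'I, ha'G⟩ := Finset.exists_of_ssubset (hGI'.ssubset_of_ne hGneI')
  have ha'0 : ∀ z ∈ e, bary T' a' z = 0 := fun z hz =>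
    ((Hc'.isTet.mem_hull_face_iff hGsub).mp (heG z hz)).2 a' (Hc'.sub ha'I) ha'G
  have heq : e = closure K' ∩ {z | bary T' a' z = 0} := by
    refine Subset.antisymm (fun z hz => ⟨heK' z hz, ha'0 z hz⟩) ?_
    rintro w ⟨hwK, hwa⟩
    obtain ⟨hwT', hw0⟩ := Hc'.mem_closure_iff.mp hwK
    obtain ⟨p, hp, q, hq, hpq⟩ := hnt
    have hp0 := (Hc'.mem_closure_iff.mp (heK' p hp)).2
    have hq0 := (Hc'.mem_closure_iff.mp (heK' q hq)).2
    have hwG : w ∈ hull G := by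
      refine (Hc'.isTet.mem_hull_face_iff hGsub).mpr ⟨hwT', fun b hb hbG => ?_⟩
      exact affine_eq_zero_of_line (Hc'.indep H ha'I hw0 hwa) hpq ⟨hp0, ha'0 p hp⟩
        ⟨hq0, ha'0 q hq⟩ ⟨hw0, hwa⟩
        (((Hc'.isTet.mem_hull_face_iff hGsub).mp (heG p hp)).2 b hb hbG)
        (((Hc'.isTet.mem_hull_face_iff hGsub).mp (heG q hq)).2 b hb hbG)
    rw [hea]
    exact ⟨Hc.mem_closure_of_surf H (hGmono T hGT hwG) (Hc'.closure_subset_surf hwK),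
      ((Hc.isTet.mem_hull_face_iff hGT).mp hwG).2 a (Hc.sub ha) haG⟩
  exact Hc'.mem_edges_iff.mpr ⟨a', ha'I, heq, hnt⟩

end FineSurface

end Edges

/-! ### Surface measure -/

section SurfaceMeasure

open Module

theorem euclideanHausdorffMeasure_eq_zero_of_dimH {X : Type*} [EMetricSpace X] [MeasurableSpace X]
    [BorelSpace X] {s : Set X} {d : ℕ} (hs : dimH s < d) : (μHE[d] : Measure X) s = 0 := by
  have h0 : (μH[(d : ℝ)] : Measure X) s = 0 := by
    have := hausdorffMeasure_of_dimH_lt (d := (d : NNReal)) (s := s) (by exact_mod_cast hs)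
    simpa using this
  rw [Measure.euclideanHausdorffMeasure_def, Measure.smul_apply, h0, smul_zero]

/-- The intersection of two independent planes has no area. -/
theorem area_line_eq_zero {f g : E3 →ᵃ[ℝ] ℝ} (hfg : LinearIndependent ℝ ![affGrad f, affGrad g]) :
    (μHE[2] : Measure E3) {z | f z = 0 ∧ g z = 0} = 0 := by
  refine euclideanHausdorffMeasure_eq_zero_of_dimH ?_
  rcases Set.subsingleton_or_nontrivial {z | f z = 0 ∧ g z = 0} with hs | ⟨p, hp, q, hq, hpq⟩
  · rw [dimH_subsingleton hs]; norm_num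
  · have hsub : {z | f z = 0 ∧ g z = 0} ⊆ range fun s : ℝ => p + s • (q - p) := by
      rintro r hr
      obtain ⟨s, hs⟩ := exists_smul_of_indep hfg (d := q - p) (e := r - p)
        (sub_ne_zero.mpr hpq.symm)
        (by rw [← affine_sub, hq.1, hp.1, sub_zero]) (by rw [← affine_sub, hq.2, hp.2, sub_zero])
        (by rw [← affine_sub, hr.1, hp.1, sub_zero]) (by rw [← affine_sub, hr.2, hp.2, sub_zero])
      exact ⟨s, by simp only; rw [← hs]; abel⟩
    have hlip : LipschitzWith ‖q - p‖₊ fun s : ℝ => p + s • (q - p) := by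
      refine LipschitzWith.of_dist_le_mul fun s t => ?_
      rw [dist_eq_norm, add_sub_add_left_eq_sub, ← sub_smul, norm_smul, mul_comm, coe_nnnorm,
        Real.dist_eq, Real.norm_eq_abs]
    refine (dimH_mono hsub).trans_lt (hlip.dimH_range_le.trans_lt ?_)
    rw [Real.dimH_univ]
    norm_num

abbrev E2 : Type := EuclideanSpace ℝ (Fin 2)

/-- An isometric parametrization of the plane orthogonal to `n`. -/
theorem exists_planeIsometry {n : E3} (hn : ‖n‖ = 1) :
    ∃ L : E2 →ₗᵢ[ℝ] E3, ∀ z, inner ℝ n z = 0 ↔ z ∈ range L := by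
  set W : Submodule ℝ E3 := (ℝ ∙ n)ᗮ with hW
  have hn0 : n ≠ 0 := by
    rintro rfl
    simp at hn
  have hfin : finrank ℝ W = 2 := by
    have h1 := Submodule.finrank_add_finrank_orthogonal (ℝ ∙ n)
    rw [finrank_span_singleton hn0, ← hW] at h1
    simp at h1
    omega
  let b : OrthonormalBasis (Fin 2) ℝ W := (stdOrthonormalBasis ℝ W).reindex (finCongr hfin)
  refine ⟨W.subtypeₗᵢ.comp b.repr.symm.toLinearIsometry, fun z => ?_⟩
  rw [← Submodule.mem_orthogonal_singleton_iff_inner_right, ← hW]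
  constructor
  · intro hz
    exact ⟨b.repr ⟨z, hz⟩, by simp⟩
  · rintro ⟨y, rfl⟩
    simp

variable {n : E3} {L : E2 →ₗᵢ[ℝ] E3}

theorem inner_isometry (hL : ∀ z, inner ℝ n z = 0 ↔ z ∈ range L) (y : E2) :
    inner ℝ n (L y) = 0 := (hL _).mpr ⟨y, rfl⟩

/-- The parametrization of the affine plane through `x`. -/
theorem isometry_plane (L : E2 →ₗᵢ[ℝ] E3) (x : E3) : Isometry fun y => x + L y :=
  (IsometryEquiv.addLeft x).isometry.comp L.isometry

theorem range_plane (hL : ∀ z, inner ℝ n z = 0 ↔ z ∈ range L) (x : E3) :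
    (range fun y => x + L y) = {z | inner ℝ n (z - x) = 0} := by
  ext z
  simp only [mem_range, mem_ofPred_eq, hL]
  exact ⟨fun ⟨y, hy⟩ => ⟨y, by rw [← hy]; abel⟩, fun ⟨y, hy⟩ => ⟨y, by rw [hy]; abel⟩⟩

theorem area_image (L : E2 →ₗᵢ[ℝ] E3) (x : E3) (s : Set E2) :
    (μHE[2] : Measure E3) ((fun y => x + L y) '' s) = volume s := by
  rw [(isometry_plane L x).euclideanHausdorffMeasure_image,
    EuclideanSpace.euclideanHausdorffMeasure_eq_volume]

theorem volume_ball_E2 (y : E2) {r : ℝ} (hr : 0 ≤ r) :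
    volume.real (Metric.ball y r) = r ^ 2 * volume.real (Metric.ball (0 : E2) 1) := by
  rw [measureReal_def, measureReal_def, Measure.addHaar_ball volume y hr, ENNReal.toReal_mul,
    ENNReal.toReal_ofReal (by positivity)]
  simp

/-- Area of a bounded planar set. -/
theorem area_le_of_planar (hn : ‖n‖ = 1) {x : E3} {r : ℝ} (hr : 0 ≤ r) {s : Set E3}
    (hs : ∀ z ∈ s, inner ℝ n (z - x) = 0) (hb : ∀ z ∈ s, dist z x < r) :
    (μHE[2] : Measure E3) s ≤ ENNReal.ofReal (r ^ 2 * volume.real (Metric.ball (0 : E2) 1)) := by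
  obtain ⟨L, hL⟩ := exists_planeIsometry hn
  have hsub : s ⊆ (fun y => x + L y) '' Metric.ball 0 r := by
    intro z hz
    obtain ⟨y, hy⟩ := (hL _).mp (hs z hz)
    refine ⟨y, ?_, by simp only; rw [hy]; abel⟩
    rw [Metric.mem_ball, dist_zero_right, ← L.norm_map, hy, ← dist_eq_norm]
    exact hb z hz
  refine (measure_mono hsub).trans ?_
  rw [area_image, ← volume_ball_E2 0 hr, measureReal_def, ENNReal.ofReal_toReal]
  exact measure_ball_lt_top.ne

/-- A set that is met by all lines in direction `n` through a ball has at least the area of the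
projected ball. -/
theorem area_ge_of_projection (hn : ‖n‖ = 1) {x : E3} {r : ℝ} {s : Set E3}
    (hs : ∀ y ∈ Metric.ball x r, ∃ t : ℝ, y + t • n ∈ s) :
    (volume : Measure E2) (Metric.ball 0 r) ≤ (μHE[2] : Measure E3) s := by
  obtain ⟨L, hL⟩ := exists_planeIsometry hn
  -- The orthogonal projection along n in coordinates of the plane; being 1-Lipschitz, it does not
  -- increase Hausdorff measure.
  set P : E3 →L[ℝ] E2 := L.toContinuousLinearMap.adjoint with hP
  have hPL : ∀ y, P (L y) = y := fun y => by
    refine ext_inner_right ℝ fun w => ?_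
    rw [hP, ContinuousLinearMap.adjoint_inner_left]
    exact L.inner_map_map y w
  have hPn : P n = 0 := by
    refine ext_inner_right ℝ fun w => ?_
    rw [hP, ContinuousLinearMap.adjoint_inner_left, inner_zero_left]
    exact inner_isometry hL w
  have hlip : LipschitzWith 1 P := by
    refine P.lipschitz.weaken ?_
    rw [← NNReal.coe_le_coe, coe_nnnorm, hP, LinearIsometryEquiv.norm_map]
    exact L.norm_toContinuousLinearMap_le
  have hsub : Metric.ball (P x) r ⊆ P '' s := by
    intro w hw
    obtain ⟨t, ht⟩ := hs (x + L (w - P x)) (by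
      rw [Metric.mem_ball, dist_eq_norm, add_sub_cancel_left, L.norm_map, ← dist_eq_norm]
      exact hw)
    refine ⟨_, ht, ?_⟩
    rw [map_add, map_add, map_smul, hPn, smul_zero, add_zero, hPL]
    abel
  calc (volume : Measure E2) (Metric.ball 0 r) = volume (Metric.ball (P x) r) :=
        (Measure.addHaar_ball_center volume (P x) r).symm
    _ ≤ volume (P '' s) := measure_mono hsub
    _ = (μHE[2] : Measure E2) (P '' s) := by
        rw [EuclideanSpace.euclideanHausdorffMeasure_eq_volume]
    _ ≤ (μHE[2] : Measure E3) s := by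
        rw [Measure.euclideanHausdorffMeasure_def, Measure.euclideanHausdorffMeasure_def,
          Measure.smul_apply, Measure.smul_apply]
        have := hlip.hausdorffMeasure_image_le (d := ((2 : ℕ) : ℝ)) (by norm_num) s
        rw [ENNReal.coe_one, ENNReal.one_rpow, one_mul] at this
        gcongr

end SurfaceMeasure

/-! ### The area of the cells. -/

section CellMeasure

namespace CellData

variable {D : CutData} {K : Set E3} {I : Finset E3} (Hc : CellData D K I)
include Hc

theorem inner_nrm_eq_zero {x y : E3} (hx : x ∈ closure K) (hy : y ∈ closure K) :
    inner ℝ (D.cellNrm K) (y - x) = 0 := by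
  rw [CutData.cellNrm, ← D.plane_sub, (Hc.mem_closure_iff.mp hx).2, (Hc.mem_closure_iff.mp hy).2,
    sub_zero]

theorem measurableSet : MeasurableSet K := by
  rw [Hc.eq]
  have : {z | D.plane (D.tetOf K) z = 0 ∧ ∀ a ∈ I, 0 < bary (D.tetOf K) a z} =
      {z | D.plane (D.tetOf K) z = 0} ∩ ⋂ a ∈ I, {z | 0 < bary (D.tetOf K) a z} := by
    ext; simp
  rw [this]
  exact (isClosed_eq (affine_continuous _) continuous_const).measurableSet.inter
    (Finset.measurableSet_biInter I fun a _ =>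
      (isOpen_lt continuous_const (affine_continuous _)).measurableSet)

theorem isCompact_closure : IsCompact (closure K) :=
  (isCompact_hull _).of_isClosed_subset isClosed_closure
    (closure_minimal Hc.subset_hull (isCompact_hull _).isClosed)

variable {F : E3 → ℝ} {U : Set E3} {h σ C R : ℝ} (H : FineSurface D F U h σ C R)
include H

theorem norm_cellNrm : ‖D.cellNrm K‖ = 1 := H.norm_nrm _ Hc.mem

theorem area_closure_le : (μHE[2] : Measure E3) (closure K) ≤
    ENNReal.ofReal ((2 * σ * h) ^ 2 * volume.real (Metric.ball (0 : E2) 1)) := by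
  have hh := H.h_pos
  have hσ := H.σ_pos
  obtain ⟨x, hx⟩ := Hc.nonempty
  refine area_le_of_planar (Hc.norm_cellNrm H) (x := x) (by positivity) (fun z hz =>
    Hc.inner_nrm_eq_zero (subset_closure hx) hz) fun z hz => ?_
  have := TetMesh.dist_le_of_mem_hull H.quasi Hc.mem_tets (Hc.mem_closure_iff.mp hz).1
    (Hc.subset_hull hx)
  nlinarith [mul_pos hσ hh]

theorem area_lt_top : (μHE[2] : Measure E3) K < ⊤ :=
  (measure_mono subset_closure).trans_lt ((Hc.area_closure_le H).trans_lt ENNReal.ofReal_lt_top)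

theorem area_le : (μHE[2] : Measure E3).real K ≤
    (2 * σ * h) ^ 2 * volume.real (Metric.ball (0 : E2) 1) := by
  refine ENNReal.toReal_le_of_le_ofReal (by positivity)
    ((measure_mono subset_closure).trans (Hc.area_closure_le H))

/-- The closure adds only points of the plane where some coordinate in I vanishes; these lie on
finitely many lines. -/
theorem closure_ae_eq : closure K =ᵐ[(μHE[2] : Measure E3)] K := by
  refine Filter.EventuallyLE.antisymm ?_ (Filter.Eventually.of_forall fun z hz => subset_closure hz)
  rw [ae_le_set]
  have hsub : closure K \ K ⊆ ⋃ a ∈ I,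
      {z | z ∈ closure K ∧ D.plane (D.tetOf K) z = 0 ∧ bary (D.tetOf K) a z = 0} := by
    rintro z ⟨hz, hzK⟩
    obtain ⟨h1, h2⟩ := Hc.mem_closure_iff.mp hz
    have h3 := (Hc.mem_hull_iff h2).mp h1
    by_contra hcon
    simp only [mem_iUnion, mem_ofPred_eq, not_exists, not_and] at hcon
    exact hzK (Hc.mem_iff.mpr ⟨h2, fun a ha =>
      lt_of_le_of_ne (h3 a ha) (Ne.symm (hcon a ha hz h2))⟩)
  refine measure_mono_null hsub ((measure_biUnion_null_iff I.countable_toSet).mpr fun a ha => ?_)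
  by_cases hex : ∃ z, D.plane (D.tetOf K) z = 0 ∧ bary (D.tetOf K) a z = 0
  · obtain ⟨z, h1, h2⟩ := hex
    exact measure_mono_null (fun z hz => hz.2) (area_line_eq_zero (Hc.indep H ha h1 h2))
  · have : {z | z ∈ closure K ∧ D.plane (D.tetOf K) z = 0 ∧ bary (D.tetOf K) a z = 0} = ∅ := by
      rw [eq_empty_iff_forall_notMem]
      exact fun z hz => hex ⟨z, hz.2⟩
    rw [this, measure_empty]

end CellData

namespace FineSurface

variable {D : CutData} {F : E3 → ℝ} {U : Set E3} {h σ C R : ℝ} (H : FineSurface D F U h σ C R)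
include H

omit H in
theorem indep_bary {T : Finset E3} (hT : IsTet T) {a b : E3} (ha : a ∈ T) (hb : b ∈ T)
    (hab : a ≠ b) : LinearIndependent ℝ ![affGrad (bary T a), affGrad (bary T b)] := by
  obtain ⟨c, hc⟩ : ((T.erase a).erase b).Nonempty := Finset.card_pos.mp (by
    rw [Finset.card_erase_of_mem (Finset.mem_erase.mpr ⟨hab.symm, hb⟩), Finset.card_erase_of_mem ha,
      hT.card_eq]; norm_num)
  simp only [Finset.mem_erase] at hc
  obtain ⟨hcb, hca, hcT⟩ := hc
  rw [LinearIndependent.pair_iff]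
  intro s t hst
  have key : ∀ w : E3, s * inner ℝ (affGrad (bary T a)) w + t * inner ℝ (affGrad (bary T b)) w = 0 := by
    intro w
    have := congrArg (fun u => inner ℝ u w) hst
    simpa [inner_add_left, real_inner_smul_left] using this
  have h1 := key (a - c)
  have h2 := key (b - c)
  rw [← affine_sub, ← affine_sub, hT.bary_self ha, hT.bary_ne hcT hca, hT.bary_ne ha hab,
    hT.bary_ne hcT hcb] at h1
  rw [← affine_sub, ← affine_sub, hT.bary_self hb, hT.bary_ne hcT hca, hT.bary_ne hb hab.symm,
    hT.bary_ne hcT hcb] at h2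
  constructor <;> linarith

/-- The cells cover the surface up to a set without area. -/
theorem area_diff_cells : (μHE[2] : Measure E3) (D.surf \ ⋃ K ∈ D.cells, K) = 0 := by
  classical
  -- A surface point outside all cells lies on the boundary of an active T: either on a mesh edge,
  -- where two coordinates vanish, or where the plane of T crosses a face transversally. Both sets
  -- are finite unions of lines.
  have hsub : D.surf \ ⋃ K ∈ D.cells, K ⊆
      (⋃ T ∈ D.active, ⋃ a ∈ T, ⋃ b ∈ T.filter (fun b => a ≠ b),
        {z | bary T a z = 0 ∧ bary T b z = 0}) ∪
      (⋃ T ∈ D.active, ⋃ a ∈ T.filter (fun a => LinearIndependent ℝ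
        ![affGrad (D.plane T), affGrad (bary T a)]), {z | D.plane T z = 0 ∧ bary T a z = 0}) := by
    rintro x ⟨hxs, hxK⟩
    simp only [mem_iUnion, not_exists] at hxK
    obtain ⟨T, hTt, hxT⟩ := H.cover x (H.surf_subset hxs)
    have hT := active_of_mem hTt hxT hxs
    have hx0 := H.plane_eq_zero hT hxT hxs
    by_cases hint : x ∈ interior (hull T)
    · exact absurd ⟨hint, hxs⟩ (hxK _ (mem_cells.mpr (Or.inl ⟨T, hT, rfl, x, hint, hxs⟩)))
    · rw [(isTet hT).mem_interior_iff] at hint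
      push Not at hint
      obtain ⟨o, ho, hle⟩ := hint
      have hxo : bary T o x = 0 := le_antisymm hle ((isTet hT).mem_hull_iff.mp hxT o ho)
      by_cases hface : ∀ a ∈ T, a ≠ o → D.plane T a = 0
      · left
        by_cases hpos : ∀ a ∈ T.erase o, 0 < bary T a x
        · refine absurd ?_ (hxK _ (H.exists_cell_of_face hT ho hface hxT hxs hpos).1)
          rw [intrinsicInterior_face (isTet hT) ho]
          exact ⟨hxo, hpos⟩
        · push Not at hpos
          obtain ⟨b, hb, hble⟩ := hpos
          have hbT := Finset.mem_of_mem_erase hb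
          simp only [mem_iUnion, Finset.mem_filter]
          exact ⟨T, hT, o, ho, b, ⟨hbT, (Finset.ne_of_mem_erase hb).symm⟩, hxo,
            le_antisymm hble ((isTet hT).mem_hull_iff.mp hxT b hbT)⟩
      · right
        push Not at hface
        obtain ⟨b, hb, hbo, hpb⟩ := hface
        simp only [mem_iUnion, Finset.mem_filter]
        refine ⟨T, hT, o, ⟨ho, ?_⟩, hx0, hxo⟩
        rw [LinearIndependent.pair_iff]
        intro s t hst
        have key : ∀ w : E3, s * (D.plane T w - D.plane T x) + t * (bary T o w - bary T o x) = 0 := by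
          intro w
          have := congrArg (fun u => inner ℝ u (w - x)) hst
          rw [affine_sub, affine_sub]
          simpa [inner_add_left, real_inner_smul_left] using this
        have h1 := key b
        have h2 := key o
        rw [hx0, hxo, (isTet hT).bary_ne hb hbo, sub_zero, sub_zero, mul_zero, add_zero] at h1
        have hs := (mul_eq_zero.mp h1).resolve_right hpb
        rw [hs, hxo, (isTet hT).bary_self ho, zero_mul, zero_add, sub_zero, mul_one] at h2
        exact ⟨hs, h2⟩
  refine measure_mono_null hsub (measure_union_null ?_ ?_)
  · refine (measure_biUnion_null_iff (Finset.countable_toSet _)).mpr fun T hT =>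
      (measure_biUnion_null_iff (Finset.countable_toSet _)).mpr fun a ha =>
      (measure_biUnion_null_iff (Finset.countable_toSet _)).mpr fun b hb => ?_
    have hb' := Finset.mem_filter.mp hb
    exact area_line_eq_zero (indep_bary (isTet hT) ha hb'.1 hb'.2)
  · refine (measure_biUnion_null_iff (Finset.countable_toSet _)).mpr fun T hT =>
      (measure_biUnion_null_iff (Finset.countable_toSet _)).mpr fun a ha => ?_
    exact area_line_eq_zero (Finset.mem_filter.mp ha).2

end FineSurface

end CellMeasure

/-! ### Lines in normal direction -/

section NormalLines

/-- Points c ± u of the inscribed ball at distance h/σ fit into a set of diameter at most σh. -/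
theorem TetMesh.Quasiuniform.one_le {M : TetMesh} {h σ : ℝ} (hM : M.Quasiuniform h σ) (hh : 0 < h)
    (hσ : 0 < σ) {T : Finset E3} (hT : T ∈ M.tets) : 1 ≤ σ := by
  obtain ⟨c, hc⟩ := (hM T hT).2
  obtain ⟨u, hu⟩ := exists_norm_eq E3 (c := h / (2 * σ)) (by positivity)
  have hlt : h / (2 * σ) < h / σ := by
    rw [← div_div, div_right_comm]; exact half_lt_self (by positivity)
  have h1 := TetMesh.dist_le_of_mem_hull hM hT
    (hc (show c + u ∈ _ by rw [Metric.mem_ball, dist_eq_norm, add_sub_cancel_left, hu]; exact hlt))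
    (hc (show c - u ∈ _ by
      rw [Metric.mem_ball, dist_eq_norm, sub_sub_cancel_left, norm_neg, hu]; exact hlt))
  have h2 : dist (c + u) (c - u) = 2 * (h / (2 * σ)) := by
    rw [dist_eq_norm, show c + u - (c - u) = (2 : ℝ) • u by rw [two_smul]; abel, norm_smul, hu]
    norm_num
  rw [h2] at h1
  have h3 : 2 * (h / (2 * σ)) = h / σ := by field_simp
  rw [h3, div_le_iff₀ hσ] at h1
  by_contra! hlt1
  have : σ * h * σ < h := by nlinarith [mul_pos hσ hh, mul_pos (mul_pos hσ hh) (sub_pos.mpr hlt1)]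
  linarith

/-- The first zero of a continuous function. -/
theorem exists_first_zero {f : ℝ → ℝ} {l : ℝ} (hl : 0 ≤ l) (hf : ContinuousOn f (Icc 0 l))
    (h0 : 0 ≤ f 0) (h1 : f l ≤ 0) : ∃ t ∈ Icc 0 l, f t = 0 ∧ ∀ s ∈ Icc 0 t, 0 ≤ f s := by
  set Z := Icc 0 l ∩ f ⁻¹' {0} with hZ
  have hcl : IsClosed Z := hf.preimage_isClosed_of_isClosed isClosed_Icc isClosed_singleton
  obtain ⟨t0, ht0, hz0⟩ := intermediate_value_Icc' hl hf ⟨h1, h0⟩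
  have hne : Z.Nonempty := ⟨t0, ht0, hz0⟩
  have hbdd : BddBelow Z := ⟨0, fun t ht => ht.1.1⟩
  obtain ⟨ht, htz⟩ := hcl.csInf_mem hne hbdd
  refine ⟨sInf Z, ht, htz, fun s hs => ?_⟩
  by_contra! hneg
  obtain ⟨w, hw, hw0⟩ := intermediate_value_Icc' hs.1
    (hf.mono (Icc_subset_Icc_right (hs.2.trans ht.2))) ⟨hneg.le, h0⟩
  have hwZ : w ∈ Z := ⟨⟨hw.1, hw.2.trans (hs.2.trans ht.2)⟩, hw0⟩
  have h2 := csInf_le hbdd hwZ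
  have h3 : w = s := le_antisymm hw.2 (hs.2.trans h2)
  rw [h3] at hw0
  exact hneg.ne hw0

/-- The points of a homothetic copy of a ball. -/
theorem exists_combo_of_mem_homothety {c b : E3} {r l : ℝ} (hl : 0 < l) {y : E3}
    (hy : y ∈ Metric.ball (b + l • (c - b)) (l * r)) :
    ∃ w ∈ Metric.ball c r, y = (1 - l) • b + l • w := by
  refine ⟨b + l⁻¹ • (y - b), ?_, ?_⟩
  · rw [Metric.mem_ball, dist_eq_norm] at hy ⊢
    have h1 : b + l⁻¹ • (y - b) - c = l⁻¹ • (y - (b + l • (c - b))) := by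
      rw [smul_sub, smul_sub l⁻¹ y (b + _), smul_add, smul_smul, inv_mul_cancel₀ hl.ne', one_smul]
      module
    rw [h1, norm_smul, Real.norm_eq_abs, abs_of_pos (inv_pos.mpr hl), inv_mul_lt_iff₀ hl]
    exact hy
  · rw [smul_add, smul_smul, mul_inv_cancel₀ hl.ne', one_smul, sub_smul, one_smul]
    abel

namespace FineSurface

variable {D : CutData} {F : E3 → ℝ} {U : Set E3} {h σ C R : ℝ} (H : FineSurface D F U h σ C R)
include H

theorem one_le {T : Finset E3} (hT : T ∈ D.active) : 1 ≤ σ :=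
  H.quasi.one_le H.h_pos H.σ_pos (mem_tets hT)

theorem abs_sub_plane_le (hR : 2 * σ * h ≤ R) {T : Finset E3} (hT : T ∈ D.active) {x z : E3}
    (hx : x ∈ hull T ∩ D.surf) (hz : ‖z - x‖ ≤ 2 * σ * h) :
    |F z - D.plane T z| ≤ C * (1 + 2 * σ + 4 * σ ^ 2) * h * h := by
  have h1 := H.expansion T hT x hx z (by
    rw [Metric.mem_closedBall, dist_eq_norm]; exact hz.trans hR)
  have h2 := D.plane_sub T x z
  rw [H.plane_eq_zero hT hx.1 hx.2, sub_zero] at h2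
  rw [h2]
  refine h1.trans ?_
  have hh := H.h_pos
  have hC := H.C_nonneg
  have h3 : ‖z - x‖ ^ 2 ≤ (2 * σ * h) ^ 2 := by gcongr
  have h4 : h * ‖z - x‖ ≤ h * (2 * σ * h) := by gcongr
  have h5 : h ^ 2 + h * ‖z - x‖ + ‖z - x‖ ^ 2 ≤ (1 + 2 * σ + 4 * σ ^ 2) * h * h := by nlinarith
  calc _ ≤ C * ((1 + 2 * σ + 4 * σ ^ 2) * h * h) := by gcongr
    _ = _ := by ring

theorem norm_sub_le {T : Finset E3} (hT : T ∈ D.active) {x z : E3} (hx : x ∈ hull T)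
    (hz : z ∈ hull T) : ‖z - x‖ ≤ σ * h := by
  rw [← dist_eq_norm]
  exact TetMesh.dist_le_of_mem_hull H.quasi (mem_tets hT) hz hx

/-- The plane section of a tetrahedron with points far from the plane on both sides contains a
disc of proportional size. -/
theorem exists_ball_on_plane {T : Finset E3} (hT : T ∈ D.active) {μ : ℝ} (hμ : 0 < μ) {c q : E3}
    (hc : Metric.ball c (h / σ) ⊆ hull T) (hq : q ∈ hull T)
    (hcq : D.plane T c * D.plane T q ≤ 0) (hqμ : μ * h ≤ |D.plane T q|) :
    ∃ y, D.plane T y = 0 ∧ Metric.ball y (μ * h / σ ^ 2) ⊆ hull T := by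
  have hh := H.h_pos
  have hσ := H.σ_pos
  set p := D.plane T c with hp
  set w := D.plane T q with hw
  have hwpos : 0 < |w| := lt_of_lt_of_le (by positivity) hqμ
  have hw0 : w ≠ 0 := abs_pos.mp hwpos
  have hcT : c ∈ hull T := hc (Metric.mem_ball_self (by positivity))
  have hpw : |p - w| = |p| + |w| := by
    rcases lt_or_gt_of_ne hw0 with hlt | hgt
    · have : 0 ≤ p := by by_contra! h1; nlinarith
      rw [abs_of_nonneg (by linarith), abs_of_nonneg this, abs_of_neg hlt]; ring
    · have : p ≤ 0 := by by_contra! h1; nlinarith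
      rw [abs_of_nonpos (by linarith), abs_of_nonpos this, abs_of_pos hgt]; ring
  have hd0 : w - p ≠ 0 := by
    rw [← abs_pos, abs_sub_comm, hpw]; linarith [abs_nonneg p]
  have hle : |w - p| ≤ σ * h := by
    rw [hw, hp, D.plane_sub]
    refine (abs_real_inner_le_norm _ _).trans ?_
    rw [H.norm_nrm T hT, one_mul]
    exact H.norm_sub_le hT hcT hq
  -- The point q + l(c - q) is where the segment from q to c meets the plane. The homothety with
  -- centre q and ratio l ≥ μ/σ carries the inscribed ball to a ball about it inside T.
  set l := w / (w - p) with hl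
  have hlabs : |w| / |w - p| = l := by
    rw [← abs_div, abs_of_nonneg]
    rw [div_nonneg_iff]
    rcases lt_or_gt_of_ne hw0 with hlt | hgt
    · right; constructor <;> nlinarith
    · left; constructor <;> nlinarith
  have hdpos : 0 < |w - p| := abs_pos.mpr hd0
  have hl0 : 0 < l := by rw [← hlabs]; positivity
  have hl1 : l ≤ 1 := by
    rw [← hlabs, div_le_one hdpos, abs_sub_comm, hpw]; linarith [abs_nonneg p]
  have hlge : μ / σ ≤ l := by
    rw [← hlabs, div_le_div_iff₀ hσ hdpos]
    calc μ * |w - p| ≤ μ * (σ * h) := by gcongr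
      _ = μ * h * σ := by ring
      _ ≤ |w| * σ := by gcongr
  refine ⟨q + l • (c - q), ?_, fun y hy => ?_⟩
  · have h1 := D.plane_sub T q (q + l • (c - q))
    rw [add_sub_cancel_left, real_inner_smul_right, ← D.plane_sub, ← hp, ← hw] at h1
    have h2 : l * (p - w) = -w := by rw [hl]; field_simp; ring
    linarith
  · have hsub : y ∈ Metric.ball (q + l • (c - q)) (l * (h / σ)) := by
      refine Metric.ball_subset_ball ?_ hy
      calc μ * h / σ ^ 2 = μ / σ * (h / σ) := by field_simp
        _ ≤ l * (h / σ) := by gcongr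
    obtain ⟨u, hu, rfl⟩ := exists_combo_of_mem_homothety hl0 hsub
    exact convex_hull T hq (hc hu) (by linarith) hl0.le (by ring)

/-- The bundle of normal segments from a ball in `T` to the surface. -/
def _root_.CutData.NormalBall (D : CutData) (T : Finset E3) (h σ : ℝ) (y₀ : E3) : Prop :=
  Metric.ball y₀ (h / (128 * σ ^ 5)) ⊆ hull T ∧
    ∀ y ∈ Metric.ball y₀ (h / (128 * σ ^ 5)), ∃ t : ℝ, |t| ≤ σ * h ∧ y + t • D.nrm T ∈ D.surf ∧
      ∀ p ∈ segment ℝ y (y + t • D.nrm T), ∃ S ∈ D.active, p ∈ hull S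

omit H in
theorem normalBall_neg {T : Finset E3} {y₀ : E3} (hN : D.neg.NormalBall T h σ y₀) :
    D.NormalBall T h σ y₀ := by
  refine ⟨hN.1, fun y hy => ?_⟩
  obtain ⟨t, h1, h2, h3⟩ := hN.2 y hy
  have e : y + t • D.neg.nrm T = y + (-t) • D.nrm T := by
    change y + t • (-D.nrm T) = _
    rw [smul_neg, neg_smul]
  rw [e] at h2 h3
  exact ⟨-t, by rwa [abs_neg], h2, h3⟩

/-- Points of T at distance at least μh on both sides of the plane, while F differs from the plane
function by less than μh, force Γ_h through the interior of T. It then fills the section, which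
contains the centre of a ball of size h in T; perpendiculars from this ball to the plane stay in the
ball. -/
theorem normalBall_of_crossing (hR : 2 * σ * h ≤ R)
    (hE : C * (1 + 2 * σ + 4 * σ ^ 2) * h < 1 / (128 * σ ^ 3)) {T : Finset E3} (hT : T ∈ D.active)
    {q q' : E3} (hq : q ∈ hull T) (hq' : q' ∈ hull T)
    (hqμ : D.plane T q ≤ -(1 / (128 * σ ^ 3) * h)) (hqμ' : 1 / (128 * σ ^ 3) * h ≤ D.plane T q') :
    ∃ y₀, D.NormalBall T h σ y₀ := by
  have hh := H.h_pos
  have hσ := H.σ_pos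
  obtain ⟨x, hx, hxs⟩ := (D.mem_active.mp hT).2
  set μ := 1 / (128 * σ ^ 3) with hμ
  have hμ0 : 0 < μ := by positivity
  have hEh : C * (1 + 2 * σ + 4 * σ ^ 2) * h * h < μ * h := by gcongr
  have hFP : ∀ z ∈ hull T, |F z - D.plane T z| ≤ C * (1 + 2 * σ + 4 * σ ^ 2) * h * h := fun z hz =>
    H.abs_sub_plane_le hR hT ⟨hx, hxs⟩ ((H.norm_sub_le hT hx hz).trans (by nlinarith [mul_pos hσ hh]))
  have hK : (interior (hull T) ∩ D.surf).Nonempty := by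
    by_contra hK
    rcases H.nonneg_or_nonpos hT hK with hs | hs
    · have := (abs_le.mp (hFP q hq)).2
      linarith [hs q hq]
    · have := (abs_le.mp (hFP q' hq')).1
      linarith [hs q' hq']
  obtain ⟨c, hc⟩ := (H.quasi T (mem_tets hT)).2
  obtain ⟨y₀, h0, hball⟩ : ∃ y, D.plane T y = 0 ∧ Metric.ball y (μ * h / σ ^ 2) ⊆ hull T := by
    have hμh : 0 < μ * h := by positivity
    rcases le_total 0 (D.plane T c) with hpos | hneg
    · exact H.exists_ball_on_plane hT hμ0 hc hq (mul_nonpos_of_nonneg_of_nonpos hpos (by linarith))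
        (by rw [abs_of_neg (by linarith)]; linarith)
    · exact H.exists_ball_on_plane hT hμ0 hc hq' (mul_nonpos_of_nonpos_of_nonneg hneg (by linarith))
        (by rw [abs_of_pos (by linarith)]; linarith)
  have hrad : h / (128 * σ ^ 5) = μ * h / σ ^ 2 := by rw [hμ]; field_simp
  rw [← hrad] at hball
  refine ⟨y₀, hball, fun y hy => ⟨-D.plane T y, ?_, ?_⟩⟩
  · have hyT := hball hy
    have h1 := D.plane_sub T x y
    rw [H.plane_eq_zero hT hx hxs, sub_zero] at h1
    rw [abs_neg, h1]
    refine (abs_real_inner_le_norm _ _).trans ?_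
    rw [H.norm_nrm T hT, one_mul]
    exact H.norm_sub_le hT hx hyT
  · have hm := H.norm_nrm T hT
    have hpl : D.plane T y = inner ℝ (D.nrm T) (y - y₀) := by rw [← D.plane_sub, h0, sub_zero]
    have hzb : y + (-D.plane T y) • D.nrm T ∈ Metric.ball y₀ (h / (128 * σ ^ 5)) := by
      rw [Metric.mem_ball, dist_eq_norm] at hy ⊢
      refine lt_of_le_of_lt ?_ hy
      have e : y + (-D.plane T y) • D.nrm T - y₀ =
          (y - y₀) - inner ℝ (D.nrm T) (y - y₀) • D.nrm T := by rw [hpl, neg_smul]; abel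
      have h2 := norm_sub_sq_real (y - y₀) (inner ℝ (D.nrm T) (y - y₀) • D.nrm T)
      rw [real_inner_smul_right, norm_smul, hm, mul_one, Real.norm_eq_abs, sq_abs,
        real_inner_comm (D.nrm T) (y - y₀)] at h2
      rw [e]
      refine (sq_le_sq₀ (norm_nonneg _) (norm_nonneg _)).mp ?_
      rw [h2]
      nlinarith [sq_nonneg (inner ℝ (D.nrm T) (y - y₀))]
    have hz0 : D.plane T (y + (-D.plane T y) • D.nrm T) = 0 := by
      have h3 := D.plane_sub T y (y + (-D.plane T y) • D.nrm T)
      rw [add_sub_cancel_left, real_inner_smul_right, real_inner_self_eq_norm_sq, hm] at h3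
      linarith
    exact ⟨(H.mem_surf_iff_plane hT hK (hball hzb)).mpr hz0, fun p hp =>
      ⟨T, hT, (convex_hull T).segment_subset (hball hy) (hball hzb) hp⟩⟩

/-- Here Γ_h may touch T in a vertex only, so the segments leave T. They start near a vertex b with
F(b) ≤ 0 and run against the normal until F first vanishes. Each point on the way has F ≥ 0 and lies
in a tetrahedron having b as a vertex; the segment from b to that point crosses Γ_h inside this
tetrahedron, which is therefore active. -/
theorem normalBall_of_above (hR : 2 * σ * h ≤ R)
    (hE : C * (1 + 2 * σ + 4 * σ ^ 2) * h < 1 / (128 * σ ^ 3)) {T : Finset E3} (hT : T ∈ D.active)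
    (hab : ∀ z ∈ hull T, -(1 / (128 * σ ^ 3) * h) < D.plane T z) :
    ∃ y₀, D.NormalBall T h σ y₀ := by
  have hh := H.h_pos
  have hσ := H.σ_pos
  have hσ1 := H.one_le hT
  have hm := H.norm_nrm T hT
  obtain ⟨x, hx, hxs⟩ := (D.mem_active.mp hT).2
  set μ := 1 / (128 * σ ^ 3) with hμ
  have hμ0 : 0 < μ := by positivity
  have hEh : C * (1 + 2 * σ + 4 * σ ^ 2) * h * h < μ * h := by gcongr
  obtain ⟨b, hb, -, hFb⟩ := H.exists_vertex_nonpos hT hx hxs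
  have hbT := vertex_mem_hull hb
  have hFP : ∀ z, ‖z - x‖ ≤ 2 * σ * h → |F z - D.plane T z| < μ * h := fun z hz =>
    (H.abs_sub_plane_le hR hT ⟨hx, hxs⟩ hz).trans_lt hEh
  have hbx : ‖b - x‖ ≤ σ * h := H.norm_sub_le hT hx hbT
  have hσh : 0 < σ * h := by positivity
  have hpb : D.plane T b < μ * h := by
    have := (abs_lt.mp (hFP b (by linarith))).1; linarith
  obtain ⟨c, hc⟩ := (H.quasi T (mem_tets hT)).2
  -- The ratio makes lσh = h/(8σ), so that the shrunk ball and the whole path stay within h/(2σ) of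
  -- b, the range of `TetMesh.mem_of_dist_lt`.
  set l := 1 / (8 * σ ^ 2) with hl
  have hl0 : 0 < l := by positivity
  have hσ2 : 1 ≤ σ ^ 2 := one_le_pow₀ hσ1
  have hl8 : l ≤ 1 / 8 := by
    rw [hl, div_le_div_iff₀ (by positivity) (by norm_num)]; linarith
  have hl1 : l ≤ 1 := by linarith
  set k := h / (32 * σ ^ 3) with hk
  have hk0 : 0 < k := by positivity
  have hμk : μ * h = k / 4 := by rw [hμ, hk]; field_simp; norm_num
  have hlr : l * (h / σ / 4) = k := by rw [hl, hk]; field_simp; norm_num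
  have hσ3 : 1 ≤ σ ^ 3 := one_le_pow₀ hσ1
  have hkle : k ≤ h / σ / 32 := by
    rw [hk, div_div, div_le_div_iff_of_pos_left hh (by positivity) (by positivity)]
    nlinarith
  have hhσ : h / σ ≤ σ * h := by rw [div_le_iff₀ hσ]; nlinarith
  have hlσ : l * (σ * h) = h / σ / 8 := by rw [hl]; field_simp
  have hsub4 : Metric.ball c (h / σ / 4) ⊆ hull T :=
    (Metric.ball_subset_ball (by linarith [div_pos hh hσ])).trans hc
  have hcpl : h / σ / 2 - μ * h < D.plane T c := by
    have h1 := hab (c - (h / σ / 2) • D.nrm T) (hc (by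
      rw [Metric.mem_ball, dist_eq_norm, sub_sub_cancel_left, norm_neg, norm_smul, hm, mul_one,
        Real.norm_eq_abs, abs_of_pos (by positivity)]
      linarith [div_pos hh hσ]))
    have h2 := D.plane_sub T c (c - (h / σ / 2) • D.nrm T)
    rw [sub_sub_cancel_left, inner_neg_right, real_inner_smul_right, real_inner_self_eq_norm_sq,
      hm] at h2
    linarith
  have hrad : h / (128 * σ ^ 5) ≤ l * (h / σ / 4) := by
    rw [hlr, hk, div_le_div_iff_of_pos_left hh (by positivity) (by positivity)]
    nlinarith [mul_nonneg (pow_nonneg hσ.le 3) (sub_nonneg.mpr hσ2)]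
  have hrep : ∀ y ∈ Metric.ball (b + l • (c - b)) (h / (128 * σ ^ 5)),
      ∃ w ∈ Metric.ball c (h / σ / 4), y = (1 - l) • b + l • w := fun y hy =>
    exists_combo_of_mem_homothety hl0 (Metric.ball_subset_ball hrad hy)
  refine ⟨b + l • (c - b), fun y hy => ?_, fun y hy => ?_⟩
  · obtain ⟨w, hw, rfl⟩ := hrep y hy
    exact convex_hull T hbT (hsub4 hw) (by linarith) hl0.le (by ring)
  obtain ⟨w, hw, hyw⟩ := hrep y hy
  have hyb : ‖y - b‖ ≤ h / σ / 8 := by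
    have : y - b = l • (w - b) := by rw [hyw, sub_smul, one_smul, smul_sub]; abel
    rw [this, norm_smul, Real.norm_eq_abs, abs_of_pos hl0, ← hlσ]
    exact mul_le_mul_of_nonneg_left (H.norm_sub_le hT hbT (hsub4 hw)) hl0.le
  have hpw : h / σ / 4 - μ * h < D.plane T w := by
    have h1 := D.plane_sub T w c
    have h2 : |inner ℝ (D.nrm T) (c - w)| < h / σ / 4 := by
      refine (abs_real_inner_le_norm _ _).trans_lt ?_
      rw [hm, one_mul, ← dist_eq_norm, dist_comm]; exact hw
    linarith [(abs_lt.mp h2).2]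
  have hpy : 2 * k / 4 < D.plane T y := by
    rw [hyw, affine_combo _ (by ring)]
    have hbl := hab b hbT
    have e1 : -(μ * h) ≤ (1 - l) * D.plane T b + l * (μ * h) := by nlinarith
    have e2 : l * (h / σ / 4 - μ * h) < l * D.plane T w := by gcongr
    have e3 : l * (μ * h) ≤ 1 / 8 * (μ * h) := by gcongr
    rw [mul_sub, hlr] at e2
    linarith
  have hpy' : D.plane T y ≤ k / 4 + h / σ / 8 := by
    have h1 := D.plane_sub T b y
    have h2 := abs_real_inner_le_norm (D.nrm T) (y - b)
    rw [hm, one_mul] at h2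
    linarith [(abs_le.mp (h2.trans hyb)).2]
  -- Since k/4 = μh exceeds |F - plane|, F is nonnegative at the start, where plane > 2μh, and
  -- nonpositive after the length l1, where plane = -2μh.
  set l1 := D.plane T y + 2 * (k / 4) with hl1def
  have hl1pos : 0 ≤ l1 := by linarith
  have hhσ0 : 0 < h / σ := by positivity
  have hpt : ∀ t ∈ Icc 0 l1, ‖y + t • (-D.nrm T) - b‖ < h / (2 * σ) := by
    intro t ht
    have e : y + t • (-D.nrm T) - b = (y - b) + t • (-D.nrm T) := by abel
    rw [e]
    refine (norm_add_le _ _).trans_lt ?_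
    rw [norm_smul, norm_neg, hm, mul_one, Real.norm_eq_abs, abs_of_nonneg ht.1]
    have : h / (2 * σ) = h / σ / 2 := by rw [div_div, mul_comm]
    rw [this]
    linarith [ht.2]
  have h2σ : h / (2 * σ) = h / σ / 2 := by rw [div_div, mul_comm]
  have hnear : ∀ z, ‖z - b‖ < h / (2 * σ) → ‖z - x‖ ≤ 2 * σ * h := by
    intro z hz
    have : z - x = (z - b) + (b - x) := by abel
    rw [this]
    refine (norm_add_le _ _).trans ?_
    linarith
  have hnearU : ∀ z, ‖z - b‖ < h / (2 * σ) → z ∈ U := fun z hz =>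
    H.closedBall_subset x hxs (by
      rw [Metric.mem_closedBall, dist_eq_norm]; exact (hnear z hz).trans hR)
  have hcont : ContinuousOn (fun t : ℝ => F (y + t • (-D.nrm T))) (Icc 0 l1) :=
    H.cont.comp (Continuous.continuousOn (by fun_prop)) fun t ht => hnearU _ (hpt t ht)
  have hpline : ∀ t : ℝ, D.plane T (y + t • (-D.nrm T)) = D.plane T y - t := by
    intro t
    have h3 := D.plane_sub T y (y + t • (-D.nrm T))
    rw [add_sub_cancel_left, real_inner_smul_right, inner_neg_right, real_inner_self_eq_norm_sq,
      hm] at h3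
    linarith
  have hF0 : 0 ≤ F (y + (0 : ℝ) • (-D.nrm T)) := by
    have h1 := (abs_lt.mp (hFP _ (hnear _ (hpt 0 (left_mem_Icc.mpr hl1pos))))).1
    rw [hpline] at h1
    linarith
  have hF1 : F (y + l1 • (-D.nrm T)) ≤ 0 := by
    have h1 := (abs_lt.mp (hFP _ (hnear _ (hpt l1 (right_mem_Icc.mpr hl1pos))))).2
    rw [hpline] at h1
    linarith
  obtain ⟨t, ht, hFt, hpos⟩ := exists_first_zero hl1pos hcont hF0 hF1
  have e : y + (-t) • D.nrm T = y + t • (-D.nrm T) := by rw [smul_neg, neg_smul]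
  refine ⟨-t, ?_, ?_, ?_⟩
  · rw [abs_neg, abs_of_nonneg ht.1]
    linarith [ht.2]
  · rw [e]
    exact (H.zero_iff _ (hnearU _ (hpt t ht))).mp hFt
  · rw [e]
    intro p hp
    rw [segment_eq_image'] at hp
    obtain ⟨θ, hθ, rfl⟩ := hp
    simp only [add_sub_cancel_left, smul_smul]
    have hθt : θ * t ∈ Icc 0 t := ⟨mul_nonneg hθ.1 ht.1, by nlinarith [hθ.2, ht.1]⟩
    have hθl : θ * t ∈ Icc 0 l1 := ⟨hθt.1, hθt.2.trans ht.2⟩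
    have hFp := hpos _ hθt
    have hpb' := hpt _ hθl
    obtain ⟨S, hS, hpS⟩ := H.cover _ (hnearU _ hpb')
    -- The path stays so close to b that every tetrahedron it meets has b as a vertex.
    have hbS : b ∈ S := by
      refine TetMesh.mem_of_dist_lt H.quasi hh hσ (mem_tets hT) hb hS hpS (fun z hz => ?_) hpb'
      refine H.cover _ (hnearU _ (lt_of_le_of_lt ?_ hpb'))
      rw [segment_eq_image'] at hz
      obtain ⟨η, hη, rfl⟩ := hz
      rw [add_sub_cancel_left, norm_smul, Real.norm_eq_abs, abs_of_nonneg hη.1]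
      exact mul_le_of_le_one_left (norm_nonneg _) hη.2
    refine ⟨S, ?_, hpS⟩
    have hbS' := vertex_mem_hull hbS
    have hsegS := (convex_hull S).segment_subset hbS' hpS
    have hsegU : segment ℝ b (y + (θ * t) • (-D.nrm T)) ⊆ U := by
      intro z hz
      refine hnearU _ (lt_of_le_of_lt ?_ hpb')
      rw [segment_eq_image'] at hz
      obtain ⟨η, hη, rfl⟩ := hz
      rw [add_sub_cancel_left, norm_smul, Real.norm_eq_abs, abs_of_nonneg hη.1]
      exact mul_le_of_le_one_left (norm_nonneg _) hη.2
    obtain ⟨z, hz, hz0⟩ := (convex_segment (𝕜 := ℝ) b _).isPreconnected.intermediate_value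
      (left_mem_segment ℝ _ _) (right_mem_segment ℝ _ _) (H.cont.mono hsegU) ⟨hFb, hFp⟩
    exact active_of_mem hS (hsegS hz) ((H.zero_iff z (hsegU hz)).mp hz0)

/-- T lies above its plane up to μh, or below it, which is the former case for the opposite
orientation, or has points at distance μh on both sides. -/
theorem exists_normalBall (hR : 2 * σ * h ≤ R)
    (hE : C * (1 + 2 * σ + 4 * σ ^ 2) * h < 1 / (128 * σ ^ 3)) {T : Finset E3}
    (hT : T ∈ D.active) : ∃ y₀, D.NormalBall T h σ y₀ := by
  by_cases h1 : ∀ z ∈ hull T, -(1 / (128 * σ ^ 3) * h) < D.plane T z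
  · exact H.normalBall_of_above hR hE hT h1
  by_cases h2 : ∀ z ∈ hull T, D.plane T z < 1 / (128 * σ ^ 3) * h
  · obtain ⟨y₀, hy⟩ := H.neg.normalBall_of_above hR hE (T := T) hT fun z hz => by
      rw [D.plane_neg]; linarith [h2 z hz]
    exact ⟨y₀, normalBall_neg hy⟩
  · push Not at h1 h2
    obtain ⟨q, hq, hq1⟩ := h1
    obtain ⟨q', hq', hq2⟩ := h2
    exact H.normalBall_of_crossing hR hE hT hq hq' hq1 hq2

/-- The normals of neighbouring tetrahedra differ by `O(h)`. -/
theorem norm_nrm_sub_le (hR : 4 * σ * h ≤ R) {S T : Finset E3} (hS : S ∈ D.active)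
    (hT : T ∈ D.active) {x y : E3} (hx : x ∈ hull T ∩ D.surf) (hy : y ∈ hull S ∩ D.surf)
    (hxy : ‖y - x‖ ≤ 3 * σ * h) :
    ‖D.nrm T - D.nrm S‖ ≤ C * (3 + 2 * (1 + 4 * σ + 16 * σ ^ 2)) * h := by
  have hh := H.h_pos
  have hσ := H.σ_pos
  have hC := H.C_nonneg
  have hσ1 := H.one_le hT
  have hhσ : h ≤ σ * h := by nlinarith
  rcases eq_or_ne (D.nrm T - D.nrm S) 0 with h0 | h0
  · rw [h0, norm_zero]; positivity
  set d := D.nrm T - D.nrm S with hd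
  have hdpos := norm_pos_iff.mpr h0
  -- A displacement of length h along the difference of the normals. F(y+w) - F(y) is given up to
  -- O(h²) by either normal, so h‖d‖ = O(h²).
  set w := (h / ‖d‖) • d with hw
  have hwn : ‖w‖ = h := by
    rw [hw, norm_smul, Real.norm_eq_abs, abs_of_pos (by positivity)]; field_simp
  have bound : ∀ z : E3, ‖z - x‖ ≤ 4 * σ * h →
      |F z - inner ℝ (D.nrm T) (z - x)| ≤ C * (1 + 4 * σ + 16 * σ ^ 2) * h * h := by
    intro z hz
    refine (H.expansion T hT x hx z (by
      rw [Metric.mem_closedBall, dist_eq_norm]; exact hz.trans hR)).trans ?_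
    have h3 : ‖z - x‖ ^ 2 ≤ (4 * σ * h) ^ 2 := by gcongr
    have h4 : h * ‖z - x‖ ≤ h * (4 * σ * h) := by gcongr
    have h5 : h ^ 2 + h * ‖z - x‖ + ‖z - x‖ ^ 2 ≤ (1 + 4 * σ + 16 * σ ^ 2) * h * h := by nlinarith
    calc _ ≤ C * ((1 + 4 * σ + 16 * σ ^ 2) * h * h) := by gcongr
      _ = _ := by ring
  have e1 := bound y (by nlinarith)
  have e2 := bound (y + w) (by
    have : y + w - x = (y - x) + w := by abel
    rw [this]
    refine (norm_add_le _ _).trans ?_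
    rw [hwn]; linarith)
  have e3 := H.expansion S hS y hy (y + w) (by
    rw [Metric.mem_closedBall, dist_eq_norm, add_sub_cancel_left, hwn]; nlinarith)
  rw [add_sub_cancel_left, hwn] at e3
  rw [H.eq_zero_of_mem hy.2] at e1
  have e4 : inner ℝ (D.nrm T) (y + w - x) = inner ℝ (D.nrm T) (y - x) + inner ℝ (D.nrm T) w := by
    rw [← inner_add_right]; congr 1; abel
  rw [e4] at e2
  have e5 : inner ℝ (D.nrm T) w - inner ℝ (D.nrm S) w = h * ‖d‖ := by
    rw [← inner_sub_left, ← hd, hw, real_inner_smul_right, real_inner_self_eq_norm_sq]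
    field_simp
  have e6 : h * ‖d‖ ≤ C * (3 + 2 * (1 + 4 * σ + 16 * σ ^ 2)) * h * h := by
    rw [abs_le] at e1 e2 e3
    rw [← e5]
    nlinarith [e1.1, e1.2, e2.1, e2.2, e3.1, e3.2]
  nlinarith

end FineSurface

end NormalLines

/-! ### The stability of nodal values by surface values and normal gradients -/

section Poincare

/-- Near a suitable point of a ball an affine function is comparable to its maximum. -/
theorem exists_ball_le_abs_affine (g : E3 →ᵃ[ℝ] ℝ) (y₀ : E3) {s : ℝ} (hs : 0 < s) :
    ∃ y₁, Metric.ball y₁ (s / 4) ⊆ Metric.ball y₀ s ∧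
      ∀ y ∈ Metric.ball y₁ (s / 4), |g y₀| + ‖affGrad g‖ * (s / 4) ≤ |g y| := by
  rcases eq_or_ne (affGrad g) 0 with h0 | h0
  · refine ⟨y₀, Metric.ball_subset_ball (by linarith), fun y _ => ?_⟩
    rw [affine_eq g y₀ y, h0, norm_zero, inner_zero_left]
    simp
  have hpos := norm_pos_iff.mpr h0
  obtain ⟨θ, hθ, hθg⟩ : ∃ θ : ℝ, |θ| = 1 ∧ θ * g y₀ = |g y₀| := by
    rcases le_total 0 (g y₀) with h1 | h1
    · exact ⟨1, by simp, by rw [one_mul, abs_of_nonneg h1]⟩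
    · exact ⟨-1, by simp, by rw [neg_one_mul, abs_of_nonpos h1]⟩
  have hθ2 : θ * θ = 1 := by rw [← abs_mul_abs_self, hθ, one_mul]
  set w := (s / 2 / ‖affGrad g‖) • affGrad g with hw
  have hwn : ‖w‖ = s / 2 := by
    rw [hw, norm_smul, Real.norm_eq_abs, abs_of_pos (by positivity)]; field_simp
  have hgw : inner ℝ (affGrad g) w = ‖affGrad g‖ * (s / 2) := by
    rw [hw, real_inner_smul_right, real_inner_self_eq_norm_sq]; field_simp
  -- Moving by s/2 in the direction of growth of |g| gains ‖∇g‖s/2; a ball of radius s/4 about the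
  -- new centre loses at most half of it.
  refine ⟨y₀ + θ • w, fun y hy => ?_, fun y hy => ?_⟩
  · rw [Metric.mem_ball, dist_eq_norm] at hy ⊢
    have e : y - y₀ = (y - (y₀ + θ • w)) + θ • w := by abel
    rw [e]
    refine (norm_add_le _ _).trans_lt ?_
    rw [norm_smul, Real.norm_eq_abs, hθ, hwn]; linarith
  · rw [Metric.mem_ball, dist_eq_norm] at hy
    have e : y - y₀ = (y - (y₀ + θ • w)) + θ • w := by abel
    have h1 : g y = g y₀ + θ * (‖affGrad g‖ * (s / 2)) +
        inner ℝ (affGrad g) (y - (y₀ + θ • w)) := by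
      rw [affine_eq g y₀ y, e, inner_add_right, real_inner_smul_right, hgw]; ring
    have h2 : |inner ℝ (affGrad g) (y - (y₀ + θ • w))| ≤ ‖affGrad g‖ * (s / 4) :=
      (abs_real_inner_le_norm _ _).trans (by gcongr)
    have h3 : |θ * g y| = |g y| := by rw [abs_mul, hθ, one_mul]
    have h4 : θ * g y = |g y₀| + ‖affGrad g‖ * (s / 2) +
        θ * inner ℝ (affGrad g) (y - (y₀ + θ • w)) := by
      rw [h1, ← hθg]
      linear_combination (‖affGrad g‖ * (s / 2)) * hθ2
    have h5 : |θ * inner ℝ (affGrad g) (y - (y₀ + θ • w))| ≤ ‖affGrad g‖ * (s / 4) := by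
      rw [abs_mul, hθ, one_mul]; exact h2
    rw [← h3]
    refine le_trans ?_ (le_abs_self _)
    rw [h4]
    linarith [(abs_le.mp h5).1]

/-- Functions that are affine on the active tetrahedra. -/
def CutData.IsPL (D : CutData) (v : E3 → ℝ) : Prop :=
  ∀ S ∈ D.active, ∀ x ∈ hull S, v x = interp S v x

open Classical in
/-- The active tetrahedra at distance `R h` from `x`. -/
noncomputable def CutData.near (D : CutData) (r : ℝ) (x : E3) : Finset (Finset E3) :=
  D.active.filter fun S => (hull S ∩ Metric.closedBall x r).Nonempty

theorem CutData.mem_near {D : CutData} {r : ℝ} {x : E3} {S : Finset E3} :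
    S ∈ D.near r x ↔ S ∈ D.active ∧ (hull S ∩ Metric.closedBall x r).Nonempty := by
  classical
  simp [near]

/-- The squared normal derivative of `v` on `S`. -/
noncomputable def CutData.normalSq (D : CutData) (v : E3 → ℝ) (S : Finset E3) : ℝ :=
  inner ℝ (D.nrm S) (elemGrad S v) ^ 2

namespace CellData

variable {D : CutData} {K : Set E3} {I : Finset E3} (Hc : CellData D K I)
  {F : E3 → ℝ} {U : Set E3} {h σ C R : ℝ} (H : FineSurface D F U h σ C R)
include Hc H

theorem integrableOn {f : E3 → ℝ} (hf : ContinuousOn f (closure K)) :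
    IntegrableOn f K (μHE[2] : Measure E3) := by
  obtain ⟨M, hM⟩ := Hc.isCompact_closure.exists_bound_of_continuousOn hf
  have hlt := Hc.area_lt_top H
  have : IsFiniteMeasure ((μHE[2] : Measure E3).restrict K) :=
    ⟨by rwa [Measure.restrict_apply_univ]⟩
  refine Integrable.of_bound ((hf.mono subset_closure).aestronglyMeasurable Hc.measurableSet) M ?_
  filter_upwards [ae_restrict_mem Hc.measurableSet] with x hx using hM x (subset_closure hx)

end CellData

namespace FineSurface

variable {D : CutData} {F : E3 → ℝ} {U : Set E3} {h σ C R : ℝ} (H : FineSurface D F U h σ C R)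
include H

/-- A cell is determined by its tetrahedron and the index set I, a subset of the vertices. -/
theorem card_cells_le (T : Finset E3) :
    open Classical in (D.cells.filter fun K => D.tetOf K = T).card ≤ 2 ^ T.card := by
  classical
  have hex : ∀ K ∈ D.cells, ∃ I, CellData D K I := fun K hK => H.exists_cellData hK
  choose! I hI using hex
  rw [← Finset.card_powerset]
  refine Finset.card_le_card_of_injOn I (fun K hK => ?_) fun K hK K' hK' hKK => ?_
  · obtain ⟨h1, h2⟩ := Finset.mem_filter.mp hK
    rw [Finset.mem_coe, Finset.mem_powerset, ← h2]
    exact (hI K h1).sub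
  · obtain ⟨h1, h2⟩ := Finset.mem_filter.mp (Finset.mem_coe.mp hK)
    obtain ⟨h1', h2'⟩ := Finset.mem_filter.mp (Finset.mem_coe.mp hK')
    rw [(hI K h1).eq, (hI K' h1').eq, h2, h2', hKK]

theorem card_cells_tet_le {T : Finset E3} (hT : T ∈ D.active) :
    open Classical in ((D.cells.filter fun K => D.tetOf K = T).card : ℝ) ≤ 16 := by
  classical
  have := H.card_cells_le T
  rw [(isTet hT).card_eq] at this
  calc _ ≤ ((2 ^ 4 : ℕ) : ℝ) := by exact_mod_cast this
    _ = 16 := by norm_num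

/-- Exchange the sums: each S is near boundedly many T, by packing around a point of S. -/
theorem sum_near_le {r : ℝ} (hr : 0 ≤ r) (X : Finset E3 → E3)
    (hX : ∀ T ∈ D.active, X T ∈ hull T) {Q : Finset E3 → ℝ} (hQ : ∀ S ∈ D.active, 0 ≤ Q S) :
    ∑ T ∈ D.active, ∑ S ∈ D.near (r * h) (X T), Q S ≤
      ((r + σ + σ + 1) * σ) ^ 3 * ∑ S ∈ D.active, Q S := by
  classical
  have hh := H.h_pos
  have hσ := H.σ_pos
  have e : ∀ T ∈ D.active, ∑ S ∈ D.near (r * h) (X T), Q S =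
      ∑ S ∈ D.active, if (hull S ∩ Metric.closedBall (X T) (r * h)).Nonempty then Q S else 0 := by
    intro T _
    rw [CutData.near, Finset.sum_filter]
  rw [Finset.sum_congr rfl e, Finset.sum_comm, Finset.mul_sum]
  refine Finset.sum_le_sum fun S hS => ?_
  rw [← Finset.sum_filter, Finset.sum_const, nsmul_eq_mul]
  refine mul_le_mul_of_nonneg_right ?_ (hQ S hS)
  obtain ⟨p, hp, -⟩ := (D.mem_active.mp hS).2
  refine TetMesh.card_near_le H.quasi hh hσ (R := r + σ) (by positivity) p _ (fun T hT =>
    mem_tets (Finset.mem_filter.mp hT).1) fun T hT => ?_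
  obtain ⟨hTa, z, hz, hzb⟩ := Finset.mem_filter.mp hT
  refine ⟨X T, hX T hTa, ?_⟩
  rw [Metric.mem_closedBall] at hzb ⊢
  have h1 := TetMesh.dist_le_of_mem_hull H.quasi (mem_tets hS) hz hp
  have h2 := dist_triangle (X T) z p
  rw [dist_comm (X T) z] at h2
  linarith

/-- The values of `v` on a normal segment. -/
theorem abs_sub_le_normal (hR : 4 * σ * h ≤ R) {v : E3 → ℝ} (hv : D.IsPL v)
    {T : Finset E3} (hT : T ∈ D.active) {x : E3} (hx : x ∈ hull T ∩ D.surf) {y : E3}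
    (hy : y ∈ hull T) {t : ℝ} (ht : |t| ≤ σ * h)
    (hseg : ∀ p ∈ segment ℝ y (y + t • D.nrm T), ∃ S ∈ D.active, p ∈ hull S) :
    |v (y + t • D.nrm T) - v y| ≤
      (∑ S ∈ D.near (2 * σ * h) x, (|inner ℝ (D.nrm S) (elemGrad S v)| +
        C * (3 + 2 * (1 + 4 * σ + 16 * σ ^ 2)) * h * ‖elemGrad S v‖)) * (σ * h) := by
  have hh := H.h_pos
  have hσ := H.σ_pos
  have hC := H.C_nonneg
  have hm := H.norm_nrm T hT
  obtain ⟨w, hw, hws⟩ : ∃ w : E3, t • D.nrm T = |t| • w ∧ (w = D.nrm T ∨ w = -D.nrm T) := by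
    rcases le_total 0 t with h1 | h1
    · exact ⟨D.nrm T, by rw [abs_of_nonneg h1], Or.inl rfl⟩
    · exact ⟨-D.nrm T, by rw [abs_of_nonpos h1, smul_neg, neg_smul, neg_neg], Or.inr rfl⟩
  rw [hw] at hseg ⊢
  set C₁ := C * (3 + 2 * (1 + 4 * σ + 16 * σ ^ 2)) with hC₁
  have hC₁0 : 0 ≤ C₁ := by positivity
  have hwn : ‖w‖ = 1 := by rcases hws with rfl | rfl <;> simp [hm]
  have hnorm : ∀ S ∈ D.near (2 * σ * h) x, ‖D.nrm T - D.nrm S‖ ≤ C₁ * h := by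
    intro S hS
    obtain ⟨hSa, z, hz, hzb⟩ := CutData.mem_near.mp hS
    obtain ⟨q, hq⟩ := (D.mem_active.mp hSa).2
    refine H.norm_nrm_sub_le hR hSa hT hx hq ?_
    rw [Metric.mem_closedBall] at hzb
    have h1 := TetMesh.dist_le_of_mem_hull H.quasi (mem_tets hSa) hq.1 hz
    have h2 := dist_triangle q z x
    rw [← dist_eq_norm]; linarith
  have hterm : ∀ S ∈ D.near (2 * σ * h) x, |inner ℝ (elemGrad S v) w| ≤
      |inner ℝ (D.nrm S) (elemGrad S v)| + C₁ * h * ‖elemGrad S v‖ := by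
    intro S hS
    have h1 : |inner ℝ (elemGrad S v) w| = |inner ℝ (D.nrm T) (elemGrad S v)| := by
      rcases hws with rfl | rfl
      · rw [real_inner_comm]
      · rw [inner_neg_right, abs_neg, real_inner_comm]
    have h2 : inner ℝ (D.nrm T) (elemGrad S v) = inner ℝ (D.nrm S) (elemGrad S v) +
        inner ℝ (D.nrm T - D.nrm S) (elemGrad S v) := by rw [inner_sub_left]; ring
    rw [h1, h2]
    refine (abs_add_le _ _).trans ?_
    gcongr
    exact (abs_real_inner_le_norm _ _).trans (by gcongr; exact hnorm S hS)
  have hnn : ∀ S ∈ D.near (2 * σ * h) x, 0 ≤ |inner ℝ (D.nrm S) (elemGrad S v)| +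
      C₁ * h * ‖elemGrad S v‖ := fun S _ => by positivity
  refine (abs_sub_le_of_segment (D.near (2 * σ * h) x) (v := v) (g := fun S => interp S v) (w := w)
    (L := ∑ S ∈ D.near (2 * σ * h) x, (|inner ℝ (D.nrm S) (elemGrad S v)| +
        C₁ * h * ‖elemGrad S v‖)) (abs_nonneg t)
    (fun S hS p hp _ => hv S (CutData.mem_near.mp hS).1 p hp)
    (fun S hS => (hterm S hS).trans (Finset.single_le_sum hnn hS)) fun p hp => ?_).trans ?_
  · obtain ⟨S, hS, hpS⟩ := hseg p hp
    refine ⟨S, CutData.mem_near.mpr ⟨hS, p, hpS, ?_⟩, hpS⟩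
    rw [segment_eq_image'] at hp
    obtain ⟨θ, hθ, rfl⟩ := hp
    rw [Metric.mem_closedBall, dist_eq_norm, add_sub_cancel_left]
    have e : y + θ • |t| • w - x = (y - x) + θ • |t| • w := by abel
    rw [e]
    refine (norm_add_le _ _).trans ?_
    have h3 := H.norm_sub_le hT hx.1 hy
    have h4 : ‖θ • |t| • w‖ ≤ σ * h := by
      rw [norm_smul, norm_smul, hwn, mul_one, Real.norm_eq_abs, Real.norm_eq_abs, abs_abs,
        abs_of_nonneg hθ.1]
      exact (mul_le_of_le_one_left (abs_nonneg t) hθ.2).trans ht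
    linarith
  · exact mul_le_mul_of_nonneg_left ht (Finset.sum_nonneg hnn)

theorem card_near_le {r : ℝ} (hr : 0 ≤ r) (x : E3) :
    ((D.near (r * h) x).card : ℝ) ≤ ((r + σ + 1) * σ) ^ 3 :=
  TetMesh.card_near_le H.quasi H.h_pos H.σ_pos hr x _
    (fun _ hS => mem_tets (CutData.mem_near.mp hS).1) fun _ hS => (CutData.mem_near.mp hS).2

omit H in
theorem interp_sq_sum {T : Finset E3} (hT : IsTet T) (v : E3 → ℝ) :
    ∑ a ∈ T, interp T v a ^ 2 = ∑ a ∈ T, v a ^ 2 :=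
  Finset.sum_congr rfl fun a ha => by rw [hT.interp_vertex v ha]

theorem norm_elemGrad_sq_le {T : Finset E3} (hT : T ∈ D.active) (v : E3 → ℝ) :
    ‖elemGrad T v‖ ^ 2 ≤ 16 * σ ^ 2 / h ^ 2 * ∑ a ∈ T, v a ^ 2 := by
  rw [elemGrad_eq, ← interp_sq_sum (isTet hT)]
  exact TetMesh.norm_affGrad_sq_le H.quasi H.σ_pos H.h_pos (mem_tets hT) _

/-- The squared change along the segment, with Cauchy–Schwarz over the boundedly many tetrahedra on
its way. The vertex values on the right carry the factor h² and are absorbed later. -/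
theorem sq_le_normal (hR : 4 * σ * h ≤ R) {v : E3 → ℝ} (hv : D.IsPL v)
    {T : Finset E3} (hT : T ∈ D.active) {x : E3} (hx : x ∈ hull T ∩ D.surf) {y : E3}
    (hy : y ∈ hull T) {t : ℝ} (ht : |t| ≤ σ * h)
    (hseg : ∀ p ∈ segment ℝ y (y + t • D.nrm T), ∃ S ∈ D.active, p ∈ hull S) :
    v y ^ 2 ≤ 2 * v (y + t • D.nrm T) ^ 2 +
      2 * σ ^ 2 * ((2 * σ + σ + 1) * σ) ^ 3 *
        (2 + 32 * (C * (3 + 2 * (1 + 4 * σ + 16 * σ ^ 2))) ^ 2 * σ ^ 2) *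
      (h ^ 2 * ∑ S ∈ D.near (2 * σ * h) x, (D.normalSq v S + ∑ a ∈ S, v a ^ 2)) := by
  have hh := H.h_pos
  have hσ := H.σ_pos
  have h1 := H.abs_sub_le_normal hR hv hT hx hy ht hseg
  set C₁ := C * (3 + 2 * (1 + 4 * σ + 16 * σ ^ 2)) with hC₁
  set N := ((2 * σ + σ + 1) * σ) ^ 3 with hN
  set z := y + t • D.nrm T
  set A := D.near (2 * σ * h) x
  set L := ∑ S ∈ A, (|inner ℝ (D.nrm S) (elemGrad S v)| + C₁ * h * ‖elemGrad S v‖) with hL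
  have hcard : (A.card : ℝ) ≤ N := H.card_near_le (by positivity) x
  have hL2 : L ^ 2 ≤ N * ((2 + 32 * C₁ ^ 2 * σ ^ 2) *
      ∑ S ∈ A, (D.normalSq v S + ∑ a ∈ S, v a ^ 2)) := by
    refine sq_sum_le_card_mul_sum_sq.trans ?_
    refine mul_le_mul hcard ?_ (Finset.sum_nonneg fun S _ => sq_nonneg _) (by positivity)
    rw [Finset.mul_sum]
    refine Finset.sum_le_sum fun S hS => ?_
    have h2 := H.norm_elemGrad_sq_le (CutData.mem_near.mp hS).1 v
    set M := ∑ a ∈ S, v a ^ 2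
    have hM : 0 ≤ M := Finset.sum_nonneg fun a _ => sq_nonneg _
    have h3 : D.normalSq v S = |inner ℝ (D.nrm S) (elemGrad S v)| ^ 2 := (sq_abs _).symm
    rw [h3]
    set q := |inner ℝ (D.nrm S) (elemGrad S v)|
    -- The factor h from the difference of the normals cancels the h⁻¹ of the inverse estimate.
    have h4 : (C₁ * h * ‖elemGrad S v‖) ^ 2 ≤ 16 * C₁ ^ 2 * σ ^ 2 * M := by
      calc (C₁ * h * ‖elemGrad S v‖) ^ 2 = C₁ ^ 2 * h ^ 2 * ‖elemGrad S v‖ ^ 2 := by ring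
        _ ≤ C₁ ^ 2 * h ^ 2 * (16 * σ ^ 2 / h ^ 2 * M) := by gcongr
        _ = 16 * C₁ ^ 2 * σ ^ 2 * M := by field_simp
    have h5 := sq_nonneg (q - C₁ * h * ‖elemGrad S v‖)
    have h6 : 0 ≤ 32 * C₁ ^ 2 * σ ^ 2 * q ^ 2 := by positivity
    linarith
  have h7 : (v z - v y) ^ 2 ≤ L ^ 2 * (σ * h) ^ 2 := by
    rw [← mul_pow, ← sq_abs]
    exact pow_le_pow_left₀ (abs_nonneg _) h1 2
  have h8 : L ^ 2 * (σ * h) ^ 2 ≤ N * ((2 + 32 * C₁ ^ 2 * σ ^ 2) *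
      ∑ S ∈ A, (D.normalSq v S + ∑ a ∈ S, v a ^ 2)) * (σ * h) ^ 2 := by gcongr
  have h9 := sq_nonneg (v z + (v z - v y))
  calc v y ^ 2 ≤ 2 * v z ^ 2 + 2 * (v z - v y) ^ 2 := by linarith
    _ ≤ 2 * v z ^ 2 + 2 * (N * ((2 + 32 * C₁ ^ 2 * σ ^ 2) *
      ∑ S ∈ A, (D.normalSq v S + ∑ a ∈ S, v a ^ 2)) * (σ * h) ^ 2) := by linarith
    _ = _ := by ring

end FineSurface

/-- The nodal values on one tetrahedron are controlled by nearby surface values, up to normal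
derivatives and terms of higher order. -/
theorem exists_local_nodal_bound (σ C : ℝ) (hσ : 0 < σ) : ∃ Cl : ℝ, 0 < Cl ∧
    ∀ (D : CutData) (F : E3 → ℝ) (U : Set E3) (h R : ℝ), FineSurface D F U h σ C R →
      4 * σ * h ≤ R → C * (1 + 2 * σ + 4 * σ ^ 2) * h < 1 / (128 * σ ^ 3) →
      ∀ v, D.IsPL v → ∀ T ∈ D.active, ∀ x ∈ hull T ∩ D.surf,
      h ^ 2 * ∑ a ∈ T, v a ^ 2 ≤ Cl * ∑ S ∈ D.near (2 * σ * h) x,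
        (∑ K ∈ D.cells with D.tetOf K = S, ∫ z in K, v z ^ 2 ∂μHE[2] +
          h ^ 4 * (D.normalSq v S + ∑ a ∈ S, v a ^ 2)) := by
  classical
  set N := ((2 * σ + σ + 1) * σ) ^ 3 with hN
  set B := 2 * σ ^ 2 * N * (2 + 32 * (C * (3 + 2 * (1 + 4 * σ + 16 * σ ^ 2))) ^ 2 * σ ^ 2) with hB
  set A := 4 * (512 * σ ^ 6) ^ 2 with hA
  set κ := volume.real (Metric.ball (0 : E2) 1) with hκ
  have hκ0 : 0 < κ := by
    rw [hκ, measureReal_def]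
    exact ENNReal.toReal_pos (Metric.measure_ball_pos volume _ one_pos).ne' measure_ball_lt_top.ne
  have hB0 : 0 < B := by positivity
  have hA0 : 0 < A := by positivity
  refine ⟨(512 * σ ^ 5) ^ 2 / κ * (2 * A + A * B * (16 * N) * ((2 * σ) ^ 2 * κ)), by positivity,
    fun D F U h R H hR hE v hv T hT x hx => ?_⟩
  have hh := H.h_pos
  have hσ1 := H.one_le hT
  have hσh : 0 < σ * h := by positivity
  set M := ∑ a ∈ T, v a ^ 2 with hM
  have hM0 : 0 ≤ M := Finset.sum_nonneg fun a _ => sq_nonneg _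
  set near := D.near (2 * σ * h) x with hnear
  set q := ∑ S ∈ near, (D.normalSq v S + ∑ a ∈ S, v a ^ 2) with hq
  have hq0 : 0 ≤ q := Finset.sum_nonneg fun S _ =>
    add_nonneg (sq_nonneg _) (Finset.sum_nonneg fun a _ => sq_nonneg _)
  obtain ⟨y₀, hball, hproj⟩ := H.exists_normalBall (by linarith) hE hT
  set s := h / (128 * σ ^ 5) with hs
  have hs0 : 0 < s := by positivity
  obtain ⟨y₁, hsub, hy₁⟩ := exists_ball_le_abs_affine (interp T v) y₀ hs0
  have hy₀T : y₀ ∈ hull T := hball (Metric.mem_ball_self hs0)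
  -- On the smaller ball |v| is at least |v(y₀)| + ‖∇v‖s/4, and the vertex values on T are bounded
  -- by |v(y₀)| + ‖∇v‖σh; since s = h/(128σ⁵), the ratio σh/(s/4) is 512σ⁶.
  have hMle : ∀ y ∈ Metric.ball y₁ (s / 4), M ≤ A * v y ^ 2 := by
    intro y hy
    have hyT := hball (hsub hy)
    have h1 := hy₁ y hy
    rw [← hv T hT y hyT] at h1
    have h2 : ∀ a ∈ T, v a ^ 2 ≤ (512 * σ ^ 6) ^ 2 * v y ^ 2 := by
      intro a ha
      rw [← mul_pow, ← sq_abs (v a), ← sq_abs (512 * σ ^ 6 * v y)]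
      refine pow_le_pow_left₀ (abs_nonneg _) ?_ 2
      rw [abs_mul, abs_of_pos (show 0 < 512 * σ ^ 6 by positivity)]
      have h3 := affine_sub (interp T v) y₀ a
      rw [(FineSurface.isTet hT).interp_vertex v ha] at h3
      have h4 : |v a - interp T v y₀| ≤ ‖affGrad (interp T v)‖ * (σ * h) := by
        rw [h3]
        exact (abs_real_inner_le_norm _ _).trans
          (by gcongr; exact H.norm_sub_le hT hy₀T (vertex_mem_hull ha))
      have h5 : |v a| ≤ |interp T v y₀| + ‖affGrad (interp T v)‖ * (σ * h) := by
        have := abs_add_le (interp T v y₀) (v a - interp T v y₀)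
        rw [add_sub_cancel] at this
        linarith
      have h6 : ‖affGrad (interp T v)‖ * (σ * h) =
          512 * σ ^ 6 * (‖affGrad (interp T v)‖ * (s / 4)) := by
        rw [hs]; field_simp; ring
      have h7 : |interp T v y₀| ≤ 512 * σ ^ 6 * |interp T v y₀| := by
        refine le_mul_of_one_le_left (abs_nonneg _) ?_
        have : 1 ≤ σ ^ 6 := one_le_pow₀ hσ1
        linarith
      calc |v a| ≤ 512 * σ ^ 6 * (|interp T v y₀| + ‖affGrad (interp T v)‖ * (s / 4)) := by
            rw [mul_add]; linarith
        _ ≤ _ := by gcongr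
    calc M ≤ ∑ a ∈ T, (512 * σ ^ 6) ^ 2 * v y ^ 2 := Finset.sum_le_sum h2
      _ = A * v y ^ 2 := by rw [Finset.sum_const, (FineSurface.isTet hT).card_eq, nsmul_eq_mul, hA]; push_cast; ring
  -- Z contains the end points of all normal segments from the small ball, hence has at least the
  -- area of its projected disc. Passing to a set defined by an inequality avoids measurability
  -- questions for the end points.
  set Z := {z | z ∈ D.surf ∧ z ∈ Metric.closedBall x (2 * σ * h) ∧
    M ≤ A * (2 * v z ^ 2 + B * (h ^ 2 * q))} with hZ
  have harea := area_ge_of_projection (H.norm_nrm T hT) (x := y₁) (r := s / 4) (s := Z) (by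
    intro y hy
    obtain ⟨t, h1, h2, h3⟩ := hproj y (hsub hy)
    have hyT := hball (hsub hy)
    refine ⟨t, h2, ?_, ?_⟩
    · rw [Metric.mem_closedBall, dist_eq_norm]
      have e : y + t • D.nrm T - x = (y - x) + t • D.nrm T := by abel
      rw [e]
      refine (norm_add_le _ _).trans ?_
      have := H.norm_sub_le hT hx.1 hyT
      rw [norm_smul, H.norm_nrm T hT, mul_one, Real.norm_eq_abs]
      linarith
    · refine (hMle y hy).trans ?_
      gcongr
      exact H.sq_le_normal hR hv hT hx hyT h1 h3)
  set cs := D.cells.filter (fun K => D.tetOf K ∈ near) with hcs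
  have hZsub : Z ⊆ (⋃ K ∈ cs, K ∩ Z) ∪ (D.surf \ ⋃ K ∈ D.cells, K) := by
    intro z hz
    by_cases hzK : z ∈ ⋃ K ∈ D.cells, K
    · left
      simp only [mem_iUnion] at hzK ⊢
      obtain ⟨K, hK, hzK⟩ := hzK
      obtain ⟨I, Hc⟩ := H.exists_cellData hK
      exact ⟨K, Finset.mem_filter.mpr ⟨hK, CutData.mem_near.mpr
        ⟨Hc.mem, z, Hc.subset_hull hzK, hz.2.1⟩⟩, hzK, hz⟩
    · exact Or.inr ⟨hz.1, hzK⟩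
  have hcell : ∀ K ∈ cs, μHE[2] (K ∩ Z) ≠ ⊤ ∧ M * (μHE[2] : Measure E3).real (K ∩ Z) ≤
      A * (2 * ∫ z in K, v z ^ 2 ∂μHE[2]) + A * B * ((2 * σ) ^ 2 * κ) * (h ^ 4 * q) := by
    intro K hK
    obtain ⟨I, Hc⟩ := H.exists_cellData (Finset.mem_filter.mp hK).1
    have hKtop := Hc.area_lt_top H
    refine ⟨((measure_mono inter_subset_left).trans_lt hKtop).ne, ?_⟩
    set g := interp (D.tetOf K) v with hg
    have hgc := affine_continuous g
    have hvg : ∀ z ∈ K, v z = g z := fun z hz => hv _ Hc.mem z (Hc.subset_hull hz)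
    have hint : IntegrableOn (fun z => A * (2 * g z ^ 2 + B * (h ^ 2 * q))) K
        (μHE[2] : Measure E3) := Hc.integrableOn H (by fun_prop)
    have hmeas : MeasurableSet {z | M ≤ A * (2 * g z ^ 2 + B * (h ^ 2 * q))} :=
      (isClosed_le continuous_const (by fun_prop)).measurableSet
    -- Markov's inequality on each cell turns the pointwise bound on Z into M times area bounded by
    -- an integral.
    have h1 := mul_meas_ge_le_integral_of_nonneg (μ := (μHE[2] : Measure E3).restrict K)
      (f := fun z => A * (2 * g z ^ 2 + B * (h ^ 2 * q)))
      (Filter.Eventually.of_forall fun z => by simp only [Pi.zero_apply]; positivity) hint M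
    rw [measureReal_restrict_apply hmeas] at h1
    have h2 : (μHE[2] : Measure E3).real (K ∩ Z) ≤
        (μHE[2] : Measure E3).real ({z | M ≤ A * (2 * g z ^ 2 + B * (h ^ 2 * q))} ∩ K) := by
      refine measureReal_mono (fun z hz => ⟨?_, hz.1⟩)
        ((measure_mono inter_subset_right).trans_lt hKtop).ne
      rw [mem_ofPred_eq, ← hvg z hz.1]
      exact hz.2.2.2
    refine (mul_le_mul_of_nonneg_left h2 hM0).trans (h1.trans ?_)
    have hi1 : IntegrableOn (fun z => g z ^ 2) K (μHE[2] : Measure E3) :=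
      Hc.integrableOn H (by fun_prop)
    have h3 : ∫ z in K, A * (2 * g z ^ 2 + B * (h ^ 2 * q)) ∂μHE[2] =
        A * (2 * ∫ z in K, v z ^ 2 ∂μHE[2]) +
          A * (B * (h ^ 2 * q)) * (μHE[2] : Measure E3).real K := by
      have h5 : ∫ z in K, v z ^ 2 ∂μHE[2] = ∫ z in K, g z ^ 2 ∂μHE[2] :=
        setIntegral_congr_fun Hc.measurableSet fun z hz => by simp only [hvg z hz]
      rw [h5, integral_const_mul, integral_add (hi1.const_mul 2)
        (integrableOn_const hKtop.ne), integral_const_mul, setIntegral_const, smul_eq_mul]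
      ring
    rw [h3]
    have h4 := Hc.area_le H
    have h5 : A * (B * (h ^ 2 * q)) * (μHE[2] : Measure E3).real K ≤
        A * (B * (h ^ 2 * q)) * ((2 * σ * h) ^ 2 * κ) := by gcongr
    refine add_le_add le_rfl (h5.trans (le_of_eq ?_))
    ring
  have hZle : (s / 4) ^ 2 * κ ≤ ∑ K ∈ cs, (μHE[2] : Measure E3).real (K ∩ Z) := by
    rw [← volume_ball_E2 0 (by positivity)]
    refine ENNReal.toReal_le_of_le_ofReal (Finset.sum_nonneg fun K _ => measureReal_nonneg) ?_
    refine harea.trans ((measure_mono hZsub).trans ((measure_union_le _ _).trans ?_))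
    rw [H.area_diff_cells, add_zero, ENNReal.ofReal_sum_of_nonneg fun K _ => measureReal_nonneg]
    refine (measure_biUnion_finset_le cs _).trans (Finset.sum_le_sum fun K hK => ?_)
    rw [measureReal_def, ENNReal.ofReal_toReal (hcell K hK).1]
  have hfib : ∀ f : Set E3 → ℝ, ∑ K ∈ cs, f K =
      ∑ S ∈ near, ∑ K ∈ D.cells with D.tetOf K = S, f K := by
    intro f
    rw [← Finset.sum_fiberwise_of_maps_to (s := cs) (t := near) (g := D.tetOf)
      (fun K hK => (Finset.mem_filter.mp hK).2)]
    refine Finset.sum_congr rfl fun S hS => Finset.sum_congr ?_ fun _ _ => rfl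
    ext K
    simp only [hcs, Finset.mem_filter]
    exact ⟨fun h => ⟨h.1.1, h.2⟩, fun h => ⟨⟨h.1, h.2 ▸ hS⟩, h.2⟩⟩
  -- Only cells near x matter, at most 16 in each of at most N tetrahedra, so the remainder is added
  -- boundedly often.
  have hcard : (cs.card : ℝ) ≤ 16 * N := by
    have h1 := hfib fun _ => 1
    rw [Finset.sum_const, nsmul_eq_mul, mul_one] at h1
    rw [h1]
    calc _ ≤ ∑ S ∈ near, (16 : ℝ) := Finset.sum_le_sum fun S hS => by
          rw [Finset.sum_const, nsmul_eq_mul, mul_one]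
          exact H.card_cells_tet_le (CutData.mem_near.mp hS).1
      _ = near.card * 16 := by rw [Finset.sum_const, nsmul_eq_mul]
      _ ≤ 16 * N := by
          rw [mul_comm]
          gcongr
          exact H.card_near_le (by positivity) x
  set V := ∑ K ∈ cs, ∫ z in K, v z ^ 2 ∂μHE[2] with hV
  have hV0 : 0 ≤ V := Finset.sum_nonneg fun K _ => integral_nonneg fun z => sq_nonneg _
  have hmain : M * ((s / 4) ^ 2 * κ) ≤
      A * (2 * V) + 16 * N * (A * B * ((2 * σ) ^ 2 * κ) * (h ^ 4 * q)) := by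
    calc M * ((s / 4) ^ 2 * κ) ≤ M * ∑ K ∈ cs, (μHE[2] : Measure E3).real (K ∩ Z) := by gcongr
      _ ≤ ∑ K ∈ cs, (A * (2 * ∫ z in K, v z ^ 2 ∂μHE[2]) +
          A * B * ((2 * σ) ^ 2 * κ) * (h ^ 4 * q)) := by
          rw [Finset.mul_sum]
          exact Finset.sum_le_sum fun K hK => (hcell K hK).2
      _ = A * (2 * V) + cs.card * (A * B * ((2 * σ) ^ 2 * κ) * (h ^ 4 * q)) := by
          rw [Finset.sum_add_distrib, ← Finset.mul_sum, ← Finset.mul_sum, Finset.sum_const,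
            nsmul_eq_mul]
      _ ≤ _ := by gcongr
  have hrhs : ∑ S ∈ near, (∑ K ∈ D.cells with D.tetOf K = S, ∫ z in K, v z ^ 2 ∂μHE[2] +
          h ^ 4 * (D.normalSq v S + ∑ a ∈ S, v a ^ 2)) = V + h ^ 4 * q := by
    rw [Finset.sum_add_distrib, ← hfib, ← Finset.mul_sum]
  rw [hrhs]
  have hsκ : h ^ 2 * M = (512 * σ ^ 5) ^ 2 / κ * (M * ((s / 4) ^ 2 * κ)) := by
    rw [hs]; field_simp; ring
  rw [hsκ, mul_assoc]
  refine mul_le_mul_of_nonneg_left (hmain.trans ?_) (by positivity)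
  have e1 : 0 ≤ A * (h ^ 4 * q) := by positivity
  have e2 : 0 ≤ A * B * (16 * N) * ((2 * σ) ^ 2 * κ) * V := by positivity
  linarith

/-- The nodal values are controlled by the surface values and the normal derivatives. -/
theorem exists_nodal_bound (σ C : ℝ) (hσ : 0 < σ) : ∃ Cp hs : ℝ, 0 < Cp ∧ 0 < hs ∧
    ∀ (D : CutData) (F : E3 → ℝ) (U : Set E3) (h R : ℝ), FineSurface D F U h σ C R →
      4 * σ * h ≤ R → h ≤ hs → ∀ v, D.IsPL v →
      h ^ 2 * ∑ T ∈ D.active, ∑ a ∈ T, v a ^ 2 ≤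
        Cp * (∑ K ∈ D.cells, ∫ z in K, v z ^ 2 ∂μHE[2] + h ^ 4 * ∑ T ∈ D.active, D.normalSq v T) := by
  classical
  obtain ⟨Cl, hCl, hloc⟩ := exists_local_nodal_bound σ C hσ
  set N := ((2 * σ + σ + σ + 1) * σ) ^ 3 with hN
  set E := |C| * (1 + 2 * σ + 4 * σ ^ 2) + 1 with hE
  have hE0 : 0 < E := by positivity
  have hN0 : 0 < N := by positivity
  -- The first bound on h makes |F - plane| small enough for `exists_normalBall`; the other two
  -- allow the absorption of the h⁴M term.
  refine ⟨2 * (Cl * N), min (1 / (256 * σ ^ 3) / E) (min 1 (1 / (2 * (Cl * N)))), by positivity,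
    by positivity, fun D F U h R H hR hs v hv => ?_⟩
  have hh := H.h_pos
  have hs1 : h ≤ 1 / (256 * σ ^ 3) / E := hs.trans (min_le_left _ _)
  have hs2 : h ≤ 1 := hs.trans ((min_le_right _ _).trans (min_le_left _ _))
  have hs3 : h ≤ 1 / (2 * (Cl * N)) := hs.trans ((min_le_right _ _).trans (min_le_right _ _))
  rw [le_div_iff₀ hE0] at hs1
  rw [le_div_iff₀ (by positivity)] at hs3
  have hEh : C * (1 + 2 * σ + 4 * σ ^ 2) * h < 1 / (128 * σ ^ 3) := by
    have h1 : C * (1 + 2 * σ + 4 * σ ^ 2) ≤ E := by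
      have : C * (1 + 2 * σ + 4 * σ ^ 2) ≤ |C| * (1 + 2 * σ + 4 * σ ^ 2) := by
        gcongr; exact le_abs_self C
      linarith
    have h2 : 1 / (256 * σ ^ 3) < 1 / (128 * σ ^ 3) := by
      rw [div_lt_div_iff_of_pos_left one_pos (by positivity) (by positivity)]
      nlinarith [pow_pos hσ 3]
    nlinarith
  have hex : ∀ T ∈ D.active, ∃ x, x ∈ hull T ∩ D.surf := fun T hT => (D.mem_active.mp hT).2
  choose! X hX using hex
  set Q : Finset E3 → ℝ := fun S => ∑ K ∈ D.cells with D.tetOf K = S, ∫ z in K, v z ^ 2 ∂μHE[2] +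
          h ^ 4 * (D.normalSq v S + ∑ a ∈ S, v a ^ 2) with hQ
  have hQ0 : ∀ S ∈ D.active, 0 ≤ Q S := fun S _ => add_nonneg
    (Finset.sum_nonneg fun K _ => integral_nonneg fun z => sq_nonneg _)
    (mul_nonneg (by positivity) (add_nonneg (sq_nonneg _) (Finset.sum_nonneg fun a _ => sq_nonneg _)))
  have h1 : h ^ 2 * ∑ T ∈ D.active, ∑ a ∈ T, v a ^ 2 ≤ Cl * (N * ∑ S ∈ D.active, Q S) := by
    rw [Finset.mul_sum]
    refine (Finset.sum_le_sum fun T hT => hloc D F U h R H hR hEh v hv T hT (X T) (hX T hT)).trans ?_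
    rw [← Finset.mul_sum]
    exact mul_le_mul_of_nonneg_left (H.sum_near_le (r := 2 * σ) (by positivity) X
      (fun T hT => (hX T hT).1) hQ0) hCl.le
  have h2 : ∑ S ∈ D.active, Q S = ∑ K ∈ D.cells, ∫ z in K, v z ^ 2 ∂μHE[2] +
      h ^ 4 * (∑ T ∈ D.active, D.normalSq v T + ∑ T ∈ D.active, ∑ a ∈ T, v a ^ 2) := by
    rw [hQ, Finset.sum_add_distrib, ← Finset.mul_sum, ← Finset.sum_add_distrib,
      Finset.sum_fiberwise_of_maps_to (fun K hK => (H.exists_cellData hK).choose_spec.mem)]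
  rw [h2] at h1
  set M := ∑ T ∈ D.active, ∑ a ∈ T, v a ^ 2
  have hM0 : 0 ≤ M := Finset.sum_nonneg fun T _ => Finset.sum_nonneg fun a _ => sq_nonneg _
  -- Absorption: the term h⁴M on the right is at most half of the left side h²M.
  have h3 : 2 * (Cl * N) * h ^ 2 ≤ 1 := by nlinarith [mul_pos hCl hN0]
  have h4 : 2 * (Cl * N * (h ^ 4 * M)) ≤ h ^ 2 * M := by
    calc 2 * (Cl * N * (h ^ 4 * M)) = (2 * (Cl * N) * h ^ 2) * (h ^ 2 * M) := by ring
      _ ≤ 1 * (h ^ 2 * M) := by gcongr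
      _ = _ := one_mul _
  linarith

end Poincare

/-! ### The divergence theorem on convex polygons in the plane -/

section PlanarPolygon

open Filter Topology

/-- A bounded polygon `⋂ i ∈ I, {a i s + b i t + c i ≥ 0}` with an interior point, together with
the endpoints of its edges, indexed by the set `J` of representatives. -/
structure PlanarPolygon {ι : Type*} (I J : Finset ι) (a b c : ι → ℝ) (p q : ι → ℝ × ℝ) : Prop where
  bounded : Bornology.IsBounded {z : ℝ × ℝ | ∀ i ∈ I, 0 ≤ a i * z.1 + b i * z.2 + c i}
  interior : ∃ z : ℝ × ℝ, ∀ i ∈ I, 0 < a i * z.1 + b i * z.2 + c i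
  sub : J ⊆ I
  ne : ∀ j ∈ J, p j ≠ q j
  edge : ∀ j ∈ J, {z : ℝ × ℝ | (∀ i ∈ I, 0 ≤ a i * z.1 + b i * z.2 + c i) ∧
    a j * z.1 + b j * z.2 + c j = 0} = segment ℝ (p j) (q j)
  inj : ∀ j ∈ J, ∀ k ∈ J, (∀ z : ℝ × ℝ, (∀ i ∈ I, 0 ≤ a i * z.1 + b i * z.2 + c i) →
    (a j * z.1 + b j * z.2 + c j = 0 ↔ a k * z.1 + b k * z.2 + c k = 0)) → j = k
  cover : ∀ k ∈ I, {z : ℝ × ℝ | (∀ i ∈ I, 0 ≤ a i * z.1 + b i * z.2 + c i) ∧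
    a k * z.1 + b k * z.2 + c k = 0}.Nontrivial → ∃ j ∈ J, ∀ z : ℝ × ℝ,
      (∀ i ∈ I, 0 ≤ a i * z.1 + b i * z.2 + c i) →
      (a j * z.1 + b j * z.2 + c j = 0 ↔ a k * z.1 + b k * z.2 + c k = 0)

namespace PlanarPolygon

variable {ι : Type*} {I J : Finset ι} {a b c : ι → ℝ} {p q : ι → ℝ × ℝ}
  (P : PlanarPolygon I J a b c p q)
include P

/-- The levels `t` of the vertices. -/
def vertexLevels (I : Finset ι) (a b c : ι → ℝ) : Set ℝ :=
  ⋃ i ∈ I, ⋃ j ∈ I, {t | a i * b j ≠ a j * b i ∧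
    (a j * b i - a i * b j) * t + (a j * c i - a i * c j) = 0}

omit P in
theorem volume_vertexLevels : volume (vertexLevels I a b c) = 0 := by
  refine (measure_biUnion_null_iff I.countable_toSet).mpr fun i _ =>
    (measure_biUnion_null_iff I.countable_toSet).mpr fun j _ => ?_
  refine Set.Subsingleton.measure_zero (fun t ht t' ht' => ?_) _
  have h0 : a j * b i - a i * b j ≠ 0 := fun h => ht.1 (by linarith)
  exact mul_left_cancel₀ h0 (by linarith [ht.2, ht'.2])

variable {s t : ℝ} (ht : t ∉ vertexLevels I a b c)
include ht

/-- Away from the levels of the vertices, two lines that pass through a common point are equal. The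
interior point makes the ratio of their equations positive. -/
theorem proportional {i j : ι} (hi : i ∈ I) (hj : j ∈ I)
    (h1 : a i * s + b i * t + c i = 0) (h2 : a j * s + b j * t + c j = 0) :
    (∀ z : ℝ × ℝ, a j * (a i * z.1 + b i * z.2 + c i) = a i * (a j * z.1 + b j * z.2 + c j)) ∧
      (a i ≠ 0 → 0 < a i * a j) := by
  have hdet : a i * b j = a j * b i := by
    by_contra hne
    refine ht ?_
    simp only [vertexLevels, mem_iUnion]
    refine ⟨i, hi, j, hj, hne, ?_⟩
    linear_combination a j * h1 - a i * h2
  have hc : a j * c i = a i * c j := by linear_combination a j * h1 - a i * h2 + t * hdet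
  have key : ∀ z : ℝ × ℝ, a j * (a i * z.1 + b i * z.2 + c i) =
      a i * (a j * z.1 + b j * z.2 + c j) := fun z => by
    linear_combination hc - z.2 * hdet
  refine ⟨key, fun hne => ?_⟩
  obtain ⟨z, hz⟩ := P.interior
  have h3 := hz i hi
  have h4 := hz j hj
  have h5 : 0 < a i ^ 2 := by positivity
  have h6 : (a i * a j) * (a i * z.1 + b i * z.2 + c i) =
      a i ^ 2 * (a j * z.1 + b j * z.2 + c j) := by linear_combination a i * key z
  refine (mul_pos_iff_of_pos_right h3).mp ?_
  rw [h6]; positivity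

/-- A short move along the line keeps every other active constraint active, by proportionality, and
the inactive ones positive. So the line carries a genuine edge, as `PlanarPolygon.cover` requires.
-/
theorem nontrivial_of_active {i : ι} (hi : i ∈ I) (hai : a i ≠ 0)
    (hQ : ∀ j ∈ I, 0 ≤ a j * s + b j * t + c j) (h1 : a i * s + b i * t + c i = 0) :
    {z : ℝ × ℝ | (∀ j ∈ I, 0 ≤ a j * z.1 + b j * z.2 + c j) ∧
      a i * z.1 + b i * z.2 + c i = 0}.Nontrivial := by
  have hev : ∀ᶠ d in 𝓝[>] (0 : ℝ), ∀ j ∈ I,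
      0 ≤ a j * (s - d * b i) + b j * (t + d * a i) + c j := by
    rw [Filter.eventually_all_finset]
    intro j hj
    rcases (hQ j hj).eq_or_lt with h0 | hpos
    · refine Eventually.of_forall fun d => le_of_eq ?_
      have h2 := (P.proportional ht hi hj h1 h0.symm).1 (s - d * b i, t + d * a i)
      simp only at h2
      have h3 : a i * (s - d * b i) + b i * (t + d * a i) + c i = 0 := by linear_combination h1
      rw [h3, mul_zero] at h2
      exact ((mul_eq_zero.mp h2.symm).resolve_left hai).symm
    · have hc : Continuous fun d : ℝ => a j * (s - d * b i) + b j * (t + d * a i) + c j := by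
        fun_prop
      have h2 : ∀ᶠ d in 𝓝 (0 : ℝ), 0 < a j * (s - d * b i) + b j * (t + d * a i) + c j :=
        (hc.tendsto 0).eventually_const_lt (by simpa using hpos)
      exact (h2.filter_mono nhdsWithin_le_nhds).mono fun d hd => hd.le
  obtain ⟨d, hd, hd0⟩ := (hev.and self_mem_nhdsWithin).exists
  refine ⟨(s, t), ⟨hQ, h1⟩, (s - d * b i, t + d * a i), ⟨hd, ?_⟩, fun h => ?_⟩
  · simp only; linear_combination h1
  · have h2 := congrArg Prod.snd h
    simp only at h2
    have : d * a i = 0 := by linarith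
    exact (mul_ne_zero (ne_of_gt hd0) hai) this

omit P ht in
theorem exists_active {d : ℝ} (hQ : ∀ j ∈ I, 0 ≤ a j * s + b j * t + c j)
    (hmax : ∀ δ > 0, ¬∀ j ∈ I, 0 ≤ a j * (s + δ * d) + b j * t + c j) :
    ∃ i ∈ I, a i * s + b i * t + c i = 0 ∧ a i * d < 0 := by
  by_contra! hcon
  have hev : ∀ᶠ δ in 𝓝[>] (0 : ℝ), ∀ j ∈ I, 0 ≤ a j * (s + δ * d) + b j * t + c j := by
    rw [Filter.eventually_all_finset]
    intro j hj
    rcases (hQ j hj).eq_or_lt with h0 | hpos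
    · filter_upwards [self_mem_nhdsWithin] with δ hδ
      have h1 := mul_nonneg (le_of_lt (mem_Ioi.mp hδ)) (hcon j hj h0.symm)
      linarith
    · have hc : Continuous fun δ : ℝ => a j * (s + δ * d) + b j * t + c j := by fun_prop
      have h2 : ∀ᶠ δ in 𝓝 (0 : ℝ), 0 < a j * (s + δ * d) + b j * t + c j :=
        (hc.tendsto 0).eventually_const_lt (by simpa using hpos)
      exact (h2.filter_mono nhdsWithin_le_nhds).mono fun δ hd => hd.le
  obtain ⟨δ, hδ, hδ0⟩ := (hev.and self_mem_nhdsWithin).exists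
  exact hmax δ hδ0 hδ

/-- A slice can end only at an active constraint that decreases in direction d; its representative
in J has a coefficient of the same sign. -/
theorem exists_rep {d : ℝ} (hQ : ∀ j ∈ I, 0 ≤ a j * s + b j * t + c j)
    (hmax : ∀ δ > 0, ¬∀ j ∈ I, 0 ≤ a j * (s + δ * d) + b j * t + c j) :
    ∃ i ∈ J, a i * s + b i * t + c i = 0 ∧ a i * d < 0 := by
  obtain ⟨i, hi, h1, h2⟩ := exists_active hQ hmax
  have hai : a i ≠ 0 := fun h => by rw [h, zero_mul] at h2; exact h2.ne rfl
  obtain ⟨j, hj, hji⟩ := P.cover i hi (P.nontrivial_of_active ht hi hai hQ h1)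
  have hj0 := (hji (s, t) hQ).mpr h1
  refine ⟨j, hj, hj0, ?_⟩
  have h3 := (P.proportional ht hi (P.sub hj) h1 hj0).2 hai
  rcases lt_or_gt_of_ne hai with hlt | hgt
  · have : a j < 0 := by by_contra! h; nlinarith
    have : 0 < d := by by_contra! h; nlinarith
    nlinarith
  · have : 0 < a j := by by_contra! h; nlinarith
    have : d < 0 := by by_contra! h; nlinarith
    nlinarith

/-- Representatives active at one point off the vertex levels cut out the same edge, and J lists
every edge once. -/
theorem rep_unique {i j : ι} (hi : i ∈ J) (hj : j ∈ J) (hai : a i ≠ 0)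
    (h1 : a i * s + b i * t + c i = 0) (h2 : a j * s + b j * t + c j = 0) : i = j := by
  obtain ⟨h3, h4⟩ := P.proportional ht (P.sub hi) (P.sub hj) h1 h2
  have haj : a j ≠ 0 := fun h => by have := h4 hai; rw [h, mul_zero] at this; exact this.ne rfl
  refine P.inj i hi j hj fun z _ => ⟨fun h => ?_, fun h => ?_⟩
  · have := h3 z
    rw [h, mul_zero] at this
    exact (mul_eq_zero.mp this.symm).resolve_left hai
  · have := h3 z
    rw [h, mul_zero] at this
    exact (mul_eq_zero.mp this).resolve_left haj

omit P ht in
theorem isClosed_setOf (I : Finset ι) (a b c : ι → ℝ) :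
    IsClosed {z : ℝ × ℝ | ∀ i ∈ I, 0 ≤ a i * z.1 + b i * z.2 + c i} := by
  have : {z : ℝ × ℝ | ∀ i ∈ I, 0 ≤ a i * z.1 + b i * z.2 + c i} =
      ⋂ i ∈ I, {z | 0 ≤ a i * z.1 + b i * z.2 + c i} := by ext; simp
  rw [this]
  exact isClosed_biInter fun i _ => isClosed_le continuous_const (by fun_prop)

omit ht in
theorem isCompact_setOf :
    IsCompact {z : ℝ × ℝ | ∀ i ∈ I, 0 ≤ a i * z.1 + b i * z.2 + c i} :=
  Metric.isCompact_of_isClosed_isBounded (isClosed_setOf I a b c) P.bounded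

/-- The position of the line of index `i` at level `t`. -/
noncomputable def lineAt (a b c : ι → ℝ) (i : ι) (t : ℝ) : ℝ := -(b i * t + c i) / a i

omit P ht in
theorem line_eq {i : ι} (hai : a i ≠ 0) (t : ℝ) : a i * lineAt a b c i t + b i * t + c i = 0 := by
  rw [lineAt]; field_simp; ring

omit P ht in
theorem eq_lineAt {i : ι} (hai : a i ≠ 0) (h : a i * s + b i * t + c i = 0) :
    s = lineAt a b c i t := by
  rw [lineAt, eq_div_iff hai]; linarith

/-- The fundamental theorem of calculus on a slice. -/
theorem integral_slice {f g : ℝ × ℝ → ℝ} (hg : Continuous g)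
    (hfg : ∀ s, HasDerivAt (fun s => f (s, t)) (g (s, t)) s) :
    ∫ s, {z : ℝ × ℝ | ∀ i ∈ I, 0 ≤ a i * z.1 + b i * z.2 + c i}.indicator g (s, t) =
      ∑ i ∈ J, -SignType.sign (a i) *
        {t | ∀ j ∈ I, 0 ≤ a j * lineAt a b c i t + b j * t + c j}.indicator
          (fun t => f (lineAt a b c i t, t)) t := by
  classical
  set S : Set ℝ := {s | ∀ j ∈ I, 0 ≤ a j * s + b j * t + c j} with hS
  have hlhs : (fun s => {z : ℝ × ℝ | ∀ i ∈ I, 0 ≤ a i * z.1 + b i * z.2 + c i}.indicator g (s, t)) =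
      S.indicator fun s => g (s, t) := by
    ext s
    by_cases hs : s ∈ S
    · rw [indicator_of_mem hs, indicator_of_mem (show (s, t) ∈ _ from hs)]
    · rw [indicator_of_notMem hs, indicator_of_notMem (show (s, t) ∉ _ from hs)]
  have hSc : IsCompact S := by
    have h1 : IsClosed S := (isClosed_setOf I a b c).preimage (f := fun s : ℝ => (s, t)) (by fun_prop)
    refine Metric.isCompact_of_isClosed_isBounded h1 ?_
    refine (LipschitzWith.prod_fst.isBounded_image P.bounded).subset fun s hs => ⟨(s, t), hs, rfl⟩
  rw [hlhs, integral_indicator hSc.measurableSet]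
  rcases S.eq_empty_or_nonempty with hemp | hne
  · rw [hemp, Measure.restrict_empty, integral_zero_measure, eq_comm]
    refine Finset.sum_eq_zero fun i _ => ?_
    rw [indicator_of_notMem, mul_zero]
    intro h
    have : lineAt a b c i t ∈ S := h
    rw [hemp] at this
    exact this
  have hconv : Convex ℝ S := by
    have : S = ⋂ j ∈ I, {s | 0 ≤ a j * s + (b j * t + c j)} := by
      ext s; simp [hS, add_assoc]
    rw [this]
    refine convex_iInter₂ fun j _ x hx y hy u w hu hw huw => ?_
    simp only [mem_ofPred_eq, smul_eq_mul] at hx hy ⊢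
    have h1 := mul_nonneg hu hx
    have h2 := mul_nonneg hw hy
    have h3 : (b j * t + c j) = (u + w) * (b j * t + c j) := by rw [huw, one_mul]
    rw [h3]; linarith
  -- The slice is an interval [A, B], and the fundamental theorem of calculus leaves the two end
  -- values.
  have hIcc := eq_Icc_of_connected_compact ⟨hne, hconv.isPreconnected⟩ hSc
  have hA := hSc.sInf_mem hne
  have hB := hSc.sSup_mem hne
  set A := sInf S
  set B := sSup S
  have hAB : A ≤ B := by rw [hIcc] at hA; exact hA.2
  rw [hIcc, integral_Icc_eq_integral_Ioc, ← intervalIntegral.integral_of_le hAB,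
    intervalIntegral.integral_eq_sub_of_hasDerivAt (fun s _ => hfg s)
      ((Continuous.intervalIntegrable (by fun_prop) _ _))]
  obtain ⟨iB, hiB, hB0, hBn⟩ := P.exists_rep ht (d := 1) hB fun δ hδ h => by
    have : B + δ * 1 ∈ S := h
    rw [hIcc] at this
    linarith [this.2]
  obtain ⟨iA, hiA, hA0, hAn⟩ := P.exists_rep ht (d := -1) hA fun δ hδ h => by
    have : A + δ * -1 ∈ S := h
    rw [hIcc] at this
    linarith [this.1]
  have hBn' : a iB < 0 := by linarith
  have hAn' : 0 < a iA := by linarith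
  have hne' : iA ≠ iB := fun h => by rw [h] at hAn'; linarith
  have hlA := eq_lineAt hAn'.ne' hA0
  have hlB := eq_lineAt hBn'.ne hB0
  -- Exactly one representative passes through each end, with positive coefficient at A and negative
  -- one at B. A further non-horizontal line meeting the slice would meet it at an end and coincide
  -- with one of these two.
  rw [Finset.sum_eq_add iA iB hne' (fun i hi hne2 => ?_) (fun h => absurd hiA h)
    (fun h => absurd hiB h)]
  · rw [sign_pos hAn', sign_neg hBn', indicator_of_mem (by rw [mem_ofPred_eq, ← hlA]; exact hA),
      indicator_of_mem (by rw [mem_ofPred_eq, ← hlB]; exact hB), ← hlA, ← hlB]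
    simp only [SignType.coe_one, SignType.coe_neg_one]
    ring
  · rcases eq_or_ne (a i) 0 with h0 | hai
    · rw [h0]; simp
    rw [indicator_of_notMem, mul_zero]
    intro hmem
    have hl0 := line_eq (b := b) (c := c) hai t
    set l := lineAt a b c i t
    have hlS : l ∈ S := hmem
    rw [hIcc] at hlS
    rcases lt_or_gt_of_ne hai with hlt | hgt
    · have h1 := hB i (P.sub hi)
      have h2 : B = l := le_antisymm (by by_contra! h; nlinarith) hlS.2
      exact hne2.2 (P.rep_unique ht hi hiB hai hl0 (by rw [← h2]; exact hB0))
    · have h1 := hA i (P.sub hi)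
      have h2 : A = l := le_antisymm hlS.1 (by by_contra! h; nlinarith)
      exact hne2.1 (P.rep_unique ht hi hiA hai hl0 (by rw [← h2]; exact hA0))

omit ht in
/-- The levels of an edge. -/
theorem levels_eq {i : ι} (hi : i ∈ J) (hai : a i ≠ 0) :
    {t | ∀ j ∈ I, 0 ≤ a j * lineAt a b c i t + b j * t + c j} = uIcc (p i).2 (q i).2 := by
  have he := P.edge i hi
  have hp : a i * (p i).1 + b i * (p i).2 + c i = 0 := by
    have : p i ∈ segment ℝ (p i) (q i) := left_mem_segment ℝ _ _
    rw [← he] at this; exact this.2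
  have hq : a i * (q i).1 + b i * (q i).2 + c i = 0 := by
    have : q i ∈ segment ℝ (p i) (q i) := right_mem_segment ℝ _ _
    rw [← he] at this; exact this.2
  ext t
  rw [← segment_eq_uIcc]
  have h1 : (∀ j ∈ I, 0 ≤ a j * lineAt a b c i t + b j * t + c j) ↔
      (lineAt a b c i t, t) ∈ segment ℝ (p i) (q i) := by
    rw [← he]
    exact ⟨fun h => ⟨h, line_eq hai t⟩, fun h => h.1⟩
  rw [mem_ofPred_eq, h1]
  constructor
  · rintro ⟨u, w, hu, hw, huw, h⟩
    exact ⟨u, w, hu, hw, huw, congrArg Prod.snd h⟩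
  · rintro ⟨u, w, hu, hw, huw, h⟩
    refine ⟨u, w, hu, hw, huw, Prod.ext ?_ h⟩
    refine eq_lineAt hai ?_
    simp only [smul_eq_mul, Prod.fst_add, Prod.smul_fst] at h ⊢
    rw [← h]
    linear_combination u * hp + w * hq - c i * huw

omit P ht in
theorem integral_uIcc (F : ℝ → ℝ) (x y : ℝ) :
    ∫ t in uIcc x y, F t = |y - x| * ∫ θ in (0 : ℝ)..1, F (x + θ * (y - x)) := by
  have h1 := intervalIntegral.smul_integral_comp_add_mul (a := 0) (b := 1) F (y - x) x
  simp only [mul_zero, add_zero, mul_one, add_sub_cancel, smul_eq_mul] at h1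
  simp_rw [mul_comm _ (y - x)]
  rcases le_total x y with h | h
  · rw [uIcc_of_le h, integral_Icc_eq_integral_Ioc, ← intervalIntegral.integral_of_le h, ← h1,
      abs_of_nonneg (by linarith)]
  · rw [uIcc_of_ge h, integral_Icc_eq_integral_Ioc, ← intervalIntegral.integral_of_le h,
      intervalIntegral.integral_symm, ← h1, abs_of_nonpos (by linarith)]
    ring

omit ht in
/-- The divergence theorem for one partial derivative. -/
theorem integral_deriv {f g : ℝ × ℝ → ℝ} (hf : Continuous f) (hg : Continuous g)
    (hfg : ∀ s t, HasDerivAt (fun s => f (s, t)) (g (s, t)) s) :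
    ∫ z in {z : ℝ × ℝ | ∀ i ∈ I, 0 ≤ a i * z.1 + b i * z.2 + c i}, g z =
      ∑ i ∈ J, -(a i / √(a i ^ 2 + b i ^ 2)) *
        (√(((q i).1 - (p i).1) ^ 2 + ((q i).2 - (p i).2) ^ 2) *
          ∫ θ in (0 : ℝ)..1, f (p i + θ • (q i - p i))) := by
  have hQc := P.isCompact_setOf
  set Q := {z : ℝ × ℝ | ∀ i ∈ I, 0 ≤ a i * z.1 + b i * z.2 + c i} with hQ
  have hint : Integrable (Q.indicator g) (volume : Measure (ℝ × ℝ)) :=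
    (hg.continuousOn.integrableOn_compact hQc).integrable_indicator hQc.measurableSet
  rw [← integral_indicator hQc.measurableSet]
  rw [Measure.volume_eq_prod] at hint ⊢
  rw [integral_prod_symm _ hint]
  have hae : ∀ᵐ t : ℝ, ∫ s, Q.indicator g (s, t) = ∑ i ∈ J, -SignType.sign (a i) *
        {t | ∀ j ∈ I, 0 ≤ a j * lineAt a b c i t + b j * t + c j}.indicator
          (fun t => f (lineAt a b c i t, t)) t := by
    filter_upwards [measure_eq_zero_iff_ae_notMem.mp (volume_vertexLevels (I := I) (a := a)
      (b := b) (c := c))] with t ht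
    exact P.integral_slice ht hg fun s => hfg s t
  have hcl : ∀ i, Continuous fun t => f (lineAt a b c i t, t) := fun i =>
    hf.comp (by unfold lineAt; fun_prop)
  rw [integral_congr_ae hae, integral_finsetSum]
  · refine Finset.sum_congr rfl fun i hi => ?_
    rw [integral_const_mul]
    rcases eq_or_ne (a i) 0 with h0 | hai
    · simp [h0]
    have he := P.edge i hi
    have hp : a i * (p i).1 + b i * (p i).2 + c i = 0 := by
      have : p i ∈ segment ℝ (p i) (q i) := left_mem_segment ℝ _ _
      rw [← he] at this; exact this.2
    have hq : a i * (q i).1 + b i * (q i).2 + c i = 0 := by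
      have : q i ∈ segment ℝ (p i) (q i) := right_mem_segment ℝ _ _
      rw [← he] at this; exact this.2
    rw [P.levels_eq hi hai, integral_indicator measurableSet_uIcc, integral_uIcc, ← mul_assoc,
      ← mul_assoc]
    congr 1
    · set d₁ := (q i).1 - (p i).1
      set d₂ := (q i).2 - (p i).2
      have hd : a i * d₁ + b i * d₂ = 0 := by simp only [d₁, d₂]; linear_combination hq - hp
      have hpos : 0 < a i ^ 2 + b i ^ 2 := by positivity
      -- The edge direction d is orthogonal to (a, b), so the height |d₂| of the edge is its length
      -- times |a|/√(a²+b²); this turns integration over levels into arc length.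
      have h1 : |a i| * √(d₁ ^ 2 + d₂ ^ 2) = √(a i ^ 2 + b i ^ 2) * |d₂| := by
        rw [← Real.sqrt_sq_eq_abs, ← Real.sqrt_sq_eq_abs, ← Real.sqrt_mul (sq_nonneg _),
          ← Real.sqrt_mul hpos.le]
        congr 1
        linear_combination (a i * d₁ - b i * d₂) * hd
      have h2 : a i = SignType.sign (a i) * |a i| := (sign_mul_abs (a i)).symm
      have h3 : 0 < √(a i ^ 2 + b i ^ 2) := Real.sqrt_pos.mpr hpos
      have h4 : a i * √(d₁ ^ 2 + d₂ ^ 2) = SignType.sign (a i) * (√(a i ^ 2 + b i ^ 2) * |d₂|) := by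
        rw [← h1, ← mul_assoc, ← h2]
      rw [neg_mul, neg_mul, div_mul_eq_mul_div, h4]
      field_simp
    · refine intervalIntegral.integral_congr fun θ _ => ?_
      congr 1
      refine Prod.ext ?_ (by simp)
      refine (eq_lineAt hai ?_).symm
      simp only [Prod.fst_add, Prod.smul_fst, Prod.fst_sub, smul_eq_mul]
      linear_combination θ * hq + (1 - θ) * hp
  · intro i hi
    rcases eq_or_ne (a i) 0 with h0 | hai
    · simp [h0]
    rw [P.levels_eq hi hai]
    exact (((hcl i).continuousOn.integrableOn_compact isCompact_uIcc).integrable_indicator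
      measurableSet_uIcc).const_mul _

end PlanarPolygon

end PlanarPolygon

/-! ### The divergence theorem on a cell -/

section PlaneChart

variable {n : E3} {L : E2 →ₗᵢ[ℝ] E3} {x : E3}

/-- Coordinates in the plane through `x` spanned by the range of `L`. -/
noncomputable def planeChart (L : E2 →ₗᵢ[ℝ] E3) (x : E3) (z : ℝ × ℝ) : E3 :=
  x + L (WithLp.toLp 2 ![z.1, z.2])

theorem planeChart_eq (L : E2 →ₗᵢ[ℝ] E3) (x : E3) (z : ℝ × ℝ) :
    planeChart L x z = x + (z.1 • L !₂[1, 0] + z.2 • L !₂[0, 1]) := by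
  rw [planeChart, ← map_smul, ← map_smul, ← map_add]
  congr 2
  ext i
  fin_cases i <;> simp

theorem planeChart_combo (z w : ℝ × ℝ) (θ : ℝ) : planeChart L x (z + θ • (w - z)) =
    planeChart L x z + θ • (planeChart L x w - planeChart L x z) := by
  simp only [planeChart_eq, Prod.fst_add, Prod.snd_add, Prod.smul_fst, Prod.smul_snd, Prod.fst_sub,
    Prod.snd_sub, smul_eq_mul]
  module

theorem norm_planeChart_sub (z w : ℝ × ℝ) : ‖planeChart L x w - planeChart L x z‖ =
    √((w.1 - z.1) ^ 2 + (w.2 - z.2) ^ 2) := by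
  rw [planeChart, planeChart, add_sub_add_left_eq_sub, ← map_sub, L.norm_map, EuclideanSpace.norm_eq]
  simp [Fin.sum_univ_two]

theorem planeChart_injective : Function.Injective (planeChart L x) := by
  intro z w h
  have h1 := norm_planeChart_sub (L := L) (x := x) z w
  rw [h, sub_self, norm_zero, eq_comm, Real.sqrt_eq_zero (by positivity)] at h1
  have h2 : w.1 - z.1 = 0 := by nlinarith [sq_nonneg (w.1 - z.1), sq_nonneg (w.2 - z.2)]
  have h3 : w.2 - z.2 = 0 := by nlinarith [sq_nonneg (w.1 - z.1), sq_nonneg (w.2 - z.2)]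
  exact Prod.ext (by linarith) (by linarith)

theorem planeChart_continuous : Continuous (planeChart L x) := by
  have : planeChart L x = fun z => x + (z.1 • L !₂[1, 0] + z.2 • L !₂[0, 1]) :=
    funext fun z => planeChart_eq L x z
  rw [this]; fun_prop

theorem exists_planeChart_eq (hL : ∀ z, inner ℝ n z = 0 ↔ z ∈ range L) {z : E3}
    (hz : inner ℝ n (z - x) = 0) : ∃ w, planeChart L x w = z := by
  obtain ⟨y, hy⟩ := (hL _).mp hz
  refine ⟨(y 0, y 1), ?_⟩
  have : WithLp.toLp 2 ![y 0, y 1] = y := by ext i; fin_cases i <;> simp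
  rw [planeChart, this, hy]; abel

theorem inner_planeChart_sub (hL : ∀ z, inner ℝ n z = 0 ↔ z ∈ range L) (w : ℝ × ℝ) :
    inner ℝ n (planeChart L x w - x) = 0 := by
  rw [planeChart, add_sub_cancel_left]; exact inner_isometry hL _

theorem mem_segment_planeChart {p q w : ℝ × ℝ} :
    w ∈ segment ℝ p q ↔ planeChart L x w ∈ segment ℝ (planeChart L x p) (planeChart L x q) := by
  rw [segment_eq_image', segment_eq_image']
  constructor
  · rintro ⟨θ, hθ, rfl⟩
    exact ⟨θ, hθ, (planeChart_combo _ _ _).symm⟩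
  · rintro ⟨θ, hθ, h⟩
    refine ⟨θ, hθ, planeChart_injective (L := L) (x := x) ?_⟩
    simp only at h ⊢
    rw [planeChart_combo, h]

/-- The chart is an isometry onto the plane, so the two-dimensional Hausdorff measure, normalised as
area, pulls back to Lebesgue measure. -/
theorem integral_planeChart (hL : ∀ z, inner ℝ n z = 0 ↔ z ∈ range L) {S : Set E3}
    (hS : MeasurableSet S) (hSn : ∀ z ∈ S, inner ℝ n (z - x) = 0) (G : E3 → ℝ) :
    ∫ z in S, G z ∂μHE[2] = ∫ w in planeChart L x ⁻¹' S, G (planeChart L x w) := by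
  have hiso := isometry_plane L x
  have hemb : MeasurableEmbedding fun y => x + L y := hiso.isClosedEmbedding.measurableEmbedding
  have h1 : (μHE[2] : Measure E3).restrict S =
      ((μHE[2] : Measure E3).restrict (range fun y => x + L y)).restrict S := by
    rw [Measure.restrict_restrict hS, inter_eq_left.mpr]
    intro z hz
    rw [range_plane hL x]; exact hSn z hz
  have hmp : MeasurePreserving (fun z : ℝ × ℝ => (WithLp.toLp 2 ![z.1, z.2] : E2)) := by
    have := (PiLp.volume_preserving_toLp (Fin 2)).comp
      (volume_preserving_finTwoArrow ℝ).symm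
    exact this
  have hme : MeasurableEmbedding (fun z : ℝ × ℝ => (WithLp.toLp 2 ![z.1, z.2] : E2)) :=
    ((MeasurableEquiv.finTwoArrow (α := ℝ)).symm.trans
      (MeasurableEquiv.toLp 2 (Fin 2 → ℝ))).measurableEmbedding
  rw [h1, ← hiso.map_euclideanHausdorffMeasure, hemb.setIntegral_map,
    EuclideanSpace.euclideanHausdorffMeasure_eq_volume, ← hmp.setIntegral_preimage_emb hme]
  rfl

/-- A compact convex set on a line is a segment. -/
theorem exists_eq_segment {e : Set E3} (hc : IsCompact e) (hconv : Convex ℝ e) (hnt : e.Nontrivial)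
    (hline : ∀ p ∈ e, ∀ q ∈ e, p ≠ q → ∀ r ∈ e, ∃ s : ℝ, r - p = s • (q - p)) :
    ∃ pq : E3 × E3, pq.1 ≠ pq.2 ∧ e = segment ℝ pq.1 pq.2 := by
  obtain ⟨p, hp, q, hq, hpq⟩ := hnt
  have hd : q - p ≠ 0 := sub_ne_zero.mpr hpq.symm
  have hdn := norm_pos_iff.mpr hd
  set φ : ℝ → E3 := fun s => p + s • (q - p) with hφ
  have hφc : Continuous φ := by fun_prop
  set S := φ ⁻¹' e with hS
  obtain ⟨M, hM⟩ := hc.isBounded.exists_norm_le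
  have hSc : IsCompact S := by
    refine Metric.isCompact_of_isClosed_isBounded (hc.isClosed.preimage hφc) ?_
    refine isBounded_iff_forall_norm_le.mpr ⟨(M + ‖p‖) / ‖q - p‖, fun s hs => ?_⟩
    rw [le_div_iff₀ hdn, ← norm_smul]
    have h1 : s • (q - p) = φ s - p := by rw [hφ]; simp
    rw [h1]
    exact (norm_sub_le _ _).trans (by linarith [hM _ hs])
  have h0 : (0 : ℝ) ∈ S := by simpa [hS, hφ] using hp
  have h1 : (1 : ℝ) ∈ S := by simpa [hS, hφ] using hq
  have hSconv : Convex ℝ S := by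
    intro s hs t ht u w hu hw huw
    have : φ (u • s + w • t) = u • φ s + w • φ t := by
      simp only [hφ, smul_eq_mul]
      have e1 : p = (u + w) • p := by rw [huw, one_smul]
      nth_rewrite 1 [e1]
      module
    rw [hS, mem_preimage, this]
    exact hconv hs ht hu hw huw
  have hIcc := eq_Icc_of_connected_compact ⟨⟨0, h0⟩, hSconv.isPreconnected⟩ hSc
  set A := sInf S
  set B := sSup S
  rw [hIcc] at h0 h1
  have hAB : A < B := by linarith [h0.1, h1.2]
  refine ⟨(φ A, φ B), fun h => ?_, ?_⟩
  · have h2 : (A - B) • (q - p) = 0 := by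
      have : (A - B) • (q - p) = φ A - φ B := by simp only [hφ]; module
      rw [this]; exact sub_eq_zero.mpr h
    rcases smul_eq_zero.mp h2 with h3 | h3
    · linarith
    · exact hd h3
  · have himg : φ '' Icc A B = segment ℝ (φ A) (φ B) := by
      have hφe : φ = fun s => AffineMap.lineMap (k := ℝ) p q s := by
        funext s; simp only [hφ, AffineMap.lineMap_apply, vsub_eq_sub, vadd_eq_add]; abel
      rw [← segment_eq_Icc hAB.le, hφe]
      exact image_segment _ (AffineMap.lineMap p q) A B
    simp only
    rw [← himg, ← hIcc]
    ext r
    constructor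
    · intro hr
      obtain ⟨s, hs⟩ := hline p hp q hq hpq r hr
      have hrs : φ s = r := by simp only [hφ]; rw [← hs]; abel
      exact ⟨s, by rw [hS, mem_preimage, hrs]; exact hr, hrs⟩
    · rintro ⟨s, hs, rfl⟩; exact hs

open Classical in
/-- Endpoints of a segment. -/
noncomputable def segEnds (e : Set E3) : E3 × E3 :=
  if h : ∃ pq : E3 × E3, pq.1 ≠ pq.2 ∧ e = segment ℝ pq.1 pq.2 then h.choose else 0

theorem segEnds_spec {e : Set E3} (h : ∃ pq : E3 × E3, pq.1 ≠ pq.2 ∧ e = segment ℝ pq.1 pq.2) :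
    (segEnds e).1 ≠ (segEnds e).2 ∧ e = segment ℝ (segEnds e).1 (segEnds e).2 := by
  rw [segEnds, dif_pos h]
  exact h.choose_spec

/-- The integral over a segment with respect to arc length. -/
noncomputable def segIntegral (e : Set E3) (f : E3 → ℝ) : ℝ :=
  ‖(segEnds e).2 - (segEnds e).1‖ *
    ∫ θ in (0 : ℝ)..1, f ((segEnds e).1 + θ • ((segEnds e).2 - (segEnds e).1))

end PlaneChart

/-! ### Conormals and integration by parts on one cell. -/

section CellDivergence

open Classical in
/-- The vertex opposite to the face of `tetOf K` that cuts the edge `e` off the cell `K`. -/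
noncomputable def CutData.edgeVertex (D : CutData) (K e : Set E3) : E3 :=
  if h : ∃ a ∈ D.tetOf K, e = closure K ∩ {z | bary (D.tetOf K) a z = 0} ∧
    (∃ z ∈ K, 0 < bary (D.tetOf K) a z) then h.choose else 0

/-- The exterior unit conormal of the cell `K` at the edge `e`. -/
noncomputable def CutData.conormal (D : CutData) (K e : Set E3) : E3 :=
  -(‖tanProj (D.cellNrm K) (affGrad (bary (D.tetOf K) (D.edgeVertex K e)))‖⁻¹ •
    tanProj (D.cellNrm K) (affGrad (bary (D.tetOf K) (D.edgeVertex K e))))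

theorem tanProj_apply (n w : E3) : tanProj n w = w - inner ℝ n w • n := by
  simp [tanProj]

theorem inner_tanProj_self {n : E3} (hn : ‖n‖ = 1) (w : E3) : inner ℝ n (tanProj n w) = 0 := by
  rw [tanProj_apply, inner_sub_right, real_inner_smul_right, real_inner_self_eq_norm_sq, hn]; ring

theorem inner_tanProj_of_orthogonal {n w : E3} {u : E3} (hu : inner ℝ n u = 0) :
    inner ℝ (tanProj n w) u = inner ℝ w u := by
  rw [tanProj_apply, inner_sub_left, real_inner_smul_left, hu, mul_zero, sub_zero]

namespace CellData

variable {D : CutData} {K : Set E3} {I : Finset E3} (Hc : CellData D K I)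
  {F : E3 → ℝ} {U : Set E3} {h σ C R : ℝ} (H : FineSurface D F U h σ C R)
include Hc

theorem edgeVertex_spec {e : Set E3} (he : e ∈ D.edges K) : D.edgeVertex K e ∈ I ∧
    e = closure K ∩ {z | bary (D.tetOf K) (D.edgeVertex K e) z = 0} := by
  obtain ⟨a, ha, hea, -⟩ := Hc.mem_edges_iff.mp he
  obtain ⟨x, hx⟩ := Hc.nonempty
  have hex : ∃ a ∈ D.tetOf K, e = closure K ∩ {z | bary (D.tetOf K) a z = 0} ∧
      (∃ z ∈ K, 0 < bary (D.tetOf K) a z) :=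
    ⟨a, Hc.sub ha, hea, x, hx, (Hc.mem_iff.mp hx).2 a ha⟩
  rw [CutData.edgeVertex, dif_pos hex]
  obtain ⟨h1, h2, z, hz, hzpos⟩ := hex.choose_spec
  exact ⟨(Hc.mem_index_iff hz h1).mpr hzpos, h2⟩

include H

theorem edge_eq_segment {e : Set E3} (he : e ∈ D.edges K) :
    (segEnds e).1 ≠ (segEnds e).2 ∧ e = segment ℝ (segEnds e).1 (segEnds e).2 := by
  obtain ⟨a, ha, hea, hnt⟩ := Hc.mem_edges_iff.mp he
  have hzero : ∀ z ∈ e, D.plane (D.tetOf K) z = 0 ∧ bary (D.tetOf K) a z = 0 := fun z hz => by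
    rw [hea] at hz
    exact ⟨(Hc.mem_closure_iff.mp hz.1).2, hz.2⟩
  refine segEnds_spec (exists_eq_segment ?_ ?_ hnt fun p hp q hq hpq r hr => ?_)
  · rw [hea]
    exact Hc.isCompact_closure.inter_right (isClosed_eq (affine_continuous _) continuous_const)
  · rw [hea]
    exact Hc.convex_closure.inter ((convex_singleton 0).affine_preimage (bary (D.tetOf K) a))
  · obtain ⟨hp1, hp2⟩ := hzero p hp
    obtain ⟨hq1, hq2⟩ := hzero q hq
    obtain ⟨hr1, hr2⟩ := hzero r hr
    exact exists_smul_of_indep (Hc.indep H ha hp1 hp2) (sub_ne_zero.mpr hpq.symm)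
      (by rw [← affine_sub, hq1, hp1, sub_zero]) (by rw [← affine_sub, hq2, hp2, sub_zero])
      (by rw [← affine_sub, hr1, hp1, sub_zero]) (by rw [← affine_sub, hr2, hp2, sub_zero])

/-- A vanishing tangential part would make the barycentric gradient a multiple of the normal,
against the independence of the two planes that meet in the edge. -/
theorem norm_tanProj_pos {e : Set E3} (he : e ∈ D.edges K) :
    0 < ‖tanProj (D.cellNrm K) (affGrad (bary (D.tetOf K) (D.edgeVertex K e)))‖ := by
  obtain ⟨ha, hea⟩ := Hc.edgeVertex_spec he
  obtain ⟨a, -, -, z, hz, -⟩ := Hc.mem_edges_iff.mp he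
  rw [hea] at hz
  have hind := Hc.indep H ha (Hc.mem_closure_iff.mp hz.1).2 hz.2
  refine norm_pos_iff.mpr fun h0 => ?_
  rw [tanProj_apply] at h0
  rw [D.affGrad_plane, LinearIndependent.pair_iff] at hind
  have := hind (-inner ℝ (D.cellNrm K) (affGrad (bary (D.tetOf K) (D.edgeVertex K e)))) 1 (by
    rw [one_smul, neg_smul]
    rw [← h0]; rw [CutData.cellNrm]; abel)
  exact one_ne_zero this.2

/-- The coordinate that vanishes on e is positive on K, so minus its normalised tangential gradient
points outwards. Thus `CoeffStable.jump` applies to this explicit conormal. -/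
theorem isConormal {e : Set E3} (he : e ∈ D.edges K) : D.IsConormal K e (D.conormal K e) := by
  obtain ⟨ha, hea⟩ := Hc.edgeVertex_spec he
  have hpos := Hc.norm_tanProj_pos H he
  have hin : ∀ x ∈ closure K, ∀ y ∈ closure K, inner ℝ (D.conormal K e) (y - x) =
      -(‖tanProj (D.cellNrm K) (affGrad (bary (D.tetOf K) (D.edgeVertex K e)))‖⁻¹ *
        (bary (D.tetOf K) (D.edgeVertex K e) y - bary (D.tetOf K) (D.edgeVertex K e) x)) := by
    intro x hx y hy
    rw [CutData.conormal, inner_neg_left, real_inner_smul_left,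
      inner_tanProj_of_orthogonal (Hc.inner_nrm_eq_zero hx hy), ← affine_sub]
  refine ⟨?_, ?_, fun x hx y hy => ?_, fun x hx y hy => ?_⟩
  · rw [CutData.conormal, norm_neg, norm_smul, norm_inv, norm_norm, inv_mul_cancel₀ hpos.ne']
  · rw [CutData.conormal, inner_neg_left, real_inner_smul_left, real_inner_comm,
      inner_tanProj_self (Hc.norm_cellNrm H), mul_zero, neg_zero]
  · rw [hea] at hx hy
    rw [hin x hx.1 y hy.1, hx.2, hy.2, sub_self, mul_zero, neg_zero]
  · rw [hea] at hx
    rw [hin x hx.1 y (subset_closure hy), hx.2, sub_zero]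
    have := (Hc.mem_iff.mp hy).2 _ ha
    have h1 := inv_pos.mpr hpos
    nlinarith [mul_pos h1 this]

/-- Integration of a derivative over a cell. -/
theorem integral_fderiv {L : E2 →ₗᵢ[ℝ] E3} (hL : ∀ z, inner ℝ (D.cellNrm K) z = 0 ↔ z ∈ range L)
    {f : E3 → ℝ} (hf : ContDiff ℝ 1 f) :
    ∫ z in K, fderiv ℝ f z (L !₂[1, 0]) ∂μHE[2] =
      ∑ e ∈ D.edges K, inner ℝ (D.conormal K e) (L !₂[1, 0]) * segIntegral e f := by
  classical
  obtain ⟨x, hx⟩ := Hc.nonempty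
  set T := D.tetOf K with hT
  set n := D.cellNrm K with hn
  set u := L !₂[1, 0] with hu
  set w := L !₂[0, 1] with hw
  have hxc := subset_closure hx
  set φ := planeChart L x with hφ
  have hplane : ∀ z ∈ closure K, inner ℝ n (z - x) = 0 := fun z hz => Hc.inner_nrm_eq_zero hxc hz
  have hpl0 : ∀ z, D.plane T (φ z) = 0 := fun z => by
    have h1 := D.plane_sub T x (φ z)
    rw [(Hc.mem_iff.mp hx).1, sub_zero] at h1
    rw [h1]; exact inner_planeChart_sub hL z
  set a : E3 → ℝ := fun i => inner ℝ (affGrad (bary T i)) u with ha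
  set b : E3 → ℝ := fun i => inner ℝ (affGrad (bary T i)) w with hb
  set c : E3 → ℝ := fun i => bary T i x with hc
  have hlin : ∀ i (z : ℝ × ℝ), a i * z.1 + b i * z.2 + c i = bary T i (φ z) := by
    intro i z
    rw [affine_eq (bary T i) x (φ z), hφ, planeChart_eq, add_sub_cancel_left, inner_add_right,
      real_inner_smul_right, real_inner_smul_right]
    simp only [ha, hb, hc]
    ring
  have hQ : ∀ z : ℝ × ℝ, (∀ i ∈ I, 0 ≤ a i * z.1 + b i * z.2 + c i) ↔ φ z ∈ closure K := by
    intro z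
    rw [Hc.mem_closure_iff, Hc.mem_hull_iff (hpl0 z)]
    simp only [hlin]
    exact ⟨fun h => ⟨h, hpl0 z⟩, fun h => h.1⟩
  have hE : ∀ i, ∀ z : ℝ × ℝ, ((∀ j ∈ I, 0 ≤ a j * z.1 + b j * z.2 + c j) ∧
      a i * z.1 + b i * z.2 + c i = 0) ↔ φ z ∈ closure K ∩ {z | bary T i z = 0} := by
    intro i z
    rw [hQ, hlin]; rfl
  have hchart : ∀ z, ∃ y, z ∈ closure K → φ y = z := fun z => by
    by_cases hz : z ∈ closure K
    · obtain ⟨y, hy⟩ := exists_planeChart_eq hL (hplane z hz)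
      exact ⟨y, fun _ => hy⟩
    · exact ⟨0, fun h => absurd h hz⟩
  choose ψ hψ using hchart
  set E : E3 → Set E3 := fun i => closure K ∩ {z | bary T i z = 0} with hEdef
  -- If the section passes through an edge of the tetrahedron, two coordinates vanish on the same
  -- edge of the cell; `edgeVertex` picks one of them, so that each edge is counted once.
  set J := (D.edges K).image (D.edgeVertex K) with hJ
  have hJE : ∀ i ∈ J, E i ∈ D.edges K ∧ D.edgeVertex K (E i) = i := by
    intro i hi
    obtain ⟨e, he, rfl⟩ := Finset.mem_image.mp hi
    have h1 := (Hc.edgeVertex_spec he).2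
    have : E (D.edgeVertex K e) = e := h1.symm
    rw [this]; exact ⟨he, rfl⟩
  have hends : ∀ i ∈ J, φ (ψ (segEnds (E i)).1) = (segEnds (E i)).1 ∧
      φ (ψ (segEnds (E i)).2) = (segEnds (E i)).2 := by
    intro i hi
    obtain ⟨h1, h2⟩ := Hc.edge_eq_segment H (hJE i hi).1
    have hsub : E i ⊆ closure K := inter_subset_left
    exact ⟨hψ _ (hsub (h2.ge (left_mem_segment ℝ _ _))),
      hψ _ (hsub (h2.ge (right_mem_segment ℝ _ _)))⟩
  have P : PlanarPolygon I J a b c (fun i => ψ (segEnds (E i)).1) (fun i => ψ (segEnds (E i)).2) := by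
    refine ⟨?_, ⟨(0, 0), fun i hi => ?_⟩, fun i hi => ?_, fun i hi hpq => ?_, fun i hi => ?_,
      fun i hi j hj hij => ?_, fun i hi hnt => ?_⟩
    · obtain ⟨M, hM⟩ := Hc.isCompact_closure.isBounded.exists_norm_le
      refine isBounded_iff_forall_norm_le.mpr ⟨M + ‖x‖, fun z hz => ?_⟩
      have h1 := hM _ ((hQ z).mp hz)
      have h2 := norm_planeChart_sub (L := L) (x := x) (0, 0) z
      have h3 : planeChart L x (0, 0) = x := by rw [planeChart_eq]; simp
      rw [h3, sub_zero, sub_zero] at h2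
      have h4 : ‖planeChart L x z - x‖ ≤ M + ‖x‖ := (norm_sub_le _ _).trans (by gcongr)
      rw [h2] at h4
      refine max_le ?_ ?_
      · exact (Real.abs_le_sqrt (by linarith [sq_nonneg z.2])).trans h4
      · exact (Real.abs_le_sqrt (by linarith [sq_nonneg z.1])).trans h4
    · have := (Hc.mem_iff.mp hx).2 i hi
      simpa [hc] using this
    · obtain ⟨e, he, rfl⟩ := Finset.mem_image.mp hi
      exact (Hc.edgeVertex_spec he).1
    · obtain ⟨h1, h2⟩ := hends i hi
      have := congrArg φ hpq
      rw [h1, h2] at this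
      exact (Hc.edge_eq_segment H (hJE i hi).1).1 this
    · ext z
      obtain ⟨h1, h2⟩ := hends i hi
      rw [mem_ofPred_eq, hE, mem_segment_planeChart (L := L) (x := x), ← hφ, h1, h2,
        ← (Hc.edge_eq_segment H (hJE i hi).1).2]
    · have : E i = E j := by
        ext z
        refine and_congr_right fun hz => ?_
        have h1 := hij (ψ z) ((hQ _).mpr (by rw [hψ z hz]; exact hz))
        rw [hlin, hlin, hψ z hz] at h1
        exact h1
      rw [← (hJE i hi).2, ← (hJE j hj).2, this]
    · have hEi : E i ∈ D.edges K := by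
        refine Hc.mem_edges_iff.mpr ⟨i, hi, rfl, ?_⟩
        obtain ⟨z, hz, y, hy, hzy⟩ := hnt
        exact ⟨φ z, (hE i z).mp hz, φ y, (hE i y).mp hy, fun h => hzy (planeChart_injective h)⟩
      refine ⟨D.edgeVertex K (E i), Finset.mem_image_of_mem _ hEi, fun z hz => ?_⟩
      have h1 := (Hc.edgeVertex_spec hEi).2
      have h2 : φ z ∈ E i ↔ φ z ∈ E (D.edgeVertex K (E i)) := by
        conv_lhs => rw [h1]
      rw [hlin, hlin]
      have h3 := (hQ z).mp hz
      exact ⟨fun h => (h2.mpr ⟨h3, h⟩).2, fun h => (h2.mp ⟨h3, h⟩).2⟩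
  have hd : ∀ s t, HasDerivAt (fun s => f (φ (s, t))) (fderiv ℝ f (φ (s, t)) u) s := by
    intro s t
    have h1 : HasDerivAt (fun s => φ (s, t)) u s := by
      have : (fun s => φ (s, t)) = fun s => x + (s • u + t • w) := by
        funext s; rw [hφ, planeChart_eq]
      rw [this]
      have h2 := ((hasDerivAt_id s).smul_const u).add_const (t • w) |>.const_add x
      simpa using h2
    exact ((hf.differentiable one_ne_zero) (φ (s, t))).hasFDerivAt.comp_hasDerivAt s h1
  have hcont : Continuous fun z => fderiv ℝ f (φ z) u :=
    ((hf.continuous_fderiv one_ne_zero).comp planeChart_continuous).clm_apply continuous_const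
  have hmain := P.integral_deriv (f := fun z => f (φ z)) (g := fun z => fderiv ℝ f (φ z) u)
    (hf.continuous.comp planeChart_continuous) hcont hd
  have hset : {z : ℝ × ℝ | ∀ i ∈ I, 0 ≤ a i * z.1 + b i * z.2 + c i} = φ ⁻¹' closure K := by
    ext z; exact hQ z
  rw [hset, ← integral_planeChart hL isClosed_closure.measurableSet hplane
    (fun z => fderiv ℝ f z u), setIntegral_congr_set (Hc.closure_ae_eq H)] at hmain
  rw [hmain, hJ, Finset.sum_image fun e he e' he' hee => by
    rw [(Hc.edgeVertex_spec he).2, (Hc.edgeVertex_spec he').2, hee]]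
  refine Finset.sum_congr rfl fun e he => ?_
  set i := D.edgeVertex K e with hi
  have hiJ : i ∈ J := Finset.mem_image_of_mem _ he
  have hEe : E i = e := (Hc.edgeVertex_spec he).2.symm
  obtain ⟨h1, h2⟩ := hends i hiJ
  rw [hEe] at h1 h2
  -- (a, b) are the plane coordinates of the tangential gradient; hence the outward unit normal of
  -- the polygon is the conormal of the cell.
  have hwnorm : ‖tanProj n (affGrad (bary T i))‖ = √(a i ^ 2 + b i ^ 2) := by
    obtain ⟨y, hy⟩ := (hL _).mp (inner_tanProj_self (Hc.norm_cellNrm H) (affGrad (bary T i)))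
    have e0 : a i = y 0 := by
      rw [ha]; simp only
      rw [← inner_tanProj_of_orthogonal (inner_isometry hL _), ← hy, L.inner_map_map]
      simp [PiLp.inner_apply, Fin.sum_univ_two]
    have e1 : b i = y 1 := by
      rw [hb]; simp only
      rw [← inner_tanProj_of_orthogonal (inner_isometry hL _), ← hy, L.inner_map_map]
      simp [PiLp.inner_apply, Fin.sum_univ_two]
    rw [← hy, L.norm_map, EuclideanSpace.norm_eq, e0, e1]
    simp [Fin.sum_univ_two]
  have hcon : inner ℝ (D.conormal K e) u = -(a i / √(a i ^ 2 + b i ^ 2)) := by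
    rw [CutData.conormal, inner_neg_left, real_inner_smul_left, ← hi, ← hT, ← hn, hwnorm,
      inner_tanProj_of_orthogonal (inner_isometry hL _), inv_mul_eq_div]
  have hline : ∀ θ : ℝ, φ (ψ (segEnds e).1 + θ • (ψ (segEnds e).2 - ψ (segEnds e).1)) =
      (segEnds e).1 + θ • ((segEnds e).2 - (segEnds e).1) := fun θ => by
    rw [hφ, planeChart_combo, ← hφ, h1, h2]
  have hlen := norm_planeChart_sub (L := L) (x := x) (ψ (segEnds e).1) (ψ (segEnds e).2)
  rw [← hφ, h1, h2] at hlen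
  simp only [hEe, hline]
  rw [hcon, segIntegral, hlen]

end CellData

end CellDivergence

/-! ### The divergence of `v² β` -/

section Divergence

open Module

/-- An orthonormal basis adapted to a plane. -/
theorem exists_onb {n : E3} (hn : ‖n‖ = 1) {L : E2 →ₗᵢ[ℝ] E3}
    (hL : ∀ z, inner ℝ n z = 0 ↔ z ∈ range L) :
    ∃ b : OrthonormalBasis (Fin 3) ℝ E3, b 0 = n ∧ b 1 = L !₂[1, 0] ∧ b 2 = L !₂[0, 1] := by
  have hon : Orthonormal ℝ ![n, L !₂[1, 0], L !₂[0, 1]] := by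
    rw [orthonormal_iff_ite]
    have h1 : ∀ y, inner ℝ n (L y) = 0 := inner_isometry hL
    have h2 : ∀ y, inner ℝ (L y) n = 0 := fun y => by rw [real_inner_comm]; exact h1 y
    intro i j
    fin_cases i <;> fin_cases j <;>
      simp [h1, h2, hn, L.inner_map_map, PiLp.inner_apply, Fin.sum_univ_two, EuclideanSpace.norm_eq]
  have hspan : ⊤ ≤ Submodule.span ℝ (range ![n, L !₂[1, 0], L !₂[0, 1]]) :=
    (hon.linearIndependent.span_eq_top_of_card_eq_finrank' (by simp)).ge
  exact ⟨OrthonormalBasis.mk hon hspan, by simp, by simp, by simp⟩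

theorem exists_planeIsometry_swap (L : E2 →ₗᵢ[ℝ] E3) : ∃ L' : E2 →ₗᵢ[ℝ] E3, range L' = range L ∧
    L' !₂[1, 0] = L !₂[0, 1] := by
  set s : E2 ≃ₗᵢ[ℝ] E2 := LinearIsometryEquiv.piLpCongrLeft 2 ℝ ℝ (Equiv.swap 0 1) with hs
  refine ⟨L.comp s.toLinearIsometry, ?_, ?_⟩
  · ext z
    constructor
    · rintro ⟨y, rfl⟩; exact ⟨s y, rfl⟩
    · rintro ⟨y, rfl⟩; exact ⟨s.symm y, by simp⟩
  · simp only [LinearIsometry.coe_comp, Function.comp_apply, LinearIsometryEquiv.coe_toLinearIsometry]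
    congr 1
    ext i
    fin_cases i <;> simp [hs, LinearIsometryEquiv.piLpCongrLeft_apply, Equiv.piCongrLeft']

theorem segIntegral_add (e : Set E3) {f g : E3 → ℝ} (hf : Continuous f) (hg : Continuous g) :
    segIntegral e (fun x => f x + g x) = segIntegral e f + segIntegral e g := by
  rw [segIntegral, segIntegral, segIntegral, intervalIntegral.integral_add, mul_add]
  · exact Continuous.intervalIntegrable (by fun_prop) _ _
  · exact Continuous.intervalIntegrable (by fun_prop) _ _

theorem segIntegral_const_mul (e : Set E3) (c : ℝ) (f : E3 → ℝ) :
    segIntegral e (fun x => c * f x) = c * segIntegral e f := by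
  rw [segIntegral, segIntegral, intervalIntegral.integral_const_mul]; ring

theorem mem_of_eq_segment {e : Set E3} (he : e = segment ℝ (segEnds e).1 (segEnds e).2) {θ : ℝ}
    (hθ : θ ∈ Icc (0 : ℝ) 1) : (segEnds e).1 + θ • ((segEnds e).2 - (segEnds e).1) ∈ e :=
  he.ge (by rw [segment_eq_image']; exact ⟨θ, hθ, rfl⟩)

theorem segIntegral_congr {e : Set E3}
    (he : e = segment ℝ (segEnds e).1 (segEnds e).2) {f g : E3 → ℝ} (hfg : ∀ x ∈ e, f x = g x) :
    segIntegral e f = segIntegral e g := by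
  rw [segIntegral, segIntegral]
  congr 1
  refine intervalIntegral.integral_congr fun θ hθ => hfg _ ?_
  rw [uIcc_of_le zero_le_one] at hθ
  exact mem_of_eq_segment he hθ

theorem abs_segIntegral_le {e : Set E3}
    (he : e = segment ℝ (segEnds e).1 (segEnds e).2) {f : E3 → ℝ} {M l : ℝ}
    (hl : ‖(segEnds e).2 - (segEnds e).1‖ ≤ l)
    (hf : ∀ x ∈ e, |f x| ≤ M) : |segIntegral e f| ≤ l * M := by
  rw [segIntegral, abs_mul, abs_norm]
  refine mul_le_mul hl ?_ (abs_nonneg _) ((norm_nonneg _).trans hl)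
  have := intervalIntegral.norm_integral_le_of_norm_le_const (a := 0) (b := 1) (C := M)
    (f := fun θ : ℝ => f ((segEnds e).1 + θ • ((segEnds e).2 - (segEnds e).1))) fun θ hθ => by
      rw [uIoc_of_le zero_le_one] at hθ
      exact hf _ (mem_of_eq_segment he ⟨hθ.1.le, hθ.2⟩)
  simpa using this

/-- The derivative of `g² (β · u)`. -/
theorem fderiv_sq_mul_inner (g : E3 →ᵃ[ℝ] ℝ) (β : E3 →ᵃ[ℝ] E3) (u : E3) :
    ContDiff ℝ 1 (fun x => g x ^ 2 * inner ℝ (β x) u) ∧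
    ∀ x w, fderiv ℝ (fun x => g x ^ 2 * inner ℝ (β x) u) x w =
      2 * g x * inner ℝ (affGrad g) w * inner ℝ (β x) u + g x ^ 2 * inner ℝ (β.linear w) u := by
  set A : E3 →L[ℝ] E3 := LinearMap.toContinuousLinearMap β.linear with hA
  have hg : ∀ x, g x = g 0 + innerSL ℝ (affGrad g) x := fun x => by
    rw [affine_eq g 0 x, sub_zero]; rfl
  have hβ : ∀ x, inner ℝ (β x) u = inner ℝ (β 0) u + ((innerSL ℝ u).comp A) x := fun x => by
    have h1 : β x = β 0 + β.linear x := by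
      have := β.map_vadd 0 x
      simpa [add_comm] using this
    rw [h1, inner_add_left]
    congr 1
    exact (real_inner_comm _ _)
  have hf : (fun x => g x ^ 2 * inner ℝ (β x) u) = fun x => (g 0 + innerSL ℝ (affGrad g) x) ^ 2 *
      (inner ℝ (β 0) u + ((innerSL ℝ u).comp A) x) := by
    funext x; rw [hg x, hβ x]
  refine ⟨?_, fun x w => ?_⟩
  · rw [hf]
    exact ((contDiff_const.add (innerSL ℝ (affGrad g)).contDiff).pow 2).mul
      (contDiff_const.add ((innerSL ℝ u).comp A).contDiff)
  · have h1 := (((innerSL ℝ (affGrad g)).hasFDerivAt (x := x)).const_add (g 0)).pow 2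
    have h2 := (((innerSL ℝ u).comp A).hasFDerivAt (x := x)).const_add (inner ℝ (β 0) u)
    have h3 := (h1.mul h2).fderiv
    rw [hf]
    rw [show (fun x => (g 0 + innerSL ℝ (affGrad g) x) ^ 2 *
      (inner ℝ (β 0) u + ((innerSL ℝ u).comp A) x)) = ((fun x => (g 0 + innerSL ℝ (affGrad g) x) ^ 2) *
      fun x => (inner ℝ (β 0) u + ((innerSL ℝ u).comp A) x)) from rfl, h3]
    rw [← hg x, ← hβ x]
    have h4 : inner ℝ u (A w) = inner ℝ (β.linear w) u := real_inner_comm _ _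
    simp [h4]
    ring

namespace CellData

variable {D : CutData} {K : Set E3} {I : Finset E3} (Hc : CellData D K I)
  {F : E3 → ℝ} {U : Set E3} {h σ C R : ℝ} (H : FineSurface D F U h σ C R)
include Hc H

/-- Apply `integral_fderiv` to g²(β·u) for u running through two orthonormal tangent vectors and
add; the tangential trace of the derivative is the surface divergence. -/
theorem integral_divergence (g : E3 →ᵃ[ℝ] ℝ) (β : E3 →ᵃ[ℝ] E3) :
    ∫ x in K, (2 * (inner ℝ (β x) (tanProj (D.cellNrm K) (affGrad g)) * g x) +
      tanDiv (D.cellNrm K) β.linear * g x ^ 2) ∂μHE[2] =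
      ∑ e ∈ D.edges K, segIntegral e fun x => inner ℝ (D.conormal K e) (β x) * g x ^ 2 := by
  have hn := Hc.norm_cellNrm H
  obtain ⟨L, hL⟩ := exists_planeIsometry hn
  -- `integral_fderiv` differentiates in the first chart direction only; swapping the coordinates
  -- supplies the second.
  obtain ⟨L', hr, hL'⟩ := exists_planeIsometry_swap L
  obtain ⟨b, hb0, hb1, hb2⟩ := exists_onb hn hL
  obtain ⟨hc1, hd1⟩ := fderiv_sq_mul_inner g β (L !₂[1, 0])
  obtain ⟨hc2, hd2⟩ := fderiv_sq_mul_inner g β (L !₂[0, 1])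
  have h1 := Hc.integral_fderiv H hL hc1
  have h2 := Hc.integral_fderiv H (L := L') (by rw [hr]; exact hL) hc2
  rw [hL'] at h2
  have hsum : ∀ x y : E3, inner ℝ x y = inner ℝ x (b 0) * inner ℝ y (b 0) +
      inner ℝ x (b 1) * inner ℝ y (b 1) + inner ℝ x (b 2) * inner ℝ y (b 2) := by
    intro x y
    have := b.sum_inner_mul_inner x y
    rw [Fin.sum_univ_three] at this
    rw [← this, real_inner_comm y (b 0), real_inner_comm y (b 1), real_inner_comm y (b 2)]
  have htr : tanDiv (D.cellNrm K) β.linear =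
      inner ℝ (β.linear (b 1)) (b 1) + inner ℝ (β.linear (b 2)) (b 2) := by
    rw [tanDiv, LinearMap.trace_eq_sum_inner _ b, Fin.sum_univ_three, hb0,
      real_inner_comm (β.linear (b 1)), real_inner_comm (β.linear (b 2))]
    ring
  have hgc := affine_continuous g
  have hβc : Continuous β := β.continuous_of_finiteDimensional
  have hint : ∀ u w : E3, IntegrableOn (fun x => 2 * g x * inner ℝ (affGrad g) w * inner ℝ (β x) u +
      g x ^ 2 * inner ℝ (β.linear w) u) K (μHE[2] : Measure E3) := fun u w =>
    Hc.integrableOn H (by fun_prop)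
  calc _ = ∫ x in K, (fderiv ℝ (fun x => g x ^ 2 * inner ℝ (β x) (L !₂[1, 0])) x (L !₂[1, 0]) +
        fderiv ℝ (fun x => g x ^ 2 * inner ℝ (β x) (L !₂[0, 1])) x (L !₂[0, 1])) ∂μHE[2] := by
        refine integral_congr_ae (Filter.Eventually.of_forall fun x => ?_)
        simp only
        rw [hd1, hd2, htr, tanProj_apply, inner_sub_right, real_inner_smul_right,
          hsum (β x) (affGrad g), hb0, hb1, hb2, real_inner_comm (affGrad g) (D.cellNrm K)]
        ring
    _ = ∑ e ∈ D.edges K, (inner ℝ (D.conormal K e) (L !₂[1, 0]) *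
          segIntegral e (fun x => g x ^ 2 * inner ℝ (β x) (L !₂[1, 0])) +
        inner ℝ (D.conormal K e) (L !₂[0, 1]) *
          segIntegral e (fun x => g x ^ 2 * inner ℝ (β x) (L !₂[0, 1]))) := by
        rw [Finset.sum_add_distrib, ← h1, ← h2]
        simp only [hd1, hd2]
        exact integral_add (hint _ _) (hint _ _)
    _ = _ := by
        refine Finset.sum_congr rfl fun e he => ?_
        rw [← segIntegral_const_mul, ← segIntegral_const_mul,
          ← segIntegral_add _ (by fun_prop) (by fun_prop)]
        refine segIntegral_congr (Hc.edge_eq_segment H he).2 fun x _ => ?_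
        -- The conormal has no component along n, so the two tangential terms add up to the full
        -- inner product with β.
        have h0 : inner ℝ (D.conormal K e) (b 0) = 0 := by
          rw [hb0]; exact (Hc.isConormal H he).2.1
        rw [hsum (D.conormal K e) (β x), h0, hb1, hb2]
        ring

end CellData

end Divergence

/-! ### The sum of the edge integrals -/

section Jumps

/-- The sum of c i + c j over ordered pairs of distinct indices is 2(m-1) times the sum of the c i.
So any number m ≥ 2 of cells may share an edge; a single cell would give no cancellation. -/
theorem abs_sum_le_of_pairwise {ι : Type*} [DecidableEq ι] {s : Finset ι} (hs : 2 ≤ s.card)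
    {c : ι → ℝ} {δ : ℝ} (h : ∀ i ∈ s, ∀ j ∈ s, i ≠ j → |c i + c j| ≤ δ) :
    |∑ i ∈ s, c i| ≤ s.card * δ := by
  set m : ℝ := (s.card : ℝ) with hm
  have hm2 : (2 : ℝ) ≤ m := by rw [hm]; exact_mod_cast hs
  have hδ : 0 ≤ δ := by
    obtain ⟨i, hi, j, hj, hij⟩ := Finset.one_lt_card.mp (by omega : 1 < s.card)
    exact (abs_nonneg _).trans (h i hi j hj hij)
  have h1 : ∑ i ∈ s, ∑ j ∈ s.erase i, (c i + c j) = 2 * (m - 1) * ∑ i ∈ s, c i := by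
    have h2 : ∀ i ∈ s, ∑ j ∈ s.erase i, (c i + c j) = (m - 2) * c i + ∑ j ∈ s, c j := by
      intro i hi
      rw [Finset.sum_add_distrib, Finset.sum_const, nsmul_eq_mul, Finset.card_erase_of_mem hi,
        ← Finset.add_sum_erase s c hi, Nat.cast_sub (by omega)]
      push_cast
      ring
    rw [Finset.sum_congr rfl h2, Finset.sum_add_distrib, ← Finset.mul_sum, Finset.sum_const,
      nsmul_eq_mul]
    ring
  have h3 : |∑ i ∈ s, ∑ j ∈ s.erase i, (c i + c j)| ≤ m * ((m - 1) * δ) := by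
    refine (Finset.abs_sum_le_sum_abs _ _).trans ?_
    refine (Finset.sum_le_card_nsmul s _ ((m - 1) * δ) fun i hi => ?_).trans (by rw [nsmul_eq_mul])
    refine (Finset.abs_sum_le_sum_abs _ _).trans ?_
    refine (Finset.sum_le_card_nsmul _ _ δ fun j hj =>
      h i hi j (Finset.mem_of_mem_erase hj) (Finset.ne_of_mem_erase hj).symm).trans ?_
    rw [nsmul_eq_mul, Finset.card_erase_of_mem hi, Nat.cast_sub (by omega)]
    push_cast
    exact le_rfl
  rw [h1, abs_mul, abs_of_pos (by linarith)] at h3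
  have h4 : (m - 1) * (2 * |∑ i ∈ s, c i|) ≤ (m - 1) * (m * δ) := by linarith
  have h5 := le_of_mul_le_mul_left h4 (by linarith)
  linarith [abs_nonneg (∑ i ∈ s, c i)]

namespace IsTet

/-- Cauchy–Schwarz together with b² ≤ b for barycentric coordinates, which sum to 1. -/
theorem interp_sq_le {T : Finset E3} (hT : IsTet T) (v : E3 → ℝ) {x : E3} (hx : x ∈ hull T) :
    interp T v x ^ 2 ≤ ∑ a ∈ T, v a ^ 2 := by
  rw [hT.interp_eq_sum v x]
  have h0 := hT.mem_hull_iff.mp hx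
  refine (Finset.sum_mul_sq_le_sq_mul_sq T v fun a => bary T a x).trans ?_
  refine mul_le_of_le_one_right (Finset.sum_nonneg fun a _ => sq_nonneg _) ?_
  rw [← hT.sum_bary x]
  refine Finset.sum_le_sum fun a ha => ?_
  nlinarith [h0 a ha, hT.bary_le_one hx ha]

end IsTet

namespace FineSurface

variable {D : CutData} {F : E3 → ℝ} {U : Set E3} {h σ C R : ℝ} (H : FineSurface D F U h σ C R)
include H

theorem card_edges_le {K : Set E3} (hK : K ∈ D.cells) : ((D.edges K).card : ℝ) ≤ 4 := by
  classical
  obtain ⟨I, Hc⟩ := H.exists_cellData hK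
  have h1 : (D.edges K).card ≤ (D.tetOf K).card :=
    (Finset.card_filter_le _ _).trans Finset.card_image_le
  rw [Hc.isTet.card_eq] at h1
  exact_mod_cast h1

/-- A sum over cells is bounded by a sum over tetrahedra. -/
theorem sum_cells_le {Q : Finset E3 → ℝ} (hQ : ∀ T ∈ D.active, 0 ≤ Q T) :
    ∑ K ∈ D.cells, Q (D.tetOf K) ≤ 16 * ∑ T ∈ D.active, Q T := by
  classical
  rw [← Finset.sum_fiberwise_of_maps_to (s := D.cells) (t := D.active) (g := D.tetOf)
    (fun K hK => (H.exists_cellData hK).choose_spec.mem), Finset.mul_sum]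
  refine Finset.sum_le_sum fun T hT => ?_
  rw [Finset.sum_congr rfl fun K hK => by rw [(Finset.mem_filter.mp hK).2], Finset.sum_const,
    nsmul_eq_mul]
  exact mul_le_mul_of_nonneg_right (H.card_cells_tet_le hT) (hQ T hT)

/-- Group the integrals by edges. As v is continuous, v² is a common factor of the fluxes at an
edge, and the fluxes cancel up to O(h²) because a second cell exists. The length of the edge gives
the third power of h; 64 is four edges per cell times 16 cells per tetrahedron. -/
theorem abs_sum_edges_le {a₀ Cb : ℝ} (hB : D.CoeffStable h a₀ Cb) {v : E3 → ℝ} (hv : D.IsPL v) :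
    |∑ K ∈ D.cells, ∑ e ∈ D.edges K, segIntegral e fun x =>
      inner ℝ (D.conormal K e) (D.beta K x) * interp (D.tetOf K) v x ^ 2| ≤
      64 * σ * |Cb| * h ^ 3 * ∑ T ∈ D.active, ∑ a ∈ T, v a ^ 2 := by
  classical
  have hh := H.h_pos
  have hσ := H.σ_pos
  set δ := |Cb| * h ^ 2 with hδ
  have hδ0 : 0 ≤ δ := by positivity
  set M : Finset E3 → ℝ := fun T => ∑ a ∈ T, v a ^ 2 with hM
  have hM0 : ∀ T, 0 ≤ M T := fun T => Finset.sum_nonneg fun a _ => sq_nonneg _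
  set E := D.cells.biUnion D.edges with hE
  rw [Finset.sum_comm' (t' := E) (s' := fun e => D.cells.filter fun K => e ∈ D.edges K) (by
    intro K e
    simp only [Finset.mem_filter, hE, Finset.mem_biUnion]
    exact ⟨fun h => ⟨h, K, h⟩, fun h => h.1⟩)]
  have hedge : ∀ e ∈ E, |∑ K ∈ D.cells with e ∈ D.edges K, segIntegral e fun x =>
      inner ℝ (D.conormal K e) (D.beta K x) * interp (D.tetOf K) v x ^ 2| ≤
      σ * h * (δ * ∑ K ∈ D.cells with e ∈ D.edges K, M (D.tetOf K)) := by
    intro e he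
    obtain ⟨K₀, hK₀, he₀⟩ := Finset.mem_biUnion.mp he
    obtain ⟨I₀, Hc₀⟩ := H.exists_cellData hK₀
    obtain ⟨hne, hseg⟩ := Hc₀.edge_eq_segment H he₀
    set s := D.cells.filter fun K => e ∈ D.edges K with hs
    have hsub : ∀ K ∈ s, e ⊆ hull (D.tetOf K) := by
      intro K hK
      obtain ⟨hKc, heK⟩ := Finset.mem_filter.mp hK
      obtain ⟨I, Hc⟩ := H.exists_cellData hKc
      obtain ⟨a, -, hea, -⟩ := Hc.mem_edges_iff.mp heK
      intro x hx
      rw [hea] at hx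
      exact (Hc.mem_closure_iff.mp hx.1).1
    have hact : ∀ K ∈ s, D.tetOf K ∈ D.active := fun K hK =>
      (H.exists_cellData (Finset.mem_filter.mp hK).1).choose_spec.mem
    have hK₀s : K₀ ∈ s := Finset.mem_filter.mpr ⟨hK₀, he₀⟩
    set g := interp (D.tetOf K₀) v with hg
    have hgK : ∀ K ∈ s, ∀ x ∈ e, interp (D.tetOf K) v x = g x := fun K hK x hx => by
      rw [← hv _ (hact K hK) x (hsub K hK hx), hv _ (hact K₀ hK₀s) x (hsub K₀ hK₀s hx)]
    have hcard : 2 ≤ s.card := by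
      obtain ⟨K', hK', hne', he'⟩ := H.exists_neighbour hK₀ he₀
      exact Finset.one_lt_card.mpr ⟨K₀, hK₀s, K', Finset.mem_filter.mpr ⟨hK', he'⟩, hne'.symm⟩
    have hsum : ∀ x ∈ e, |∑ K ∈ s, inner ℝ (D.conormal K e) (D.beta K x)| ≤ s.card * δ := by
      intro x hx
      refine abs_sum_le_of_pairwise hcard fun K hK K' hK' hKK => ?_
      obtain ⟨hKc, heK⟩ := Finset.mem_filter.mp hK
      obtain ⟨hKc', heK'⟩ := Finset.mem_filter.mp hK'
      obtain ⟨I, Hc⟩ := H.exists_cellData hKc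
      obtain ⟨I', Hc'⟩ := H.exists_cellData hKc'
      have hint := H.closure_inter_closure hKc hKc' hKK heK heK'
      have h1 := hB.jump K hKc K' hKc' hKK
      rw [hint] at h1
      obtain ⟨a, -, -, hnt⟩ := Hc.mem_edges_iff.mp heK
      refine (h1 hnt _ _ (Hc.isConormal H heK) (Hc'.isConormal H heK') x hx).trans ?_
      exact mul_le_mul_of_nonneg_right (le_abs_self _) (by positivity)
    have hlin : ∑ K ∈ s, segIntegral e (fun x =>
        inner ℝ (D.conormal K e) (D.beta K x) * interp (D.tetOf K) v x ^ 2) =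
        segIntegral e fun x => (∑ K ∈ s, inner ℝ (D.conormal K e) (D.beta K x)) * g x ^ 2 := by
      rw [Finset.sum_congr rfl fun K hK => segIntegral_congr hseg fun x hx => by rw [hgK K hK x hx]]
      simp only [segIntegral]
      rw [← Finset.mul_sum, ← intervalIntegral.integral_finsetSum]
      · simp only [Finset.sum_mul]
      · intro K _
        have hgc := affine_continuous g
        have hβc : Continuous (D.beta K) := (D.beta K).continuous_of_finiteDimensional
        exact Continuous.intervalIntegrable (by fun_prop) _ _
    rw [hlin]
    refine abs_segIntegral_le hseg ?_ fun x hx => ?_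
    · rw [← dist_eq_norm]
      have h0 := hsub K₀ hK₀s
      exact TetMesh.dist_le_of_mem_hull H.quasi (mem_tets (hact K₀ hK₀s))
        (h0 (hseg.ge (right_mem_segment ℝ _ _))) (h0 (hseg.ge (left_mem_segment ℝ _ _)))
    · rw [abs_mul, abs_of_nonneg (sq_nonneg (g x)), Finset.mul_sum]
      calc _ ≤ s.card * δ * g x ^ 2 := by gcongr; exact hsum x hx
        _ = ∑ K ∈ s, δ * g x ^ 2 := by rw [Finset.sum_const, nsmul_eq_mul]; ring
        _ ≤ _ := Finset.sum_le_sum fun K hK => by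
            rw [← hgK K hK x hx]
            exact mul_le_mul_of_nonneg_left ((isTet (hact K hK)).interp_sq_le v (hsub K hK hx)) hδ0
  have hcomm : ∑ e ∈ E, ∑ K ∈ D.cells with e ∈ D.edges K, M (D.tetOf K) =
      ∑ K ∈ D.cells, ∑ e ∈ D.edges K, M (D.tetOf K) := by
    refine (Finset.sum_comm' ?_).symm
    intro K e
    simp only [Finset.mem_filter, hE, Finset.mem_biUnion]
    exact ⟨fun h => ⟨h, K, h⟩, fun h => h.1⟩
  calc _ ≤ ∑ e ∈ E, σ * h * (δ * ∑ K ∈ D.cells with e ∈ D.edges K, M (D.tetOf K)) :=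
        (Finset.abs_sum_le_sum_abs _ _).trans (Finset.sum_le_sum hedge)
    _ = σ * h * (δ * ∑ K ∈ D.cells, ∑ e ∈ D.edges K, M (D.tetOf K)) := by
        rw [← Finset.mul_sum, ← Finset.mul_sum, hcomm]
    _ ≤ σ * h * (δ * (4 * ∑ K ∈ D.cells, M (D.tetOf K))) := by
        gcongr
        rw [Finset.mul_sum]
        refine Finset.sum_le_sum fun K hK => ?_
        rw [Finset.sum_const, nsmul_eq_mul]
        exact mul_le_mul_of_nonneg_right (H.card_edges_le hK) (hM0 _)
    _ ≤ σ * h * (δ * (4 * (16 * ∑ T ∈ D.active, M T))) := by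
        gcongr
        exact H.sum_cells_le fun T _ => hM0 T
    _ = _ := by rw [hδ]; ring

end FineSurface

end Jumps

/-! ### The bilinear form on piecewise linear functions -/

section Bilinear

theorem CutData.isTet (D : CutData) {T : Finset E3} (hT : T ∈ D.active) : IsTet T :=
  TetMesh.isTet (D.mem_active.mp hT).1

namespace IsTet

variable {T : Finset E3} (hT : IsTet T)
include hT

theorem interp_add (v w : E3 → ℝ) (x : E3) :
    interp T (v + w) x = interp T v x + interp T w x := by
  simp only [hT.interp_eq_sum, Pi.add_apply, add_mul, Finset.sum_add_distrib]

theorem interp_smul (c : ℝ) (v : E3 → ℝ) (x : E3) : interp T (c • v) x = c * interp T v x := by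
  simp only [hT.interp_eq_sum, Pi.smul_apply, smul_eq_mul, Finset.mul_sum, mul_assoc]

theorem elemGrad_eq_sum (v : E3 → ℝ) : elemGrad T v = ∑ a ∈ T, v a • affGrad (bary T a) := by
  rw [elemGrad_eq, hT.affGrad_eq_sum]
  exact Finset.sum_congr rfl fun a ha => by rw [hT.interp_vertex v ha]

theorem elemGrad_add (v w : E3 → ℝ) : elemGrad T (v + w) = elemGrad T v + elemGrad T w := by
  simp only [hT.elemGrad_eq_sum, Pi.add_apply, add_smul, Finset.sum_add_distrib]

theorem elemGrad_smul (c : ℝ) (v : E3 → ℝ) : elemGrad T (c • v) = c • elemGrad T v := by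
  simp only [hT.elemGrad_eq_sum, Pi.smul_apply, smul_eq_mul, Finset.smul_sum, mul_smul]

end IsTet

namespace CutData

/-- The space `V_h` of continuous piecewise linear functions. -/
noncomputable def plSpace (D : CutData) : Submodule ℝ (E3 → ℝ) where
  carrier := {v | D.IsPL v}
  zero_mem' := fun S hS x _ => by
    rw [(D.isTet hS).interp_eq_sum]; simp
  add_mem' := fun hv hw S hS x hx => by
    rw [(D.isTet hS).interp_add, Pi.add_apply, hv S hS x hx, hw S hS x hx]
  smul_mem' := fun c v hv S hS x hx => by
    rw [(D.isTet hS).interp_smul, Pi.smul_apply, smul_eq_mul, hv S hS x hx]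

theorem hat_mem_plSpace (D : CutData) (a : E3) : D.hat a ∈ D.plSpace := fun S hS x hx => by
  rw [D.hat_eqOn a hS hx, (D.isTet hS).interp_eq_sum, (D.isTet hS).interp_eq_sum]
  refine Finset.sum_congr rfl fun b hb => ?_
  rw [D.hat_node a b (Finset.mem_biUnion.mpr ⟨S, hS, hb⟩)]

/-- The integrand of the surface part of `A_h`. -/
noncomputable def density (D : CutData) (ε τ : ℝ) (K : Set E3) (v w : E3 → ℝ) (x : E3) : ℝ :=
  inner ℝ (D.beta K x) (D.surfGrad K v) * w x + D.alpha K x * v x * w x +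
    ε * inner ℝ (D.surfGrad K v) (D.surfGrad K w) +
    τ * ((inner ℝ (D.beta K x) (D.surfGrad K v) + D.alpha K x * v x) *
      inner ℝ (D.beta K x) (D.surfGrad K w))

/-- The normal gradient terms of `A_h`. -/
noncomputable def normalForm (D : CutData) (v w : E3 → ℝ) : ℝ :=
  ∑ T ∈ D.active, volume.real (hull T) *
    (inner ℝ (D.nrm T) (elemGrad T v) * inner ℝ (D.nrm T) (elemGrad T w))

end CutData

namespace FineSurface

variable {D : CutData} {F : E3 → ℝ} {U : Set E3} {h σ C R : ℝ} (H : FineSurface D F U h σ C R)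
include H

theorem continuousOn_closure {v : E3 → ℝ} (hv : D.IsPL v) {K : Set E3} (hK : K ∈ D.cells) :
    ContinuousOn v (closure K) := by
  obtain ⟨I, Hc⟩ := H.exists_cellData hK
  exact (affine_continuous (interp (D.tetOf K) v)).continuousOn.congr fun x hx =>
    hv _ Hc.mem x (Hc.mem_closure_iff.mp hx).1

theorem integrableOn_density (ε τ : ℝ) {v w : E3 → ℝ} (hv : D.IsPL v) (hw : D.IsPL w)
    {K : Set E3} (hK : K ∈ D.cells) : IntegrableOn (D.density ε τ K v w) K μHE[2] := by
  obtain ⟨I, Hc⟩ := H.exists_cellData hK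
  have hcv := H.continuousOn_closure hv hK
  have hcw := H.continuousOn_closure hw hK
  have hα := affine_continuous (D.alpha K)
  have hβ : Continuous (D.beta K) := (D.beta K).continuous_of_finiteDimensional
  refine Hc.integrableOn H ?_
  unfold CutData.density
  fun_prop

/-- All surface terms become one integral per cell, and the element gradients are constant, so the
normal term is a weighted sum with the volumes as weights. -/
theorem Ah_eq (ε τ₁ τ₂ γ : ℝ) {v w : E3 → ℝ} (hv : D.IsPL v) (hw : D.IsPL w) :
    D.Ah ε τ₁ τ₂ h γ v w = ∑ K ∈ D.cells, ∫ x in K, D.density ε (τ₁ * h) K v w x ∂μHE[2] +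
      τ₂ * h ^ γ * D.normalForm v w := by
  have h2 : D.sh2 τ₂ h γ v w = τ₂ * h ^ γ * D.normalForm v w := by
    rw [CutData.sh2, CutData.normalForm]
    simp only [setIntegral_const, smul_eq_mul]
  rw [CutData.Ah, h2, CutData.ah, CutData.sh1, Finset.mul_sum, ← Finset.sum_add_distrib]
  refine congrArg (· + _) (Finset.sum_congr rfl fun K hK => ?_)
  obtain ⟨I, Hc⟩ := H.exists_cellData hK
  have hcv := H.continuousOn_closure hv hK
  have hcw := H.continuousOn_closure hw hK
  have hα := affine_continuous (D.alpha K)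
  have hβ : Continuous (D.beta K) := (D.beta K).continuous_of_finiteDimensional
  rw [← integral_const_mul, ← integral_add (Hc.integrableOn H (by fun_prop))
    (Hc.integrableOn H (by fun_prop))]
  rfl

theorem surfGrad_add {K : Set E3} (hK : K ∈ D.cells) (v w : E3 → ℝ) :
    D.surfGrad K (v + w) = D.surfGrad K v + D.surfGrad K w := by
  obtain ⟨I, Hc⟩ := H.exists_cellData hK
  rw [CutData.surfGrad, Hc.isTet.elemGrad_add, map_add]; rfl

theorem surfGrad_smul {K : Set E3} (hK : K ∈ D.cells) (c : ℝ) (v : E3 → ℝ) :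
    D.surfGrad K (c • v) = c • D.surfGrad K v := by
  obtain ⟨I, Hc⟩ := H.exists_cellData hK
  rw [CutData.surfGrad, Hc.isTet.elemGrad_smul, map_smul]; rfl

theorem Ah_add_left (ε τ₁ τ₂ γ : ℝ) {v v' w : E3 → ℝ} (hv : D.IsPL v) (hv' : D.IsPL v')
    (hw : D.IsPL w) :
    D.Ah ε τ₁ τ₂ h γ (v + v') w = D.Ah ε τ₁ τ₂ h γ v w + D.Ah ε τ₁ τ₂ h γ v' w := by
  rw [H.Ah_eq _ _ _ _ (D.plSpace.add_mem hv hv') hw, H.Ah_eq _ _ _ _ hv hw,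
    H.Ah_eq _ _ _ _ hv' hw]
  have h1 : D.normalForm (v + v') w = D.normalForm v w + D.normalForm v' w := by
    simp only [CutData.normalForm, ← Finset.sum_add_distrib]
    refine Finset.sum_congr rfl fun T hT => ?_
    rw [(D.isTet hT).elemGrad_add, inner_add_right]
    ring
  have h2 : ∀ K ∈ D.cells, ∫ x in K, D.density ε (τ₁ * h) K (v + v') w x ∂μHE[2] =
      ∫ x in K, D.density ε (τ₁ * h) K v w x ∂μHE[2] +
        ∫ x in K, D.density ε (τ₁ * h) K v' w x ∂μHE[2] := fun K hK => by
    rw [← integral_add (H.integrableOn_density _ _ hv hw hK)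
      (H.integrableOn_density _ _ hv' hw hK)]
    refine integral_congr_ae (Filter.Eventually.of_forall fun x => ?_)
    simp only [CutData.density, H.surfGrad_add hK, inner_add_right, inner_add_left, Pi.add_apply]
    ring
  rw [Finset.sum_congr rfl h2, Finset.sum_add_distrib, h1]
  ring

theorem Ah_smul_left (ε τ₁ τ₂ γ c : ℝ) {v w : E3 → ℝ} (hv : D.IsPL v) (hw : D.IsPL w) :
    D.Ah ε τ₁ τ₂ h γ (c • v) w = c * D.Ah ε τ₁ τ₂ h γ v w := by
  rw [H.Ah_eq _ _ _ _ (D.plSpace.smul_mem c hv) hw, H.Ah_eq _ _ _ _ hv hw]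
  have h1 : D.normalForm (c • v) w = c * D.normalForm v w := by
    simp only [CutData.normalForm, Finset.mul_sum]
    refine Finset.sum_congr rfl fun T hT => ?_
    rw [(D.isTet hT).elemGrad_smul, real_inner_smul_right]
    ring
  have h2 : ∀ K ∈ D.cells, ∫ x in K, D.density ε (τ₁ * h) K (c • v) w x ∂μHE[2] =
      c * ∫ x in K, D.density ε (τ₁ * h) K v w x ∂μHE[2] := fun K hK => by
    rw [← integral_const_mul]
    refine integral_congr_ae (Filter.Eventually.of_forall fun x => ?_)
    simp only [CutData.density, H.surfGrad_smul hK, real_inner_smul_right, real_inner_smul_left,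
      Pi.smul_apply, smul_eq_mul]
    ring
  rw [Finset.sum_congr rfl h2, ← Finset.mul_sum, h1]
  ring

theorem Ah_add_right (ε τ₁ τ₂ γ : ℝ) {v w w' : E3 → ℝ} (hv : D.IsPL v) (hw : D.IsPL w)
    (hw' : D.IsPL w') :
    D.Ah ε τ₁ τ₂ h γ v (w + w') = D.Ah ε τ₁ τ₂ h γ v w + D.Ah ε τ₁ τ₂ h γ v w' := by
  rw [H.Ah_eq _ _ _ _ hv (D.plSpace.add_mem hw hw'), H.Ah_eq _ _ _ _ hv hw,
    H.Ah_eq _ _ _ _ hv hw']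
  have h1 : D.normalForm v (w + w') = D.normalForm v w + D.normalForm v w' := by
    simp only [CutData.normalForm, ← Finset.sum_add_distrib]
    refine Finset.sum_congr rfl fun T hT => ?_
    rw [(D.isTet hT).elemGrad_add, inner_add_right]
    ring
  have h2 : ∀ K ∈ D.cells, ∫ x in K, D.density ε (τ₁ * h) K v (w + w') x ∂μHE[2] =
      ∫ x in K, D.density ε (τ₁ * h) K v w x ∂μHE[2] +
        ∫ x in K, D.density ε (τ₁ * h) K v w' x ∂μHE[2] := fun K hK => by
    rw [← integral_add (H.integrableOn_density _ _ hv hw hK)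
      (H.integrableOn_density _ _ hv hw' hK)]
    refine integral_congr_ae (Filter.Eventually.of_forall fun x => ?_)
    simp only [CutData.density, H.surfGrad_add hK, inner_add_right, Pi.add_apply]
    ring
  rw [Finset.sum_congr rfl h2, Finset.sum_add_distrib, h1]
  ring

theorem Ah_smul_right (ε τ₁ τ₂ γ c : ℝ) {v w : E3 → ℝ} (hv : D.IsPL v) (hw : D.IsPL w) :
    D.Ah ε τ₁ τ₂ h γ v (c • w) = c * D.Ah ε τ₁ τ₂ h γ v w := by
  rw [H.Ah_eq _ _ _ _ hv (D.plSpace.smul_mem c hw), H.Ah_eq _ _ _ _ hv hw]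
  have h1 : D.normalForm v (c • w) = c * D.normalForm v w := by
    simp only [CutData.normalForm, Finset.mul_sum]
    refine Finset.sum_congr rfl fun T hT => ?_
    rw [(D.isTet hT).elemGrad_smul, real_inner_smul_right]
    ring
  have h2 : ∀ K ∈ D.cells, ∫ x in K, D.density ε (τ₁ * h) K v (c • w) x ∂μHE[2] =
      c * ∫ x in K, D.density ε (τ₁ * h) K v w x ∂μHE[2] := fun K hK => by
    rw [← integral_const_mul]
    refine integral_congr_ae (Filter.Eventually.of_forall fun x => ?_)
    simp only [CutData.density, H.surfGrad_smul hK, real_inner_smul_right,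
      Pi.smul_apply, smul_eq_mul]
    ring
  rw [Finset.sum_congr rfl h2, ← Finset.mul_sum, h1]
  ring

/-- The form `A_h` on the space `V_h`. -/
noncomputable def bilin (ε τ₁ τ₂ γ : ℝ) : D.plSpace →ₗ[ℝ] D.plSpace →ₗ[ℝ] ℝ :=
  LinearMap.mk₂ ℝ (fun v w => D.Ah ε τ₁ τ₂ h γ v w)
    (fun v v' w => H.Ah_add_left _ _ _ _ v.2 v'.2 w.2)
    (fun c v w => H.Ah_smul_left _ _ _ _ c v.2 w.2)
    (fun v w w' => H.Ah_add_right _ _ _ _ v.2 w.2 w'.2)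
    (fun c v w => H.Ah_smul_right _ _ _ _ c v.2 w.2)

end FineSurface

namespace CutData

/-- The function in `V_h` with given nodal values. -/
noncomputable def nodal (D : CutData) (ξ : D.nodes → ℝ) : E3 → ℝ := ∑ a, ξ a • D.hat a

theorem isPL_nodal (D : CutData) (ξ : D.nodes → ℝ) : D.IsPL (D.nodal ξ) :=
  D.plSpace.sum_mem fun a _ => D.plSpace.smul_mem _ (D.hat_mem_plSpace a)

theorem nodal_apply (D : CutData) (ξ : D.nodes → ℝ) (b : D.nodes) : D.nodal ξ b = ξ b := by
  rw [nodal, Finset.sum_apply, Finset.sum_eq_single b]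
  · rw [Pi.smul_apply, D.hat_node _ _ b.2, if_pos rfl, smul_eq_mul, mul_one]
  · intro a _ hab
    rw [Pi.smul_apply, D.hat_node _ _ b.2, if_neg fun h => hab (Subtype.ext h.symm), smul_zero]
  · simp

/-- The sum of the squared vertex values over the active tetrahedra. -/
noncomputable def vertexSq (D : CutData) (v : E3 → ℝ) : ℝ := ∑ T ∈ D.active, ∑ a ∈ T, v a ^ 2

theorem vertexSq_nonneg (D : CutData) (v : E3 → ℝ) : 0 ≤ D.vertexSq v :=
  Finset.sum_nonneg fun _ _ => Finset.sum_nonneg fun _ _ => sq_nonneg _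

theorem vertexSq_eq (D : CutData) (v : E3 → ℝ) :
    D.vertexSq v = ∑ a ∈ D.nodes, ((D.active.filter (a ∈ ·)).card : ℝ) * v a ^ 2 := by
  rw [vertexSq, Finset.sum_comm' (t' := D.nodes) (s' := fun a => D.active.filter (a ∈ ·)) (by
    intro T a
    simp only [Finset.mem_filter, nodes, Finset.mem_biUnion, id]
    exact ⟨fun h => ⟨h, T, h⟩, fun h => h.1⟩)]
  exact Finset.sum_congr rfl fun a _ => by rw [Finset.sum_const, nsmul_eq_mul]

theorem norm_sq_le_vertexSq (D : CutData) (ξ : EuclideanSpace ℝ D.nodes) :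
    ‖ξ‖ ^ 2 ≤ D.vertexSq (D.nodal ξ) := by
  rw [EuclideanSpace.real_norm_sq_eq, vertexSq_eq, ← Finset.sum_coe_sort D.nodes]
  refine Finset.sum_le_sum fun a _ => ?_
  rw [D.nodal_apply]
  refine le_mul_of_one_le_left (sq_nonneg _) ?_
  obtain ⟨T, hT, haT⟩ := Finset.mem_biUnion.mp a.2
  have : (D.active.filter ((a : E3) ∈ ·)).Nonempty := ⟨T, Finset.mem_filter.mpr ⟨hT, haT⟩⟩
  exact_mod_cast this.card_pos

end CutData

namespace FineSurface

variable {D : CutData} {F : E3 → ℝ} {U : Set E3} {h σ C R : ℝ} (H : FineSurface D F U h σ C R)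
include H

/-- A node belongs to boundedly many tetrahedra: packing with radius zero. -/
theorem vertexSq_le (ξ : EuclideanSpace ℝ D.nodes) :
    D.vertexSq (D.nodal ξ) ≤ ((σ + 1) * σ) ^ 3 * ‖ξ‖ ^ 2 := by
  rw [EuclideanSpace.real_norm_sq_eq, CutData.vertexSq_eq, ← Finset.sum_coe_sort D.nodes, Finset.mul_sum]
  refine Finset.sum_le_sum fun a _ => ?_
  rw [D.nodal_apply]
  refine mul_le_mul_of_nonneg_right ?_ (sq_nonneg _)
  have := TetMesh.card_near_le H.quasi H.h_pos H.σ_pos le_rfl (a : E3)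
    (D.active.filter ((a : E3) ∈ ·)) (fun T hT => mem_tets (Finset.mem_filter.mp hT).1)
    fun T hT => ⟨a, vertex_mem_hull (Finset.mem_filter.mp hT).2, by simp⟩
  rwa [zero_add] at this

/-- The entry (i, j) has the trial function in the row index, so the left vector of the quadratic
form enters A_h in the first slot. -/
theorem inner_stiffness (ε τ₁ τ₂ γ : ℝ) (ξ η : EuclideanSpace ℝ D.nodes) :
    inner ℝ ξ (Matrix.toEuclideanCLM (𝕜 := ℝ) (D.stiffness ε τ₁ τ₂ h γ) η) =
      D.Ah ε τ₁ τ₂ h γ (D.nodal ξ) (D.nodal η) := by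
  set φ : D.nodes → D.plSpace := fun a => ⟨D.hat a, D.hat_mem_plSpace a⟩ with hφ
  have key : ∀ ζ : D.nodes → ℝ, ((∑ a, ζ a • φ a : D.plSpace) : E3 → ℝ) = D.nodal ζ := fun ζ => by
    rw [CutData.nodal, Submodule.coe_sum]; rfl
  have h1 : D.Ah ε τ₁ τ₂ h γ (D.nodal ξ) (D.nodal η) =
      H.bilin ε τ₁ τ₂ γ (∑ a, ξ a • φ a) (∑ a, η a • φ a) := by
    rw [← key, ← key]; rfl
  rw [h1, LinearMap.map_sum₂, PiLp.inner_apply]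
  refine Finset.sum_congr rfl fun i _ => ?_
  rw [map_smul, LinearMap.smul_apply, map_sum, smul_eq_mul]
  have h2 : (Matrix.toEuclideanCLM (𝕜 := ℝ) (D.stiffness ε τ₁ τ₂ h γ) η) i =
      ∑ j : D.nodes, D.Ah ε τ₁ τ₂ h γ (D.hat i) (D.hat j) * η j := rfl
  rw [h2, RCLike.inner_apply, conj_trivial, mul_comm]
  refine congrArg _ (Finset.sum_congr rfl fun j _ => ?_)
  rw [map_smul, smul_eq_mul, mul_comm]
  rfl

end FineSurface

end Bilinear

/-! ### Continuity and coercivity of the bilinear form -/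

section Bounds

theorem norm_tanProj_le {n : E3} (hn : ‖n‖ = 1) (u : E3) : ‖tanProj n u‖ ≤ ‖u‖ := by
  refine le_of_sq_le_sq ?_ (norm_nonneg u)
  rw [tanProj_apply, norm_sub_sq_real, norm_smul, real_inner_smul_right, real_inner_comm, hn,
    mul_one, Real.norm_eq_abs, sq_abs]
  nlinarith [sq_nonneg (inner ℝ n u)]

namespace CutData

/-- Uniform bounds for the discrete coefficients. -/
structure CoeffBdd (D : CutData) (B : ℝ) : Prop where
  nonneg : 0 ≤ B
  alpha_le : ∀ K ∈ D.cells, ∀ x ∈ K, |D.alpha K x| ≤ B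
  beta_le : ∀ K ∈ D.cells, ∀ x ∈ K, ‖D.beta K x‖ ≤ B

end CutData

namespace FineSurface

variable {D : CutData} {F : E3 → ℝ} {U : Set E3} {h σ C R : ℝ} (H : FineSurface D F U h σ C R)
include H

theorem norm_elemGrad_le {T : Finset E3} (hT : T ∈ D.active) (v : E3 → ℝ) :
    ‖elemGrad T v‖ ≤ 4 * σ / h * √(∑ a ∈ T, v a ^ 2) := by
  have hh := H.h_pos
  have hσ := H.σ_pos
  refine le_of_sq_le_sq ((H.norm_elemGrad_sq_le hT v).trans (le_of_eq ?_)) (by positivity)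
  rw [mul_pow, Real.sq_sqrt (Finset.sum_nonneg fun a _ => sq_nonneg _)]
  ring

theorem abs_density_le {B : ℝ} (hB : D.CoeffBdd B) {ε τ : ℝ} (hε : 0 ≤ ε) (hτ : 0 ≤ τ)
    {v w : E3 → ℝ} (hv : D.IsPL v) (hw : D.IsPL w) {K : Set E3} (hK : K ∈ D.cells) {x : E3}
    (hx : x ∈ K) :
    |D.density ε τ K v w x| ≤ (B * (4 * σ / h) + B + ε * (4 * σ / h) ^ 2 +
      τ * ((B * (4 * σ / h) + B) * (B * (4 * σ / h)))) *
      (√(∑ a ∈ D.tetOf K, v a ^ 2) * √(∑ a ∈ D.tetOf K, w a ^ 2)) := by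
  have hh := H.h_pos
  have hσ := H.σ_pos
  have hB0 := hB.nonneg
  obtain ⟨I, Hc⟩ := H.exists_cellData hK
  have hn := Hc.norm_cellNrm H
  have hval : ∀ u, D.IsPL u → |u x| ≤ √(∑ a ∈ D.tetOf K, u a ^ 2) := fun u hu => by
    refine Real.abs_le_sqrt ?_
    rw [hu _ Hc.mem x (Hc.subset_hull hx)]
    exact Hc.isTet.interp_sq_le u (Hc.subset_hull hx)
  have hgrad : ∀ u : E3 → ℝ, ‖D.surfGrad K u‖ ≤ 4 * σ / h * √(∑ a ∈ D.tetOf K, u a ^ 2) :=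
    fun u => (norm_tanProj_le hn _).trans (H.norm_elemGrad_le Hc.mem u)
  have hα := hB.alpha_le K hK x hx
  have hβ := hB.beta_le K hK x hx
  have hvx := hval v hv
  have hwx := hval w hw
  have hgv := hgrad v
  have hgw := hgrad w
  set P := √(∑ a ∈ D.tetOf K, v a ^ 2)
  set Q := √(∑ a ∈ D.tetOf K, w a ^ 2)
  have hP : 0 ≤ P := Real.sqrt_nonneg _
  have hQ : 0 ≤ Q := Real.sqrt_nonneg _
  set s := 4 * σ / h
  have hs : 0 ≤ s := by positivity
  have hbv : |inner ℝ (D.beta K x) (D.surfGrad K v)| ≤ B * (s * P) :=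
    (abs_real_inner_le_norm _ _).trans (by gcongr)
  have hbw : |inner ℝ (D.beta K x) (D.surfGrad K w)| ≤ B * (s * Q) :=
    (abs_real_inner_le_norm _ _).trans (by gcongr)
  have hvw : |inner ℝ (D.surfGrad K v) (D.surfGrad K w)| ≤ (s * P) * (s * Q) :=
    (abs_real_inner_le_norm _ _).trans (by gcongr)
  have hav : |D.alpha K x * v x| ≤ B * P := by rw [abs_mul]; gcongr
  have hsum : |inner ℝ (D.beta K x) (D.surfGrad K v) + D.alpha K x * v x| ≤ B * (s * P) + B * P :=
    (abs_add_le _ _).trans (add_le_add hbv hav)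
  calc |D.density ε τ K v w x| ≤ B * (s * P) * Q + B * P * Q + ε * ((s * P) * (s * Q)) +
        τ * ((B * (s * P) + B * P) * (B * (s * Q))) := by
        refine (abs_add_le _ _).trans (add_le_add ((abs_add_le _ _).trans (add_le_add
          ((abs_add_le _ _).trans (add_le_add ?_ ?_)) ?_)) ?_)
        · rw [abs_mul]; gcongr
        · rw [abs_mul]; gcongr
        · rw [abs_mul, abs_of_nonneg hε]; gcongr
        · rw [abs_mul, abs_of_nonneg hτ, abs_mul]; gcongr
    _ = _ := by ring

theorem abs_normalForm_le (v w : E3 → ℝ) :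
    |D.normalForm v w| ≤ 8 * σ ^ 5 * volume.real (Metric.ball (0 : E3) 1) * h *
      (D.vertexSq v + D.vertexSq w) := by
  have hh := H.h_pos
  have hσ := H.σ_pos
  set κ := volume.real (Metric.ball (0 : E3) 1)
  have hκ : 0 ≤ κ := measureReal_nonneg
  rw [CutData.vertexSq, CutData.vertexSq, ← Finset.sum_add_distrib, Finset.mul_sum]
  refine (Finset.abs_sum_le_sum_abs _ _).trans (Finset.sum_le_sum fun T hT => ?_)
  have hin : ∀ u : E3 → ℝ, |inner ℝ (D.nrm T) (elemGrad T u)| ≤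
      4 * σ / h * √(∑ a ∈ T, u a ^ 2) := fun u => by
    refine (abs_real_inner_le_norm _ _).trans ?_
    rw [H.norm_nrm T hT, one_mul]
    exact H.norm_elemGrad_le hT u
  have hvol := TetMesh.volume_hull_le H.quasi H.h_pos H.σ_pos (mem_tets hT)
  have hv := hin v
  have hw := hin w
  have hMv : √(∑ a ∈ T, v a ^ 2) ^ 2 = ∑ a ∈ T, v a ^ 2 :=
    Real.sq_sqrt (Finset.sum_nonneg fun a _ => sq_nonneg _)
  have hMw : √(∑ a ∈ T, w a ^ 2) ^ 2 = ∑ a ∈ T, w a ^ 2 :=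
    Real.sq_sqrt (Finset.sum_nonneg fun a _ => sq_nonneg _)
  rw [← hMv, ← hMw]
  set P := √(∑ a ∈ T, v a ^ 2)
  set Q := √(∑ a ∈ T, w a ^ 2)
  have hP : 0 ≤ P := Real.sqrt_nonneg _
  have hQ : 0 ≤ Q := Real.sqrt_nonneg _
  rw [abs_mul, abs_mul, abs_of_nonneg measureReal_nonneg]
  calc _ ≤ (σ * h) ^ 3 * κ * ((4 * σ / h * P) * (4 * σ / h * Q)) := by gcongr
    _ = 8 * σ ^ 5 * κ * h * (2 * P * Q) := by field_simp; ring
    _ ≤ _ := by gcongr; exact two_mul_le_add_sq P Q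

/-- Count powers of h: on a cell the area is h² and a gradient costs h⁻¹, so convection, reaction
and streamline terms are O(h) and diffusion is O(ε). The normal term has h^γ h³ h⁻² ≤ h times τ₂ ≤
C₂(1+ε/h), again C₂(h+ε). -/
theorem abs_Ah_le {B : ℝ} (hB : D.CoeffBdd B) (hh1 : h ≤ 1) {ε τ₁ τ₂ γ τb C₂ : ℝ} (hε : 0 ≤ ε)
    (hτ₁ : 0 ≤ τ₁) (hτb : τ₁ ≤ τb) (hτ₂ : 0 ≤ τ₂) (hC₂ : τ₂ ≤ C₂ * (1 + ε * h⁻¹)) (hγ : 0 ≤ γ)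
    {v w : E3 → ℝ} (hv : D.IsPL v) (hw : D.IsPL w) :
    |D.Ah ε τ₁ τ₂ h γ v w| ≤ (32 * ((4 * σ + 1) * B + 16 * σ ^ 2 +
      τb * ((4 * σ + 1) * B * (B * (4 * σ)))) * (σ ^ 2 * volume.real (Metric.ball (0 : E2) 1)) +
      C₂ * (8 * σ ^ 5 * volume.real (Metric.ball (0 : E3) 1))) *
      (h + ε) * (D.vertexSq v + D.vertexSq w) := by
  have hh := H.h_pos
  have hσ := H.σ_pos
  have hB0 := hB.nonneg
  have hτb0 := hτ₁.trans hτb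
  set κ₂ := volume.real (Metric.ball (0 : E2) 1) with hκ₂
  have hκ₂0 : 0 ≤ κ₂ := measureReal_nonneg
  set κ₃ := volume.real (Metric.ball (0 : E3) 1) with hκ₃
  have hκ₃0 : 0 ≤ κ₃ := measureReal_nonneg
  set Λ₀ := (4 * σ + 1) * B + 16 * σ ^ 2 + τb * ((4 * σ + 1) * B * (B * (4 * σ))) with hΛ₀
  set Λ := B * (4 * σ / h) + B + ε * (4 * σ / h) ^ 2 +
      τ₁ * h * ((B * (4 * σ / h) + B) * (B * (4 * σ / h))) with hΛ
  have hΛ0 : 0 ≤ Λ := by positivity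
  have hΛh : Λ * h ^ 2 ≤ Λ₀ * (h + ε) := by
    have e : Λ * h ^ 2 = (4 * σ * h + h * h) * B + 16 * σ ^ 2 * ε +
        τ₁ * ((4 * σ + h) * B * (B * (4 * σ))) * h := by rw [hΛ]; field_simp; ring
    rw [e]
    have h1 : (4 * σ * h + h * h) * B ≤ (4 * σ * h + 1 * h) * B := by gcongr
    have h2 : τ₁ * ((4 * σ + h) * B * (B * (4 * σ))) * h ≤
        τb * ((4 * σ + 1) * B * (B * (4 * σ))) * h := by gcongr
    have h3 : 0 ≤ (4 * σ + 1) * B * ε := by positivity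
    have h4 : 0 ≤ 16 * σ ^ 2 * h := by positivity
    have h5 : 0 ≤ τb * ((4 * σ + 1) * B * (B * (4 * σ))) * ε := by positivity
    rw [hΛ₀]
    linarith
  have hΛ₀0 : 0 ≤ Λ₀ := by positivity
  clear_value Λ Λ₀ κ₂ κ₃
  have hcell : ∀ K ∈ D.cells, |∫ x in K, D.density ε (τ₁ * h) K v w x ∂μHE[2]| ≤
      2 * σ ^ 2 * κ₂ * (Λ₀ * (h + ε)) *
        (∑ a ∈ D.tetOf K, v a ^ 2 + ∑ a ∈ D.tetOf K, w a ^ 2) := fun K hK => by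
    obtain ⟨I, Hc⟩ := H.exists_cellData hK
    have h1 := norm_setIntegral_le_of_norm_le_const (μ := (μHE[2] : Measure E3))
      (Hc.area_lt_top H) fun x hx => (Real.norm_eq_abs _).trans_le
        (H.abs_density_le hB hε (mul_nonneg hτ₁ hh.le) hv hw hK hx)
    rw [Real.norm_eq_abs, ← hΛ] at h1
    have hMv : √(∑ a ∈ D.tetOf K, v a ^ 2) ^ 2 = ∑ a ∈ D.tetOf K, v a ^ 2 :=
      Real.sq_sqrt (Finset.sum_nonneg fun a _ => sq_nonneg _)
    have hMw : √(∑ a ∈ D.tetOf K, w a ^ 2) ^ 2 = ∑ a ∈ D.tetOf K, w a ^ 2 :=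
      Real.sq_sqrt (Finset.sum_nonneg fun a _ => sq_nonneg _)
    rw [← hMv, ← hMw]
    set P := √(∑ a ∈ D.tetOf K, v a ^ 2)
    set Q := √(∑ a ∈ D.tetOf K, w a ^ 2)
    have hP : 0 ≤ P := Real.sqrt_nonneg _
    have hQ : 0 ≤ Q := Real.sqrt_nonneg _
    have harea := Hc.area_le H
    rw [← hκ₂] at harea
    clear_value P Q
    refine h1.trans ?_
    calc Λ * (P * Q) * (μHE[2] : Measure E3).real K ≤ Λ * (P * Q) * ((2 * σ * h) ^ 2 * κ₂) :=
          mul_le_mul_of_nonneg_left harea (by positivity)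
      _ = 2 * σ ^ 2 * κ₂ * (Λ * h ^ 2) * (2 * P * Q) := by ring
      _ ≤ 2 * σ ^ 2 * κ₂ * (Λ₀ * (h + ε)) * (P ^ 2 + Q ^ 2) := by
          gcongr
          exact two_mul_le_add_sq P Q
  have hsum : |∑ K ∈ D.cells, ∫ x in K, D.density ε (τ₁ * h) K v w x ∂μHE[2]| ≤
      2 * σ ^ 2 * κ₂ * (Λ₀ * (h + ε)) * (16 * (D.vertexSq v + D.vertexSq w)) := by
    refine (Finset.abs_sum_le_sum_abs _ _).trans ((Finset.sum_le_sum hcell).trans ?_)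
    rw [← Finset.mul_sum]
    refine mul_le_mul_of_nonneg_left ?_ (by positivity)
    rw [CutData.vertexSq, CutData.vertexSq, ← Finset.sum_add_distrib]
    exact H.sum_cells_le (Q := fun T => ∑ a ∈ T, v a ^ 2 + ∑ a ∈ T, w a ^ 2) fun T _ =>
      add_nonneg (Finset.sum_nonneg fun a _ => sq_nonneg _)
        (Finset.sum_nonneg fun a _ => sq_nonneg _)
  have hM : 0 ≤ D.vertexSq v + D.vertexSq w :=
    add_nonneg (D.vertexSq_nonneg v) (D.vertexSq_nonneg w)
  have hnormal : |τ₂ * h ^ γ * D.normalForm v w| ≤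
      C₂ * (h + ε) * (8 * σ ^ 5 * κ₃ * (D.vertexSq v + D.vertexSq w)) := by
    have h0 : 0 ≤ h ^ γ := by positivity
    have h1 : h ^ γ ≤ 1 := Real.rpow_le_one hh.le hh1 hγ
    rw [abs_mul, abs_of_nonneg (mul_nonneg hτ₂ h0)]
    calc _ ≤ C₂ * (1 + ε * h⁻¹) * 1 * (8 * σ ^ 5 * κ₃ * h * (D.vertexSq v + D.vertexSq w)) := by
          have := hτ₂.trans hC₂
          have hn := H.abs_normalForm_le v w
          rw [← hκ₃] at hn
          gcongr
      _ = _ := by field_simp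
  rw [H.Ah_eq _ _ _ _ hv hw]
  refine (abs_add_le _ _).trans ((add_le_add hsum hnormal).trans (le_of_eq ?_))
  ring

/-- Half of the divergence identity replaces the convection term, leaving α_h - ½ div β_h ≥ a₀. The
indefinite part of the streamline term is handled by completing the square, (b + ay)b ≥ -a²y²/4. -/
theorem integral_density_ge {B : ℝ} (hB : D.CoeffBdd B) {a₀ Cb : ℝ} (hS : D.CoeffStable h a₀ Cb)
    {ε τ : ℝ} (hε : 0 ≤ ε) (hτ : 0 ≤ τ) {v : E3 → ℝ} (hv : D.IsPL v) {K : Set E3}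
    (hK : K ∈ D.cells) :
    1 / 2 * (∑ e ∈ D.edges K, segIntegral e fun x =>
      inner ℝ (D.conormal K e) (D.beta K x) * interp (D.tetOf K) v x ^ 2) +
      (a₀ - τ * B ^ 2 / 4) * ∫ x in K, v x ^ 2 ∂μHE[2] ≤
      ∫ x in K, D.density ε τ K v v x ∂μHE[2] := by
  obtain ⟨I, Hc⟩ := H.exists_cellData hK
  have hcv := H.continuousOn_closure hv hK
  have hcg := affine_continuous (interp (D.tetOf K) v)
  have hβ : Continuous (D.beta K) := (D.beta K).continuous_of_finiteDimensional
  rw [← Hc.integral_divergence H, ← integral_const_mul, ← integral_const_mul,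
    ← integral_add (Hc.integrableOn H (by fun_prop)) (Hc.integrableOn H (by fun_prop))]
  refine setIntegral_mono_on (Hc.integrableOn H (by fun_prop))
    (H.integrableOn_density _ _ hv hv hK) Hc.measurableSet fun x hx => ?_
  rw [← hv _ Hc.mem x (Hc.subset_hull hx), ← elemGrad_eq, CutData.density]
  change 1 / 2 * (2 * (inner ℝ (D.beta K x) (D.surfGrad K v) * v x) + D.cellDiv K * v x ^ 2) + _ ≤ _
  have hpos := hS.pos K hK x hx
  have hα := hB.alpha_le K hK x hx
  have h1 := mul_nonneg hε (real_inner_self_nonneg (x := D.surfGrad K v))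
  set b := inner ℝ (D.beta K x) (D.surfGrad K v)
  set y := v x
  set a := D.alpha K x
  have h2 : a ^ 2 ≤ B ^ 2 := sq_le_sq' (abs_le.mp hα).1 (abs_le.mp hα).2
  have h3 : 0 ≤ τ * (b + a * y / 2) ^ 2 := by positivity
  have h4 : τ * (y ^ 2 * a ^ 2) ≤ τ * (y ^ 2 * B ^ 2) := by gcongr
  have h5 : a₀ * y ^ 2 ≤ (a - 1 / 2 * D.cellDiv K) * y ^ 2 := by gcongr
  linarith

/-- The bound τb h B² ≤ 2a₀ keeps the streamline loss τ₁hB²/4 below a₀/2; the volume of a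
tetrahedron, at least a multiple of (h/σ)³, gives the power of h in the normal term. -/
theorem Ah_self_ge {B : ℝ} (hB : D.CoeffBdd B) {a₀ Cb : ℝ} (hS : D.CoeffStable h a₀ Cb)
    {ε τ₁ τ₂ γ τb c₂ : ℝ} (hε : 0 ≤ ε) (hτ₁ : 0 ≤ τ₁) (hτb : τ₁ ≤ τb) (hc₂ : 0 ≤ c₂)
    (hτ₂ : c₂ ≤ τ₂) (hsmall : τb * h * B ^ 2 ≤ 2 * a₀) {v : E3 → ℝ} (hv : D.IsPL v) :
    a₀ / 2 * ∑ K ∈ D.cells, ∫ x in K, v x ^ 2 ∂μHE[2] +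
      c₂ * volume.real (Metric.ball (0 : E3) 1) / σ ^ 3 * (h ^ γ * h ^ 3 *
        ∑ T ∈ D.active, D.normalSq v T) - 32 * σ * |Cb| * h ^ 3 * D.vertexSq v ≤
      D.Ah ε τ₁ τ₂ h γ v v := by
  have hh := H.h_pos
  have hσ := H.σ_pos
  have hedges := H.abs_sum_edges_le hS hv
  have hcells := Finset.sum_le_sum fun K hK =>
    H.integral_density_ge hB hS hε (mul_nonneg hτ₁ hh.le) hv hK
  rw [Finset.sum_add_distrib, ← Finset.mul_sum, ← Finset.mul_sum] at hcells
  rw [H.Ah_eq _ _ _ _ hv hv]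
  have hV : 0 ≤ ∑ K ∈ D.cells, ∫ x in K, v x ^ 2 ∂μHE[2] :=
    Finset.sum_nonneg fun K _ => integral_nonneg fun x => sq_nonneg _
  set V := ∑ K ∈ D.cells, ∫ x in K, v x ^ 2 ∂μHE[2]
  have h1 : a₀ / 2 * V ≤ (a₀ - τ₁ * h * B ^ 2 / 4) * V := by
    refine mul_le_mul_of_nonneg_right ?_ hV
    have : τ₁ * h * B ^ 2 ≤ τb * h * B ^ 2 := by gcongr
    linarith
  have h2 : c₂ * volume.real (Metric.ball (0 : E3) 1) / σ ^ 3 * (h ^ γ * h ^ 3 *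
        ∑ T ∈ D.active, D.normalSq v T) ≤ τ₂ * h ^ γ * D.normalForm v v := by
    have e : c₂ * volume.real (Metric.ball (0 : E3) 1) / σ ^ 3 * (h ^ γ * h ^ 3 *
        ∑ T ∈ D.active, D.normalSq v T) = c₂ * h ^ γ * ∑ T ∈ D.active,
        (h / σ) ^ 3 * volume.real (Metric.ball (0 : E3) 1) * D.normalSq v T := by
      rw [← Finset.mul_sum]; field_simp
    have h0 : 0 ≤ h ^ γ := by positivity
    rw [e]
    refine mul_le_mul (by gcongr) (Finset.sum_le_sum fun T hT => ?_)
      (Finset.sum_nonneg fun T _ => mul_nonneg (by positivity) (sq_nonneg _)) (by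
        have := hc₂.trans hτ₂
        positivity)
    rw [CutData.normalSq, sq (inner ℝ _ _)]
    exact mul_le_mul_of_nonneg_right
      (TetMesh.volume_hull_ge H.quasi H.h_pos H.σ_pos (mem_tets hT)) (mul_self_nonneg _)
  have h3 := (abs_le.mp hedges).1
  rw [CutData.vertexSq]
  linarith

end FineSurface

end Bounds

/-! ### The condition number -/

section ConditionNumber

/-- Test with the multiple of A y that has the norm of y, so that both squares on the right are
equal. -/
theorem ContinuousLinearMap.opNorm_le_of_abs_inner_le {E : Type*} [NormedAddCommGroup E]
    [InnerProductSpace ℝ E] (A : E →L[ℝ] E) {m : ℝ} (hm : 0 ≤ m)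
    (h : ∀ x y, |inner ℝ x (A y)| ≤ m * (‖x‖ ^ 2 + ‖y‖ ^ 2)) : ‖A‖ ≤ 2 * m := by
  refine A.opNorm_le_bound (by positivity) fun y => ?_
  rcases eq_or_ne (A y) 0 with h0 | h0
  · rw [h0, norm_zero]; positivity
  have hz : 0 < ‖A y‖ := norm_pos_iff.mpr h0
  have hy : 0 < ‖y‖ := norm_pos_iff.mpr fun h1 => h0 (by rw [h1, map_zero])
  have h1 := h ((‖y‖ / ‖A y‖) • A y) y
  rw [real_inner_smul_left, real_inner_self_eq_norm_sq, norm_smul, norm_div, norm_norm, norm_norm,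
    div_mul_cancel₀ _ hz.ne'] at h1
  have e : ‖y‖ / ‖A y‖ * ‖A y‖ ^ 2 = ‖y‖ * ‖A y‖ := by field_simp
  rw [e, abs_of_nonneg (by positivity)] at h1
  refine le_of_mul_le_mul_left (h1.trans (le_of_eq ?_)) hy
  ring

theorem Matrix.isUnit_of_coercive {ι : Type*} [Fintype ι] [DecidableEq ι] {A : Matrix ι ι ℝ} {c : ℝ}
    (hc : 0 < c)
    (h : ∀ x : EuclideanSpace ℝ ι, c * ‖x‖ ^ 2 ≤ inner ℝ x (Matrix.toEuclideanCLM (𝕜 := ℝ) A x)) :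
    IsUnit A := by
  rw [← Matrix.mulVec_injective_iff_isUnit]
  intro v w hvw
  have h1 := h (WithLp.toLp 2 (v - w))
  have h2 : Matrix.toEuclideanCLM (𝕜 := ℝ) A (WithLp.toLp 2 (v - w)) = 0 := by
    rw [Matrix.toEuclideanCLM_toLp, Matrix.mulVec_sub]
    rw [show A.mulVec v = A.mulVec w from hvw, sub_self]; rfl
  rw [h2, inner_zero_right] at h1
  have h3 : ‖(WithLp.toLp 2 (v - w) : EuclideanSpace ℝ ι)‖ = 0 := by
    have : ‖(WithLp.toLp 2 (v - w) : EuclideanSpace ℝ ι)‖ ^ 2 ≤ 0 := by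
      by_contra! h4
      linarith [mul_pos hc h4]
    exact pow_eq_zero_iff two_ne_zero |>.mp (le_antisymm this (sq_nonneg _))
  rw [norm_eq_zero] at h3
  exact sub_eq_zero.mp (congrArg WithLp.ofLp h3)

/-- The finite dimensional Lax–Milgram argument: coercivity bounds the inverse by 1/c. -/
theorem condNumber_le {ι : Type*} [Fintype ι] [DecidableEq ι] {A : Matrix ι ι ℝ} {c m : ℝ}
    (hc : 0 < c) (hm : 0 ≤ m)
    (h : ∀ x : EuclideanSpace ℝ ι, c * ‖x‖ ^ 2 ≤ inner ℝ x (Matrix.toEuclideanCLM (𝕜 := ℝ) A x))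
    (h' : ∀ x y : EuclideanSpace ℝ ι,
      |inner ℝ x (Matrix.toEuclideanCLM (𝕜 := ℝ) A y)| ≤ m * (‖x‖ ^ 2 + ‖y‖ ^ 2)) :
    condNumber A ≤ 2 * m / c := by
  have hA := Matrix.isUnit_of_coercive hc h
  rw [condNumber, div_eq_mul_inv]
  refine mul_le_mul (ContinuousLinearMap.opNorm_le_of_abs_inner_le _ hm h') ?_ (norm_nonneg _)
    (by positivity)
  refine ContinuousLinearMap.opNorm_le_bound _ (by positivity) fun y => ?_
  set x := Matrix.toEuclideanCLM (𝕜 := ℝ) A⁻¹ y with hx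
  have h1 : Matrix.toEuclideanCLM (𝕜 := ℝ) A x = y := by
    rw [hx, ← mul_apply_eq_comp, ← map_mul,
      Matrix.mul_nonsing_inv _ ((Matrix.isUnit_iff_isUnit_det _).mp hA), map_one]
    rfl
  have h2 := (h x).trans (real_inner_le_norm _ _)
  rw [h1] at h2
  rcases (norm_nonneg x).eq_or_lt with h0 | h0
  · rw [← h0]; positivity
  rw [inv_mul_eq_div, le_div_iff₀ hc]
  refine le_of_mul_le_mul_left (a := ‖x‖) ?_ h0
  linarith

theorem exists_rpow_le {s q : ℝ} (hs : 0 < s) (hq : 0 < q) :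
    ∃ t : ℝ, 0 < t ∧ ∀ h : ℝ, 0 < h → h ≤ t → h ^ s ≤ q := by
  refine ⟨q ^ s⁻¹, Real.rpow_pos_of_pos hq _, fun h hh hle => ?_⟩
  refine (Real.rpow_le_rpow hh.le hle hs.le).trans (le_of_eq ?_)
  rw [← Real.rpow_mul hq.le, inv_mul_cancel₀ hs.ne', Real.rpow_one]

/-- Half of h^θ times the Poincaré inequality is kept, the other half pays for the edge error h³M,
which is h^(1-θ) times smaller. Since θ < 1 for γ < 2 this works for small h; the smallness depends
on γ, the constant c does not. -/
theorem exists_coercivity (σ C : ℝ) (hσ : 0 < σ) (B a₀ Cb τb c₂ : ℝ) (ha₀ : 0 < a₀)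
    (hc₂ : 0 < c₂) : ∃ c : ℝ, 0 < c ∧ ∀ γ : ℝ, 0 ≤ γ → γ < 2 → ∃ h₁ : ℝ, 0 < h₁ ∧
      ∀ (D : CutData) (F : E3 → ℝ) (U : Set E3) (h R : ℝ), FineSurface D F U h σ C R →
        4 * σ * h ≤ R → h ≤ h₁ → D.CoeffBdd B → D.CoeffStable h a₀ Cb →
        ∀ ε τ₁ τ₂ : ℝ, 0 ≤ ε → 0 ≤ τ₁ → τ₁ ≤ τb → c₂ ≤ τ₂ → ∀ v, D.IsPL v →
          c * (h ^ (1 - min 1 (2 - γ)) * h ^ 2) * D.vertexSq v ≤ D.Ah ε τ₁ τ₂ h γ v v := by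
  obtain ⟨Cp, hs, hCp, hs0, hbound⟩ := exists_nodal_bound σ C hσ
  set κ := volume.real (Metric.ball (0 : E3) 1) with hκ
  have hκ0 : 0 < κ :=
    ENNReal.toReal_pos (Metric.measure_ball_pos _ _ one_pos).ne' measure_ball_lt_top.ne
  set k := min (a₀ / 2) (c₂ * κ / σ ^ 3) with hk
  have hk0 : 0 < k := lt_min (by positivity) (by positivity)
  refine ⟨k / (2 * Cp), by positivity, fun γ hγ hγ2 => ?_⟩
  -- θ = max(0, γ-1): θ ≥ γ-1 lets the normal stabilization dominate h^θ h⁴ ∑|n_h·∇v|², and θ ≥ 0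
  -- lets ∫v² dominate h^θ ∫v².
  set θ := 1 - min 1 (2 - γ) with hθ
  have hθ1 : 0 < 1 - θ := by
    have : 0 < min 1 (2 - γ) := lt_min one_pos (by linarith)
    linarith
  have hθ0 : 0 ≤ θ := by linarith [min_le_left 1 (2 - γ)]
  have hθγ : γ + 3 ≤ θ + 4 := by linarith [min_le_right 1 (2 - γ)]
  obtain ⟨t, ht, htle⟩ := exists_rpow_le hθ1
    (show 0 < k / (2 * Cp) / (32 * σ * |Cb| + 1) by positivity)
  refine ⟨min (min hs 1) (min t (2 * a₀ / (|τb| * B ^ 2 + 1))),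
    lt_min (lt_min hs0 one_pos) (lt_min ht (by positivity)), ?_⟩
  intro D F U h R H hR hle hB hS ε τ₁ τ₂ hε hτ₁ hτb hτ₂ v hv
  have hh := H.h_pos
  obtain ⟨⟨hle1, hle2⟩, hle3, hle4⟩ : (h ≤ hs ∧ h ≤ 1) ∧ h ≤ t ∧
      h ≤ 2 * a₀ / (|τb| * B ^ 2 + 1) := by simpa only [le_min_iff] using hle
  have hsmall : τb * h * B ^ 2 ≤ 2 * a₀ := by
    rw [le_div_iff₀ (by positivity)] at hle4
    have : τb * h * B ^ 2 ≤ |τb| * h * B ^ 2 := by gcongr; exact le_abs_self _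
    linarith
  have h1 := H.Ah_self_ge (γ := γ) hB hS hε hτ₁ hτb hc₂.le hτ₂ hsmall hv
  have h2 := hbound D F U h R H hR hle1 v hv
  have h3 := htle h hh hle3
  rw [le_div_iff₀ (by positivity)] at h3
  rw [← CutData.vertexSq] at h2
  rw [← hκ] at h1
  have hV : 0 ≤ ∑ K ∈ D.cells, ∫ x in K, v x ^ 2 ∂μHE[2] :=
    Finset.sum_nonneg fun K _ => integral_nonneg fun x => sq_nonneg _
  have hG : 0 ≤ ∑ T ∈ D.active, D.normalSq v T := Finset.sum_nonneg fun T _ => sq_nonneg _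
  have hM := D.vertexSq_nonneg v
  set V := ∑ K ∈ D.cells, ∫ x in K, v x ^ 2 ∂μHE[2]
  set G := ∑ T ∈ D.active, D.normalSq v T
  set M := D.vertexSq v
  clear_value V G M κ θ
  have hp0 : 0 < h ^ θ := Real.rpow_pos_of_pos hh _
  have hp1 : h ^ θ ≤ 1 := Real.rpow_le_one hh.le hle2 hθ0
  have hpow : h ^ θ * h ^ 4 ≤ h ^ γ * h ^ 3 := by
    rw [← Real.rpow_natCast h 4, ← Real.rpow_natCast h 3, ← Real.rpow_add hh, ← Real.rpow_add hh]
    exact Real.rpow_le_rpow_of_exponent_ge hh hle2 (by push_cast; linarith)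
  have hcube : h ^ 3 = h ^ θ * h ^ 2 * h ^ (1 - θ) := by
    rw [mul_right_comm, ← Real.rpow_add hh, add_sub_cancel, Real.rpow_one]; ring
  have h4 : 32 * σ * |Cb| * h ^ 3 * M ≤ k / (2 * Cp) * (h ^ θ * h ^ 2) * M := by
    have : 32 * σ * |Cb| * h ^ (1 - θ) ≤ k / (2 * Cp) := by
      have := Real.rpow_pos_of_pos hh (1 - θ)
      linarith
    calc _ = 32 * σ * |Cb| * h ^ (1 - θ) * (h ^ θ * h ^ 2) * M := by rw [hcube]; ring
      _ ≤ _ := by gcongr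
  have h5 : k / Cp * (h ^ θ * h ^ 2) * M ≤ a₀ / 2 * V + c₂ * κ / σ ^ 3 * (h ^ γ * h ^ 3 * G) := by
    calc k / Cp * (h ^ θ * h ^ 2) * M = k / Cp * h ^ θ * (h ^ 2 * M) := by ring
      _ ≤ k / Cp * h ^ θ * (Cp * (V + h ^ 4 * G)) := by gcongr
      _ = k * (h ^ θ * V) + k * (h ^ θ * h ^ 4 * G) := by field_simp
      _ ≤ k * (1 * V) + k * (h ^ γ * h ^ 3 * G) := by gcongr
      _ ≤ a₀ / 2 * V + c₂ * κ / σ ^ 3 * (h ^ γ * h ^ 3 * G) := by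
        rw [one_mul]
        have := Real.rpow_pos_of_pos hh γ
        gcongr
        · exact min_le_left _ _
        · exact min_le_right _ _
  have e : k / Cp * (h ^ θ * h ^ 2) * M = 2 * (k / (2 * Cp) * (h ^ θ * h ^ 2) * M) := by
    field_simp
  linarith

theorem exists_condNumber_bound (σ C : ℝ) (hσ : 0 < σ) (B a₀ Cb τb c₂ C₂ : ℝ) (ha₀ : 0 < a₀)
    (hc₂ : 0 < c₂) : ∃ Cc : ℝ, 0 < Cc ∧ ∀ γ : ℝ, 0 ≤ γ → γ < 2 → ∃ h₁ : ℝ, 0 < h₁ ∧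
      ∀ (D : CutData) (F : E3 → ℝ) (U : Set E3) (h R : ℝ), FineSurface D F U h σ C R →
        4 * σ * h ≤ R → h ≤ h₁ → D.CoeffBdd B → D.CoeffStable h a₀ Cb →
        ∀ ε τ₁ τ₂ : ℝ, 0 ≤ ε → 0 ≤ τ₁ → τ₁ ≤ τb → c₂ ≤ τ₂ → τ₂ ≤ C₂ * (1 + ε * h⁻¹) →
          IsUnit (D.stiffness ε τ₁ τ₂ h γ) ∧ condNumber (D.stiffness ε τ₁ τ₂ h γ) ≤
            Cc * h ^ (min 1 (2 - γ) - 2) * (1 + ε * h⁻¹) := by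
  obtain ⟨c, hc, hcoer⟩ := exists_coercivity σ C hσ B a₀ Cb τb c₂ ha₀ hc₂
  set L := 32 * ((4 * σ + 1) * B + 16 * σ ^ 2 +
      τb * ((4 * σ + 1) * B * (B * (4 * σ)))) * (σ ^ 2 * volume.real (Metric.ball (0 : E2) 1)) +
      C₂ * (8 * σ ^ 5 * volume.real (Metric.ball (0 : E3) 1)) with hL
  set N := ((σ + 1) * σ) ^ 3 with hN
  have hN0 : 0 < N := by positivity
  refine ⟨2 * ((|L| + 1) * N) / c, by positivity, fun γ hγ hγ2 => ?_⟩
  obtain ⟨h₁, hh₁, hcoer⟩ := hcoer γ hγ hγ2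
  refine ⟨min h₁ 1, lt_min hh₁ one_pos, ?_⟩
  intro D F U h R H hR hle hB hS ε τ₁ τ₂ hε hτ₁ hτb hτ₂ hC₂
  have hh := H.h_pos
  have hle1 := hle.trans (min_le_left _ _)
  have hle2 := hle.trans (min_le_right _ _)
  set θ := 1 - min 1 (2 - γ) with hθ
  have hp : 0 < h ^ θ := Real.rpow_pos_of_pos hh _
  have hlow : ∀ x : EuclideanSpace ℝ D.nodes, c * (h ^ θ * h ^ 2) * ‖x‖ ^ 2 ≤
      inner ℝ x (Matrix.toEuclideanCLM (𝕜 := ℝ) (D.stiffness ε τ₁ τ₂ h γ) x) := fun x => by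
    rw [H.inner_stiffness]
    refine le_trans ?_ (hcoer D F U h R H hR hle1 hB hS ε τ₁ τ₂ hε hτ₁ hτb hτ₂ _ (D.isPL_nodal x))
    exact mul_le_mul_of_nonneg_left (D.norm_sq_le_vertexSq x) (by positivity)
  have hup : ∀ x y : EuclideanSpace ℝ D.nodes,
      |inner ℝ x (Matrix.toEuclideanCLM (𝕜 := ℝ) (D.stiffness ε τ₁ τ₂ h γ) y)| ≤
      (|L| + 1) * N * (h + ε) * (‖x‖ ^ 2 + ‖y‖ ^ 2) := fun x y => by
    rw [H.inner_stiffness]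
    refine (H.abs_Ah_le hB hle2 hε hτ₁ hτb (hc₂.le.trans hτ₂) hC₂ hγ (D.isPL_nodal x)
      (D.isPL_nodal y)).trans ?_
    rw [← hL]
    have h1 := H.vertexSq_le x
    have h2 := H.vertexSq_le y
    have h3 := add_nonneg (D.vertexSq_nonneg (D.nodal x)) (D.vertexSq_nonneg (D.nodal y))
    calc L * (h + ε) * (D.vertexSq (D.nodal x) + D.vertexSq (D.nodal y))
        ≤ (|L| + 1) * (h + ε) * (D.vertexSq (D.nodal x) + D.vertexSq (D.nodal y)) := by
          gcongr; linarith [le_abs_self L]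
      _ ≤ (|L| + 1) * (h + ε) * (N * ‖x‖ ^ 2 + N * ‖y‖ ^ 2) := by gcongr
      _ = _ := by ring
  refine ⟨Matrix.isUnit_of_coercive (by positivity) hlow,
    (condNumber_le (by positivity) (by positivity) hlow hup).trans (le_of_eq ?_)⟩
  -- One power of h in h^θ h² is spent on h + ε = h(1 + ε/h), which leaves this exponent.
  have e : h ^ (min 1 (2 - γ) - 2) = (h ^ θ * h)⁻¹ := by
    rw [← Real.rpow_add_one hh.ne', ← Real.rpow_neg hh.le]
    congr 1
    rw [hθ]; ring
  rw [e]
  field_simp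

theorem tauOne_nonneg {cτ b ε h : ℝ} (hcτ : 0 ≤ cτ) (hb : 0 ≤ b) (hε : 0 ≤ ε) (hh : 0 ≤ h) :
    0 ≤ tauOne cτ b ε h := by
  unfold tauOne
  split_ifs <;> positivity

theorem tauOne_le {cτ b ε h : ℝ} (hcτ : 0 ≤ cτ) (hb : 0 < b) (hh : 0 < h) :
    tauOne cτ b ε h ≤ cτ * b⁻¹ := by
  unfold tauOne
  split_ifs with h1
  · exact le_rfl
  · rw [not_le] at h1
    have hε : 0 < ε := (mul_pos hb hh).trans h1
    refine mul_le_mul_of_nonneg_left ?_ hcτ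
    rw [← div_eq_mul_inv, inv_eq_one_div, div_le_div_iff₀ hε hb]
    linarith

/-- The supremum of the empty set of reals is 0 by convention, so a positive maximum excludes an
empty surface. -/
theorem frontier_nonempty_of_surfSup_pos {O : Set E3} {β : E3 → E3} (h : 0 < surfSup O β) :
    (frontier O).Nonempty := by
  by_contra h0
  rw [not_nonempty_iff_eq_empty] at h0
  rw [surfSup, h0, image_empty, Real.sSup_empty] at h
  exact lt_irrefl _ h

end ConditionNumber
theorem mainTheorem2
    -- the smooth closed surface and a tubular neighbourhood
    (O : Set E3) (hO : IsSmoothDomain O) (δ₀ : ℝ) (hδ₀ : 0 < δ₀)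
    (hp : ∀ x ∈ tube O δ₀, ∃! y, y ∈ frontier O ∧ dist x y = Metric.infDist x (frontier O))
    -- the coefficients
    (α : E3 → ℝ) (β : E3 → E3) (hα : ContDiff ℝ (⊤ : ℕ∞) α) (hβ : ContDiff ℝ (⊤ : ℕ∞) β)
    (hβtan : ∀ x ∈ frontier O, inner ℝ (surfNormal O x) (β x) = 0)
    (hβpos : 0 < surfSup O β)
    (α₀ : ℝ) (hα₀ : 0 < α₀)
    (hαβ : ∀ x ∈ frontier O, α₀ ≤ α x - (1 / 2) * surfDiv O β x)
    -- the background domain and the family of meshes, surfaces and discrete coefficients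
    (Ω₀ : Set E3) (hΩopen : IsOpen Ω₀) (hΩconn : IsConnected Ω₀) (hΩ : tube O δ₀ ⊆ Ω₀)
    (h₀ : ℝ) (hh₀ : 0 < h₀) (D : ℝ → CutData)
    (hspace : ∀ h ∈ Set.Ioc 0 h₀, (D h).mesh.complex.space = closure Ω₀)
    (hmesh : ∃ σ : ℝ, 0 < σ ∧ ∀ h ∈ Set.Ioc 0 h₀, (D h).mesh.Quasiuniform h σ)
    (hsurf : ∀ h ∈ Set.Ioc 0 h₀, (D h).IsDiscreteSurface O δ₀)
    (hA : ∃ C : ℝ, ∀ h ∈ Set.Ioc 0 h₀, (D h).GeomApprox O h C)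
    (hB : ∃ a₀ C : ℝ, 0 < a₀ ∧ ∀ h ∈ Set.Ioc 0 h₀, (D h).CoeffStable h a₀ C)
    (hC : ∃ C : ℝ, ∀ h ∈ Set.Ioc 0 h₀, (D h).CoeffApprox O α β h C)
    -- the stabilization parameters
    (cτ : ℝ) (hcτ : 0 < cτ) (c₂ C₂ : ℝ) (hc₂ : 0 < c₂) :
    ∃ C : ℝ, 0 < C ∧
      (∀ γ : ℝ, 0 ≤ γ → γ < 2 → ∃ h₁ : ℝ, 0 < h₁ ∧ h₁ ≤ h₀ ∧
        ∀ h ∈ Set.Ioc 0 h₁, ∀ ε : ℝ, 0 ≤ ε →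
          ∀ τ₂ : ℝ, c₂ ≤ τ₂ → τ₂ ≤ C₂ * (1 + ε * h⁻¹) →
            IsUnit ((D h).stiffness ε (tauOne cτ (surfSup O β) ε h) τ₂ h γ) ∧
            condNumber ((D h).stiffness ε (tauOne cτ (surfSup O β) ε h) τ₂ h γ) ≤
              C * h ^ (min 1 (2 - γ) - 2) * (1 + ε * h⁻¹)) ∧
      (∃ h₁ : ℝ, 0 < h₁ ∧ h₁ ≤ h₀ ∧
        ∀ h ∈ Set.Ioc 0 h₁, ∀ ε : ℝ, 0 ≤ ε →
          ∀ τ₂ : ℝ, c₂ ≤ τ₂ → τ₂ ≤ C₂ * (1 + ε * h⁻¹) →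
            IsUnit ((D h).stiffness ε (tauOne cτ (surfSup O β) ε h) τ₂ h 1) ∧
            condNumber ((D h).stiffness ε (tauOne cτ (surfSup O β) ε h) τ₂ h 1) ≤
              C * h⁻¹ * (1 + ε * h⁻¹)) := by
  obtain ⟨σ, hσ, hmesh⟩ := hmesh
  obtain ⟨CA, hA⟩ := hA
  obtain ⟨a₀, Cb, ha₀, hB⟩ := hB
  obtain ⟨B, hC⟩ := hC
  obtain ⟨C, R, hs, U, hs0, hsle, hlevel⟩ := exists_levelSurface O hO
    (frontier_nonempty_of_surfSup_pos hβpos) δ₀ hδ₀ hp Ω₀ hΩ h₀ hh₀ D hspace σ hσ hmesh hsurf CA hA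
  obtain ⟨Cc, hCc, hcond⟩ := exists_condNumber_bound σ C hσ |B| a₀ Cb (cτ * (surfSup O β)⁻¹) c₂ C₂
    ha₀ hc₂
  have main : ∀ γ : ℝ, 0 ≤ γ → γ < 2 → ∃ h₁ : ℝ, 0 < h₁ ∧ h₁ ≤ h₀ ∧
      ∀ h ∈ Set.Ioc 0 h₁, ∀ ε : ℝ, 0 ≤ ε →
        ∀ τ₂ : ℝ, c₂ ≤ τ₂ → τ₂ ≤ C₂ * (1 + ε * h⁻¹) →
          IsUnit ((D h).stiffness ε (tauOne cτ (surfSup O β) ε h) τ₂ h γ) ∧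
          condNumber ((D h).stiffness ε (tauOne cτ (surfSup O β) ε h) τ₂ h γ) ≤
            Cc * h ^ (min 1 (2 - γ) - 2) * (1 + ε * h⁻¹) := by
    intro γ hγ hγ2
    obtain ⟨h₁, hh₁, hcond⟩ := hcond γ hγ hγ2
    have hR : 0 < R := by
      obtain ⟨F, hF⟩ := hlevel hs ⟨hs0, le_rfl⟩
      exact hF.R_pos
    -- R/(4σ) keeps neighbouring tetrahedra within the range of the expansion of F; the last entry
    -- makes Ch ≤ 1/2, so that discrete and exact normals form a small angle.
    refine ⟨min (min hs h₁) (min (R / (4 * σ)) (1 / 2 / (|C| + 1))),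
      lt_min (lt_min hs0 hh₁) (lt_min (by positivity) (by positivity)),
      (min_le_left _ _).trans ((min_le_left _ _).trans hsle), ?_⟩
    intro h ⟨hh, hle⟩ ε hε τ₂ hτ₂ hτ₂'
    obtain ⟨⟨hle1, hle2⟩, hle3, hle4⟩ : (h ≤ hs ∧ h ≤ h₁) ∧ h ≤ R / (4 * σ) ∧
        h ≤ 1 / 2 / (|C| + 1) := by simpa only [le_min_iff] using hle
    obtain ⟨F, hF⟩ := hlevel h ⟨hh, hle1⟩
    rw [le_div_iff₀ (by positivity)] at hle3 hle4
    have hσh : 0 < σ * h := mul_pos hσ hh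
    have hCh : C * h ≤ |C| * h := mul_le_mul_of_nonneg_right (le_abs_self C) hh.le
    have H : FineSurface (D h) F U h σ C R :=
      { hF with mesh_le := by linarith, normal_le := by linarith }
    have hmem : h ∈ Set.Ioc 0 h₀ := ⟨hh, hle1.trans hsle⟩
    exact hcond (D h) F U h R H (by linarith) hle2
      ⟨abs_nonneg B, fun K hK x hx => ((hC h hmem).alpha_bdd K hK x hx).trans (le_abs_self B),
        fun K hK x hx => ((hC h hmem).beta_bdd K hK x hx).trans (le_abs_self B)⟩
      (hB h hmem) ε _ τ₂ hε (tauOne_nonneg hcτ.le hβpos.le hε hh.le) (tauOne_le hcτ.le hβpos hh)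
      hτ₂ hτ₂'
  refine ⟨Cc, hCc, main, ?_⟩
  obtain ⟨h₁, hh₁, hle, hmain⟩ := main 1 zero_le_one one_lt_two
  refine ⟨h₁, hh₁, hle, fun h hh ε hε τ₂ hτ₂ hτ₂' => ?_⟩
  have := hmain h hh ε hε τ₂ hτ₂ hτ₂'
  rwa [show min 1 (2 - (1 : ℝ)) - 2 = -1 by norm_num, Real.rpow_neg_one] at this
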